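/- Let $M$ be a smooth (Hausdorff, second countable) manifold of dimension $m+n$, and let $\mathcal V\subseteq \mathbb CTM$ be a formally integrable structure of rank $n$ and corank $m$, i.e. a smooth complex subbundle of rank $n$ with $[\mathcal V,\mathcal V]\subseteq\mathcal V$. Let $N^*\mathcal V\subseteq\mathbb CT^*M$ be its annihilator, let $\Lambda_{\mathcal V}^{p,q}=\Lambda^pN^*\mathcal V\wedge\Lambda^q\mathbb CT^*M\subseteq\Lambda^{p+q}\mathbb CT^*M$ (with $\Lambda_{\mathcal V}^{1,-1}=0$), and let $K_{\mathcal V}=\Lambda^mN^*\mathcal V$. Let $\vartheta$ be a smooth complex $1$-form on $M$ such that $d\vartheta$ is a section of $\Lambda_{\mathcal V}^{1,1}$. A smooth function $g$ is called basic if $Xg=0$ for all $X\in\mathcal V$. Suppose that the line bundle $K_{\mathcal V}$ is basic: there are an open covering $\{U_\alpha\}$ of $M$ and smooth nowhere vanishing sections $\Theta_\alpha$ of $K_{\mathcal V}$ over $U_\alpha$ whose transition functions are basic; fix such data (if $m=0$, the section $1$ of $K_{\mathcal V}=\Lambda^0$ is required to be basic). A section of $K_{\mathcal V}$ is called basic if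 its components with respect to the $\Theta_\alpha$ are basic. Let $\sigma_\alpha$ be the frame of $K_{\mathcal V}^{-1}$ dual to $\Theta_\alpha$. Let $\Xi_{\mathcal V}$ be given locally on sections of $\Lambda_{\mathcal V}^{m,q}$ by $\big(\sum_l\theta^l_l\big)\wedge$, where $\theta^1,\dots,\theta^m$ is a smooth local frame of $N^*\mathcal V$ with $\theta^1\wedge\dots\wedge\theta^m$ basic and the $\theta^j_l$ are smooth $1$-forms with $d\theta^j=\sum_l\theta^j_l\wedge\theta^l$. For $u=u_\alpha\otimes\sigma_\alpha$ put $$d_{\mathcal V,\vartheta}u=(d-\Xi_{\mathcal V}-\vartheta\wedge)u_\alpha\otimes\sigma_\alpha .$$ Let $\mathcal A_{\mathcal V}^{m,q}(K_{\mathcal V}^{-1})$ and $\mathcal L_{\mathcal V}^{m,q}(K_{\mathcal V}^{-1})$ be the sheaves of smooth, respectively $L^2_{loc}$, sections of $\Lambda_{\mathcal V}^{m,q}\otimes K_{\mathcal V}^{-1}$, let $\mathfrak U_{\mathcal V}^q$ and $\mathfrak L_{\mathcal V}^q$ be the sheaves of smooth, respectively $L^2_{loc}$, sections of $\Lambda^q\mathbb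 CT^*M/\Lambda_{\mathcal V}^{1,q-1}$, and let $d'_\vartheta(u \bmod \Lambda_{\mathcal V}^{1,q-1})=(du-\vartheta\wedge u)\bmod\Lambda_{\mathcal V}^{1,q}$. On $L^2_{loc}$ sections both operators are understood as maximal (distributional) extensions. Then for every $q\ge 0$ there is a unique morphism of sheaves of complex vector spaces $\Phi_q:\mathcal L_{\mathcal V}^{m,q}(K_{\mathcal V}^{-1})\to\mathfrak L_{\mathcal V}^q$ such that, for every open $U\subseteq M$, every smooth frame $\theta^1,\dots,\theta^m$ of $N^*\mathcal V$ over $U$ for which $\Theta_U=\theta^1\wedge\dots\wedge\theta^m$ is basic, with dual frame $\sigma_U$ of $K_{\mathcal V}^{-1}$, and every $L^2_{loc}$ $q$-form $v$ on $U$, $$\Phi_q(\Theta_U\wedge v\otimes\sigma_U)=(-1)^{qm}v \bmod \Lambda_{\mathcal V}^{1,q-1},$$ and $\Phi_q$ is an isomorphism. Moreover $\Phi_{q+1}\circ d_{\mathcal V,\vartheta}=d'_\vartheta\circ\Phi_q$: for $L^2_{loc}$ sections $u$, $f$ over an open set, $d_{\mathcal V,\vartheta}u=f$ if and only if $d'_\vartheta\Phi_q(u)=\Phi_{q+1}(f)$.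 On smooth sections $d_{\mathcal V,\vartheta}$ and $d'_\vartheta$ are well-defined morphisms of sheaves with square zero, and the $\Phi_q$ induce an isomorphism from the complex $(\mathcal A_{\mathcal V}^{m,*}(K_{\mathcal V}^{-1}),d_{\mathcal V,\vartheta})$ to the Morse–Novikov–Treves complex $(\mathfrak U_{\mathcal V}^*,d'_\vartheta)$. In particular, this applies if $\mathcal V$ is locally integrable, i.e. if near every point there are smooth functions $f_1,\dots,f_m$ whose differentials span $N^*\mathcal V$: in that case $K_{\mathcal V}$ is basic, with a choice of the data above for which all sections $df_1\wedge\dots\wedge df_m$ of this kind are basic. -/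

import Mathlib

universe u v

open scoped Manifold ContDiff TensorProduct Topology
open TopologicalSpace CategoryTheory MeasureTheory Opposite

noncomputable section

namespace FormInt

/-! ### Complexified (co)tangent spaces and complex-valued differential forms -/

/-- The model space `ℝ^d`. -/
abbrev Euc (d : ℕ) : Type := EuclideanSpace ℝ (Fin d)

section Forms

variable (d : ℕ) {M : Type u} [TopologicalSpace M] [ChartedSpace (Euc d) M]

/-- The real tangent space `T_pM`. -/
abbrev Tan (p : M) : Type := TangentSpace 𝓘(ℝ, Euc d) p

/-- The complexified tangent space `ℂT_pM`. -/
abbrev CTan (p : M) : Type := ℂ ⊗[ℝ] Tan d p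

/-- The complexified cotangent space `ℂT_p^*M`: real-linear maps `T_pM → ℂ`. -/
abbrev Cot (p : M) : Type := Tan d p →L[ℝ] ℂ

/-- `Λ^k ℂT_p^*M`: alternating real-multilinear maps on `T_pM` with values in `ℂ`. -/
abbrev Form (k : ℕ) (p : M) : Type := Tan d p [⋀^Fin k]→L[ℝ] ℂ

variable {d}

/-- The complex tangent vector `X + iY`. -/
def cvec {p : M} (X Y : Tan d p) : CTan d p :=
  (1 : ℂ) ⊗ₜ[ℝ] X + Complex.I ⊗ₜ[ℝ] Y

/-- The `ℂ`-linear pairing of a covector with a complex tangent vector. -/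
def pair {p : M} (θ : Cot d p) (Z : CTan d p) : ℂ :=
  LinearMap.liftBaseChange ℂ (θ : Tan d p →ₗ[ℝ] ℂ) Z

/-- A covector as a form of degree one. -/
def toForm {p : M} (θ : Cot d p) : Form d 1 p :=
  ContinuousAlternatingMap.ofSubsingleton ℝ (Tan d p) ℂ (0 : Fin 1) θ

/-- `θ ∧ u` for a covector `θ`:
`(θ ∧ u)(v_0, …, v_k) = ∑ i, (-1)^i θ(v_i) u(v_0, …, v̂_i, …, v_k)`. -/
def wedgeOne {k : ℕ} {p : M} (θ : Cot d p) (u : Form d k p) : Form d (k + 1) p :=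
  ContinuousAlternatingMap.alternatizeUncurryFin (𝕜 := ℝ) (E := Euc d) (F := ℂ)
    (ContinuousLinearMap.smulRight (M₁ := Euc d) (θ : Euc d →L[ℝ] ℂ)
      (u : Euc d [⋀^Fin k]→L[ℝ] ℂ))

/-- Transport of a form along an equality of degrees. -/
def castForm {k l : ℕ} (h : k = l) {p : M} (u : Form d k p) : Form d l p :=
  h ▸ u

/-- `θ^1 ∧ (θ^2 ∧ (⋯ ∧ (θ^k ∧ u)))`, with the degree written as `q + k`. -/
def iterWedge {q : ℕ} {p : M} : (k : ℕ) → (Fin k → Cot d p) → Form d q p → Form d (q + k) p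
  | 0, _, u => u
  | k + 1, θ, u => wedgeOne (θ 0) (iterWedge k (fun j => θ j.succ) u)

/-- `θ^1 ∧ ⋯ ∧ θ^k ∧ u` as a form of degree `k + q`. -/
def wedgeFrame {k q : ℕ} {p : M} (θ : Fin k → Cot d p) (u : Form d q p) : Form d (k + q) p :=
  castForm (Nat.add_comm q k) (iterWedge k θ u)

/-- `θ^1 ∧ ⋯ ∧ θ^k`; the empty product is the constant `1`. -/
def wedgeAll {k : ℕ} {p : M} (θ : Fin k → Cot d p) : Form d k p :=
  wedgeFrame (q := 0) θ (ContinuousAlternatingMap.constOfIsEmpty ℝ (Tan d p) (Fin 0) (1 : ℂ))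

/-- The coordinate expression of a `k`-form in the preferred chart at `a`
(meaningful on the target of that chart): the pullback of `w` by the inverse chart. -/
def inChart {k : ℕ} (a : M) (w : ∀ p : M, Form d k p) (y : Euc d) : Euc d [⋀^Fin k]→L[ℝ] ℂ :=
  (w ((extChartAt 𝓘(ℝ, Euc d) a).symm y)).compContinuousLinearMap
    (mfderiv 𝓘(ℝ, Euc d) 𝓘(ℝ, Euc d) (extChartAt 𝓘(ℝ, Euc d) a).symm y)

/-- The coordinate image `φ_a(U ∩ dom φ_a)` of an open set in the preferred chart at `a`. -/
def chartDom (d : ℕ) {M : Type u} [TopologicalSpace M] [ChartedSpace (Euc d) M]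
    (a : M) (U : Opens M) : Set (Euc d) :=
  (extChartAt 𝓘(ℝ, Euc d) a).target ∩ (extChartAt 𝓘(ℝ, Euc d) a).symm ⁻¹' (U : Set M)

/-- The exterior derivative of a `k`-form: at `p` it is computed in the preferred chart at `p`. -/
def dForm {k : ℕ} (w : ∀ p : M, Form d k p) (p : M) : Form d (k + 1) p :=
  (extDeriv (inChart p w) (extChartAt 𝓘(ℝ, Euc d) p p)).compContinuousLinearMap
    (mfderiv 𝓘(ℝ, Euc d) 𝓘(ℝ, Euc d) (extChartAt 𝓘(ℝ, Euc d) p) p)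

/-- The differential of a complex-valued function. -/
def dFun (f : M → ℂ) (p : M) : Cot d p :=
  (mfderiv 𝓘(ℝ, Euc d) 𝓘(ℝ, ℂ) f p : Tan d p →L[ℝ] ℂ)

end Forms

/-! ### Two regularity classes: smooth forms, and `L²_loc` forms modulo null sets -/

section Regularity

variable (d : ℕ) (M : Type u) [TopologicalSpace M] [ChartedSpace (Euc d) M]

/-- A class of differential forms that can be used to define sheaves of sections: for each degree
`k` and each open set `U` the space `P k U` of forms that are regular on `U`. Only the restriction
of a form to `U` matters, and two forms on `U` are identified when they agree on `U` up to the
exceptional sets of `nul` (a set is exceptional if its complement belongs to `nul`). -/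
structure Regularity where
  nul : Filter M
  countable : CountableInterFilter nul
  P : (k : ℕ) → Opens M → Submodule ℂ (∀ p : M, Form d k p)
  mono : ∀ {k : ℕ} {U W : Opens M}, W ≤ U → P k U ≤ P k W
  of_local : ∀ {k : ℕ} {U : Opens M} {w : ∀ p : M, Form d k p},
    (∀ p ∈ U, ∃ W : Opens M, p ∈ W ∧ W ≤ U ∧ w ∈ P k W) → w ∈ P k U
  congr : ∀ {k : ℕ} {U : Opens M} {w w' : ∀ p : M, Form d k p},
    w ∈ P k U → (∀ᶠ p in nul, p ∈ U → w p = w' p) → w' ∈ P k U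

variable {d M}

lemma inChart_add {k : ℕ} (a : M) (w w' : ∀ p : M, Form d k p) :
    inChart a (w + w') = inChart a w + inChart a w' := rfl

lemma inChart_smul {k : ℕ} (a : M) (c : ℂ) (w : ∀ p : M, Form d k p) :
    inChart a (c • w) = c • inChart a w := rfl

lemma inChart_zero {k : ℕ} (a : M) : inChart a (0 : ∀ p : M, Form d k p) = 0 := rfl

lemma isOpen_chartDom (a : M) (U : Opens M) : IsOpen (chartDom d a U) :=
  (continuousOn_extChartAt_symm a).isOpen_inter_preimage (isOpen_extChartAt_target a) U.2

lemma chartDom_mono (a : M) {U W : Opens M} (h : W ≤ U) : chartDom d a W ⊆ chartDom d a U :=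
  fun _ hy => ⟨hy.1, h hy.2⟩

/-- `w` is a smooth form on `U`: its coordinate expressions are smooth. -/
def SmoothOn {k : ℕ} (U : Opens M) (w : ∀ p : M, Form d k p) : Prop :=
  ∀ a : M, ∀ y ∈ chartDom d a U, ContDiffAt ℝ ∞ (inChart a w) y

/-- `w` is an `L²_loc` form on `U`: its coordinate expressions are measurable and locally
square-integrable with respect to Lebesgue measure. -/
def L2LocOn {k : ℕ} (U : Opens M) (w : ∀ p : M, Form d k p) : Prop :=
  ∀ a : M, ∀ y ∈ chartDom d a U, ∃ N ∈ 𝓝 y, MemLp (inChart a w) 2 (volume.restrict N)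

lemma L2LocOn.zero {k : ℕ} (U : Opens M) : L2LocOn U (0 : ∀ p : M, Form d k p) := by
  intro a y _
  refine ⟨Set.univ, Filter.univ_mem, ?_⟩
  rw [inChart_zero]
  exact MemLp.zero (ε := Euc d [⋀^Fin k]→L[ℝ] ℂ)

lemma memLp_add_aux {X F : Type*} [MeasurableSpace X] [NormedAddCommGroup F] {μ : Measure X}
    (N N' : Set X) {w w' : X → F} (h1 : MemLp w 2 (μ.restrict N))
    (h2 : MemLp w' 2 (μ.restrict N')) : MemLp (w + w') 2 (μ.restrict (N ∩ N')) :=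
  MemLp.add (h1.mono_measure (Measure.restrict_mono Set.inter_subset_left le_rfl))
    (h2.mono_measure (Measure.restrict_mono Set.inter_subset_right le_rfl))

lemma L2LocOn.add {k : ℕ} {U : Opens M} {w w' : ∀ p : M, Form d k p}
    (h : L2LocOn U w) (h' : L2LocOn U w') : L2LocOn U (w + w') := by
  intro a y hy
  obtain ⟨N, hN, h1⟩ := h a y hy
  obtain ⟨N', hN', h2⟩ := h' a y hy
  have h3 := memLp_add_aux N N' h1 h2
  refine ⟨N ∩ N', Filter.inter_mem hN hN', ?_⟩
  rw [inChart_add]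
  exact h3

lemma L2LocOn.smul {k : ℕ} {U : Opens M} (c : ℂ) {w : ∀ p : M, Form d k p}
    (h : L2LocOn U w) : L2LocOn U (c • w) := by
  intro a y hy
  obtain ⟨N, hN, h1⟩ := h a y hy
  refine ⟨N, hN, ?_⟩
  rw [inChart_smul]
  exact h1.const_smul c

/-- A one-form is smooth on `U`. -/
def SmoothCotOn (U : Opens M) (θ : ∀ p : M, Cot d p) : Prop :=
  SmoothOn U (fun p => toForm (θ p))

variable (d M)

/-- The almost-everywhere filter of the manifold: a set belongs to it if, in every preferred chart,
its complement is Lebesgue-null. -/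
def aeFilter : Filter M :=
  ⨆ a : M, Filter.map (extChartAt 𝓘(ℝ, Euc d) a).symm
    (ae ((volume : Measure (Euc d)).restrict (extChartAt 𝓘(ℝ, Euc d) a).target))

instance aeFilter_countable : CountableInterFilter (aeFilter d M) := by
  constructor
  intro S hS h
  unfold aeFilter at h ⊢
  rw [Filter.mem_iSup]
  intro a
  exact (countable_sInter_mem hS).2 fun s hs => Filter.mem_iSup.1 (h s hs) a

variable {d M} in
lemma inChart_ae_eq {k : ℕ} {U : Opens M} {w w' : ∀ p : M, Form d k p}
    (h : ∀ᶠ p in aeFilter d M, p ∈ U → w p = w' p) (a : M) :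
    ∀ᵐ y ∂(volume.restrict (chartDom d a U)), inChart a w y = inChart a w' y := by
  have h1 := Filter.mem_iSup.1 h a
  rw [Filter.mem_map] at h1
  have h2 : ∀ᵐ y ∂((volume : Measure (Euc d)).restrict (extChartAt 𝓘(ℝ, Euc d) a).target),
      (extChartAt 𝓘(ℝ, Euc d) a).symm y ∈ U →
        w ((extChartAt 𝓘(ℝ, Euc d) a).symm y) = w' ((extChartAt 𝓘(ℝ, Euc d) a).symm y) := h1
  have h3 := ae_restrict_of_ae_restrict_of_subset
    (s := chartDom d a U) (fun y hy => hy.1) h2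
  filter_upwards [h3, ae_restrict_mem (isOpen_chartDom a U).measurableSet] with y hy hyU
  unfold inChart
  rw [hy hyU.2]

/-- Smooth forms; two forms are identified on `U` if they coincide on `U`. -/
def smoothReg : Regularity d M where
  nul := ⊤
  countable := inferInstance
  P k U :=
    { carrier := {w | SmoothOn U w}
      zero_mem' := fun a y _ => by rw [inChart_zero]; exact contDiffAt_const
      add_mem' := fun h h' a y hy => by rw [inChart_add]; exact (h a y hy).add (h' a y hy)
      smul_mem' := fun c w h a y hy => by rw [inChart_smul]; exact (h a y hy).const_smul c }
  mono h _ hw a y hy := hw a y (chartDom_mono a h hy)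
  of_local h a y hy := by
    obtain ⟨W, hp, -, hw⟩ := h _ hy.2
    exact hw a y ⟨hy.1, hp⟩
  congr := by
    intro k U w w' hw h a y hy
    refine (hw a y hy).congr_of_eventuallyEq ?_
    filter_upwards [(isOpen_chartDom a U).mem_nhds hy] with z hz
    unfold inChart
    rw [Filter.eventually_top.1 h _ hz.2]

/-- Locally square-integrable forms; two forms are identified on `U` if they coincide almost
everywhere on `U`. -/
def l2Reg : Regularity d M where
  nul := aeFilter d M
  countable := inferInstance
  P k U :=
    { carrier := {w | L2LocOn U w}
      zero_mem' := L2LocOn.zero U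
      add_mem' := fun h h' => L2LocOn.add h h'
      smul_mem' := fun c _ h => L2LocOn.smul c h }
  mono h _ hw a y hy := hw a y (chartDom_mono a h hy)
  of_local h a y hy := by
    obtain ⟨W, hp, -, hw⟩ := h _ hy.2
    exact hw a y ⟨hy.1, hp⟩
  congr := by
    intro k U w w' hw h a y hy
    obtain ⟨N, hN, h1⟩ := hw a y hy
    refine ⟨N ∩ chartDom d a U, Filter.inter_mem hN ((isOpen_chartDom a U).mem_nhds hy), ?_⟩
    refine (h1.mono_measure (Measure.restrict_mono Set.inter_subset_left le_rfl)).ae_eq ?_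
    exact ae_restrict_of_ae_restrict_of_subset Set.inter_subset_right (inChart_ae_eq h a)

end Regularity

/-! ### Sheaves of sections -/

/-- A sheaf of `ℂ`-vector spaces on `M` presented by (not necessarily continuous) sections of a
family of vector spaces: `sec U` consists of the sections which are admissible on `U`, and two of
them define the same element over `U` if they agree on `U` up to the exceptional sets of `nul`. -/
structure SectionSpace (M : Type u) [TopologicalSpace M] where
  F : M → Type
  [grp : ∀ p, AddCommGroup (F p)]
  [mod : ∀ p, Module ℂ (F p)]
  nul : Filter M
  countable : CountableInterFilter nul
  sec : Opens M → Submodule ℂ (∀ p, F p)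
  mono : ∀ {U W : Opens M}, W ≤ U → sec U ≤ sec W
  of_local : ∀ {U : Opens M} {s : ∀ p, F p},
    (∀ p ∈ U, ∃ W : Opens M, p ∈ W ∧ W ≤ U ∧ s ∈ sec W) → s ∈ sec U
  congr : ∀ {U : Opens M} {s t : ∀ p, F p},
    s ∈ sec U → (∀ᶠ p in nul, p ∈ U → s p = t p) → t ∈ sec U

namespace SectionSpace

variable {M : Type u} [TopologicalSpace M] (S : SectionSpace M)

attribute [instance] SectionSpace.grp SectionSpace.mod

/-- The sections over `U` that vanish on `U` up to an exceptional set. -/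
def null (U : Opens M) : Submodule ℂ (S.sec U) where
  carrier := {s | ∀ᶠ p in S.nul, p ∈ U → s.1 p = 0}
  zero_mem' := Filter.Eventually.of_forall fun _ _ => rfl
  add_mem' := fun {s t} hs ht => by
    filter_upwards [hs, ht] with p h1 h2 hp
    change s.1 p + t.1 p = 0
    rw [h1 hp, h2 hp, add_zero]
  smul_mem' := fun c s hs => by
    filter_upwards [hs] with p h1 hp
    change c • s.1 p = 0
    rw [h1 hp, smul_zero]

/-- Restriction of classes of sections. -/
def res {U W : Opens M} (h : W ≤ U) : (S.sec U ⧸ S.null U) →ₗ[ℂ] (S.sec W ⧸ S.null W) :=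
  Submodule.mapQ _ _ (Submodule.inclusion (S.mono h)) fun _ hs => by
    have hs' := hs
    exact Filter.Eventually.mono hs' fun _ h1 hp => h1 (h hp)

/-- The presheaf `U ↦ sec U / null U`. -/
def presheaf : TopCat.Presheaf (ModuleCat.{u} ℂ) (TopCat.of M) where
  obj U := ModuleCat.of ℂ (S.sec U.unop ⧸ S.null U.unop)
  map f := ModuleCat.ofHom (S.res f.unop.le)
  map_id U := by
    ext x
    rfl
  map_comp f g := by
    ext x
    rfl

/-- The class over `U` of an admissible section. -/
def cls {U : Opens M} {s : ∀ p, S.F p} (hs : s ∈ S.sec U) : S.presheaf.obj (op U) :=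
  (S.null U).mkQ ⟨s, hs⟩

lemma cls_surjective {U : Opens M} (x : S.presheaf.obj (op U)) :
    ∃ (s : ∀ p, S.F p) (hs : s ∈ S.sec U), S.cls hs = x := by
  obtain ⟨s, rfl⟩ := Submodule.mkQ_surjective _ x
  exact ⟨s.1, s.2, rfl⟩

lemma map_cls {U W : Opens M} (f : op U ⟶ op W) {s : ∀ p, S.F p} (hs : s ∈ S.sec U) :
    S.presheaf.map f (S.cls hs) = S.cls (S.mono f.unop.le hs) := rfl

lemma cls_eq_iff {U : Opens M} {s t : ∀ p, S.F p} (hs : s ∈ S.sec U) (ht : t ∈ S.sec U) :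
    S.cls hs = S.cls ht ↔ ∀ᶠ p in S.nul, p ∈ U → s p = t p := by
  refine (Submodule.Quotient.eq (S.null U) (x := ⟨s, hs⟩) (y := ⟨t, ht⟩)).trans ?_
  change (∀ᶠ p in S.nul, p ∈ U → s p - t p = 0) ↔ _
  simp only [sub_eq_zero]

theorem isSheaf [SecondCountableTopology M] : S.presheaf.IsSheaf := by
  have := S.countable
  rw [TopCat.Presheaf.isSheaf_iff_isSheafUniqueGluing]
  intro ι U sf hsf
  choose s hs hsx using fun i => S.cls_surjective (sf i)
  have hcompat : ∀ i j, ∀ᶠ p in S.nul, p ∈ U i → p ∈ U j → s i p = s j p := by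
    intro i j
    have h := hsf i j
    rw [← hsx i, ← hsx j] at h
    have h' := (S.cls_eq_iff _ _).1 h
    filter_upwards [h'] with p hp h1 h2 using hp ⟨h1, h2⟩
  obtain ⟨T, hT, hTU⟩ := TopologicalSpace.isOpen_iUnion_countable
    (fun i => (U i : Set M)) (fun i => (U i).2)
  have hcov : ∀ p, p ∈ iSup U → ∃ i ∈ T, p ∈ U i := by
    intro p hp
    have : p ∈ ⋃ i ∈ T, (U i : Set M) := by
      rw [hTU]; simpa using (Opens.mem_iSup.1 hp)
    simpa using this
  classical
  let g : ∀ p, S.F p := fun p => if h : ∃ i ∈ T, p ∈ U i then s h.choose p else 0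
  have hg : ∀ j, ∀ᶠ p in S.nul, p ∈ U j → s j p = g p := by
    intro j
    have : ∀ᶠ p in S.nul, ∀ i ∈ T, p ∈ U i → p ∈ U j → s i p = s j p :=
      (eventually_countable_ball hT).2 fun i _ => hcompat i j
    filter_upwards [this] with p hp hpj
    have hex : ∃ i ∈ T, p ∈ U i := hcov p (Opens.mem_iSup.2 ⟨j, hpj⟩)
    simp only [g, dif_pos hex]
    exact (hp _ hex.choose_spec.1 hex.choose_spec.2 hpj).symm
  have hgs : g ∈ S.sec (iSup U) := S.of_local fun p hp => by
    obtain ⟨i, hi⟩ := Opens.mem_iSup.1 hp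
    exact ⟨U i, hi, le_iSup U i, S.congr (hs i) (hg i)⟩
  refine ⟨S.cls hgs, ?_, ?_⟩
  · intro i
    rw [← hsx i]
    refine (S.cls_eq_iff _ _).2 ?_
    filter_upwards [hg i] with p hp h1 using (hp h1).symm
  · intro y hy
    obtain ⟨t, ht, rfl⟩ := S.cls_surjective y
    refine (S.cls_eq_iff _ _).2 ?_
    have : ∀ᶠ p in S.nul, ∀ i ∈ T, p ∈ U i → t p = g p := by
      refine (eventually_countable_ball hT).2 fun i _ => ?_
      have h1 := hy i
      rw [← hsx i] at h1
      have h2 := (S.cls_eq_iff (S.mono (le_iSup U i) ht) (hs i)).1 h1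
      filter_upwards [h2, hg i] with p h3 h4 h5
      rw [h3 h5, h4 h5]
    filter_upwards [this] with p hp hpU
    obtain ⟨i, hi, hpi⟩ := hcov p hpU
    exact hp i hi hpi

/-- The sheaf of sections. -/
def sheaf [SecondCountableTopology M] : TopCat.Sheaf (ModuleCat.{u} ℂ) (TopCat.of M) :=
  ⟨S.presheaf, S.isSheaf⟩

end SectionSpace

/-! ### Formally integrable structures -/

section Structures

variable (m n : ℕ) (M : Type u) [TopologicalSpace M] [ChartedSpace (Euc (m + n)) M]
  [IsManifold 𝓘(ℝ, Euc (m + n)) ∞ M]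

/-- A smooth real vector field on `U`. -/
def SmoothFieldOn {d : ℕ} {M : Type u} [TopologicalSpace M] [ChartedSpace (Euc d) M]
    [IsManifold 𝓘(ℝ, Euc d) ∞ M] (U : Opens M) (X : ∀ p : M, Tan d p) : Prop :=
  ContMDiffOn 𝓘(ℝ, Euc d) 𝓘(ℝ, Euc d).tangent ∞
    (fun p => (⟨p, X p⟩ : TangentBundle 𝓘(ℝ, Euc d) M)) U

/-- A formally integrable structure of rank `n` and corank `m` on the `(m+n)`-dimensional manifold
`M`: a smooth complex subbundle `𝒱 ⊆ ℂTM` of rank `n` with `[𝒱, 𝒱] ⊆ 𝒱`. Complex vector fields are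
written `X + iY` with real `X`, `Y`, and the Lie bracket is extended complex-bilinearly. -/
structure Structure where
  fib : ∀ p : M, Submodule ℂ (CTan (m + n) p)
  localFrame : ∀ p₀ : M, ∃ U : Opens M, p₀ ∈ U ∧
    ∃ X Y : Fin n → ∀ p : M, Tan (m + n) p,
      (∀ j, SmoothFieldOn U (X j)) ∧ (∀ j, SmoothFieldOn U (Y j)) ∧
      ∀ p ∈ U, LinearIndependent ℂ (fun j => cvec (X j p) (Y j p)) ∧
        Submodule.span ℂ (Set.range fun j => cvec (X j p) (Y j p)) = fib p
  involutive : ∀ (U : Opens M) (X Y X' Y' : ∀ p : M, Tan (m + n) p),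
    SmoothFieldOn U X → SmoothFieldOn U Y → SmoothFieldOn U X' → SmoothFieldOn U Y' →
    (∀ p ∈ U, cvec (X p) (Y p) ∈ fib p) → (∀ p ∈ U, cvec (X' p) (Y' p) ∈ fib p) →
    ∀ p ∈ U, cvec
      (VectorField.mlieBracket 𝓘(ℝ, Euc (m + n)) X X' p
        - VectorField.mlieBracket 𝓘(ℝ, Euc (m + n)) Y Y' p)
      (VectorField.mlieBracket 𝓘(ℝ, Euc (m + n)) X Y' p
        + VectorField.mlieBracket 𝓘(ℝ, Euc (m + n)) Y X' p) ∈ fib p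

variable {m n M}

namespace Structure

variable (V : Structure m n M)

/-- The conormal space `N_p^*𝒱`: the covectors annihilating `𝒱_p`. -/
def conormal (p : M) : Submodule ℂ (Cot (m + n) p) where
  carrier := {θ | ∀ Z ∈ V.fib p, pair θ Z = 0}
  zero_mem' := fun Z _ => by
    have h : ((0 : Cot (m + n) p) : Tan (m + n) p →ₗ[ℝ] ℂ) = 0 := rfl
    rw [pair, h, LinearMap.liftBaseChange, map_zero]; rfl
  add_mem' := fun {θ η} hθ hη Z hZ => by
    have h : ((θ + η : Cot (m + n) p) : Tan (m + n) p →ₗ[ℝ] ℂ) = (θ : Tan (m + n) p →ₗ[ℝ] ℂ) + η :=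
      rfl
    have h1 := hθ Z hZ
    have h2 := hη Z hZ
    rw [pair, LinearMap.liftBaseChange] at h1 h2 ⊢
    rw [h, map_add, LinearMap.add_apply, h1, h2, add_zero]
  smul_mem' := fun c θ hθ Z hZ => by
    have h : ((c • θ : Cot (m + n) p) : Tan (m + n) p →ₗ[ℝ] ℂ)
      = c • (θ : Tan (m + n) p →ₗ[ℝ] ℂ) := rfl
    have h1 := hθ Z hZ
    rw [pair, LinearMap.liftBaseChange] at h1 ⊢
    rw [h, map_smul, LinearMap.smul_apply, h1, smul_zero]

/-- `Lam r k p` is the space `Λ^r N_p^*𝒱 ∧ Λ^{k-r} ℂT_p^*M` of forms of *total* degree `k`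
(zero if `k < r`); thus `Λ_𝒱^{r,q}` is `Lam r (r + q)`. It is spanned by the products
`θ^1 ∧ ⋯ ∧ θ^r ∧ u` with `θ^j` conormal. -/
def Lam (p : M) : (r k : ℕ) → Submodule ℂ (Form (m + n) k p)
  | 0, _ => ⊤
  | _ + 1, 0 => ⊥
  | r + 1, k + 1 =>
      Submodule.span ℂ {w | ∃ θ ∈ V.conormal p, ∃ u ∈ Lam p r k, w = wedgeOne θ u}

/-- The fibre of the canonical bundle `K_𝒱 = Λ^m N^*𝒱`. -/
abbrev canonical (p : M) : Submodule ℂ (Form (m + n) m p) := V.Lam p m m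

lemma iterWedge_mem {p : M} {q : ℕ} (u : Form (m + n) q p) :
    ∀ (k : ℕ) (θ : Fin k → Cot (m + n) p), (∀ j, θ j ∈ V.conormal p) →
      iterWedge k θ u ∈ V.Lam p k (q + k)
  | 0, _, _ => by rw [Lam]; exact Submodule.mem_top
  | k + 1, θ, h => Submodule.subset_span
      ⟨θ 0, h 0, _, iterWedge_mem u k (fun j => θ j.succ) (fun j => h j.succ), rfl⟩

lemma castForm_mem {p : M} {r k l : ℕ} (h : k = l) {w : Form (m + n) k p} (hw : w ∈ V.Lam p r k) :
    castForm h w ∈ V.Lam p r l := by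
  subst h; exact hw

lemma wedgeFrame_mem {p : M} {k q : ℕ} (θ : Fin k → V.conormal p) (u : Form (m + n) q p) :
    wedgeFrame (fun j => (θ j : Cot (m + n) p)) u ∈ V.Lam p k (k + q) :=
  V.castForm_mem _ (V.iterWedge_mem u k _ fun j => (θ j).2)

/-- `Θ ∧ u ∈ Λ_𝒱^{m,q}` for `Θ = θ^1 ∧ ⋯ ∧ θ^m`. -/
def wedgeLam {p : M} {q : ℕ} (θ : Fin m → V.conormal p) (u : Form (m + n) q p) :
    V.Lam p m (m + q) :=
  ⟨wedgeFrame (fun j => (θ j : Cot (m + n) p)) u, V.wedgeFrame_mem θ u⟩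

/-- `Θ = θ^1 ∧ ⋯ ∧ θ^m` as an element of the canonical bundle. -/
def wedgeCan {p : M} (θ : Fin m → V.conormal p) : V.canonical p :=
  ⟨wedgeAll fun j => (θ j : Cot (m + n) p), V.wedgeFrame_mem (q := 0) θ _⟩

/-- A smooth function on `U` annihilated by `𝒱`. -/
def IsBasicFun (U : Opens M) (g : M → ℂ) : Prop :=
  ContMDiffOn 𝓘(ℝ, Euc (m + n)) 𝓘(ℝ, ℂ) ∞ g U ∧ ∀ p ∈ U, dFun g p ∈ V.conormal p

/-- A system of first integrals on `U`: functions whose differentials span `N^*𝒱`. -/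
def IsFirstIntegrals (U : Opens M) (f : Fin m → M → ℂ) : Prop :=
  (∀ j, ContMDiffOn 𝓘(ℝ, Euc (m + n)) 𝓘(ℝ, ℂ) ∞ (f j) U) ∧
  ∀ p ∈ U, Submodule.span ℂ (Set.range fun j => dFun (f j) p) = V.conormal p

/-- Local integrability. -/
def LocallyIntegrable : Prop :=
  ∀ p₀ : M, ∃ U : Opens M, p₀ ∈ U ∧ ∃ f : Fin m → M → ℂ, V.IsFirstIntegrals U f

/-- The structure of a basic bundle on the canonical line bundle `K_𝒱`: a covering of `M` by open
sets with smooth nowhere vanishing sections `Θ_i` of `K_𝒱` (local trivializations) whose transition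
functions are annihilated by `𝒱`. (Only the values of `Θ_i` on `U_i` matter.) In the degenerate
case `m = 0`, where `K_𝒱` is the trivial bundle `Λ^0` and the empty product of covectors is the
section `1`, the section `1` is required to be basic. -/
structure BasicCanonical (ι : Type v) where
  U : ι → Opens M
  cover : ∀ p : M, ∃ i, p ∈ U i
  Θ : ι → ∀ p : M, V.canonical p
  smooth : ∀ i, SmoothOn (U i) (fun p => (Θ i p : Form (m + n) m p))
  ne_zero : ∀ i, ∀ p ∈ U i, Θ i p ≠ 0
  transition : ∀ i j, ∃ g : M → ℂ, V.IsBasicFun (U i ⊓ U j) g ∧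
    ∀ p ∈ U i ⊓ U j, Θ j p = g p • Θ i p
  unit_basic : m = 0 → ∀ i, V.IsBasicFun (U i) (fun p => (Θ i p : Form (m + n) m p) 0)

/-- The fibre of `Λ_𝒱^{m,q}(K_𝒱^{-1}) = Λ_𝒱^{m,q} ⊗ K_𝒱^{-1}`. -/
abbrev LamK (q : ℕ) (p : M) : Type :=
  V.Lam p m (m + q) ⊗[ℂ] Module.Dual ℂ (V.canonical p)

instance (q : ℕ) (p : M) : AddCommGroup (V.LamK q p) :=
  TensorProduct.addCommGroup (R := ℂ) (M := V.Lam p m (m + q))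
    (N := Module.Dual ℂ (V.canonical p))

/-- The contraction of `u ∈ Λ_𝒱^{m,q} ⊗ K_𝒱^{-1}` with `κ ∈ K_𝒱`, `w ⊗ σ ↦ σ(κ) w`. If `κ ≠ 0`
and `σ` is the dual frame of `K_𝒱^{-1}`, then `u = (contraction of u with κ) ⊗ σ`. -/
def contract {q : ℕ} {p : M} (κ : V.canonical p) : V.LamK q p →ₗ[ℂ] Form (m + n) (m + q) p :=
  (V.Lam p m (m + q)).subtype ∘ₗ (TensorProduct.rid ℂ (V.Lam p m (m + q))).toLinearMap ∘ₗ
    LinearMap.lTensor (V.Lam p m (m + q)) (LinearMap.applyₗ κ)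

/-- The fibre of `Λ^q ℂT^*M / Λ_𝒱^{1,q-1}`. -/
abbrev Quot (q : ℕ) (p : M) : Type := Form (m + n) q p ⧸ V.Lam p 1 q

/-- The sections of `Λ^q ℂT^*M / Λ_𝒱^{1,q-1}` of regularity `R`: those which are locally the class
of a form of regularity `R`. -/
def quotSections (R : Regularity (m + n) M) (q : ℕ) : SectionSpace M where
  F := V.Quot q
  nul := R.nul
  countable := R.countable
  sec U :=
    { carrier := {s | ∀ p ∈ U, ∃ W : Opens M, p ∈ W ∧ W ≤ U ∧ ∃ v ∈ R.P q W,
        ∀ᶠ p' in R.nul, p' ∈ W → s p' = (V.Lam p' 1 q).mkQ (v p')}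
      zero_mem' := fun p hp => ⟨U, hp, le_rfl, 0, Submodule.zero_mem _,
        Filter.Eventually.of_forall fun p' _ => (map_zero (V.Lam p' 1 q).mkQ).symm⟩
      add_mem' := by
        intro s t hs ht p hp
        obtain ⟨W, hW, hWU, v, hv, hsv⟩ := hs p hp
        obtain ⟨W', hW', -, v', hv', htv⟩ := ht p hp
        refine ⟨W ⊓ W', ⟨hW, hW'⟩, inf_le_left.trans hWU, v + v',
          Submodule.add_mem _ (R.mono inf_le_left hv) (R.mono inf_le_right hv'), ?_⟩
        filter_upwards [hsv, htv] with p' h1 h2 h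
        change s p' + t p' = (V.Lam p' 1 q).mkQ (v p' + v' p')
        rw [h1 h.1, h2 h.2, map_add]
      smul_mem' := by
        intro c s hs p hp
        obtain ⟨W, hW, hWU, v, hv, hsv⟩ := hs p hp
        refine ⟨W, hW, hWU, c • v, Submodule.smul_mem _ c hv, ?_⟩
        filter_upwards [hsv] with p' h1 h
        change c • s p' = (V.Lam p' 1 q).mkQ (c • v p')
        rw [h1 h, map_smul] }
  mono := by
    intro U W hWU s hs p hp
    obtain ⟨W', hW', -, v, hv, hsv⟩ := hs p (hWU hp)
    refine ⟨W' ⊓ W, ⟨hW', hp⟩, inf_le_right, v, R.mono inf_le_left hv, ?_⟩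
    filter_upwards [hsv] with p' h1 h using h1 h.1
  of_local := by
    intro U s h p hp
    obtain ⟨W, hW, hWU, hs⟩ := h p hp
    obtain ⟨W', hW', hWW, v, hv, hsv⟩ := hs p hW
    exact ⟨W', hW', hWW.trans hWU, v, hv, hsv⟩
  congr := by
    intro U s t hs hst p hp
    obtain ⟨W, hW, hWU, v, hv, hsv⟩ := hs p hp
    refine ⟨W, hW, hWU, v, hv, ?_⟩
    filter_upwards [hsv, hst] with p' h1 h2 h
    rw [← h2 (hWU h), h1 h]

namespace BasicCanonical

variable {V} {ι : Type v} (K : V.BasicCanonical ι)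

/-- The component `u_i` of a section `u = u_i ⊗ σ_i` of `Λ_𝒱^{m,q} ⊗ K_𝒱^{-1}` over `U_i`, where
`σ_i` is the frame of `K_𝒱^{-1}` dual to `Θ_i`. -/
def comp {q : ℕ} (u : ∀ p : M, V.LamK q p) (i : ι) (p : M) : Form (m + n) (m + q) p :=
  V.contract (K.Θ i p) (u p)

/-- The sections of `Λ_𝒱^{m,q}(K_𝒱^{-1})` of regularity `R`: those all of whose components are of
regularity `R`. -/
def sections (R : Regularity (m + n) M) (q : ℕ) : SectionSpace M where
  F := V.LamK q
  nul := R.nul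
  countable := R.countable
  sec U :=
    { carrier := {u | ∀ i, K.comp u i ∈ R.P (m + q) (U ⊓ K.U i)}
      zero_mem' := fun i => by
        have h : K.comp (0 : ∀ p : M, V.LamK q p) i = 0 := by
          funext p; exact (V.contract (K.Θ i p)).map_zero
        rw [h]; exact Submodule.zero_mem _
      add_mem' := by
        intro u u' h h' i
        have e : K.comp (u + u') i = K.comp u i + K.comp u' i := by
          funext p; exact (V.contract (K.Θ i p)).map_add (u p) (u' p)
        rw [e]; exact Submodule.add_mem _ (h i) (h' i)
      smul_mem' := by
        intro c u h i
        have e : K.comp (c • u) i = c • K.comp u i := by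
          funext p; exact (V.contract (K.Θ i p)).map_smul c (u p)
        rw [e]; exact Submodule.smul_mem _ c (h i) }
  mono := fun hWU _ h i => R.mono (inf_le_inf_right _ hWU) (h i)
  of_local := by
    intro U u h i
    refine R.of_local fun p hp => ?_
    obtain ⟨W, hW, hWU, hu⟩ := h p hp.1
    exact ⟨W ⊓ K.U i, ⟨hW, hp.2⟩, inf_le_inf_right _ hWU, hu i⟩
  congr := by
    intro U u u' h huu i
    refine R.congr (h i) ?_
    filter_upwards [huu] with p hp hpU
    unfold comp
    rw [hp hpU.1]

/-- A section of `K_𝒱` over `W` is basic if its components with respect to the `Θ_i` are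
annihilated by `𝒱`. -/
def IsBasicSection (W : Opens M) (s : ∀ p : M, V.canonical p) : Prop :=
  ∀ i, ∃ g : M → ℂ, V.IsBasicFun (W ⊓ K.U i) g ∧ ∀ p ∈ W ⊓ K.U i, s p = g p • K.Θ i p

/-- A smooth frame `θ^1, …, θ^m` of `N^*𝒱` over `W` for which `Θ_W = θ^1 ∧ ⋯ ∧ θ^m` is a basic
section of `K_𝒱`, together with the dual frame `σ_W` of `K_𝒱^{-1}`. -/
structure BasicFrame (W : Opens M) where
  θ : Fin m → ∀ p : M, V.conormal p
  smooth : ∀ j, SmoothCotOn W (fun p => (θ j p : Cot (m + n) p))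
  linInd : ∀ p ∈ W, LinearIndependent ℂ (fun j => (θ j p : Cot (m + n) p))
  span : ∀ p ∈ W, Submodule.span ℂ (Set.range fun j => (θ j p : Cot (m + n) p)) = V.conormal p
  basic : K.IsBasicSection W (fun p => V.wedgeCan fun j => θ j p)
  σ : ∀ p : M, Module.Dual ℂ (V.canonical p)
  σ_apply : ∀ p ∈ W, σ p (V.wedgeCan fun j => θ j p) = 1

/-- `ξ ∧` represents `Ξ_𝒱` over `W`: for some frame `θ` as above and some smooth one-forms
`θ_l^j` with `dθ^j = ∑_l θ_l^j ∧ θ^l` one has `ξ = ∑_l θ_l^l`. -/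
def IsXi (W : Opens M) (ξ : ∀ p : M, Cot (m + n) p) : Prop :=
  ∃ (B : K.BasicFrame W) (η : Fin m → Fin m → ∀ p : M, Cot (m + n) p),
    (∀ j l, SmoothCotOn W (η j l)) ∧
    (∀ j, ∀ p ∈ W, dForm (fun p' => toForm (B.θ j p' : Cot (m + n) p')) p =
      ∑ l, wedgeOne (η j l p) (toForm (B.θ l p : Cot (m + n) p))) ∧
    ∀ p ∈ W, ξ p = ∑ l, η l l p

end BasicCanonical

end Structure

end Structures

/-! ### The differential operators -/

section Operators

variable {m n : ℕ} {M : Type u} [TopologicalSpace M] [ChartedSpace (Euc (m + n)) M]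

/-- `d w ≡ g` weakly on `U`, modulo a family `S` of subspaces of the spaces of `(k+1)`-forms:
in each preferred chart, for every smooth test section `T`, compactly supported in the coordinate
image of `U`, of the dual of the bundle of `(k+1)`-forms which annihilates `S`,
`∫ ⟨T, g⟩ dy = - ∫ ∑_i ⟨∂_i T, dy^i ∧ w⟩ dy`.
For `S = 0` this says that `g` is the distributional exterior derivative of `w`. -/
def WeakD {d : ℕ} {M : Type u} [TopologicalSpace M] [ChartedSpace (Euc d) M] {k : ℕ}
    (S : ∀ p : M, Submodule ℂ (Form d (k + 1) p)) (U : Opens M)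
    (w : ∀ p : M, Form d k p) (g : ∀ p : M, Form d (k + 1) p) : Prop :=
  ∀ (a : M) (T : Euc d → (Euc d [⋀^Fin (k + 1)]→L[ℝ] ℂ) →L[ℂ] ℂ),
    ContDiff ℝ ∞ T → HasCompactSupport T → tsupport T ⊆ chartDom d a U →
    (∀ b : ∀ p : M, Form d (k + 1) p, (∀ p, b p ∈ S p) → ∀ y, T y (inChart a b y) = 0) →
    ∫ y, T y (inChart a g y) =
      - ∫ y, ∑ i : Fin d, (fderiv ℝ T y (EuclideanSpace.single i 1))
        (ContinuousAlternatingMap.alternatizeUncurryFin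
          (ContinuousLinearMap.smulRight
            (Complex.ofRealCLM.comp (EuclideanSpace.proj i : Euc d →L[ℝ] ℝ)) (inChart a w y)))

variable [IsManifold 𝓘(ℝ, Euc (m + n)) ∞ M]

namespace Structure

variable {V : Structure m n M} {ι : Type v}

/-- `f = d_{𝒱,ϑ} u` for smooth sections `u`, `f` of `Λ_𝒱^{m,q}(K_𝒱^{-1})` and
`Λ_𝒱^{m,q+1}(K_𝒱^{-1})` over `U`: in components, `f_i = (d - Ξ_𝒱 - ϑ ∧) u_i`. -/
def BasicCanonical.IsD (K : V.BasicCanonical ι) (ϑ : ∀ p : M, Cot (m + n) p) {q : ℕ} (U : Opens M)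
    (u : ∀ p : M, V.LamK q p) (f : ∀ p : M, V.LamK (q + 1) p) : Prop :=
  ∀ (W : Opens M) (ξ : ∀ p : M, Cot (m + n) p), K.IsXi W ξ → ∀ i, ∀ p ∈ U ⊓ W ⊓ K.U i,
    K.comp f i p = dForm (K.comp u i) p - wedgeOne (ξ p) (K.comp u i p)
      - wedgeOne (ϑ p) (K.comp u i p)

/-- `f = d_{𝒱,ϑ} u` for the maximal extension of `d_{𝒱,ϑ}` to `L²_loc` sections: the identity
`d u_i = f_i + Ξ_𝒱 u_i + ϑ ∧ u_i` holds in the sense of distributions. -/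
def BasicCanonical.IsMaxD (K : V.BasicCanonical ι) (ϑ : ∀ p : M, Cot (m + n) p) {q : ℕ}
    (U : Opens M) (u : ∀ p : M, V.LamK q p) (f : ∀ p : M, V.LamK (q + 1) p) : Prop :=
  ∀ (W : Opens M) (ξ : ∀ p : M, Cot (m + n) p), K.IsXi W ξ → ∀ i,
    WeakD (fun _ => ⊥) (U ⊓ W ⊓ K.U i) (K.comp u i)
      (fun p => K.comp f i p + wedgeOne (ξ p) (K.comp u i p) + wedgeOne (ϑ p) (K.comp u i p))

/-- `t = d'_ϑ s` for smooth sections of `Λ^q ℂT^*M / Λ_𝒱^{1,q-1}` and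
`Λ^{q+1} ℂT^*M / Λ_𝒱^{1,q}` over `U`: if `s` is the class of a smooth form `v`, then `t` is the
class of `dv - ϑ ∧ v`. -/
def IsD' (V : Structure m n M) (ϑ : ∀ p : M, Cot (m + n) p) {q : ℕ} (U : Opens M)
    (s : ∀ p : M, V.Quot q p) (t : ∀ p : M, V.Quot (q + 1) p) : Prop :=
  ∀ W : Opens M, W ≤ U → ∀ v : ∀ p : M, Form (m + n) q p, SmoothOn W v →
    (∀ p ∈ W, s p = (V.Lam p 1 q).mkQ (v p)) →
    ∀ p ∈ W, t p = (V.Lam p 1 (q + 1)).mkQ (dForm v p - wedgeOne (ϑ p) (v p))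

/-- `t = d'_ϑ s` for the maximal extension of `d'_ϑ` to `L²_loc` sections: if `s` and `t` are the
classes of the `L²_loc` forms `v` and `g`, then `dv - ϑ ∧ v` is congruent to `g` modulo
`Λ_𝒱^{1,q}` in the sense of distributions. -/
def IsMaxD' (V : Structure m n M) (ϑ : ∀ p : M, Cot (m + n) p) {q : ℕ} (U : Opens M)
    (s : ∀ p : M, V.Quot q p) (t : ∀ p : M, V.Quot (q + 1) p) : Prop :=
  ∀ W : Opens M, W ≤ U → ∀ (v : ∀ p : M, Form (m + n) q p) (g : ∀ p : M, Form (m + n) (q + 1) p),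
    L2LocOn W v → L2LocOn W g →
    (∀ᶠ p in aeFilter (m + n) M, p ∈ W → s p = (V.Lam p 1 q).mkQ (v p)) →
    (∀ᶠ p in aeFilter (m + n) M, p ∈ W → t p = (V.Lam p 1 (q + 1)).mkQ (g p)) →
    WeakD (fun p => V.Lam p 1 (q + 1)) W v (fun p => g p + wedgeOne (ϑ p) (v p))

/-! ### The sheaves, and the local isomorphisms -/

section Sheaves

/-- The `L²_loc` sections of `Λ_𝒱^{m,q}(K_𝒱^{-1})`, modulo equality almost everywhere. -/
abbrev BasicCanonical.secL (K : V.BasicCanonical ι) (q : ℕ) : SectionSpace M :=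
  K.sections (l2Reg (m + n) M) q

/-- The smooth sections of `Λ_𝒱^{m,q}(K_𝒱^{-1})`. -/
abbrev BasicCanonical.secA (K : V.BasicCanonical ι) (q : ℕ) : SectionSpace M :=
  K.sections (smoothReg (m + n) M) q

/-- The `L²_loc` sections of `Λ^q ℂT^*M / Λ_𝒱^{1,q-1}`, modulo equality almost everywhere. -/
abbrev qsecL (V : Structure m n M) (q : ℕ) : SectionSpace M :=
  V.quotSections (l2Reg (m + n) M) q

/-- The smooth sections of `Λ^q ℂT^*M / Λ_𝒱^{1,q-1}`. -/
abbrev qsecU (V : Structure m n M) (q : ℕ) : SectionSpace M :=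
  V.quotSections (smoothReg (m + n) M) q

variable [SecondCountableTopology M]

/-- The sheaf `ℒ_𝒱^{m,q}(K_𝒱^{-1})` of `L²_loc` sections of `Λ_𝒱^{m,q}(K_𝒱^{-1})`. -/
abbrev BasicCanonical.sheafL (K : V.BasicCanonical ι) (q : ℕ) :
    TopCat.Sheaf (ModuleCat.{u} ℂ) (TopCat.of M) :=
  (K.secL q).sheaf

/-- The sheaf `𝒜_𝒱^{m,q}(K_𝒱^{-1})` of smooth sections of `Λ_𝒱^{m,q}(K_𝒱^{-1})`. -/
abbrev BasicCanonical.sheafA (K : V.BasicCanonical ι) (q : ℕ) :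
    TopCat.Sheaf (ModuleCat.{u} ℂ) (TopCat.of M) :=
  (K.secA q).sheaf

/-- The sheaf `𝔏_𝒱^q` of `L²_loc` sections of `Λ^q ℂT^*M / Λ_𝒱^{1,q-1}`. -/
abbrev quotL (V : Structure m n M) (q : ℕ) : TopCat.Sheaf (ModuleCat.{u} ℂ) (TopCat.of M) :=
  (V.qsecL q).sheaf

/-- The sheaf `𝔘_𝒱^q` of smooth sections of `Λ^q ℂT^*M / Λ_𝒱^{1,q-1}`. -/
abbrev quotU (V : Structure m n M) (q : ℕ) : TopCat.Sheaf (ModuleCat.{u} ℂ) (TopCat.of M) :=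
  (V.qsecU q).sheaf

/-- The morphism `Φ` restricts to the local maps
`Φ_q^W : Θ_W ∧ v ⊗ σ_W ↦ (-1)^{qm} v mod Λ_𝒱^{1,q-1}`, for all open `W ⊆ M`, all basic frames over
`W` and all `L²_loc` forms `v` over `W`. -/
def BasicCanonical.ExtendsLocalMaps (K : V.BasicCanonical ι) {q : ℕ}
    (Φ : K.sheafL q ⟶ V.quotL q) : Prop :=
  ∀ (W : Opens M) (B : K.BasicFrame W) (v : ∀ p : M, Form (m + n) q p), L2LocOn W v →
    ∃ (hu : (fun p => V.wedgeLam (fun j => B.θ j p) (v p) ⊗ₜ[ℂ] B.σ p) ∈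
        (K.secL q).sec W)
      (hs : (fun p => (-1 : ℂ) ^ (q * m) • (V.Lam p 1 q).mkQ (v p)) ∈
        (V.qsecL q).sec W),
      Φ.hom.app (op W) ((K.secL q).cls hu) =
        (V.qsecL q).cls hs

end Sheaves

end Structure

end Operators

end FormInt
end

/-!
Fix `κ ≠ 0` in the canonical line `K_𝒱 = Λ^m N^*𝒱` at a point. Multiplication by `κ` maps
`Λ^q ℂT^*M` onto `Λ_𝒱^{m,q}`, and its kernel is `Λ_𝒱^{1,q-1}`; both facts follow from contraction
with complex vectors dual to a basis of `N^*𝒱`. Hence `Λ_𝒱^{m,q} ⊗ K_𝒱^{-1}` and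
`Λ^q ℂT^*M / Λ_𝒱^{1,q-1}` are isomorphic fibre by fibre, through
`κ ∧ v ⊗ κ^{-1} ↦ (-1)^{qm} v`, and this isomorphism (`Structure.phi`) does not depend on `κ`.
Multiplication by a smooth section of `K_𝒱` and the division which inverts it have smooth
coefficients in local coordinates, so the fibrewise isomorphism preserves smooth and `L²_loc`
sections (`BasicCanonical.mem_sections_iff`) and induces the isomorphisms `Φ_q` of sheaves. They are
determined by their values on local frames because every section is locally of the form
`Θ ∧ v ⊗ σ` (`eq_of_extendsLocalMaps`).

The operators correspond to each other because of the structure equation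
`d(Θ_i ∧ v) = ξ ∧ Θ_i ∧ v + (-1)^m Θ_i ∧ dv`, where `ξ` is any one-form representing `Ξ_𝒱`
(`BasicCanonical.extDeriv_opC`). For the product of a frame with `dθ^j = ∑ l, θ^j_l ∧ θ^l` it is the
Leibniz rule. Passing from such a product to `Θ_i` multiplies it by a basic function `c`, and `dc`
is conormal, so that `dc ∧ Θ_i = 0`; this is where basicness of the bundle is used. On smooth
sections the structure equation gives the commutation with the differentials directly
(`BasicCanonical.dForm_comp_eq`, `BasicCanonical.isD_iff`). The operator `d'_ϑ` is well defined since
`dΛ_𝒱^{1,q-1} ⊆ Λ_𝒱^{1,q}` by integrability, and its square is multiplication by `-dϑ`, which takes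
values in the ideal generated by `N^*𝒱`.

For the maximal extensions, a test section `T` which annihilates `Λ_𝒱^{1,q}` factors as
`T = S ∘ (Θ_i ∧)` with a test section `S`, and every such composition annihilates `Λ_𝒱^{1,q}`. The
structure equation shows that `T` and `S` test the same equation (`BasicCanonical.weakEq_iff`), and
a smooth partition of unity reduces weak equations to small open sets (`WeakD.of_local`).

If `f_1, …, f_m` are first integrals, then `df_1 ∧ ⋯ ∧ df_m` is closed. If `s` and `g s` are closed
nowhere vanishing sections of `K_𝒱`, then `dg ∧ s = 0`, which means that `dg` is conormal: `g` is
basic (`exists_basic_quotient`).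
-/

noncomputable section

namespace FormInt

/-! ### Exterior algebra of a real normed space with complex coefficients -/

section Algebra

variable {E : Type*} [NormedAddCommGroup E] [NormedSpace ℝ E]

section Scalars

variable {k : ℕ} (c c' : ℂ) (u w : E [⋀^Fin k]→L[ℝ] ℂ)

lemma form_zero_smul : (0 : ℂ) • u = 0 := zero_smul ℂ u
lemma form_one_smul : (1 : ℂ) • u = u := one_smul ℂ u
lemma form_smul_zero : c • (0 : E [⋀^Fin k]→L[ℝ] ℂ) = 0 :=
  smul_zero (A := E [⋀^Fin k]→L[ℝ] ℂ) c
lemma form_add_smul : (c + c') • u = c • u + c' • u := add_smul c c' u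
lemma form_mul_smul : (c * c') • u = c • c' • u := mul_smul c c' u
lemma form_smul_add : c • (u + w) = c • u + c • w := smul_add c u w
lemma form_smul_sub : c • (u - w) = c • u - c • w := smul_sub c u w
lemma form_neg_smul : (-c) • u = -(c • u) := neg_smul c u
lemma form_smul_comm : c • c' • u = c' • c • u := smul_comm c c' u

lemma form_smul_cancel {c : ℂ} {u w : E [⋀^Fin k]→L[ℝ] ℂ} (hc : c ≠ 0) (h : c • u = c • w) :
    u = w := by
  have := congrArg (fun x => c⁻¹ • x) h
  simp only [← form_mul_smul, inv_mul_cancel₀ hc, form_one_smul] at this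
  exact this

lemma form_eq_zero_of_eq_neg {u : E [⋀^Fin k]→L[ℝ] ℂ} (h : u = -u) : u = 0 := by
  ext v
  have : u v = - u v := DFunLike.congr_fun h v
  exact self_eq_neg.1 this

end Scalars

/-- The wedge product `θ ∧ u` of a covector and a `k`-form, as a continuous bilinear map. -/
def wedgeL (E : Type*) [NormedAddCommGroup E] [NormedSpace ℝ E] (k : ℕ) :
    (E →L[ℝ] ℂ) →L[ℂ] (E [⋀^Fin k]→L[ℝ] ℂ) →L[ℂ] (E [⋀^Fin (k + 1)]→L[ℝ] ℂ) :=
  LinearMap.mkContinuous₂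
    (LinearMap.mk₂ ℂ
      (fun (θ : E →L[ℝ] ℂ) (u : E [⋀^Fin k]→L[ℝ] ℂ) =>
        ContinuousAlternatingMap.alternatizeUncurryFin
          (ContinuousLinearMap.smulRight (S := ℂ) θ u))
      (fun θ η u => by
        rw [← ContinuousAlternatingMap.alternatizeUncurryFin_add]
        congr 1; ext x : 1; exact form_add_smul _ _ u)
      (fun c θ u => by
        rw [← ContinuousAlternatingMap.alternatizeUncurryFin_smul]
        congr 1; ext x : 1; exact form_mul_smul _ _ u)
      (fun θ u w => by
        rw [← ContinuousAlternatingMap.alternatizeUncurryFin_add]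
        congr 1; ext x : 1; exact form_smul_add _ u w)
      (fun c θ u => by
        rw [← ContinuousAlternatingMap.alternatizeUncurryFin_smul]
        congr 1; ext x : 1; exact form_smul_comm _ _ u))
    (k + 1)
    (fun θ u => by
      refine (ContinuousAlternatingMap.norm_alternatizeUncurryFin_le _).trans ?_
      rw [mul_assoc]
      refine mul_le_mul_of_nonneg_left ?_ (by positivity)
      refine ContinuousLinearMap.opNorm_le_bound _ (by positivity) fun x => ?_
      change ‖θ x • u‖ ≤ _
      rw [norm_smul, mul_right_comm]
      exact mul_le_mul_of_nonneg_right (θ.le_opNorm x) (norm_nonneg u))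

lemma wedgeL_def {k : ℕ} (θ : E →L[ℝ] ℂ) (u : E [⋀^Fin k]→L[ℝ] ℂ) :
    wedgeL E k θ u =
      ContinuousAlternatingMap.alternatizeUncurryFin (ContinuousLinearMap.smulRight θ u) := rfl

lemma wedgeL_apply {k : ℕ} (θ : E →L[ℝ] ℂ) (u : E [⋀^Fin k]→L[ℝ] ℂ) (v : Fin (k + 1) → E) :
    wedgeL E k θ u v = ∑ i : Fin (k + 1), (-1) ^ (i : ℕ) * (θ (v i) * u (i.removeNth v)) := by
  rw [wedgeL_def, ContinuousAlternatingMap.alternatizeUncurryFin_apply]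
  refine Finset.sum_congr rfl fun i _ => ?_
  change ((-1 : ℤ) ^ (i : ℕ)) • (θ (v i) * u (i.removeNth v)) = _
  rw [zsmul_eq_mul]; push_cast; rfl

/-- The contraction `u(x, ·, …, ·)` of a form with a fixed real vector. -/
def contrAux {k : ℕ} (x : E) : (E [⋀^Fin (k + 1)]→L[ℝ] ℂ) →L[ℂ] (E [⋀^Fin k]→L[ℝ] ℂ) :=
  LinearMap.mkContinuous
    { toFun := fun u : E [⋀^Fin (k + 1)]→L[ℝ] ℂ => u.curryLeft x
      map_add' := fun _ _ => rfl
      map_smul' := fun _ _ => rfl } ‖x‖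
    (fun u => by
      refine (u.curryLeft.le_opNorm x).trans ?_
      rw [ContinuousAlternatingMap.norm_curryLeft, mul_comm])

/-- The linear map underlying `contrL`. -/
def contrLin (E : Type*) [NormedAddCommGroup E] [NormedSpace ℝ E] (k : ℕ) :
    E →ₗ[ℝ] (E [⋀^Fin (k + 1)]→L[ℝ] ℂ) →L[ℂ] (E [⋀^Fin k]→L[ℝ] ℂ) where
  toFun x := contrAux x
  map_add' x y := ContinuousLinearMap.ext fun u =>
    ContinuousAlternatingMap.ext fun v => u.toMultilinearMap.cons_add v x y
  map_smul' c x := ContinuousLinearMap.ext fun u =>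
    ContinuousAlternatingMap.ext fun v => u.toMultilinearMap.cons_smul v c x

lemma norm_contrLin_le {k : ℕ} (x : E) : ‖contrLin E k x‖ ≤ 1 * ‖x‖ := by
  rw [one_mul]
  refine ContinuousLinearMap.opNorm_le_bound _ (norm_nonneg x) fun u => ?_
  refine (u.curryLeft.le_opNorm x).trans ?_
  rw [ContinuousAlternatingMap.norm_curryLeft, mul_comm]

/-- The contraction `u(x, ·, …, ·)` of a form with a real vector. -/
def contrL (E : Type*) [NormedAddCommGroup E] [NormedSpace ℝ E] (k : ℕ) :
    E →L[ℝ] (E [⋀^Fin (k + 1)]→L[ℝ] ℂ) →L[ℂ] (E [⋀^Fin k]→L[ℝ] ℂ) :=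
  LinearMap.mkContinuous (E := E) (F := (E [⋀^Fin (k + 1)]→L[ℝ] ℂ) →L[ℂ] (E [⋀^Fin k]→L[ℝ] ℂ))
    (contrLin E k) 1 norm_contrLin_le

lemma contrL_apply {k : ℕ} (x : E) (u : E [⋀^Fin (k + 1)]→L[ℝ] ℂ) (v : Fin k → E) :
    contrL E k x u v = u (Fin.cons x v) := rfl

/-- The contraction of a form with the complex vector `z.1 + i z.2`. -/
def contrC {k : ℕ} (z : E × E) : (E [⋀^Fin (k + 1)]→L[ℝ] ℂ) →L[ℂ] (E [⋀^Fin k]→L[ℝ] ℂ) :=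
  contrL E k z.1 + Complex.I • contrL E k z.2

lemma contrC_apply {k : ℕ} (z : E × E) (u : E [⋀^Fin (k + 1)]→L[ℝ] ℂ) (v : Fin k → E) :
    contrC z u v = u (Fin.cons z.1 v) + Complex.I * u (Fin.cons z.2 v) := rfl

/-- The value of a covector on the complex vector `z.1 + i z.2`. -/
def evC (θ : E →L[ℝ] ℂ) (z : E × E) : ℂ := θ z.1 + Complex.I * θ z.2

lemma contrL_wedgeL {k : ℕ} (x : E) (θ : E →L[ℝ] ℂ) (u : E [⋀^Fin (k + 1)]→L[ℝ] ℂ) :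
    contrL E (k + 1) x (wedgeL E (k + 1) θ u) = θ x • u - wedgeL E k θ (contrL E k x u) := by
  ext v
  change wedgeL E (k + 1) θ u (Fin.cons x v) = θ x * u v - wedgeL E k θ (contrL E k x u) v
  rw [wedgeL_apply, wedgeL_apply, Fin.sum_univ_succ, sub_eq_add_neg, ← Finset.sum_neg_distrib]
  congr 1
  · simp
  · refine Finset.sum_congr rfl fun i _ => ?_
    rw [contrL_apply]
    have : (i.succ).removeNth (Fin.cons x v : Fin (k + 2) → E) = Fin.cons x (i.removeNth v) := by
      ext j
      refine Fin.cases ?_ (fun j => ?_) j <;> simp [Fin.removeNth]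
    rw [this]
    simp [pow_succ]

lemma contrL_wedgeL_zero (x : E) (θ : E →L[ℝ] ℂ) (u : E [⋀^Fin 0]→L[ℝ] ℂ) :
    contrL E 0 x (wedgeL E 0 θ u) = θ x • u := by
  ext v
  change wedgeL E 0 θ u (Fin.cons x v) = θ x * u v
  rw [wedgeL_apply]
  refine (Fin.sum_univ_one _).trans ?_
  rw [Subsingleton.elim (Fin.removeNth 0 _) v]
  simp

lemma contrC_wedgeL {k : ℕ} (z : E × E) (θ : E →L[ℝ] ℂ) (u : E [⋀^Fin (k + 1)]→L[ℝ] ℂ) :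
    contrC z (wedgeL E (k + 1) θ u) = evC θ z • u - wedgeL E k θ (contrC z u) := by
  change contrL E (k + 1) z.1 _ + Complex.I • contrL E (k + 1) z.2 _ =
    evC θ z • u - wedgeL E k θ (contrL E k z.1 u + Complex.I • contrL E k z.2 u)
  rw [contrL_wedgeL, contrL_wedgeL, map_add, map_smul, evC, form_add_smul, form_mul_smul,
    form_smul_sub]
  abel

lemma contrC_wedgeL_zero (z : E × E) (θ : E →L[ℝ] ℂ) (u : E [⋀^Fin 0]→L[ℝ] ℂ) :
    contrC z (wedgeL E 0 θ u) = evC θ z • u := by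
  change contrL E 0 z.1 _ + Complex.I • contrL E 0 z.2 _ = _
  rw [contrL_wedgeL_zero, contrL_wedgeL_zero, evC, form_add_smul, form_mul_smul]

/-- The bilinear map `(x, y) ↦ B(x)(y) u` for a bilinear form `B`. -/
def smulBil {k : ℕ} (B : E →L[ℝ] E →L[ℝ] ℂ) (u : E [⋀^Fin k]→L[ℝ] ℂ) :
    E →L[ℝ] E →L[ℝ] (E [⋀^Fin k]→L[ℝ] ℂ) :=
  LinearMap.mkContinuous₂
    (LinearMap.mk₂ ℝ (fun x y => B x y • u)
      (fun x y z => by rw [map_add, add_apply]; exact form_add_smul _ _ u)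
      (fun c x y => by rw [map_smul, smul_apply]; exact smul_assoc c (B x y) u)
      (fun x y z => by rw [map_add]; exact form_add_smul _ _ u)
      (fun c x y => by rw [map_smul]; exact smul_assoc c (B x y) u))
    (‖B‖ * ‖u‖) (fun x y => by
      change ‖B x y • u‖ ≤ _
      rw [norm_smul]
      refine (mul_le_mul_of_nonneg_right (B.le_opNorm₂ x y) (norm_nonneg u)).trans_eq ?_
      ring)

/-- The form `∑ i, θ^i ∧ η^i ∧ u` attached to a bilinear form `B = ∑ i, θ^i ⊗ η^i`. -/
def wedgeBil {k : ℕ} (B : E →L[ℝ] E →L[ℝ] ℂ) (u : E [⋀^Fin k]→L[ℝ] ℂ) :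
    E [⋀^Fin (k + 2)]→L[ℝ] ℂ :=
  ContinuousAlternatingMap.alternatizeUncurryFin
    (ContinuousAlternatingMap.alternatizeUncurryFinCLM ℝ E ℂ ∘L smulBil B u)

lemma wedgeBil_apply {k : ℕ} (B : E →L[ℝ] E →L[ℝ] ℂ) (u : E [⋀^Fin k]→L[ℝ] ℂ)
    (v : Fin (k + 2) → E) : wedgeBil B u v =
      ∑ i : Fin (k + 1), ∑ j ≥ i, (-1) ^ (i + j : ℕ) *
        ((B (v i.castSucc) (v j.succ) - B (v j.succ) (v i.castSucc)) *
          u (j.removeNth <| i.castSucc.removeNth v)) := by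
  rw [wedgeBil,
    ContinuousAlternatingMap.alternatizeUncurryFin_alternatizeUncurryFinCLM_comp_apply]
  refine Finset.sum_congr rfl fun i _ => Finset.sum_congr rfl fun j _ => ?_
  rw [zsmul_eq_mul, sub_mul]
  push_cast
  rfl

lemma wedgeBil_add {k : ℕ} (B B' : E →L[ℝ] E →L[ℝ] ℂ) (u : E [⋀^Fin k]→L[ℝ] ℂ) :
    wedgeBil (B + B') u = wedgeBil B u + wedgeBil B' u := by
  ext v
  change _ = wedgeBil B u v + wedgeBil B' u v
  simp only [wedgeBil_apply, ← Finset.sum_add_distrib, add_apply]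
  refine Finset.sum_congr rfl fun i _ => Finset.sum_congr rfl fun j _ => ?_
  ring

/-- The form `B ∧ u` only depends on the antisymmetrization of the bilinear form `B`. -/
lemma wedgeBil_congr {k : ℕ} {B B' : E →L[ℝ] E →L[ℝ] ℂ}
    (hB : ∀ x y, B x y - B y x = B' x y - B' y x) (u : E [⋀^Fin k]→L[ℝ] ℂ) :
    wedgeBil B u = wedgeBil B' u := by
  ext v
  simp only [wedgeBil_apply, hB]

lemma wedgeL_wedgeL {k : ℕ} (θ η : E →L[ℝ] ℂ) (u : E [⋀^Fin k]→L[ℝ] ℂ) :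
    wedgeL E (k + 1) θ (wedgeL E k η u) = wedgeBil (ContinuousLinearMap.smulRight θ η) u := by
  rw [wedgeL_def, wedgeBil]
  congr 1
  ext x : 1
  change θ x • wedgeL E k η u =
    ContinuousAlternatingMap.alternatizeUncurryFin (smulBil (ContinuousLinearMap.smulRight θ η) u x)
  have : smulBil (ContinuousLinearMap.smulRight θ η) u x =
      θ x • (ContinuousLinearMap.smulRight η u : E →L[ℝ] (E [⋀^Fin k]→L[ℝ] ℂ)) := by
    ext y : 1; exact form_mul_smul _ _ u
  rw [this, ContinuousAlternatingMap.alternatizeUncurryFin_smul, wedgeL_def]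

lemma wedgeL_anticomm {k : ℕ} (θ η : E →L[ℝ] ℂ) (u : E [⋀^Fin k]→L[ℝ] ℂ) :
    wedgeL E (k + 1) θ (wedgeL E k η u) = - wedgeL E (k + 1) η (wedgeL E k θ u) := by
  rw [wedgeL_wedgeL, wedgeL_wedgeL]
  ext v
  change _ = - wedgeBil (ContinuousLinearMap.smulRight η θ) u v
  simp only [wedgeBil_apply, ← Finset.sum_neg_distrib]
  refine Finset.sum_congr rfl fun i _ => Finset.sum_congr rfl fun j _ => ?_
  change _ * ((θ _ * η _ - θ _ * η _) * _) = -(_ * ((η _ * θ _ - η _ * θ _) * _))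
  ring

lemma wedgeL_self {k : ℕ} (θ : E →L[ℝ] ℂ) (u : E [⋀^Fin k]→L[ℝ] ℂ) :
    wedgeL E (k + 1) θ (wedgeL E k θ u) = 0 :=
  form_eq_zero_of_eq_neg (wedgeL_anticomm θ θ u)

/-- `θ^1 ∧ ⋯ ∧ θ^k ∧ u`, in degree `q + k`, as a continuous linear map in `u`. -/
def iterW {q : ℕ} : (k : ℕ) → (Fin k → E →L[ℝ] ℂ) →
    (E [⋀^Fin q]→L[ℝ] ℂ) →L[ℂ] (E [⋀^Fin (q + k)]→L[ℝ] ℂ)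
  | 0, _ => ContinuousLinearMap.id ℂ _
  | k + 1, θ => (wedgeL E (q + k) (θ 0)).comp (iterW k (fun j => θ j.succ))

lemma iterW_succ {q k : ℕ} (θ : Fin (k + 1) → E →L[ℝ] ℂ) (u : E [⋀^Fin q]→L[ℝ] ℂ) :
    iterW (k + 1) θ u = wedgeL E (q + k) (θ 0) (iterW k (fun j => θ j.succ) u) := rfl

/-- The successive contraction with `z_0`, …, `z_{k-1}`. -/
def iterC {q : ℕ} : (k : ℕ) → (Fin k → E × E) →
    (E [⋀^Fin (q + k)]→L[ℝ] ℂ) →L[ℂ] (E [⋀^Fin q]→L[ℝ] ℂ)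
  | 0, _ => ContinuousLinearMap.id ℂ _
  | k + 1, z => (iterC k (fun j => z j.succ)).comp (contrC (k := q + k) (z 0))

lemma iterC_succ {q k : ℕ} (z : Fin (k + 1) → E × E) (u : E [⋀^Fin (q + (k + 1))]→L[ℝ] ℂ) :
    iterC (k + 1) z u = iterC k (fun j => z j.succ) (contrC (k := q + k) (z 0) u) := rfl

/-- Transport of a form on a normed space along an equality of degrees. -/
def castF {k l : ℕ} (h : k = l) : (E [⋀^Fin k]→L[ℝ] ℂ) →L[ℂ] (E [⋀^Fin l]→L[ℝ] ℂ) :=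
  h ▸ ContinuousLinearMap.id ℂ _

lemma castF_castF {k l r : ℕ} (h : k = l) (h' : l = r) (u : E [⋀^Fin k]→L[ℝ] ℂ) :
    castF h' (castF h u) = castF (h.trans h') u := by subst h; subst h'; rfl

lemma wedgeL_castF {k l : ℕ} (h : k = l) (θ : E →L[ℝ] ℂ) (u : E [⋀^Fin k]→L[ℝ] ℂ) :
    wedgeL E l θ (castF h u) = castF (congrArg (· + 1) h) (wedgeL E k θ u) := by subst h; rfl

lemma iterW_wedgeL {q : ℕ} (α : E →L[ℝ] ℂ) (u : E [⋀^Fin q]→L[ℝ] ℂ) :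
    ∀ (k : ℕ) (θ : Fin k → E →L[ℝ] ℂ), iterW k θ (wedgeL E q α u) =
      (-1 : ℂ) ^ k • castF (Nat.add_right_comm q k 1) (wedgeL E (q + k) α (iterW k θ u))
  | 0, θ => by rw [pow_zero, form_one_smul]; rfl
  | k + 1, θ => by
    rw [iterW_succ, iterW_wedgeL α u k, map_smul, wedgeL_castF, wedgeL_anticomm, iterW_succ,
      pow_succ, form_mul_smul, form_neg_smul, form_one_smul, map_neg]
    rfl

lemma wedgeL_iterW_mem {q : ℕ} (u : E [⋀^Fin q]→L[ℝ] ℂ) :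
    ∀ (k : ℕ) (θ : Fin k → E →L[ℝ] ℂ) (j : Fin k), wedgeL E (q + k) (θ j) (iterW k θ u) = 0
  | 0, _, j => j.elim0
  | k + 1, θ, j => by
    rw [iterW_succ]
    refine Fin.cases ?_ (fun i => ?_) j
    · exact wedgeL_self _ _
    · exact (wedgeL_anticomm (k := q + k) _ _ _).trans (by
        rw [wedgeL_iterW_mem u k (fun j => θ j.succ) i, map_zero, neg_zero])

lemma iterW_eq_zero {q : ℕ} (u : E [⋀^Fin q]→L[ℝ] ℂ) :
    ∀ (k : ℕ) (θ : Fin k → E →L[ℝ] ℂ) (i j : Fin k), i ≠ j → θ i = θ j → iterW k θ u = 0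
  | 0, _, j, _, _, _ => j.elim0
  | k + 1, θ, i, j, hij, h => by
    have key : ∀ r : Fin k, θ 0 = θ r.succ → iterW (k + 1) θ u = 0 := fun r hr => by
      rw [iterW_succ, hr]; exact wedgeL_iterW_mem u k (fun j => θ j.succ) r
    rcases Fin.eq_zero_or_eq_succ i with rfl | ⟨i, rfl⟩ <;>
      rcases Fin.eq_zero_or_eq_succ j with rfl | ⟨j, rfl⟩
    · exact absurd rfl hij
    · exact key j h
    · exact key i h.symm
    · rw [iterW_succ, iterW_eq_zero u k (fun j => θ j.succ) i j (fun e => hij (by rw [e])) h,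
        map_zero]

/-- A form killed by the wedge products with the `θ^j` is divisible by `θ^1 ∧ ⋯ ∧ θ^k`; the
contraction with dual complex vectors provides the quotient. -/
lemma iterW_iterC {q : ℕ} : ∀ (k : ℕ) (θ : Fin k → E →L[ℝ] ℂ) (z : Fin k → E × E)
    (_ : ∀ i j, evC (θ i) (z j) = if i = j then 1 else 0) (u : E [⋀^Fin (q + k)]→L[ℝ] ℂ)
    (_ : ∀ j, wedgeL E (q + k) (θ j) u = 0), iterW k θ (iterC k z u) = u
  | 0, _, _, _, _, _ => rfl
  | k + 1, θ, z, h, u, hu => by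
    have h0 : wedgeL E (q + k) (θ 0) (contrC (k := q + k) (z 0) u) = u := by
      have := contrC_wedgeL (k := q + k) (z 0) (θ 0) u
      rw [show wedgeL E (q + k + 1) (θ 0) u = 0 from hu 0, map_zero, h 0 0, if_pos rfl, form_one_smul] at this
      exact (sub_eq_zero.1 this.symm).symm
    rw [iterC_succ, iterW_succ, iterW_iterC k (fun j => θ j.succ) (fun j => z j.succ)
      (fun i j => by simpa using h i.succ j.succ), h0]
    intro j
    have := contrC_wedgeL (k := q + k) (z 0) (θ j.succ) u
    rw [show wedgeL E (q + k + 1) (θ j.succ) u = 0 from hu j.succ, map_zero, h j.succ 0, if_neg (Fin.succ_ne_zero j), form_zero_smul, zero_sub] at this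
    exact neg_eq_zero.1 this.symm

/-- The forms of degree `k` in the `r`-th power of the ideal generated by a space `N` of
covectors. -/
def LamE (N : Submodule ℂ (E →L[ℝ] ℂ)) : (r k : ℕ) → Submodule ℂ (E [⋀^Fin k]→L[ℝ] ℂ)
  | 0, _ => ⊤
  | _ + 1, 0 => ⊥
  | r + 1, k + 1 => Submodule.span ℂ {w | ∃ θ ∈ N, ∃ u ∈ LamE N r k, w = wedgeL E k θ u}

lemma wedgeL_mem_LamE {N : Submodule ℂ (E →L[ℝ] ℂ)} {k : ℕ} {θ : E →L[ℝ] ℂ} (hθ : θ ∈ N)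
    (u : E [⋀^Fin k]→L[ℝ] ℂ) : wedgeL E k θ u ∈ LamE N 1 (k + 1) := by
  rw [LamE]
  exact Submodule.subset_span ⟨θ, hθ, u, by rw [LamE]; trivial, rfl⟩

lemma LamE_one_induction {N : Submodule ℂ (E →L[ℝ] ℂ)} {k : ℕ}
    {p : (E [⋀^Fin (k + 1)]→L[ℝ] ℂ) → Prop}
    (hw : ∀ θ ∈ N, ∀ u, p (wedgeL E k θ u)) (h0 : p 0) (hadd : ∀ x y, p x → p y → p (x + y))
    (hs : ∀ (c : ℂ) x, p x → p (c • x)) {w : E [⋀^Fin (k + 1)]→L[ℝ] ℂ}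
    (h : w ∈ LamE N 1 (k + 1)) : p w := by
  rw [LamE] at h
  induction h using Submodule.span_induction with
  | mem x hx => obtain ⟨θ, hθ, u, -, rfl⟩ := hx; exact hw θ hθ u
  | zero => exact h0
  | add x y _ _ hx hy => exact hadd x y hx hy
  | smul c x _ hx => exact hs c x hx

lemma wedgeL_LamE {N : Submodule ℂ (E →L[ℝ] ℂ)} {k : ℕ} (α : E →L[ℝ] ℂ)
    {w : E [⋀^Fin k]→L[ℝ] ℂ} (h : w ∈ LamE N 1 k) : wedgeL E k α w ∈ LamE N 1 (k + 1) := by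
  cases k with
  | zero => rw [LamE, Submodule.mem_bot] at h; rw [h, map_zero]; exact zero_mem _
  | succ k =>
    refine LamE_one_induction (p := fun w => wedgeL E (k + 1) α w ∈ LamE N 1 (k + 2))
      (fun θ hθ u => ?_) ?_ (fun x y hx hy => ?_) (fun c x hx => ?_) h
    · rw [wedgeL_anticomm]; exact neg_mem (wedgeL_mem_LamE hθ _)
    · rw [map_zero]; exact zero_mem _
    · rw [map_add]; exact add_mem hx hy
    · rw [map_smul]; exact Submodule.smul_mem _ c hx

lemma LamE_mono {N N' : Submodule ℂ (E →L[ℝ] ℂ)} (hN : N ≤ N') {k : ℕ} :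
    LamE N 1 k ≤ LamE N' 1 k := by
  cases k with
  | zero => rw [LamE, LamE]
  | succ k =>
    intro w h
    refine LamE_one_induction (p := fun w => w ∈ LamE N' 1 (k + 1))
      (fun θ hθ u => wedgeL_mem_LamE (hN hθ) u) (zero_mem _) (fun x y hx hy => add_mem hx hy)
      (fun c x hx => Submodule.smul_mem _ c hx) h

lemma contrC_LamE {N : Submodule ℂ (E →L[ℝ] ℂ)} {z : E × E} (hz : ∀ θ ∈ N, evC θ z = 0) {k : ℕ}
    {w : E [⋀^Fin (k + 1)]→L[ℝ] ℂ} (h : w ∈ LamE N 1 (k + 1)) : contrC z w ∈ LamE N 1 k := by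
  refine LamE_one_induction (p := fun w => contrC z w ∈ LamE N 1 k)
      (fun θ hθ u => ?_) ?_ (fun x y hx hy => ?_) (fun c x hx => ?_) h
  · cases k with
    | zero => rw [contrC_wedgeL_zero, hz θ hθ, form_zero_smul]; exact zero_mem _
    | succ k =>
      rw [contrC_wedgeL, hz θ hθ, form_zero_smul, zero_sub]
      exact neg_mem (wedgeL_mem_LamE hθ _)
  · rw [map_zero]; exact zero_mem _
  · rw [map_add]; exact add_mem hx hy
  · rw [map_smul]; exact Submodule.smul_mem _ c hx

lemma iterC_LamE {N : Submodule ℂ (E →L[ℝ] ℂ)} {q : ℕ} :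
    ∀ (k : ℕ) (z : Fin k → E × E) (_ : ∀ j, ∀ θ ∈ N, evC θ (z j) = 0)
      (w : E [⋀^Fin (q + k)]→L[ℝ] ℂ) (_ : w ∈ LamE N 1 (q + k)), iterC k z w ∈ LamE N 1 q
  | 0, _, _, _, h => h
  | k + 1, z, hz, _, h =>
    iterC_LamE k (fun j => z j.succ) (fun j => hz j.succ) _ (contrC_LamE (k := q + k) (hz 0) h)

/-- The contraction with dual vectors undoes `θ^1 ∧ ⋯ ∧ θ^k ∧` modulo the ideal of the `θ^j`. -/
lemma iterC_iterW {q : ℕ} : ∀ (k : ℕ) (θ : Fin k → E →L[ℝ] ℂ) (z : Fin k → E × E)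
    (_ : ∀ i j, evC (θ i) (z j) = if i = j then 1 else 0) (u : E [⋀^Fin q]→L[ℝ] ℂ),
    iterC k z (iterW k θ u) - u ∈ LamE (Submodule.span ℂ (Set.range θ)) 1 q
  | 0, _, _, _, u => by
    change u - u ∈ _
    rw [sub_self]; exact zero_mem _
  | k + 1, θ, z, h, u => by
    set w := iterW k (fun j => θ j.succ) u with hw
    have hx : ∃ x ∈ LamE (Submodule.span ℂ {θ 0}) 1 (q + k),
        contrC (k := q + k) (z 0) (wedgeL E (q + k) (θ 0) w) = w - x := by
      have h00 : evC (θ 0) (z 0) = 1 := by rw [h, if_pos rfl]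
      clear_value w
      clear hw
      generalize q + k = r at w
      cases r with
      | zero => exact ⟨0, zero_mem _, by rw [contrC_wedgeL_zero, h00, form_one_smul, sub_zero]⟩
      | succ r =>
        exact ⟨_, wedgeL_mem_LamE (Submodule.mem_span_singleton_self _) _, by
          rw [contrC_wedgeL, h00, form_one_smul]⟩
    obtain ⟨x, hx, e⟩ := hx
    rw [iterC_succ, iterW_succ, e, map_sub, sub_right_comm]
    refine sub_mem (LamE_mono (Submodule.span_mono ?_) (iterC_iterW k (fun j => θ j.succ)
      (fun j => z j.succ) (fun i j => by simpa using h i.succ j.succ) u))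
      (LamE_mono (Submodule.span_mono ?_) (iterC_LamE k _ (fun j η hη => ?_) x hx))
    · rintro _ ⟨j, rfl⟩; exact ⟨_, rfl⟩
    · rintro _ rfl; exact ⟨0, rfl⟩
    · obtain ⟨c, rfl⟩ := Submodule.mem_span_singleton.1 hη
      have : evC (c • θ 0) (z j.succ) = c * evC (θ 0) (z j.succ) := by
        simp only [evC, smul_apply, smul_eq_mul]; ring
      rw [this, h, if_neg (Fin.succ_ne_zero j).symm, mul_zero]

lemma wedgeL_eq_zero_of_mem_span {ι : Type*} {θ : ι → E →L[ℝ] ℂ} {k : ℕ}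
    {w : E [⋀^Fin k]→L[ℝ] ℂ} (h : ∀ j, wedgeL E k (θ j) w = 0) {α : E →L[ℝ] ℂ}
    (hα : α ∈ Submodule.span ℂ (Set.range θ)) : wedgeL E k α w = 0 := by
  induction hα using Submodule.span_induction with
  | mem x hx => obtain ⟨j, rfl⟩ := hx; exact h j
  | zero => rw [map_zero]; rfl
  | add x y _ _ hx hy => rw [map_add, add_apply, hx, hy, add_zero]
  | smul c x _ hx => rw [map_smul, smul_apply, hx, form_smul_zero]

lemma iterW_LamE {k q : ℕ} {θ : Fin k → E →L[ℝ] ℂ} {w : E [⋀^Fin q]→L[ℝ] ℂ}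
    (h : w ∈ LamE (Submodule.span ℂ (Set.range θ)) 1 q) : iterW k θ w = 0 := by
  cases q with
  | zero => rw [LamE, Submodule.mem_bot] at h; rw [h, map_zero]
  | succ q =>
    refine LamE_one_induction (p := fun w => iterW k θ w = 0)
      (fun α hα u => ?_) (map_zero _) (fun x y hx hy => by rw [map_add, hx, hy, add_zero])
      (fun c x hx => by rw [map_smul, hx, form_smul_zero]) h
    rw [iterW_wedgeL, wedgeL_eq_zero_of_mem_span (wedgeL_iterW_mem u k θ) hα, map_zero, form_smul_zero]

lemma LamE_le_span {ι : Type*} (θ : ι → E →L[ℝ] ℂ) {q : ℕ} : ∀ r : ℕ,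
    LamE (Submodule.span ℂ (Set.range θ)) r (q + r) ≤
      Submodule.span ℂ {w | ∃ (s : Fin r → ι) (u : E [⋀^Fin q]→L[ℝ] ℂ),
        w = iterW r (fun j => θ (s j)) u}
  | 0 => fun w _ => Submodule.subset_span ⟨Fin.elim0, w, rfl⟩
  | r + 1 => by
    change Submodule.span ℂ _ ≤ _
    refine Submodule.span_le.2 ?_
    rintro _ ⟨α, hα, u, hu, rfl⟩
    have hu' := LamE_le_span θ r hu
    induction hα using Submodule.span_induction with
    | zero => rw [map_zero]; exact zero_mem _
    | add x y _ _ hx hy => rw [map_add]; exact add_mem hx hy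
    | smul c x _ hx => rw [map_smul]; exact Submodule.smul_mem _ c hx
    | mem x hx =>
      obtain ⟨i, rfl⟩ := hx
      clear hu
      induction hu' using Submodule.span_induction with
      | zero => rw [map_zero]; exact zero_mem _
      | add x y _ _ hx hy => rw [map_add]; exact add_mem hx hy
      | smul c x _ hx => rw [map_smul]; exact Submodule.smul_mem _ c hx
      | mem x hx =>
        obtain ⟨s, v, rfl⟩ := hx
        exact Submodule.subset_span ⟨Fin.cons i s, v, rfl⟩

/-- The top power of an ideal generated by `k` covectors is killed by these covectors. -/
lemma wedgeL_LamE_top {k q : ℕ} {θ : Fin k → E →L[ℝ] ℂ} {w : E [⋀^Fin (q + k)]→L[ℝ] ℂ}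
    (h : w ∈ LamE (Submodule.span ℂ (Set.range θ)) k (q + k)) (j : Fin k) :
    wedgeL E (q + k) (θ j) w = 0 := by
  suffices hs : Submodule.span ℂ {w | ∃ (s : Fin k → Fin k) (u : E [⋀^Fin q]→L[ℝ] ℂ),
      w = iterW k (fun j => θ (s j)) u} ≤ LinearMap.ker (wedgeL E (q + k) (θ j)).toLinearMap from
    hs (LamE_le_span θ k h)
  refine Submodule.span_le.2 ?_
  rintro _ ⟨s, u, rfl⟩
  change wedgeL E (q + k) (θ j) (iterW k (fun j => θ (s j)) u) = 0
  by_cases hs : Function.Injective s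
  · obtain ⟨i, rfl⟩ := (Finite.injective_iff_surjective.1 hs) j
    exact wedgeL_iterW_mem u k (fun j => θ (s j)) i
  · simp only [Function.Injective, not_forall] at hs
    obtain ⟨i, i', h, hne⟩ := hs
    rw [iterW_eq_zero u k _ i i' hne (by rw [h]), map_zero]

/-- `θ^1 ∧ ⋯ ∧ θ^k ∧ u` as an alternating map of the covectors `θ^j`. -/
def iterWAlt {q : ℕ} (k : ℕ) (u : E [⋀^Fin q]→L[ℝ] ℂ) :
    (E →L[ℝ] ℂ) [⋀^Fin k]→ₗ[ℂ] (E [⋀^Fin (q + k)]→L[ℝ] ℂ) where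
  toFun θ := iterW k θ u
  map_update_add' := by
    intro _ θ i x y
    obtain rfl : ‹DecidableEq (Fin k)› = instDecidableEqFin k := Subsingleton.elim _ _
    induction k with
    | zero => exact i.elim0
    | succ k ih =>
      refine Fin.cases ?_ (fun i => ?_) i
      · simp only [iterW_succ, Function.update_self]
        simp only [ne_eq, Fin.succ_ne_zero, not_false_eq_true, Function.update_of_ne, map_add,
          add_apply]
      · have e (x : E →L[ℝ] ℂ) : (fun j : Fin k => Function.update θ i.succ x j.succ) =
            Function.update (fun j => θ j.succ) i x := by
          ext1 j
          by_cases h : j = i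
          · subst h; simp
          · simp [h]
        simp only [iterW_succ, e, ih, map_add]
        rw [Function.update_of_ne (Fin.succ_ne_zero i).symm,
          Function.update_of_ne (Fin.succ_ne_zero i).symm,
          Function.update_of_ne (Fin.succ_ne_zero i).symm]
  map_update_smul' := by
    intro _ θ i c x
    obtain rfl : ‹DecidableEq (Fin k)› = instDecidableEqFin k := Subsingleton.elim _ _
    induction k with
    | zero => exact i.elim0
    | succ k ih =>
      refine Fin.cases ?_ (fun i => ?_) i
      · simp only [iterW_succ, Function.update_self]
        simp only [ne_eq, Fin.succ_ne_zero, not_false_eq_true, Function.update_of_ne, map_smul,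
          smul_apply]
      · have e (x : E →L[ℝ] ℂ) : (fun j : Fin k => Function.update θ i.succ x j.succ) =
            Function.update (fun j => θ j.succ) i x := by
          ext1 j
          by_cases h : j = i
          · subst h; simp
          · simp [h]
        simp only [iterW_succ, e, ih, map_smul]
        rw [Function.update_of_ne (Fin.succ_ne_zero i).symm,
          Function.update_of_ne (Fin.succ_ne_zero i).symm]
  map_eq_zero_of_eq' θ i j h hij := iterW_eq_zero u k θ i j hij h

lemma exists_alternating_eq_smul {F : Type*} [AddCommGroup F] [Module ℂ F] {k : ℕ}
    {θ φ : Fin k → F} (hθ : LinearIndependent ℂ θ)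
    (hφ : ∀ j, φ j ∈ Submodule.span ℂ (Set.range θ)) :
    ∃ c : ℂ, ∀ (G : Type u) [AddCommGroup G] [Module ℂ G] (f : F [⋀^Fin k]→ₗ[ℂ] G),
      f φ = c • f θ := by
  let b : Module.Basis (Fin k) ℂ (Submodule.span ℂ (Set.range θ)) := Module.Basis.span hθ
  have hb (j) : (b j : F) = θ j := congrArg Subtype.val (Module.Basis.span_apply hθ j)
  refine ⟨b.det fun j => ⟨φ j, hφ j⟩, fun G _ _ f => ?_⟩
  have key : f.compLinearMap (Submodule.span ℂ (Set.range θ)).subtype =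
      (LinearMap.toSpanSingleton ℂ _ (f θ)).compAlternatingMap b.det := by
    refine Module.Basis.ext_alternating b fun s hs => ?_
    let σ : Equiv.Perm (Fin k) := Equiv.ofBijective s (Finite.injective_iff_bijective.1 hs)
    have hσ : (fun j => b (s j)) = b ∘ σ := rfl
    rw [hσ]
    have e1 := AlternatingMap.map_perm (f.compLinearMap (Submodule.span ℂ (Set.range θ)).subtype)
      b σ
    have e2 := AlternatingMap.map_perm
      ((LinearMap.toSpanSingleton ℂ _ (f θ)).compAlternatingMap b.det) b σ
    refine e1.trans (Eq.trans ?_ e2.symm)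
    congr 1
    have e3 : b.det b = 1 := b.det_self
    change f (fun j => (b j : F)) = b.det b • f θ
    rw [e3, one_smul]
    simp only [hb]
  exact DFunLike.congr_fun key fun j => ⟨φ j, hφ j⟩

/-- A change of basis multiplies `θ^1 ∧ ⋯ ∧ θ^k ∧ u` by a factor independent of `u`. -/
lemma exists_iterW_eq_smul {k : ℕ} {θ φ : Fin k → E →L[ℝ] ℂ} (hθ : LinearIndependent ℂ θ)
    (hφ : ∀ j, φ j ∈ Submodule.span ℂ (Set.range θ)) :
    ∃ c : ℂ, ∀ (q : ℕ) (u : E [⋀^Fin q]→L[ℝ] ℂ), iterW k φ u = c • iterW k θ u := by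
  obtain ⟨c, hc⟩ := exists_alternating_eq_smul hθ hφ
  exact ⟨c, fun q u => hc _ (iterWAlt k u)⟩

end Algebra

/-! ### Two-forms, and the Leibniz rule for iterated wedge products -/

section Calculus

variable {E : Type*} [NormedAddCommGroup E] [NormedSpace ℝ E]

/-- A covector as a form of degree one. -/
def ofCov (θ : E →L[ℝ] ℂ) : E [⋀^Fin 1]→L[ℝ] ℂ :=
  ContinuousAlternatingMap.ofSubsingleton ℝ E ℂ (0 : Fin 1) θ

lemma ofCov_apply (θ : E →L[ℝ] ℂ) (v : Fin 1 → E) : ofCov θ v = θ (v 0) := rfl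

/-- The covector underlying a form of degree one. -/
def cov (u : E [⋀^Fin 1]→L[ℝ] ℂ) : E →L[ℝ] ℂ :=
  (ContinuousAlternatingMap.ofSubsingletonLIE (𝕜 := ℝ) (E := E) (F := ℂ) (0 : Fin 1)).symm u

lemma ofCov_cov (u : E [⋀^Fin 1]→L[ℝ] ℂ) : ofCov (cov u) = u :=
  (ContinuousAlternatingMap.ofSubsingletonLIE (𝕜 := ℝ) (E := E) (F := ℂ)
    (0 : Fin 1)).apply_symm_apply u

lemma cov_apply (u : E [⋀^Fin 1]→L[ℝ] ℂ) (x : E) : cov u x = u ![x] := by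
  conv_rhs => rw [← ofCov_cov u]
  rfl

/-- The bilinear form `τ / 2` of a two-form `τ`. -/
def halfBil (τ : E [⋀^Fin 2]→L[ℝ] ℂ) : E →L[ℝ] E →L[ℝ] ℂ :=
  LinearMap.mkContinuous₂
    (LinearMap.mk₂ ℝ (fun x y => 2⁻¹ * contrL E 0 y (contrL E 1 x τ) ![])
      (fun x y z => by
        rw [map_add, add_apply, map_add, ← mul_add]; rfl)
      (fun c x y => by
        have : τ ![c • x, y] = (c : ℂ) * τ ![x, y] := τ.toMultilinearMap.cons_smul _ c x
        exact (congrArg (2⁻¹ * ·) this).trans (mul_left_comm _ _ _))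
      (fun x y z => by
        rw [map_add, add_apply, ← mul_add]; rfl)
      (fun c x y => by
        rw [map_smul, smul_apply]
        exact mul_left_comm _ _ _))
    ‖τ‖ (fun x y => by
      change ‖2⁻¹ * τ ![x, y]‖ ≤ _
      rw [norm_mul]
      have h := τ.le_opNorm ![x, y]
      simp only [Fin.prod_univ_two, Matrix.cons_val_zero, Matrix.cons_val_one] at h
      have h2 : ‖(2⁻¹ : ℂ)‖ ≤ 1 := by norm_num
      calc _ ≤ 1 * (‖τ‖ * (‖x‖ * ‖y‖)) := by gcongr
        _ = _ := by ring)

lemma halfBil_apply (τ : E [⋀^Fin 2]→L[ℝ] ℂ) (x y : E) : halfBil τ x y = 2⁻¹ * τ ![x, y] := rfl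

lemma map_swap (τ : E [⋀^Fin 2]→L[ℝ] ℂ) (x y : E) : τ ![y, x] = - τ ![x, y] := by
  have := τ.toAlternatingMap.map_swap ![x, y] (i := 0) (j := 1) (by decide)
  rw [← show τ (![x, y] ∘ Equiv.swap 0 1) = - τ ![x, y] from this]
  congr 1
  ext i
  fin_cases i <;> simp

/-- The wedge product of a two-form with a `k`-form. -/
def wedge2 {k : ℕ} (u : E [⋀^Fin k]→L[ℝ] ℂ) : (E [⋀^Fin 2]→L[ℝ] ℂ) →ₗ[ℂ]
    (E [⋀^Fin (k + 2)]→L[ℝ] ℂ) where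
  toFun τ := wedgeBil (halfBil τ) u
  map_add' τ τ' := by
    rw [← wedgeBil_add]
    congr 1
    ext x y
    exact mul_add _ _ _
  map_smul' c τ := by
    ext v
    change _ = c * wedgeBil (halfBil τ) u v
    simp only [wedgeBil_apply, Finset.mul_sum, halfBil_apply]
    refine Finset.sum_congr rfl fun i _ => Finset.sum_congr rfl fun j _ => ?_
    change _ * ((2⁻¹ * (c * τ _) - 2⁻¹ * (c * τ _)) * _) = _
    ring

lemma wedgeBil_eq_wedge2 {k : ℕ} {B : E →L[ℝ] E →L[ℝ] ℂ} {τ : E [⋀^Fin 2]→L[ℝ] ℂ}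
    (h : ∀ x y, τ ![x, y] = B x y - B y x) (u : E [⋀^Fin k]→L[ℝ] ℂ) :
    wedgeBil B u = wedge2 u τ := by
  refine wedgeBil_congr (fun x y => ?_) u
  rw [halfBil_apply, halfBil_apply, map_swap τ x y, h]
  ring

lemma wedgeL_ofCov_apply (α β : E →L[ℝ] ℂ) (x y : E) :
    wedgeL E 1 α (ofCov β) ![x, y] = α x * β y - α y * β x := by
  rw [wedgeL_apply, Fin.sum_univ_two]
  simp [ofCov_apply, Fin.removeNth, sub_eq_add_neg]

lemma wedge2_wedgeL {k : ℕ} (α β : E →L[ℝ] ℂ) (u : E [⋀^Fin k]→L[ℝ] ℂ) :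
    wedge2 u (wedgeL E 1 α (ofCov β)) = wedgeL E (k + 1) α (wedgeL E k β u) := by
  rw [wedgeL_wedgeL]
  exact (wedgeBil_eq_wedge2 (fun x y => wedgeL_ofCov_apply α β x y) u).symm

lemma wedge2_LamE {N : Submodule ℂ (E →L[ℝ] ℂ)} {k : ℕ} (u : E [⋀^Fin k]→L[ℝ] ℂ)
    {τ : E [⋀^Fin 2]→L[ℝ] ℂ} (h : τ ∈ LamE N 1 2) : wedge2 u τ ∈ LamE N 1 (k + 2) := by
  refine LamE_one_induction (p := fun τ => wedge2 u τ ∈ LamE N 1 (k + 2))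
    (fun θ hθ v => ?_) ?_ (fun x y hx hy => ?_) (fun c x hx => ?_) h
  · rw [← ofCov_cov v, wedge2_wedgeL]; exact wedgeL_mem_LamE hθ _
  · rw [map_zero]; exact zero_mem _
  · rw [map_add]; exact add_mem hx hy
  · rw [map_smul]; exact Submodule.smul_mem _ c hx

/-- The bilinear map `(x, y) ↦ θ(x) L(y)`. -/
def smulCLM {k : ℕ} (θ : E →L[ℝ] ℂ) (L : E →L[ℝ] (E [⋀^Fin k]→L[ℝ] ℂ)) :
    E →L[ℝ] E →L[ℝ] (E [⋀^Fin k]→L[ℝ] ℂ) :=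
  LinearMap.mkContinuous₂
    (LinearMap.mk₂ ℝ (fun x y => θ x • L y)
      (fun x y z => by rw [map_add]; exact form_add_smul _ _ _)
      (fun c x y => by rw [map_smul]; exact smul_assoc c (θ x) (L y))
      (fun x y z => by rw [map_add]; exact form_smul_add _ _ _)
      (fun c x y => by rw [map_smul]; exact smul_comm (θ x) c (L y)))
    (‖θ‖ * ‖L‖) (fun x y => by
      change ‖θ x • L y‖ ≤ _
      rw [norm_smul]
      calc _ ≤ (‖θ‖ * ‖x‖) * (‖L‖ * ‖y‖) := by
            gcongr
            · exact θ.le_opNorm x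
            · exact L.le_opNorm y
        _ = _ := by ring)

lemma alternatize_wedgeL {k : ℕ} (θ : E →L[ℝ] ℂ) (L : E →L[ℝ] (E [⋀^Fin k]→L[ℝ] ℂ))
    (L' : E →L[ℝ] (E [⋀^Fin (k + 1)]→L[ℝ] ℂ)) (hL : ∀ x, L' x = wedgeL E k θ (L x)) :
    ContinuousAlternatingMap.alternatizeUncurryFin L' =
      - wedgeL E (k + 1) θ (ContinuousAlternatingMap.alternatizeUncurryFin L) := by
  have e1 : L' = ContinuousAlternatingMap.alternatizeUncurryFinCLM ℝ E ℂ ∘L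
      (smulCLM θ L).flip := by
    ext1 x
    rw [hL]
    change _ = ContinuousAlternatingMap.alternatizeUncurryFin ((smulCLM θ L).flip x)
    rw [wedgeL_def]
    rfl
  have e2 : wedgeL E (k + 1) θ (ContinuousAlternatingMap.alternatizeUncurryFin L) =
      ContinuousAlternatingMap.alternatizeUncurryFin
        (ContinuousAlternatingMap.alternatizeUncurryFinCLM ℝ E ℂ ∘L smulCLM θ L) := by
    rw [wedgeL_def]
    congr 1
    ext1 x
    change θ x • ContinuousAlternatingMap.alternatizeUncurryFin L =
      ContinuousAlternatingMap.alternatizeUncurryFin (θ x • L)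
    rw [ContinuousAlternatingMap.alternatizeUncurryFin_smul]
  rw [e1, e2]
  ext v
  change _ = - (ContinuousAlternatingMap.alternatizeUncurryFin _ v)
  rw [ContinuousAlternatingMap.alternatizeUncurryFin_alternatizeUncurryFinCLM_comp_apply,
    ContinuousAlternatingMap.alternatizeUncurryFin_alternatizeUncurryFinCLM_comp_apply,
    ← Finset.sum_neg_distrib]
  refine Finset.sum_congr rfl fun i _ => ?_
  rw [← Finset.sum_neg_distrib]
  refine Finset.sum_congr rfl fun j _ => ?_
  rw [← smul_neg, neg_sub]
  rfl

lemma isBoundedBilinearMap_real {F G H : Type*} [NormedAddCommGroup F] [NormedSpace ℂ F]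
    [NormedSpace ℝ F] [IsScalarTower ℝ ℂ F] [NormedAddCommGroup G] [NormedSpace ℂ G]
    [NormedSpace ℝ G] [IsScalarTower ℝ ℂ G] [NormedAddCommGroup H] [NormedSpace ℂ H]
    [NormedSpace ℝ H] [IsScalarTower ℝ ℂ H] {f : F × G → H} (h : IsBoundedBilinearMap ℂ f) :
    IsBoundedBilinearMap ℝ f where
  add_left := h.add_left
  smul_left c x y := by
    rw [← algebraMap_smul ℂ c x, h.smul_left, algebraMap_smul]
  add_right := h.add_right
  smul_right c x y := by
    rw [← algebraMap_smul ℂ c y, h.smul_right, algebraMap_smul]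
  bound := h.bound

lemma isBoundedBilinearMap_wedgeL (k : ℕ) : IsBoundedBilinearMap ℝ
    (fun p : (E →L[ℝ] ℂ) × (E [⋀^Fin k]→L[ℝ] ℂ) => wedgeL E k p.1 p.2) :=
  isBoundedBilinearMap_real (wedgeL E k).isBoundedBilinearMap

/-- The Leibniz rule for the product of a one-form and a `k`-form. -/
lemma extDeriv_wedgeL {k : ℕ} {θ : E → E →L[ℝ] ℂ} {w : E → E [⋀^Fin k]→L[ℝ] ℂ} {x : E}
    (hθ : DifferentiableAt ℝ θ x) (hw : DifferentiableAt ℝ w x) :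
    extDeriv (fun y => wedgeL E k (θ y) (w y)) x =
      wedge2 (w x) (extDeriv (fun y => ofCov (θ y)) x) - wedgeL E (k + 1) (θ x) (extDeriv w x) := by
  have h := ((isBoundedBilinearMap_wedgeL (E := E) k).hasFDerivAt (θ x, w x)).comp x
    (hθ.hasFDerivAt.prodMk hw.hasFDerivAt)
  have h1 : HasFDerivAt (fun y => ofCov (θ y))
      ((ContinuousAlternatingMap.ofSubsingletonLIE (𝕜 := ℝ) (E := E) (F := ℂ)
        (0 : Fin 1)).toContinuousLinearEquiv.toContinuousLinearMap ∘L fderiv ℝ θ x) x :=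
    ((ContinuousAlternatingMap.ofSubsingletonLIE (𝕜 := ℝ) (E := E) (F := ℂ)
      (0 : Fin 1)).toContinuousLinearEquiv.toContinuousLinearMap.hasFDerivAt).comp x
        hθ.hasFDerivAt
  have h2 : ∀ a b, extDeriv (fun y => ofCov (θ y)) x ![a, b] =
      fderiv ℝ θ x a b - fderiv ℝ θ x b a := by
    intro a b
    rw [extDeriv, h1.fderiv, ContinuousAlternatingMap.alternatizeUncurryFin_apply,
      Fin.sum_univ_two]
    change (-1 : ℤ) ^ 0 • (fderiv ℝ θ x a b) + (-1 : ℤ) ^ 1 • (fderiv ℝ θ x b a) = _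
    simp [sub_eq_add_neg]
  rw [← wedgeBil_eq_wedge2 h2]
  have h3 : fderiv ℝ (fun y => wedgeL E k (θ y) (w y)) x =
      (isBoundedBilinearMap_wedgeL (E := E) k).deriv (θ x, w x) ∘L
        ((fderiv ℝ θ x).prod (fderiv ℝ w x)) := h.fderiv
  rw [extDeriv, h3]
  have h4 : (isBoundedBilinearMap_wedgeL (E := E) k).deriv (θ x, w x) ∘L
        ((fderiv ℝ θ x).prod (fderiv ℝ w x)) =
      (isBoundedBilinearMap_wedgeL (E := E) k).deriv (θ x, w x) ∘L
        ((0 : E →L[ℝ] E →L[ℝ] ℂ).prod (fderiv ℝ w x)) +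
      ContinuousAlternatingMap.alternatizeUncurryFinCLM ℝ E ℂ ∘L smulBil (fderiv ℝ θ x) (w x) := by
    ext1 e
    change wedgeL E k (θ x) (fderiv ℝ w x e) + wedgeL E k (fderiv ℝ θ x e) (w x) =
      (wedgeL E k (θ x) (fderiv ℝ w x e) + wedgeL E k 0 (w x)) +
        ContinuousAlternatingMap.alternatizeUncurryFin (smulBil (fderiv ℝ θ x) (w x) e)
    rw [map_zero]
    change _ = (wedgeL E k (θ x) (fderiv ℝ w x e) + 0) + _
    rw [add_zero]
    rfl
  rw [h4, ContinuousAlternatingMap.alternatizeUncurryFin_add]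
  rw [alternatize_wedgeL (θ x) (fderiv ℝ w x) _ fun e => ?_]
  · exact (add_comm _ _).trans (sub_eq_add_neg _ _).symm
  · change wedgeL E k (θ x) (fderiv ℝ w x e) + wedgeL E k 0 (w x) = _
    rw [map_zero]
    exact add_zero _

end Calculus

section FrameCalculus

variable {E : Type*} [NormedAddCommGroup E] [NormedSpace ℝ E]

/-! ### The operators `θ^1 ∧ ⋯ ∧ θ^k ∧` and their dependence on a point -/

section Smooth

variable {X F G H : Type*} [NormedAddCommGroup X] [NormedSpace ℝ X]
  [NormedAddCommGroup F] [NormedSpace ℂ F] [NormedSpace ℝ F] [IsScalarTower ℝ ℂ F]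
  [NormedAddCommGroup G] [NormedSpace ℂ G] [NormedSpace ℝ G] [IsScalarTower ℝ ℂ G]
  [NormedAddCommGroup H] [NormedSpace ℂ H] [NormedSpace ℝ H] [IsScalarTower ℝ ℂ H]
  {x : X}

lemma contDiffAt_bilin {F G H : Type*} [NormedAddCommGroup F] [NormedSpace ℝ F]
    [NormedAddCommGroup G] [NormedSpace ℝ G] [NormedAddCommGroup H] [NormedSpace ℝ H]
    {b : F × G → H} (hb : IsBoundedBilinearMap ℝ b) {f : X → F} {g : X → G}
    (hf : ContDiffAt ℝ ∞ f x) (hg : ContDiffAt ℝ ∞ g x) :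
    ContDiffAt ℝ ∞ (fun y => b (f y, g y)) x :=
  (hb.contDiff.contDiffAt (x := (f x, g x))).comp x (hf.prodMk hg)

/-- Application of a smooth family of complex-linear maps. -/
lemma contDiffAt_apply_complex {f : X → F →L[ℂ] G} {g : X → F}
    (hf : ContDiffAt ℝ ∞ f x) (hg : ContDiffAt ℝ ∞ g x) :
    ContDiffAt ℝ ∞ (fun y => f y (g y)) x :=
  contDiffAt_bilin (b := fun p : (F →L[ℂ] G) × F => p.1 p.2)
    (isBoundedBilinearMap_real isBoundedBilinearMap_apply) hf hg

lemma contDiffAt_comp_complex {F : Type*} [NormedAddCommGroup F] [NormedSpace ℂ F]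
    {f : X → G →L[ℂ] H} {g : X → F →L[ℂ] G}
    (hf : ContDiffAt ℝ ∞ f x) (hg : ContDiffAt ℝ ∞ g x) :
    ContDiffAt ℝ ∞ (fun y => (f y).comp (g y)) x :=
  contDiffAt_bilin (b := fun p : (G →L[ℂ] H) × (F →L[ℂ] G) => p.1.comp p.2)
    (isBoundedBilinearMap_real isBoundedBilinearMap_comp) hf hg

lemma contDiffAt_smul_complex {f : X → ℂ} {g : X → F}
    (hf : ContDiffAt ℝ ∞ f x) (hg : ContDiffAt ℝ ∞ g x) :
    ContDiffAt ℝ ∞ (fun y => f y • g y) x :=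
  contDiffAt_bilin (b := fun p : ℂ × F => p.1 • p.2)
    (isBoundedBilinearMap_real isBoundedBilinearMap_smul) hf hg

lemma contDiffAt_linear_complex (L : F →L[ℂ] G) {g : X → F} (hg : ContDiffAt ℝ ∞ g x) :
    ContDiffAt ℝ ∞ (fun y => L (g y)) x :=
  ((L.restrictScalars ℝ).contDiff.contDiffAt (x := g x)).comp x hg

end Smooth

variable {X : Type*} [NormedAddCommGroup X] [NormedSpace ℝ X] {x : X}

lemma contDiffAt_wedgeL {k : ℕ} {θ : X → E →L[ℝ] ℂ} (hθ : ContDiffAt ℝ ∞ θ x) :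
    ContDiffAt ℝ ∞ (fun y => wedgeL E k (θ y)) x :=
  contDiffAt_linear_complex (F := E →L[ℝ] ℂ)
    (G := (E [⋀^Fin k]→L[ℝ] ℂ) →L[ℂ] (E [⋀^Fin (k + 1)]→L[ℝ] ℂ)) (wedgeL E k) hθ

lemma contDiffAt_iterW {q : ℕ} : ∀ (k : ℕ) {θ : Fin k → X → E →L[ℝ] ℂ}
    (_ : ∀ j, ContDiffAt ℝ ∞ (θ j) x),
    ContDiffAt ℝ ∞ (fun y => iterW (q := q) k (fun j => θ j y)) x
  | 0, _, _ => contDiffAt_const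
  | k + 1, _, h => contDiffAt_comp_complex (contDiffAt_wedgeL (h 0))
      (contDiffAt_iterW k fun j => h j.succ)

lemma contDiffAt_contrC {k : ℕ} {z : X → E × E} (hz : ContDiffAt ℝ ∞ z x) :
    ContDiffAt ℝ ∞ (fun y => contrC (k := k) (z y)) x := by
  have h0 : ContDiff ℝ ∞ (fun v : E => contrL E k v) := ContinuousLinearMap.contDiff (𝕜 := ℝ)
    (E := E) (F := (E [⋀^Fin (k + 1)]→L[ℝ] ℂ) →L[ℂ] (E [⋀^Fin k]→L[ℝ] ℂ)) (contrL E k)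
  have h1 : ContDiffAt ℝ ∞ (fun y => contrL E k (z y).1) x := h0.contDiffAt.comp x hz.fst
  have h2 : ContDiffAt ℝ ∞ (fun y => contrL E k (z y).2) x := h0.contDiffAt.comp x hz.snd
  exact h1.add (h2.const_smul Complex.I)

lemma contDiffAt_iterC {q : ℕ} : ∀ (k : ℕ) {z : Fin k → X → E × E}
    (_ : ∀ j, ContDiffAt ℝ ∞ (z j) x),
    ContDiffAt ℝ ∞ (fun y => iterC (q := q) k (fun j => z j y)) x
  | 0, _, _ => contDiffAt_const
  | k + 1, _, h => contDiffAt_comp_complex (contDiffAt_iterC k fun j => h j.succ)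
      (contDiffAt_contrC (h 0))

lemma differentiableAt_iterW {q : ℕ} {w : E → E [⋀^Fin q]→L[ℝ] ℂ} {x : E}
    (hw : DifferentiableAt ℝ w x) : ∀ (k : ℕ) {θ : Fin k → E → E →L[ℝ] ℂ}
    (_ : ∀ j, DifferentiableAt ℝ (θ j) x),
    DifferentiableAt ℝ (fun y => iterW k (fun j => θ j y) (w y)) x
  | 0, _, _ => hw
  | k + 1, _, h =>
    ((isBoundedBilinearMap_wedgeL (E := E) (q + k)).differentiableAt _).comp x
      ((h 0).prodMk (differentiableAt_iterW hw k fun j => h j.succ))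

/-- The exterior derivative of `θ^1 ∧ ⋯ ∧ θ^k ∧ w` when `dθ^j = ∑ l, η^j_l ∧ φ^l`: the `j`-th
factor contributes `∑ l, η^j_l ∧ θ^1 ∧ ⋯ ∧ φ^l ∧ ⋯ ∧ θ^k ∧ w` with `φ^l` in place of `θ^j`. -/
lemma extDeriv_iterW {ι : Type*} [Fintype ι] {q : ℕ} {w : E → E [⋀^Fin q]→L[ℝ] ℂ} {x : E}
    (hw : DifferentiableAt ℝ w x) (φ : ι → E →L[ℝ] ℂ) :
    ∀ (k : ℕ) (θ : Fin k → E → E →L[ℝ] ℂ) (η : Fin k → ι → E →L[ℝ] ℂ)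
      (_ : ∀ j, DifferentiableAt ℝ (θ j) x)
      (_ : ∀ j, extDeriv (fun y => ofCov (θ j y)) x = ∑ l, wedgeL E 1 (η j l) (ofCov (φ l))),
      extDeriv (fun y => iterW k (fun j => θ j y) (w y)) x =
        (∑ j, ∑ l, wedgeL E (q + k) (η j l)
          (iterW k (Function.update (fun j => θ j x) j (φ l)) (w x))) +
        (-1 : ℂ) ^ k • castF (Nat.add_right_comm q 1 k) (iterW k (fun j => θ j x) (extDeriv w x))
  | 0, _, _, _, _ => by
    rw [pow_zero, form_one_smul, Finset.univ_eq_empty, Finset.sum_empty, zero_add]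
    rfl
  | k + 1, θ, η, hθ, hd => by
    have ih := extDeriv_iterW hw φ k (fun j => θ j.succ) (fun j => η j.succ)
      (fun j => hθ j.succ) (fun j => hd j.succ)
    have h1 := extDeriv_wedgeL (hθ 0) (differentiableAt_iterW hw k fun j => hθ j.succ)
    refine (h1.trans ?_)
    rw [ih, hd 0, Fin.sum_univ_succ, map_sum, map_add, map_sum, sub_eq_add_neg, neg_add]
    refine Eq.trans ?_ (add_assoc _ _ _).symm
    congr 1
    · refine Finset.sum_congr rfl fun l _ => ?_
      rw [wedge2_wedgeL]
      rfl
    congr 1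
    · rw [← Finset.sum_neg_distrib]
      refine Finset.sum_congr rfl fun j _ => ?_
      rw [map_sum, ← Finset.sum_neg_distrib]
      refine Finset.sum_congr rfl fun l _ => ?_
      rw [wedgeL_anticomm, neg_neg, iterW_succ]
      have e : (fun i : Fin k => Function.update (fun j => θ j x) j.succ (φ l) i.succ) =
          Function.update (fun j => θ j.succ x) j (φ l) := by
        funext i
        by_cases hij : i = j
        · subst hij; simp
        · rw [Function.update_of_ne hij, Function.update_of_ne (by simpa using hij)]
      rw [e, Function.update_of_ne (Fin.succ_ne_zero j).symm]
      rfl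
    · rw [map_smul, wedgeL_castF, pow_succ, mul_neg_one, form_neg_smul]
      rfl

/-- `θ^1 ∧ ⋯ ∧ θ^k ∧ u`, in degree `k + q`, as a continuous linear map in `u`. -/
def frameW {q : ℕ} (k : ℕ) (θ : Fin k → E →L[ℝ] ℂ) :
    (E [⋀^Fin q]→L[ℝ] ℂ) →L[ℂ] (E [⋀^Fin (k + q)]→L[ℝ] ℂ) :=
  (castF (Nat.add_comm q k)).comp (iterW k θ)

/-- Successive contraction with `z_0, …, z_{k-1}` of a form of degree `k + q`. -/
def frameC {q : ℕ} (k : ℕ) (z : Fin k → E × E) :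
    (E [⋀^Fin (k + q)]→L[ℝ] ℂ) →L[ℂ] (E [⋀^Fin q]→L[ℝ] ℂ) :=
  (iterC k z).comp (castF (Nat.add_comm k q))

lemma frameW_apply {q k : ℕ} (θ : Fin k → E →L[ℝ] ℂ) (u : E [⋀^Fin q]→L[ℝ] ℂ) :
    frameW k θ u = castF (Nat.add_comm q k) (iterW k θ u) := rfl

lemma contDiffAt_frameW {q k : ℕ} {θ : Fin k → X → E →L[ℝ] ℂ}
    (h : ∀ j, ContDiffAt ℝ ∞ (θ j) x) :
    ContDiffAt ℝ ∞ (fun y => frameW (q := q) k (fun j => θ j y)) x :=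
  contDiffAt_comp_complex contDiffAt_const (contDiffAt_iterW k h)

lemma contDiffAt_frameC {q k : ℕ} {z : Fin k → X → E × E}
    (h : ∀ j, ContDiffAt ℝ ∞ (z j) x) :
    ContDiffAt ℝ ∞ (fun y => frameC (q := q) k (fun j => z j y)) x :=
  contDiffAt_comp_complex (contDiffAt_iterC k h) contDiffAt_const

lemma frameW_wedgeL {q k : ℕ} (θ : Fin k → E →L[ℝ] ℂ) (α : E →L[ℝ] ℂ)
    (u : E [⋀^Fin q]→L[ℝ] ℂ) :
    frameW k θ (wedgeL E q α u) = (-1 : ℂ) ^ k • wedgeL E (k + q) α (frameW k θ u) := by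
  rw [frameW_apply, frameW_apply, iterW_wedgeL, map_smul, castF_castF, wedgeL_castF]

lemma wedgeL_frameW {q k : ℕ} {θ : Fin k → E →L[ℝ] ℂ} {α : E →L[ℝ] ℂ}
    (hα : α ∈ Submodule.span ℂ (Set.range θ)) (u : E [⋀^Fin q]→L[ℝ] ℂ) :
    wedgeL E (k + q) α (frameW k θ u) = 0 := by
  rw [frameW_apply, wedgeL_castF,
    wedgeL_eq_zero_of_mem_span (fun j => wedgeL_iterW_mem u k θ j) hα, map_zero]

lemma frameC_frameW {q k : ℕ} {θ : Fin k → E →L[ℝ] ℂ} {z : Fin k → E × E}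
    (h : ∀ i j, evC (θ i) (z j) = if i = j then 1 else 0) (u : E [⋀^Fin q]→L[ℝ] ℂ) :
    frameC k z (frameW k θ u) - u ∈ LamE (Submodule.span ℂ (Set.range θ)) 1 q := by
  change iterC k z (castF _ (castF _ (iterW k θ u))) - u ∈ _
  rw [castF_castF]
  exact iterC_iterW k θ z h u

lemma frameW_eq_zero {q k : ℕ} {θ : Fin k → E →L[ℝ] ℂ} {u : E [⋀^Fin q]→L[ℝ] ℂ}
    (h : u ∈ LamE (Submodule.span ℂ (Set.range θ)) 1 q) : frameW k θ u = 0 := by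
  rw [frameW_apply, iterW_LamE h, map_zero]

lemma frameW_eq_zero_iff {q k : ℕ} {θ : Fin k → E →L[ℝ] ℂ} {z : Fin k → E × E}
    (h : ∀ i j, evC (θ i) (z j) = if i = j then 1 else 0) {u : E [⋀^Fin q]→L[ℝ] ℂ} :
    frameW k θ u = 0 ↔ u ∈ LamE (Submodule.span ℂ (Set.range θ)) 1 q := by
  refine ⟨fun hu => ?_, frameW_eq_zero⟩
  have := frameC_frameW h u
  rw [hu, map_zero, zero_sub] at this
  exact neg_mem_iff.1 this

lemma castF_mem_LamE {N : Submodule ℂ (E →L[ℝ] ℂ)} {r k l : ℕ} (h : k = l)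
    {u : E [⋀^Fin k]→L[ℝ] ℂ} (hu : u ∈ LamE N r k) : castF h u ∈ LamE N r l := by
  subst h; exact hu

lemma frameW_frameC {q k : ℕ} {θ : Fin k → E →L[ℝ] ℂ} {z : Fin k → E × E}
    (h : ∀ i j, evC (θ i) (z j) = if i = j then 1 else 0) {u : E [⋀^Fin (k + q)]→L[ℝ] ℂ}
    (hu : u ∈ LamE (Submodule.span ℂ (Set.range θ)) k (k + q)) :
    frameW k θ (frameC k z u) = u := by
  change castF _ (iterW k θ (iterC k z (castF _ u))) = u
  rw [iterW_iterC k θ z h _ fun j => wedgeL_LamE_top (castF_mem_LamE _ hu) j, castF_castF]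
  rfl

/-- The Leibniz rule for the product of a function and a form. -/
lemma extDeriv_smul_fun {k : ℕ} {c : E → ℂ} {f : E → E [⋀^Fin k]→L[ℝ] ℂ} {x : E}
    (hc : DifferentiableAt ℝ c x) (hf : DifferentiableAt ℝ f x) :
    extDeriv (fun y => c y • f y) x =
      wedgeL E k (fderiv ℝ c x) (f x) + c x • extDeriv f x := by
  have h5 := (isBoundedBilinearMap_real (isBoundedBilinearMap_smul (𝕜 := ℂ) (A := ℂ)
    (E := E [⋀^Fin k]→L[ℝ] ℂ))).hasFDerivAt (c x, f x)
  have h6 := (HasFDerivAt.comp x h5 (hc.hasFDerivAt.prodMk hf.hasFDerivAt)).fderiv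
  rw [extDeriv]
  refine (congrArg _ h6).trans ?_
  rw [wedgeL_def, extDeriv, ← ContinuousAlternatingMap.alternatizeUncurryFin_smul,
    ← ContinuousAlternatingMap.alternatizeUncurryFin_add]
  congr 1
  ext1 e
  exact add_comm _ _

/-- The exterior derivative of `c θ^1 ∧ ⋯ ∧ θ^k ∧ w` when `dθ^j = ∑ l, η^j_l ∧ θ^l` and `dc` is a
combination of the `θ^j`. -/
lemma extDeriv_smul_frameW {q k : ℕ} {w : E → E [⋀^Fin q]→L[ℝ] ℂ} {c : E → ℂ}
    {θ : Fin k → E → E →L[ℝ] ℂ} {η : Fin k → Fin k → E →L[ℝ] ℂ} {x : E}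
    (hw : DifferentiableAt ℝ w x) (hc : DifferentiableAt ℝ c x)
    (hdc : fderiv ℝ c x ∈ Submodule.span ℂ (Set.range fun j => θ j x))
    (hθ : ∀ j, DifferentiableAt ℝ (θ j) x)
    (hd : ∀ j, extDeriv (fun y => ofCov (θ j y)) x =
      ∑ l, wedgeL E 1 (η j l) (ofCov (θ l x))) :
    extDeriv (fun y => c y • frameW k (fun j => θ j y) (w y)) x =
      wedgeL E (k + q) (∑ l, η l l) (c x • frameW k (fun j => θ j x) (w x)) +
        (-1 : ℂ) ^ k • c x • frameW k (fun j => θ j x) (extDeriv w x) := by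
  have h1 := extDeriv_iterW hw (fun l => θ l x) k θ η hθ hd
  have h2 : ∀ j l, iterW k (Function.update (fun j => θ j x) j (θ l x)) (w x) =
      if l = j then iterW k (fun j => θ j x) (w x) else 0 := by
    intro j l
    split_ifs with hlj
    · subst hlj; rw [Function.update_eq_self l (fun j => θ j x)]
    · refine iterW_eq_zero _ k _ l j hlj ?_
      rw [Function.update_self, Function.update_of_ne hlj]
  simp only [h2, apply_ite, map_zero, Finset.sum_ite_eq', Finset.mem_univ, if_true] at h1
  have h3 : extDeriv (fun y => frameW k (fun j => θ j y) (w y)) x =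
      wedgeL E (k + q) (∑ l, η l l) (frameW k (fun j => θ j x) (w x)) +
        (-1 : ℂ) ^ k • frameW k (fun j => θ j x) (extDeriv w x) := by
    have e : ∀ {r s : ℕ} (h : r = s) (f : E → E [⋀^Fin r]→L[ℝ] ℂ),
        extDeriv (fun y => castF h (f y)) x = castF (congrArg (· + 1) h) (extDeriv f x) := by
      rintro r s rfl f; rfl
    refine (e (Nat.add_comm q k) _).trans ?_
    refine (congrArg _ h1).trans ?_
    rw [map_add, map_smul, castF_castF, frameW_apply, frameW_apply, wedgeL_castF]
    congr 1
    rw [map_sum (wedgeL E (q + k)), sum_apply]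
  have hf : DifferentiableAt ℝ (fun y => frameW k (fun j => θ j y) (w y)) x :=
    (((castF (E := E) (Nat.add_comm q k)).restrictScalars ℝ).differentiableAt).comp x
      (differentiableAt_iterW hw k hθ)
  rw [extDeriv_smul_fun hc hf, wedgeL_frameW hdc, zero_add, h3, form_smul_add, map_smul, form_smul_comm]

end FrameCalculus

/-! ### Complex vectors, coframes and two-forms vanishing on a distribution -/

section ComplexVectors

variable {E : Type*} [NormedAddCommGroup E] [NormedSpace ℝ E]

/-- The multiple `c z` of the complex vector `z.1 + i z.2`. -/
def csm (c : ℂ) (a : E × E) : E × E :=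
  (c.re • a.1 - c.im • a.2, c.re • a.2 + c.im • a.1)

lemma evC_sub (θ : E →L[ℝ] ℂ) (a b : E × E) : evC θ (a - b) = evC θ a - evC θ b := by
  simp only [evC, Prod.fst_sub, Prod.snd_sub, map_sub]; ring

lemma evC_sum {ι : Type*} (s : Finset ι) (θ : E →L[ℝ] ℂ) (a : ι → E × E) :
    evC θ (∑ i ∈ s, a i) = ∑ i ∈ s, evC θ (a i) := by
  simp only [evC, Prod.fst_sum, Prod.snd_sum, map_sum, Finset.sum_add_distrib, Finset.mul_sum]

lemma evC_csm (θ : E →L[ℝ] ℂ) (c : ℂ) (a : E × E) : evC θ (csm c a) = c * evC θ a := by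
  simp only [evC, csm, map_add, map_sub, map_smul, Complex.real_smul]
  conv_rhs => rw [← Complex.re_add_im c]
  linear_combination (-(c.im : ℂ) * θ a.2) * Complex.I_mul_I

lemma evC_real (θ : E →L[ℝ] ℂ) (x : E) : evC θ (x, 0) = θ x := by simp [evC]

lemma smul_evC (c : ℂ) (θ : E →L[ℝ] ℂ) (a : E × E) : evC (c • θ) a = c * evC θ a := by
  simp only [evC, smul_apply, smul_eq_mul]; ring

lemma sum_evC {ι : Type*} (s : Finset ι) (θ : ι → E →L[ℝ] ℂ) (a : E × E) :
    evC (∑ i ∈ s, θ i) a = ∑ i ∈ s, evC (θ i) a := by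
  simp only [evC, sum_apply, Finset.sum_add_distrib, Finset.mul_sum]

lemma eq_sum_evC {k : ℕ} {θ : Fin k → E →L[ℝ] ℂ} {z : Fin k → E × E}
    (h : ∀ i j, evC (θ i) (z j) = if i = j then 1 else 0) {α : E →L[ℝ] ℂ}
    (hα : α ∈ Submodule.span ℂ (Set.range θ)) : α = ∑ i, evC α (z i) • θ i := by
  obtain ⟨c, rfl⟩ := (Submodule.mem_span_range_iff_exists_fun ℂ).1 hα
  refine Finset.sum_congr rfl fun i _ => ?_
  congr 1
  rw [sum_evC]
  simp [smul_evC, h]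

lemma linearIndependent_of_dual {k : ℕ} {θ : Fin k → E →L[ℝ] ℂ} {z : Fin k → E × E}
    (h : ∀ i j, evC (θ i) (z j) = if i = j then 1 else 0) : LinearIndependent ℂ θ := by
  rw [Fintype.linearIndependent_iff]
  intro c hc i
  have := congrArg (fun α => evC α (z i)) hc
  simp only [sum_evC, smul_evC, h] at this
  simpa [evC] using this

lemma cov_contrC_apply (b : E × E) (τ : E [⋀^Fin 2]→L[ℝ] ℂ) (y : E) :
    cov (contrC b τ) y = τ ![b.1, y] + Complex.I * τ ![b.2, y] := by
  rw [cov_apply]; rfl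

/-- The one-forms `η_l` with `τ = ∑ l, η_l ∧ θ^l`, for a two-form `τ` in the ideal generated by a
coframe `θ` with dual vectors `z`. -/
def etaOf {k : ℕ} (θ : Fin k → E →L[ℝ] ℂ) (z : Fin k → E × E) (τ : E [⋀^Fin 2]→L[ℝ] ℂ)
    (l : Fin k) : E →L[ℝ] ℂ :=
  (2⁻¹ : ℂ) • (∑ i, evC (cov (contrC (z l) τ)) (z i) • θ i) - cov (contrC (z l) τ)

lemma etaOf_apply {k : ℕ} (θ : Fin k → E →L[ℝ] ℂ) (z : Fin k → E × E) (τ : E [⋀^Fin 2]→L[ℝ] ℂ)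
    (l : Fin k) (x : E) : etaOf θ z τ l x =
      2⁻¹ * (∑ i, evC (cov (contrC (z l) τ)) (z i) * θ i x) - cov (contrC (z l) τ) x := by
  rw [etaOf, sub_apply, smul_apply, sum_apply]
  rfl

/-- A two-form whose contraction with each vector annihilated by the coframe `θ` is a combination
of the `θ^l` lies in the ideal generated by `θ`. -/
lemma eq_sum_etaOf {k : ℕ} {θ : Fin k → E →L[ℝ] ℂ} {z : Fin k → E × E}
    (h : ∀ i j, evC (θ i) (z j) = if i = j then 1 else 0) {τ : E [⋀^Fin 2]→L[ℝ] ℂ}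
    (hτ : ∀ b, (∀ l, evC (θ l) b = 0) → cov (contrC b τ) ∈ Submodule.span ℂ (Set.range θ)) :
    τ = ∑ l, wedgeL E 1 (etaOf θ z τ l) (ofCov (θ l)) := by
  set A : Fin k → E →L[ℝ] ℂ := fun l => cov (contrC (z l) τ) with hA
  have hAx : ∀ l x, A l x = τ ![(z l).1, x] + Complex.I * τ ![(z l).2, x] :=
    fun l x => cov_contrC_apply _ _ _
  -- the component of `τ(x, ·)` along the vectors annihilated by `θ`
  have key : ∀ x y, τ ![x, y] = (∑ l, θ l x * A l y) -
      ∑ i, (A i x + ∑ l, θ l x * evC (A l) (z i)) * θ i y := by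
    intro x y
    set b : E × E := (x, 0) - ∑ l, csm (θ l x) (z l) with hb
    have hb0 : ∀ l, evC (θ l) b = 0 := fun l => by
      rw [hb, evC_sub, evC_sum, evC_real]
      simp [evC_csm, h]
    have hbτ : ∀ w, cov (contrC b τ) w = τ ![x, w] - ∑ l, θ l x * A l w := by
      intro w
      have e : ∀ a : E × E, cov (contrC a τ) w = - evC (cov (contrL E 1 w τ)) a := by
        intro a
        rw [cov_contrC_apply, evC, cov_apply, cov_apply, map_swap τ w, map_swap τ w]
        change _ = -(τ ![w, a.1] + Complex.I * τ ![w, a.2])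
        ring
      rw [e, hb, evC_sub, evC_sum, evC_real, cov_apply]
      change -(τ ![w, x] - _) = _
      rw [map_swap τ x w]
      simp only [evC_csm]
      rw [neg_sub, sub_neg_eq_add, add_comm, sub_eq_add_neg, ← Finset.sum_neg_distrib]
      congr 1
      refine Finset.sum_congr rfl fun l _ => ?_
      change _ = -(θ l x * cov (contrC (z l) τ) w)
      rw [e]; ring
    have h1 := eq_sum_evC h (hτ b hb0)
    have h2 := DFunLike.congr_fun h1 y
    rw [hbτ, sum_apply] at h2
    have h3 : ∀ i, evC (cov (contrC b τ)) (z i) = -(A i x + ∑ l, θ l x * evC (A l) (z i)) := by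
      intro i
      rw [evC, hbτ, hbτ, hAx, map_swap τ (z i).1, map_swap τ (z i).2]
      simp only [evC, mul_add, Finset.sum_add_distrib]
      have : ∑ l, θ l x * (Complex.I * A l (z i).2) = Complex.I * ∑ l, θ l x * A l (z i).2 := by
        rw [Finset.mul_sum]; exact Finset.sum_congr rfl fun l _ => by ring
      rw [this]
      ring
    have h4 : τ ![x, y] = (∑ l, θ l x * A l y) + ∑ i, (evC (cov (contrC b τ)) (z i) • θ i) y := by
      rw [← h2]; ring
    rw [h4, sub_eq_add_neg, ← Finset.sum_neg_distrib]
    congr 1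
    refine Finset.sum_congr rfl fun i _ => ?_
    rw [h3]
    exact neg_mul _ _
  have hs : ∀ i l, evC (A l) (z i) = - evC (A i) (z l) := by
    intro i l
    simp only [evC, hAx]
    rw [map_swap τ (z i).1 (z l).1, map_swap τ (z i).2 (z l).1, map_swap τ (z i).1 (z l).2,
      map_swap τ (z i).2 (z l).2]
    ring
  ext v
  have hv : v = ![v 0, v 1] := by ext i; fin_cases i <;> rfl
  rw [hv]
  generalize v 0 = x
  generalize v 1 = y
  have e1 : (∑ l, wedgeL E 1 (etaOf θ z τ l) (ofCov (θ l))) ![x, y] =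
      ∑ l, wedgeL E 1 (etaOf θ z τ l) (ofCov (θ l)) ![x, y] := by
    rw [ContinuousAlternatingMap.sum_apply]
  rw [e1, key]
  simp only [wedgeL_ofCov_apply, etaOf_apply]
  have e2 : ∑ l, (2⁻¹ * (∑ i, evC (A l) (z i) * θ i x)) * θ l y =
      - (2⁻¹ * ∑ i, (∑ l, θ l x * evC (A l) (z i)) * θ i y) := by
    rw [Finset.mul_sum, ← Finset.sum_neg_distrib]
    refine Finset.sum_congr rfl fun l _ => ?_
    rw [← mul_assoc, ← neg_mul, Finset.mul_sum, Finset.mul_sum, ← Finset.sum_neg_distrib]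
    congr 1
    refine Finset.sum_congr rfl fun i _ => ?_
    rw [hs l i]; ring
  have e3 : ∑ l, (2⁻¹ * (∑ i, evC (A l) (z i) * θ i y)) * θ l x =
      2⁻¹ * ∑ i, (∑ l, θ l x * evC (A l) (z i)) * θ i y := by
    simp only [Finset.mul_sum, Finset.sum_mul]
    rw [Finset.sum_comm]
    refine Finset.sum_congr rfl fun l _ => Finset.sum_congr rfl fun i _ => ?_
    ring
  have e4 : ∑ i, (A i x + ∑ l, θ l x * evC (A l) (z i)) * θ i y =
      ∑ i, A i x * θ i y + ∑ i, (∑ l, θ l x * evC (A l) (z i)) * θ i y := by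
    rw [← Finset.sum_add_distrib]
    exact Finset.sum_congr rfl fun i _ => add_mul _ _ _
  have e5 : ∑ l, θ l x * A l y = ∑ l, A l y * θ l x :=
    Finset.sum_congr rfl fun l _ => mul_comm _ _
  change _ = ∑ l, ((2⁻¹ * (∑ i, evC (A l) (z i) * θ i x) - A l x) * θ l y -
    (2⁻¹ * (∑ i, evC (A l) (z i) * θ i y) - A l y) * θ l x)
  simp only [sub_mul, Finset.sum_sub_distrib]
  rw [e2, e3, e4, e5]
  ring

end ComplexVectors

section Coframe

variable {d : ℕ}

/-- The complex vector `z.1 + i z.2` as an element of `ℂ^d`. -/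
def cxv (z : Euc d × Euc d) : Fin d → ℂ := fun i => z.1 i + Complex.I * z.2 i

lemma cxv_surjective (v : Fin d → ℂ) : ∃ z : Euc d × Euc d, cxv z = v :=
  ⟨(WithLp.toLp 2 fun i => (v i).re, WithLp.toLp 2 fun i => (v i).im), by
    ext i; rw [cxv, mul_comm]; exact Complex.re_add_im (v i)⟩

/-- The inclusion of `ℝ^d` into `ℂ^d`. -/
def cxL (d : ℕ) : Euc d →L[ℝ] (Fin d → ℂ) :=
  ContinuousLinearMap.pi fun i => Complex.ofRealCLM.comp (EuclideanSpace.proj i)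

lemma cxv_eq (z : Euc d × Euc d) : cxv z = cxL d z.1 + Complex.I • cxL d z.2 := rfl

lemma contDiffAt_cxv {X : Type*} [NormedAddCommGroup X] [NormedSpace ℝ X] {x : X}
    {z : X → Euc d × Euc d} (hz : ContDiffAt ℝ ∞ z x) : ContDiffAt ℝ ∞ (fun y => cxv (z y)) x := by
  have h1 : ContDiffAt ℝ ∞ (fun y => cxL d (z y).1) x :=
    (cxL d).contDiff.contDiffAt.comp x hz.fst
  have h2 : ContDiffAt ℝ ∞ (fun y => cxL d (z y).2) x :=
    (cxL d).contDiff.contDiffAt.comp x hz.snd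
  exact h1.add (h2.const_smul Complex.I)

/-- The complex-linear extension of a covector. -/
def extC (α : Euc d →L[ℝ] ℂ) : (Fin d → ℂ) →ₗ[ℂ] ℂ :=
  ∑ i, α (EuclideanSpace.single i 1) • LinearMap.proj i

lemma extC_cxv (α : Euc d →L[ℝ] ℂ) (z : Euc d × Euc d) : extC α (cxv z) = evC α z := by
  have h : ∀ x : Euc d, α x = ∑ i, α (EuclideanSpace.single i 1) * (x i : ℂ) := by
    intro x
    conv_lhs => rw [← (EuclideanSpace.basisFun (Fin d) ℝ).sum_repr x, map_sum]
    refine Finset.sum_congr rfl fun i _ => ?_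
    rw [map_smul, Complex.real_smul, mul_comm]
    simp
  rw [evC, h z.1, h z.2, extC, LinearMap.sum_apply, Finset.mul_sum, ← Finset.sum_add_distrib]
  refine Finset.sum_congr rfl fun i _ => ?_
  change _ * ((z.1 i : ℂ) + Complex.I * z.2 i) = _
  ring

lemma exists_complement {n m : ℕ} {v : Fin n → Fin (m + n) → ℂ} (hv : LinearIndependent ℂ v) :
    ∃ w : Fin m → Fin (m + n) → ℂ, LinearIndependent ℂ (Sum.elim v w) := by
  obtain ⟨S, hS⟩ := Submodule.exists_isCompl (Submodule.span ℂ (Set.range v))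
  have h1 := Submodule.finrank_add_eq_of_isCompl hS
  rw [finrank_span_eq_card hv, Fintype.card_fin, Module.finrank_fin_fun] at h1
  let b := Module.finBasisOfFinrankEq ℂ S (show Module.finrank ℂ S = m by omega)
  refine ⟨fun i => b i, hv.sum_type (b.linearIndependent.map' S.subtype S.ker_subtype) ?_⟩
  refine hS.disjoint.mono_right (Submodule.span_le.2 ?_)
  rintro _ ⟨i, rfl⟩
  exact (b i).2

/-- The linear map `c ↦ ∑ i, c_i v_i`. -/
def combL {ι : Type*} [Fintype ι] (v : ι → Fin d → ℂ) : (ι → ℂ) →L[ℂ] (Fin d → ℂ) :=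
  ∑ i, ContinuousLinearMap.smulRightL ℂ (ι → ℂ) (Fin d → ℂ) (ContinuousLinearMap.proj i) (v i)

lemma combL_apply {ι : Type*} [Fintype ι] (v : ι → Fin d → ℂ) (c : ι → ℂ) :
    combL v c = ∑ i, c i • v i := by
  rw [combL, sum_apply]; rfl

lemma combL_single {ι : Type*} [Fintype ι] [DecidableEq ι] (v : ι → Fin d → ℂ) (i : ι) :
    combL v (Pi.single i 1) = v i := by
  rw [combL_apply, Finset.sum_eq_single i]
  · simp
  · intro j _ hj; simp [hj]
  · intro h; exact absurd (Finset.mem_univ i) h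

lemma contDiffAt_combL {ι X : Type*} [Fintype ι] [NormedAddCommGroup X] [NormedSpace ℝ X] {x : X}
    {v : ι → X → Fin d → ℂ} (hv : ∀ i, ContDiffAt ℝ ∞ (v i) x) :
    ContDiffAt ℝ ∞ (fun y => combL fun i => v i y) x := by
  unfold combL
  exact ContDiffAt.sum fun i _ => contDiffAt_linear_complex _ (hv i)

/-- Near `y₀`, the annihilator of a smooth family of linearly independent complex vectors has a
smooth coframe, with constant dual vectors. -/
lemma exists_smooth_coframe {n m : ℕ} {Z : Fin n → Euc (m + n) → Euc (m + n) × Euc (m + n)}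
    {O : Set (Euc (m + n))} (hO : IsOpen O) {y₀ : Euc (m + n)} (hy₀ : y₀ ∈ O)
    (hZ : ∀ j, ∀ y ∈ O, ContDiffAt ℝ ∞ (Z j) y)
    (hli : LinearIndependent ℂ fun j => cxv (Z j y₀)) :
    ∃ (θ : Fin m → Euc (m + n) → Euc (m + n) →L[ℝ] ℂ) (z : Fin m → Euc (m + n) × Euc (m + n))
      (O' : Set (Euc (m + n))), IsOpen O' ∧ y₀ ∈ O' ∧ O' ⊆ O ∧ ∀ y ∈ O',
        (∀ j, ContDiffAt ℝ ∞ (θ j) y) ∧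
        (∀ i j, evC (θ i y) (z j) = if i = j then 1 else 0) ∧
        (∀ i j, evC (θ i y) (Z j y) = 0) ∧
        ∀ α : Euc (m + n) →L[ℝ] ℂ, (∀ j, evC α (Z j y) = 0) →
          α ∈ Submodule.span ℂ (Set.range fun i => θ i y) := by
  classical
  obtain ⟨w, hw⟩ := exists_complement hli
  choose z hz using fun i => cxv_surjective (w i)
  let v : Fin n ⊕ Fin m → Euc (m + n) → Fin (m + n) → ℂ :=
    Sum.elim (fun j y => cxv (Z j y)) (fun i _ => w i)
  have hv : ∀ i, ∀ y ∈ O, ContDiffAt ℝ ∞ (v i) y := by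
    rintro (j | i) y hy
    · exact contDiffAt_cxv (hZ j y hy)
    · exact contDiffAt_const
  let L : Euc (m + n) → (Fin n ⊕ Fin m → ℂ) →L[ℂ] (Fin (m + n) → ℂ) :=
    fun y => combL fun i => v i y
  have hL : ∀ y ∈ O, ContDiffAt ℝ ∞ L y := fun y hy => contDiffAt_combL fun i => hv i y hy
  have hinv : ∃ e : (Fin n ⊕ Fin m → ℂ) ≃L[ℂ] (Fin (m + n) → ℂ),
      (e : (Fin n ⊕ Fin m → ℂ) →L[ℂ] (Fin (m + n) → ℂ)) = L y₀ := by
    have hv0 : LinearIndependent ℂ fun i => v i y₀ := by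
      convert hw using 1
      ext i : 1
      rcases i with i | i <;> rfl
    let b := basisOfLinearIndependentOfCardEqFinrank' _ hv0 (by simp [add_comm])
    refine ⟨b.equivFun.symm.toContinuousLinearEquiv, ?_⟩
    ext1 c
    change b.equivFun.symm c = _
    rw [b.equivFun_symm_apply, combL_apply]
    simp [b]
  let R : Set ((Fin n ⊕ Fin m → ℂ) →L[ℂ] (Fin (m + n) → ℂ)) :=
    Set.range ((↑) : ((Fin n ⊕ Fin m → ℂ) ≃L[ℂ] (Fin (m + n) → ℂ)) → _)
  have hLO : ContinuousOn L O := fun y hy => (hL y hy).continuousAt.continuousWithinAt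
  refine ⟨fun i y => (ContinuousLinearMap.proj (R := ℝ) (φ := fun _ => ℂ) (Sum.inr i)).comp
      (((L y).inverse.restrictScalars ℝ).comp (cxL (m + n))), z, O ∩ L ⁻¹' R,
    hLO.isOpen_inter_preimage hO (ContinuousLinearEquiv.isOpen), ⟨hy₀, hinv⟩,
    Set.inter_subset_left, ?_⟩
  rintro y ⟨hyO, e, he⟩
  have hev : ∀ i a, evC ((ContinuousLinearMap.proj (R := ℝ) (φ := fun _ => ℂ) (Sum.inr i)).comp
      (((L y).inverse.restrictScalars ℝ).comp (cxL (m + n)))) a = e.symm (cxv a) (Sum.inr i) := by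
    intro i a
    rw [← he, ContinuousLinearMap.inverse_equiv, cxv_eq, map_add, map_smul]
    rfl
  have hsym : ∀ i, e.symm (v i y) = Pi.single i 1 := by
    intro i
    rw [ContinuousLinearEquiv.symm_apply_eq]
    refine (combL_single (fun i => v i y) i).symm.trans ?_
    exact (DFunLike.congr_fun he (Pi.single i 1)).symm
  refine ⟨fun j => ?_, fun i j => ?_, fun i j => ?_, fun α hα => ?_⟩
  · have h1 : ContDiffAt ℝ ∞ (fun y => (L y).inverse) y := by
      have h2 : ContDiffAt ℝ ∞ (ContinuousLinearMap.inverse :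
          ((Fin n ⊕ Fin m → ℂ) →L[ℂ] (Fin (m + n) → ℂ)) → _) (L y) := by
        rw [← he]
        exact (contDiffAt_map_inverse e).restrict_scalars ℝ
      exact h2.comp y (hL y hyO)
    have h3 : ContDiffAt ℝ ∞ (fun y => (L y).inverse.restrictScalars ℝ) y :=
      (ContinuousLinearMap.restrictScalarsL ℂ (Fin (m + n) → ℂ) (Fin n ⊕ Fin m → ℂ) ℝ
        ℝ).contDiff.contDiffAt.comp y h1
    exact contDiffAt_const.clm_comp (h3.clm_comp contDiffAt_const)
  · rw [hev, hz, show w j = v (Sum.inr j) y from rfl, hsym, Pi.single_apply]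
    simp
  · rw [hev, show cxv (Z j y) = v (Sum.inl j) y from rfl, hsym, Pi.single_apply]
    simp
  · rw [Submodule.mem_span_range_iff_exists_fun]
    refine ⟨fun i => evC α (z i), ?_⟩
    ext1 x
    rw [sum_apply, ← evC_real α x, ← extC_cxv]
    have h1 : cxv (x, 0) = ∑ i, e.symm (cxv (x, 0)) i • v i y := by
      rw [← combL_apply]
      exact (e.apply_symm_apply _).symm.trans (DFunLike.congr_fun he _)
    conv_rhs => rw [h1, map_sum, Fintype.sum_sum_type]
    have h2 : ∀ j, extC α (v (Sum.inl j) y) = 0 := fun j => (extC_cxv α (Z j y)).trans (hα j)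
    have h3 : ∀ i, extC α (v (Sum.inr i) y) = evC α (z i) := fun i => by
      rw [← extC_cxv, hz]; rfl
    simp only [map_smul, h2, h3, smul_zero, Finset.sum_const_zero, zero_add]
    refine Finset.sum_congr rfl fun i _ => ?_
    rw [← hev i (x, 0), evC_real]
    exact mul_comm _ _

end Coframe

/-! ### Pullback of forms by linear maps -/

section Pull

variable {E : Type*} [NormedAddCommGroup E] [NormedSpace ℝ E]

/-- The pullback of forms by a linear map. -/
def pull {k : ℕ} (A : E →L[ℝ] E) (u : E [⋀^Fin k]→L[ℝ] ℂ) : E [⋀^Fin k]→L[ℝ] ℂ :=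
  u.compContinuousLinearMap A

lemma pull_apply {k : ℕ} (A : E →L[ℝ] E) (u : E [⋀^Fin k]→L[ℝ] ℂ) (v : Fin k → E) :
    pull A u v = u (fun i => A (v i)) := rfl

lemma pull_id {k : ℕ} (u : E [⋀^Fin k]→L[ℝ] ℂ) : pull (ContinuousLinearMap.id ℝ E) u = u := rfl

lemma pull_pull {k : ℕ} (A B : E →L[ℝ] E) (u : E [⋀^Fin k]→L[ℝ] ℂ) :
    pull A (pull B u) = pull (B.comp A) u := rfl

lemma pull_add {k : ℕ} (A : E →L[ℝ] E) (u w : E [⋀^Fin k]→L[ℝ] ℂ) :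
    pull A (u + w) = pull A u + pull A w := rfl

lemma pull_smul {k : ℕ} (A : E →L[ℝ] E) (c : ℂ) (u : E [⋀^Fin k]→L[ℝ] ℂ) :
    pull A (c • u) = c • pull A u := rfl

lemma pull_zero {k : ℕ} (A : E →L[ℝ] E) : pull A (0 : E [⋀^Fin k]→L[ℝ] ℂ) = 0 := rfl

lemma pull_sub {k : ℕ} (A : E →L[ℝ] E) (u w : E [⋀^Fin k]→L[ℝ] ℂ) :
    pull A (u - w) = pull A u - pull A w := rfl

lemma pull_sum {ι : Type*} (s : Finset ι) {k : ℕ} (A : E →L[ℝ] E)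
    (u : ι → E [⋀^Fin k]→L[ℝ] ℂ) : pull A (∑ i ∈ s, u i) = ∑ i ∈ s, pull A (u i) := by
  classical
  induction s using Finset.induction_on with
  | empty => exact pull_zero A
  | insert i s hi ih => rw [Finset.sum_insert hi, Finset.sum_insert hi, pull_add, ih]

lemma pull_castF {k l : ℕ} (h : k = l) (A : E →L[ℝ] E) (u : E [⋀^Fin k]→L[ℝ] ℂ) :
    pull A (castF h u) = castF h (pull A u) := by subst h; rfl

lemma pull_wedgeL {k : ℕ} (A : E →L[ℝ] E) (θ : E →L[ℝ] ℂ) (u : E [⋀^Fin k]→L[ℝ] ℂ) :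
    pull A (wedgeL E k θ u) = wedgeL E k (θ.comp A) (pull A u) := by
  ext v
  rw [pull_apply, wedgeL_apply, wedgeL_apply]
  rfl

lemma pull_iterW {q : ℕ} (A : E →L[ℝ] E) (u : E [⋀^Fin q]→L[ℝ] ℂ) :
    ∀ (k : ℕ) (θ : Fin k → E →L[ℝ] ℂ),
      pull A (iterW k θ u) = iterW k (fun j => (θ j).comp A) (pull A u)
  | 0, _ => rfl
  | k + 1, θ => by rw [iterW_succ, pull_wedgeL, pull_iterW A u k]; rfl

lemma pull_frameW {q k : ℕ} (A : E →L[ℝ] E) (θ : Fin k → E →L[ℝ] ℂ) (u : E [⋀^Fin q]→L[ℝ] ℂ) :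
    pull A (frameW k θ u) = frameW k (fun j => (θ j).comp A) (pull A u) := by
  rw [frameW_apply, pull_castF, pull_iterW]; rfl

lemma pull_contrC {k : ℕ} (A : E →L[ℝ] E) (z : E × E) (u : E [⋀^Fin (k + 1)]→L[ℝ] ℂ) :
    pull A (contrC (A z.1, A z.2) u) = contrC z (pull A u) := by
  ext v
  rw [pull_apply, contrC_apply, contrC_apply, pull_apply, pull_apply]
  congr 2 <;> congr 1 <;> ext i <;> refine Fin.cases ?_ (fun j => ?_) i <;> rfl

lemma pull_iterC {q : ℕ} (A : E →L[ℝ] E) : ∀ (k : ℕ) (z : Fin k → E × E)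
    (u : E [⋀^Fin (q + k)]→L[ℝ] ℂ),
      pull A (iterC k (fun j => (A (z j).1, A (z j).2)) u) = iterC k z (pull A u)
  | 0, _, _ => rfl
  | k + 1, z, u => by
    rw [iterC_succ, pull_iterC A k (fun j => z j.succ), iterC_succ]
    exact congrArg _ (pull_contrC (k := q + k) A (z 0) u)

lemma pull_frameC {q k : ℕ} (A : E →L[ℝ] E) (z : Fin k → E × E)
    (u : E [⋀^Fin (k + q)]→L[ℝ] ℂ) :
    pull A (frameC k (fun j => (A (z j).1, A (z j).2)) u) = frameC k z (pull A u) := by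
  rw [frameC, frameC, ContinuousLinearMap.comp_apply, ContinuousLinearMap.comp_apply, pull_iterC,
    pull_castF]

lemma evC_comp (A : E →L[ℝ] E) (θ : E →L[ℝ] ℂ) (z : E × E) :
    evC (θ.comp A) z = evC θ (A z.1, A z.2) := rfl

end Pull

/-! ### Calculus in charts -/

section Charts

variable {d : ℕ} {M : Type u} [TopologicalSpace M] [ChartedSpace (Euc d) M]

/-- The chart at `a`, as a partial equivalence with values in the model space. -/
abbrev ch (a : M) : PartialEquiv M (Euc d) := extChartAt 𝓘(ℝ, Euc d) a

/-- The derivative of the inverse of the chart at `a`. -/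
def dSymm (a : M) (y : Euc d) : Euc d →L[ℝ] Euc d :=
  mfderiv 𝓘(ℝ, Euc d) 𝓘(ℝ, Euc d) (extChartAt 𝓘(ℝ, Euc d) a).symm y

/-- The derivative of the chart at `a`. -/
def dChart (a p : M) : Euc d →L[ℝ] Euc d :=
  mfderiv 𝓘(ℝ, Euc d) 𝓘(ℝ, Euc d) (extChartAt 𝓘(ℝ, Euc d) a) p

/-- The coordinate change from the chart at `a` to the chart at `b`. -/
def chg (a b : M) : Euc d → Euc d := ch b ∘ (ch a).symm

/-- The domain of the coordinate change from the chart at `a` to the chart at `b`. -/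
def ovl (a b : M) : Set (Euc d) := (ch a).target ∩ (ch a).symm ⁻¹' (ch (d := d) b).source

lemma isOpen_ovl (a b : M) : IsOpen (ovl (d := d) a b) :=
  (continuousOn_extChartAt_symm a).isOpen_inter_preimage (isOpen_extChartAt_target a)
    (isOpen_extChartAt_source b)

lemma chg_mem {a b : M} {y : Euc d} (hy : y ∈ ovl a b) : chg a b y ∈ (ch b).target :=
  (ch b).map_source hy.2

lemma symm_chg {a b : M} {y : Euc d} (hy : y ∈ ovl a b) :
    (ch b).symm (chg a b y) = (ch a).symm y := (ch b).left_inv hy.2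

lemma inChart_eq {k : ℕ} (a : M) (w : ∀ p : M, Form d k p) (y : Euc d) :
    inChart a w y = pull (dSymm a y) (w ((ch a).symm y)) := rfl

/-- The coordinate expression of a one-form, as a covector. -/
def cotC (a : M) (θ : M → Euc d →L[ℝ] ℂ) (y : Euc d) : Euc d →L[ℝ] ℂ :=
  (θ ((ch a).symm y)).comp (dSymm a y)

/-- The coordinate expression of a complex vector field. -/
def vecC (a : M) (z : M → Euc d × Euc d) (y : Euc d) : Euc d × Euc d :=
  (dChart a ((ch a).symm y) (z ((ch a).symm y)).1, dChart a ((ch a).symm y) (z ((ch a).symm y)).2)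

/-- Smoothness over `U` of an object given by its coordinate expressions `G a`. -/
def SmIn {X : Type*} [NormedAddCommGroup X] [NormedSpace ℝ X] (U : Opens M) (G : M → Euc d → X) :
    Prop :=
  ∀ a : M, ∀ y ∈ chartDom d a U, ContDiffAt ℝ ∞ (G a) y

lemma SmIn.mono {X : Type*} [NormedAddCommGroup X] [NormedSpace ℝ X] {U W : Opens M}
    {G : M → Euc d → X} (h : SmIn U G) (hW : W ≤ U) : SmIn W G :=
  fun a y hy => h a y (chartDom_mono a hW hy)

lemma SmIn.congr {X : Type*} [NormedAddCommGroup X] [NormedSpace ℝ X] {U : Opens M}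
    {G G' : M → Euc d → X} (h : SmIn U G) (e : ∀ a, ∀ y ∈ chartDom d a U, G' a y = G a y) :
    SmIn U G' :=
  fun a y hy => (h a y hy).congr_of_eventuallyEq
    (Filter.eventuallyEq_of_mem ((isOpen_chartDom a U).mem_nhds hy) (e a))

lemma contDiffAt_ofCov {X E : Type*} [NormedAddCommGroup X] [NormedSpace ℝ X]
    [NormedAddCommGroup E] [NormedSpace ℝ E] {x : X} {θ : X → E →L[ℝ] ℂ} :
    ContDiffAt ℝ ∞ (fun y => ofCov (θ y)) x ↔ ContDiffAt ℝ ∞ θ x :=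
  (ContinuousAlternatingMap.ofSubsingletonLIE (𝕜 := ℝ) (E := E) (F := ℂ)
    (0 : Fin 1)).toContinuousLinearEquiv.comp_contDiffAt_iff

lemma smoothCotOn_iff {U : Opens M} {θ : M → Euc d →L[ℝ] ℂ} :
    SmoothCotOn (d := d) U θ ↔ SmIn U (fun a => cotC a θ) :=
  forall_congr' fun a => forall_congr' fun y => forall_congr' fun _ =>
    contDiffAt_ofCov (x := y) (θ := cotC a θ)

variable [IsManifold 𝓘(ℝ, Euc d) ∞ M]

lemma dChart_comp_dSymm {a : M} {y : Euc d} (hy : y ∈ (ch a).target) :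
    (dChart a ((ch a).symm y)).comp (dSymm a y) = ContinuousLinearMap.id ℝ (Euc d) := by
  have := mfderiv_extChartAt_comp_mfderivWithin_extChartAt_symm (I := 𝓘(ℝ, Euc d)) hy
  rw [ModelWithCorners.range_eq_univ, mfderivWithin_univ] at this
  exact this

lemma dSymm_comp_dChart {a : M} {y : Euc d} (hy : y ∈ (ch a).target) :
    (dSymm a y).comp (dChart a ((ch a).symm y)) = ContinuousLinearMap.id ℝ (Euc d) := by
  have := mfderivWithin_extChartAt_symm_comp_mfderiv_extChartAt (I := 𝓘(ℝ, Euc d)) hy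
  rw [ModelWithCorners.range_eq_univ, mfderivWithin_univ] at this
  exact this

lemma dChart_dSymm {a : M} {y : Euc d} (hy : y ∈ (ch a).target) (v : Euc d) :
    dChart a ((ch a).symm y) (dSymm a y v) = v := DFunLike.congr_fun (dChart_comp_dSymm hy) v

lemma dSymm_dChart {a : M} {y : Euc d} (hy : y ∈ (ch a).target) (v : Euc d) :
    dSymm a y (dChart a ((ch a).symm y) v) = v := DFunLike.congr_fun (dSymm_comp_dChart hy) v

lemma contDiffAt_chg {a b : M} {y : Euc d} (hy : y ∈ ovl a b) : ContDiffAt ℝ ∞ (chg a b) y := by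
  have h := contDiffWithinAt_ext_coord_change (I := 𝓘(ℝ, Euc d)) (n := ∞) b a (y := y)
    (by rw [PartialEquiv.trans_source, PartialEquiv.symm_source]; exact hy)
  rw [ModelWithCorners.range_eq_univ, contDiffWithinAt_univ] at h
  exact h

lemma mdifferentiableAt_symm {a : M} {y : Euc d} (hy : y ∈ (ch a).target) :
    MDifferentiableAt 𝓘(ℝ, Euc d) 𝓘(ℝ, Euc d) (extChartAt 𝓘(ℝ, Euc d) a).symm y := by
  have := mdifferentiableWithinAt_extChartAt_symm (I := 𝓘(ℝ, Euc d)) hy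
  rw [ModelWithCorners.range_eq_univ, mdifferentiableWithinAt_univ] at this
  exact this

lemma fderiv_chg {a b : M} {y : Euc d} (hy : y ∈ ovl a b) :
    fderiv ℝ (chg a b) y = (dChart b ((ch a).symm y)).comp (dSymm a y) := by
  have h2 : MDifferentiableAt 𝓘(ℝ, Euc d) 𝓘(ℝ, Euc d) (extChartAt 𝓘(ℝ, Euc d) b)
      ((ch a).symm y) := mdifferentiableAt_extChartAt (by
        have := hy.2; rwa [← extChartAt_source (I := 𝓘(ℝ, Euc d))])
  have h := mfderiv_comp y h2 (mdifferentiableAt_symm hy.1)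
  rw [mfderiv_eq_fderiv] at h
  exact h

lemma dSymm_chg {a b : M} {y : Euc d} (hy : y ∈ ovl a b) :
    (dSymm b (chg a b y)).comp (fderiv ℝ (chg a b) y) = dSymm a y := by
  rw [fderiv_chg hy, ← ContinuousLinearMap.comp_assoc, ← symm_chg hy,
    dSymm_comp_dChart (chg_mem hy), ContinuousLinearMap.id_comp]

lemma inChart_chg {k : ℕ} {a b : M} (w : ∀ p : M, Form d k p) {y : Euc d} (hy : y ∈ ovl a b) :
    inChart a w y = pull (fderiv ℝ (chg a b) y) (inChart b w (chg a b y)) := by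
  let w' : M → Euc d [⋀^Fin k]→L[ℝ] ℂ := w
  change pull (dSymm a y) (w' ((ch a).symm y)) = pull (fderiv ℝ (chg a b) y)
    (pull (dSymm b (chg a b y)) (w' ((ch b).symm (chg a b y))))
  rw [pull_pull, dSymm_chg hy, symm_chg hy]

lemma cotC_chg {a b : M} (θ : M → Euc d →L[ℝ] ℂ) {y : Euc d} (hy : y ∈ ovl a b) :
    cotC a θ y = (cotC b θ (chg a b y)).comp (fderiv ℝ (chg a b) y) := by
  rw [cotC, cotC, ContinuousLinearMap.comp_assoc, dSymm_chg hy, symm_chg hy]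

omit [IsManifold 𝓘(ℝ, Euc d) ∞ M] in
lemma mem_ovl_symm {a b : M} {y : Euc d} (hy : y ∈ ovl a b) : chg a b y ∈ ovl b a := by
  refine ⟨chg_mem hy, ?_⟩
  change (ch b).symm (chg a b y) ∈ (ch a).source
  rw [symm_chg hy]
  exact (ch a).map_target hy.1

lemma vecC_chg {a b : M} (z : M → Euc d × Euc d) {y : Euc d} (hy : y ∈ ovl a b) :
    vecC a z y = (fderiv ℝ (chg b a) (chg a b y) (vecC b z (chg a b y)).1,
      fderiv ℝ (chg b a) (chg a b y) (vecC b z (chg a b y)).2) := by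
  rw [fderiv_chg (mem_ovl_symm hy)]
  unfold vecC
  rw [symm_chg hy]
  have : ∀ v, dSymm b (chg a b y) (dChart b ((ch a).symm y) v) = v := fun v => by
    rw [← symm_chg hy]; exact dSymm_dChart (chg_mem hy) v
  simp only [ContinuousLinearMap.comp_apply, this]

lemma contDiffAt_fderiv_chg {a b : M} {y : Euc d} (hy : y ∈ ovl a b) :
    ContDiffAt ℝ ∞ (fderiv ℝ (chg a b)) y :=
  (contDiffAt_chg hy).fderiv_right (m := ∞) (by simp)

omit [IsManifold 𝓘(ℝ, Euc d) ∞ M] in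
lemma chartDom_ovl {a b : M} {U : Opens M} (hU : (U : Set M) ⊆ (ch (d := d) b).source) {y : Euc d}
    (hy : y ∈ chartDom d a U) : y ∈ ovl a b ∧ chg a b y ∈ chartDom d b U := by
  have h : y ∈ ovl a b := ⟨hy.1, hU hy.2⟩
  refine ⟨h, chg_mem h, ?_⟩
  change (ch b).symm (chg a b y) ∈ U
  rw [symm_chg h]
  exact hy.2

lemma smIn_cot_of_chart {b : M} {U : Opens M} (hU : (U : Set M) ⊆ (ch (d := d) b).source)
    {θ : M → Euc d →L[ℝ] ℂ} (h : ∀ y ∈ chartDom d b U, ContDiffAt ℝ ∞ (cotC b θ) y) :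
    SmIn U (fun a => cotC a θ) := by
  intro a y hy
  obtain ⟨h1, h2⟩ := chartDom_ovl hU hy
  refine ContDiffAt.congr_of_eventuallyEq ?_ (Filter.eventuallyEq_of_mem
    ((isOpen_ovl a b).mem_nhds h1) fun y' hy' => cotC_chg θ hy')
  exact ((h _ h2).comp y (contDiffAt_chg h1)).clm_comp (contDiffAt_fderiv_chg h1)

lemma smIn_vec_of_chart {b : M} {U : Opens M} (hU : (U : Set M) ⊆ (ch (d := d) b).source)
    {z : M → Euc d × Euc d} (h : ∀ y ∈ chartDom d b U, ContDiffAt ℝ ∞ (vecC b z) y) :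
    SmIn U (fun a => vecC a z) := by
  intro a y hy
  obtain ⟨h1, h2⟩ := chartDom_ovl hU hy
  refine ContDiffAt.congr_of_eventuallyEq ?_ (Filter.eventuallyEq_of_mem
    ((isOpen_ovl a b).mem_nhds h1) fun y' hy' => vecC_chg z hy')
  have h3 := (contDiffAt_fderiv_chg (mem_ovl_symm h1)).comp y (contDiffAt_chg h1)
  have h4 := (h _ h2).comp y (contDiffAt_chg h1)
  exact (h3.clm_apply h4.fst).prodMk (h3.clm_apply h4.snd)

lemma cotC_of_chart {b : M} (ζ : Euc d → Euc d →L[ℝ] ℂ) {y : Euc d} (hy : y ∈ (ch b).target) :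
    cotC b (fun p => (ζ (ch b p)).comp (dChart b p)) y = ζ y := by
  change ((ζ (ch b ((ch b).symm y))).comp (dChart b ((ch b).symm y))).comp (dSymm b y) = _
  rw [ContinuousLinearMap.comp_assoc, dChart_comp_dSymm hy, (ch b).right_inv hy,
    ContinuousLinearMap.comp_id]

lemma vecC_of_chart {b : M} (ζ : Euc d → Euc d × Euc d) {y : Euc d} (hy : y ∈ (ch b).target) :
    vecC b (fun p => (dSymm b (ch b p) (ζ (ch b p)).1, dSymm b (ch b p) (ζ (ch b p)).2)) y =
      ζ y := by
  unfold vecC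
  beta_reduce
  rw [(ch b).right_inv hy, dChart_dSymm hy, dChart_dSymm hy]

lemma evC_cotC {a : M} (θ : M → Euc d →L[ℝ] ℂ) (z : M → Euc d × Euc d) {y : Euc d}
    (hy : y ∈ (ch a).target) :
    evC (cotC a θ y) (vecC a z y) = evC (θ ((ch a).symm y)) (z ((ch a).symm y)) := by
  refine (evC_comp _ _ _).trans ?_
  unfold vecC
  rw [dSymm_dChart hy, dSymm_dChart hy]

lemma smIn_fun_iff {U : Opens M} {c : M → ℂ} :
    ContMDiffOn 𝓘(ℝ, Euc d) 𝓘(ℝ, ℂ) ∞ c U ↔ SmIn U (fun a => c ∘ (ch (d := d) a).symm) := by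
  constructor
  · intro h a y hy
    have h1 : ContMDiffAt 𝓘(ℝ, Euc d) 𝓘(ℝ, ℂ) ∞ c ((ch a).symm y) :=
      h.contMDiffAt (U.2.mem_nhds hy.2)
    have h2 := (contMDiffOn_extChartAt_symm (I := 𝓘(ℝ, Euc d)) (n := ∞) a).contMDiffAt
      ((isOpen_extChartAt_target a).mem_nhds hy.1)
    exact contMDiffAt_iff_contDiffAt.1 (h1.comp y h2)
  · intro h p hp
    refine ContMDiffAt.contMDiffWithinAt ?_
    have h0 : ch p p ∈ chartDom d p U :=
      ⟨mem_extChartAt_target p, by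
        change (ch p).symm (ch p p) ∈ U; rwa [(ch p).left_inv (mem_extChartAt_source p)]⟩
    have h1 := contMDiffAt_iff_contDiffAt.2 (h p _ h0)
    have h2 : ContMDiffAt 𝓘(ℝ, Euc d) 𝓘(ℝ, Euc d) ∞ (ch p) p := contMDiffAt_extChartAt
    refine (ContMDiffAt.comp p h1 h2).congr_of_eventuallyEq ?_
    filter_upwards [extChartAt_source_mem_nhds (I := 𝓘(ℝ, Euc d)) p] with p' hp'
    exact (congrArg c ((ch p).left_inv hp')).symm

omit [IsManifold 𝓘(ℝ, Euc d) ∞ M] in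
lemma ch_mem_chartDom {U : Opens M} {p : M} (hp : p ∈ U) : ch (d := d) p p ∈ chartDom d p U :=
  ⟨mem_extChartAt_target p, by
    change (ch p).symm (ch p p) ∈ U; rwa [(ch p).left_inv (mem_extChartAt_source p)]⟩

lemma cotC_dFun {U : Opens M} {c : M → ℂ} (hc : ContMDiffOn 𝓘(ℝ, Euc d) 𝓘(ℝ, ℂ) ∞ c U) {a : M}
    {y : Euc d} (hy : y ∈ chartDom d a U) :
    cotC a (fun p => dFun c p) y = fderiv ℝ (c ∘ (ch a).symm) y := by
  have h1 : MDifferentiableAt 𝓘(ℝ, Euc d) 𝓘(ℝ, ℂ) c ((ch a).symm y) :=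
    (hc.contMDiffAt (U.2.mem_nhds hy.2)).mdifferentiableAt (by simp)
  have h := mfderiv_comp y h1 (mdifferentiableAt_symm hy.1)
  rw [mfderiv_eq_fderiv] at h
  exact h.symm

/-- The exterior derivative is given in any chart by the exterior derivative of the coordinate
expression. -/
lemma inChart_dForm {k : ℕ} {U : Opens M} {w : ∀ p : M, Form d k p} (hw : SmoothOn U w) {a : M}
    {y : Euc d} (hy : y ∈ chartDom d a U) :
    inChart a (dForm w) y = extDeriv (inChart a w) y := by
  set p := (ch a).symm y with hp
  have hy' : y ∈ ovl a p := ⟨hy.1, mem_extChartAt_source p⟩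
  have e1 : chg a p y = ch p p := rfl
  have h1 : inChart a (dForm w) y =
      pull (fderiv ℝ (chg a p) y) (extDeriv (inChart p w) (chg a p y)) := by
    rw [fderiv_chg hy', ← pull_pull]
    rfl
  rw [h1]
  have hdiff : DifferentiableAt ℝ (inChart p w) (chg a p y) :=
    (hw p _ (ch_mem_chartDom hy.2)).differentiableAt (by simp)
  refine (extDeriv_pullback (r := ∞) hdiff (contDiffAt_chg hy')
    (by rw [minSmoothness_of_isRCLikeNormedField]; exact WithTop.coe_le_coe.2 le_top)).symm.trans ?_
  refine Filter.EventuallyEq.extDeriv_eq (Filter.eventuallyEq_of_mem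
    ((isOpen_ovl a p).mem_nhds hy') fun y' hy' => (inChart_chg w hy').symm)

lemma SmoothOn.dForm {k : ℕ} {U : Opens M} {w : ∀ p : M, Form d k p} (hw : SmoothOn U w) :
    SmoothOn U (dForm w) := by
  refine SmIn.congr (G := fun a => extDeriv (inChart a w)) (fun a y hy => ?_)
    fun a y hy => inChart_dForm hw hy
  have h1 : ContDiffAt ℝ ∞ (fderiv ℝ (inChart a w)) y :=
    (hw a y hy).fderiv_right (m := ∞) (by simp)
  exact (ContinuousAlternatingMap.alternatizeUncurryFinCLM ℝ (Euc d) ℂ).contDiff.contDiffAt.comp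
    y h1

end Charts

/-! ### Formally integrable structures: coframes of the conormal bundle -/

section Bracket

variable {E : Type*} [NormedAddCommGroup E] [NormedSpace ℝ E]

lemma extDeriv_ofCov_apply {θ : E → E →L[ℝ] ℂ} {x : E} (hθ : DifferentiableAt ℝ θ x) (v w : E) :
    extDeriv (fun y => ofCov (θ y)) x ![v, w] = fderiv ℝ θ x v w - fderiv ℝ θ x w v := by
  have h1 : HasFDerivAt (fun y => ofCov (θ y))
      ((ContinuousAlternatingMap.ofSubsingletonLIE (𝕜 := ℝ) (E := E) (F := ℂ)
        (0 : Fin 1)).toContinuousLinearEquiv.toContinuousLinearMap ∘L fderiv ℝ θ x) x :=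
    ((ContinuousAlternatingMap.ofSubsingletonLIE (𝕜 := ℝ) (E := E) (F := ℂ)
      (0 : Fin 1)).toContinuousLinearEquiv.toContinuousLinearMap.hasFDerivAt).comp x
        hθ.hasFDerivAt
  rw [extDeriv, h1.fderiv, ContinuousAlternatingMap.alternatizeUncurryFin_apply,
    Fin.sum_univ_two]
  change (-1 : ℤ) ^ 0 • (fderiv ℝ θ x v w) + (-1 : ℤ) ^ 1 • (fderiv ℝ θ x w v) = _
  simp [sub_eq_add_neg]

/-- If `θ` annihilates the complex vector fields `A + iB` and `A' + iB'` and their bracket, then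
`dθ` vanishes on them. -/
lemma extDeriv_ofCov_eq_zero {θ : E → E →L[ℝ] ℂ} {A B A' B' : E → E} {x : E}
    (hθ : DifferentiableAt ℝ θ x) (hA : DifferentiableAt ℝ A x) (hB : DifferentiableAt ℝ B x)
    (hA' : DifferentiableAt ℝ A' x) (hB' : DifferentiableAt ℝ B' x)
    (h : ∀ᶠ y in 𝓝 x, evC (θ y) (A y, B y) = 0) (h' : ∀ᶠ y in 𝓝 x, evC (θ y) (A' y, B' y) = 0)
    (hb : evC (θ x) (VectorField.lieBracket ℝ A A' x - VectorField.lieBracket ℝ B B' x,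
      VectorField.lieBracket ℝ A B' x + VectorField.lieBracket ℝ B A' x) = 0) :
    evC (cov (contrC (A x, B x) (extDeriv (fun y => ofCov (θ y)) x))) (A' x, B' x) = 0 := by
  have key : ∀ {C D : E → E} (_ : DifferentiableAt ℝ C x) (_ : DifferentiableAt ℝ D x)
      (_ : ∀ᶠ y in 𝓝 x, evC (θ y) (C y, D y) = 0) (v : E),
      fderiv ℝ θ x v (C x) + θ x (fderiv ℝ C x v) +
        Complex.I * (fderiv ℝ θ x v (D x) + θ x (fderiv ℝ D x v)) = 0 := by
    intro C D hC hD hCD v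
    have e1 := hθ.hasFDerivAt.clm_apply hC.hasFDerivAt
    have e2 := hθ.hasFDerivAt.clm_apply hD.hasFDerivAt
    have e3 := e1.add (e2.const_smul Complex.I)
    have e4 : HasFDerivAt (fun _ : E => (0 : ℂ)) (0 : E →L[ℝ] ℂ) x := hasFDerivAt_const 0 x
    have e5 := DFunLike.congr_fun (e3.unique (e4.congr_of_eventuallyEq hCD)) v
    simp only [add_apply, smul_apply, ContinuousLinearMap.comp_apply,
      ContinuousLinearMap.flip_apply, zero_apply, smul_eq_mul] at e5
    linear_combination e5
  have k1 := key hA' hB' h' (A x)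
  have k2 := key hA' hB' h' (B x)
  have k3 := key hA hB h (A' x)
  have k4 := key hA hB h (B' x)
  simp only [evC, VectorField.lieBracket, map_sub, map_add] at hb
  simp only [evC, cov_contrC_apply, extDeriv_ofCov_apply hθ]
  linear_combination k1 + Complex.I * k2 - k3 - Complex.I * k4 - hb +
    (θ x (fderiv ℝ B x (B' x)) - θ x (fderiv ℝ B' x (B x))) * Complex.I_mul_I

end Bracket

section Fibres

variable {d : ℕ} {M : Type u} [TopologicalSpace M] [ChartedSpace (Euc d) M]

lemma castForm_eq {k l : ℕ} (h : k = l) {p : M} (u : Form d k p) :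
    castForm h u = castF (E := Euc d) h u := by subst h; rfl

lemma iterWedge_eq {q : ℕ} {p : M} (u : Form d q p) : ∀ (k : ℕ) (θ : Fin k → Cot d p),
    iterWedge k θ u = iterW (E := Euc d) k θ u
  | 0, _ => rfl
  | k + 1, θ => congrArg (wedgeL (Euc d) (q + k) (θ 0)) (iterWedge_eq u k fun j => θ j.succ)

lemma wedgeFrame_eq {k q : ℕ} {p : M} (θ : Fin k → Cot d p) (u : Form d q p) :
    wedgeFrame θ u = frameW (E := Euc d) k θ u := by
  rw [wedgeFrame, castForm_eq, iterWedge_eq]; rfl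

/-- The constant `1` as a form of degree zero. -/
def oneForm (E : Type*) [NormedAddCommGroup E] [NormedSpace ℝ E] : E [⋀^Fin 0]→L[ℝ] ℂ :=
  ContinuousAlternatingMap.constOfIsEmpty ℝ E (Fin 0) (1 : ℂ)

lemma eq_smul_oneForm {E : Type*} [NormedAddCommGroup E] [NormedSpace ℝ E]
    (u : E [⋀^Fin 0]→L[ℝ] ℂ) : u = u ![] • oneForm E := by
  ext v
  rw [Subsingleton.elim v ![]]
  exact (mul_one _).symm

lemma wedgeAll_eq {k : ℕ} {p : M} (θ : Fin k → Cot d p) :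
    wedgeAll θ = frameW (E := Euc d) k θ (oneForm (Euc d)) := wedgeFrame_eq θ _

lemma pair_cvec {p : M} (θ : Cot d p) (X Y : Tan d p) :
    pair θ (cvec X Y) = evC (E := Euc d) θ (X, Y) := by
  unfold pair cvec
  rw [map_add, LinearMap.liftBaseChange_tmul, LinearMap.liftBaseChange_tmul, one_smul]
  rfl

lemma cvec_surjective {p : M} (Z : CTan d p) : ∃ X Y : Tan d p, cvec X Y = Z := by
  induction Z using TensorProduct.induction_on with
  | zero => exact ⟨0, 0, by rw [cvec, TensorProduct.tmul_zero, TensorProduct.tmul_zero, add_zero]⟩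
  | tmul c x =>
    refine ⟨c.re • x, c.im • x, ?_⟩
    rw [cvec, TensorProduct.tmul_smul, TensorProduct.tmul_smul, TensorProduct.smul_tmul',
      TensorProduct.smul_tmul', ← TensorProduct.add_tmul]
    congr 1
    conv_rhs => rw [← Complex.re_add_im c]
    simp [mul_comm]
  | add a b ha hb =>
    obtain ⟨X, Y, rfl⟩ := ha
    obtain ⟨X', Y', rfl⟩ := hb
    refine ⟨X + X', Y + Y', ?_⟩
    simp only [cvec, TensorProduct.tmul_add]
    abel

/-- Coordinates on the complexified tangent space. -/
def cxEquiv (d : ℕ) : (ℂ ⊗[ℝ] Euc d) ≃ₗ[ℂ] (Fin d → ℂ) :=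
  ((EuclideanSpace.basisFun (Fin d) ℝ).toBasis.baseChange ℂ).equivFun

lemma cxEquiv_tmul (c : ℂ) (x : Euc d) : cxEquiv d (c ⊗ₜ[ℝ] x) = fun i => c * x i := by
  ext i
  simp only [cxEquiv, Module.Basis.equivFun_apply, Module.Basis.baseChange_repr_tmul]
  simp [mul_comm]

lemma cxEquiv_cvec {p : M} (X Y : Tan d p) :
    cxEquiv d (cvec X Y) = cxv ((X : Euc d), (Y : Euc d)) := by
  refine (map_add (cxEquiv d) ((1 : ℂ) ⊗ₜ[ℝ] (X : Euc d)) (Complex.I ⊗ₜ[ℝ] (Y : Euc d))).trans ?_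
  refine (congrArg₂ (· + ·) (cxEquiv_tmul 1 X) (cxEquiv_tmul Complex.I Y)).trans ?_
  ext i
  simp [cxv]

lemma linearIndependent_cxv {ι : Type*} {p : M} {X Y : ι → Tan d p}
    (h : LinearIndependent ℂ fun j => cvec (X j) (Y j)) :
    LinearIndependent ℂ fun j => cxv ((X j : Euc d), (Y j : Euc d)) := by
  have h1 := h.map' (cxEquiv d).toLinearMap (cxEquiv d).ker
  have e : (fun j => cxv ((X j : Euc d), (Y j : Euc d))) =
      (cxEquiv d).toLinearMap ∘ fun j => cvec (X j) (Y j) :=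
    funext fun j => (cxEquiv_cvec (X j) (Y j)).symm
  rw [e]
  exact h1

variable [IsManifold 𝓘(ℝ, Euc d) ∞ M]

lemma dChart_self (p : M) : dChart (d := d) p p = ContinuousLinearMap.id ℝ (Euc d) :=
  mfderiv_extChartAt_self (I := 𝓘(ℝ, Euc d))

lemma dSymm_self (p : M) : dSymm p (ch p p) = ContinuousLinearMap.id ℝ (Euc d) := by
  have h := dSymm_comp_dChart (mem_extChartAt_target (I := 𝓘(ℝ, Euc d)) p)
  rw [show (ch p).symm (extChartAt 𝓘(ℝ, Euc d) p p) = p from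
    (ch p).left_inv (mem_extChartAt_source p), dChart_self] at h
  exact h

lemma dForm_eq {k : ℕ} (w : ∀ p : M, Form d k p) (p : M) :
    dForm w p = extDeriv (inChart p w) (ch p p) := by
  change pull (dChart p p) _ = _
  rw [dChart_self]
  rfl

lemma inChart_self {k : ℕ} (w : ∀ p : M, Form d k p) (p : M) : inChart p w (ch p p) = w p := by
  rw [inChart_eq, dSymm_self, show (ch p).symm (ch p p) = p from
    (ch p).left_inv (mem_extChartAt_source p)]
  rfl

lemma cotC_self (θ : M → Euc d →L[ℝ] ℂ) (p : M) : cotC p θ (ch p p) = θ p := by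
  rw [cotC, dSymm_self, show (ch p).symm (ch p p) = p from
    (ch p).left_inv (mem_extChartAt_source p)]
  rfl

lemma vecC_self (z : M → Euc d × Euc d) (p : M) : vecC p z (ch p p) = z p := by
  rw [vecC, show (ch p).symm (ch p p) = p from
    (ch p).left_inv (mem_extChartAt_source p), dChart_self]
  rfl

lemma contDiffAt_of_smoothFieldOn {U : Opens M} {X : ∀ p : M, Tan d p} (hX : SmoothFieldOn U X)
    {a : M} {y : Euc d} (hy : y ∈ chartDom d a U) :
    ContDiffAt ℝ ∞ (fun y => dChart a ((ch a).symm y) (X ((ch a).symm y))) y := by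
  have h1 := hX.contMDiffAt (U.2.mem_nhds hy.2)
  have hs : ∀ y' ∈ (ch a).target, (ch a).symm y' ∈ (chartAt (Euc d) a).source := fun y' h' => by
    rw [← extChartAt_source 𝓘(ℝ, Euc d)]; exact (ch a).map_target h'
  have h2 := ((trivializationAt (Euc d) (TangentSpace 𝓘(ℝ, Euc d)) a).contMDiffAt_section_iff
    (IB := 𝓘(ℝ, Euc d)) (n := ∞) (s := X) (x₀ := (ch a).symm y) (by
      rw [TangentBundle.trivializationAt_baseSet]; exact hs y hy.1)).1 h1
  have h3 := (contMDiffOn_extChartAt_symm (I := 𝓘(ℝ, Euc d)) (n := ∞) a).contMDiffAt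
    ((isOpen_extChartAt_target a).mem_nhds hy.1)
  refine (contMDiffAt_iff_contDiffAt.1 (ContMDiffAt.comp y h2 h3)).congr_of_eventuallyEq ?_
  filter_upwards [(isOpen_extChartAt_target (I := 𝓘(ℝ, Euc d)) a).mem_nhds hy.1] with y' hy'
  have h4 := TangentBundle.continuousLinearMapAt_trivializationAt (I := 𝓘(ℝ, Euc d)) (hs y' hy')
  refine (DFunLike.congr_fun h4.symm (X ((ch a).symm y'))).trans ?_
  have hb : (ch a).symm y' ∈
      (trivializationAt (Euc d) (TangentSpace 𝓘(ℝ, Euc d)) a).baseSet := by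
    rw [TangentBundle.trivializationAt_baseSet]; exact hs y' hy'
  rw [Bundle.Trivialization.continuousLinearMapAt_apply,
    Bundle.Trivialization.linearMapAt_apply, if_pos hb]
  rfl

lemma mlieBracket_eq (X X' : ∀ p : M, Tan d p) (p : M) :
    VectorField.mlieBracket 𝓘(ℝ, Euc d) X X' p =
      VectorField.lieBracket ℝ (fun y => dChart p ((ch p).symm y) (X ((ch p).symm y)))
        (fun y => dChart p ((ch p).symm y) (X' ((ch p).symm y))) (ch p p) := by
  have h : ∀ X : ∀ p : M, Tan d p, ∀ y ∈ (ch p).target,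
      VectorField.mpullbackWithin 𝓘(ℝ, Euc d) 𝓘(ℝ, Euc d) (extChartAt 𝓘(ℝ, Euc d) p).symm X
        Set.univ y = dChart p ((ch p).symm y) (X ((ch p).symm y)) := by
    intro X y hy
    have h1 : (dSymm p y).inverse = dChart p ((ch p).symm y) :=
      ContinuousLinearMap.inverse_eq (dSymm_comp_dChart hy) (dChart_comp_dSymm hy)
    rw [← h1]
    change ContinuousLinearMap.inverse (mfderivWithin _ _ _ _ _) _ = _
    rw [mfderivWithin_univ]
    rfl
  have h2 := VectorField.mlieBracketWithin_apply (I := 𝓘(ℝ, Euc d)) (V := X) (W := X')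
    (s := Set.univ) (x₀ := p)
  rw [VectorField.mlieBracketWithin_univ] at h2
  refine h2.trans ?_
  have h3 : (mfderiv 𝓘(ℝ, Euc d) 𝓘(ℝ, Euc d) (extChartAt 𝓘(ℝ, Euc d) p) p).inverse =
      ContinuousLinearMap.id ℝ (Euc d) := by
    refine (congrArg _ (dChart_self p)).trans ?_
    exact ContinuousLinearMap.inverse_id
  rw [h3, ModelWithCorners.range_eq_univ, Set.preimage_univ, Set.univ_inter]
  refine (congrFun (VectorField.lieBracketWithin_univ (𝕜 := ℝ) (E := Euc d)) _).trans ?_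
  have hn := (isOpen_extChartAt_target (I := 𝓘(ℝ, Euc d)) p).mem_nhds (mem_extChartAt_target p)
  exact Filter.EventuallyEq.lieBracket_vectorField_eq (Filter.eventuallyEq_of_mem hn (h X))
    (Filter.eventuallyEq_of_mem hn (h X'))

end Fibres

section EtaSmooth

variable {E : Type*} [NormedAddCommGroup E] [NormedSpace ℝ E]
  {X : Type*} [NormedAddCommGroup X] [NormedSpace ℝ X] {x : X}

lemma contDiffAt_cov {u : X → E [⋀^Fin 1]→L[ℝ] ℂ} (hu : ContDiffAt ℝ ∞ u x) :
    ContDiffAt ℝ ∞ (fun y => cov (u y)) x := by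
  rw [← contDiffAt_ofCov]
  simpa only [ofCov_cov] using hu

lemma contDiffAt_evC {θ : X → E →L[ℝ] ℂ} {z : X → E × E} (hθ : ContDiffAt ℝ ∞ θ x)
    (hz : ContDiffAt ℝ ∞ z x) : ContDiffAt ℝ ∞ (fun y => evC (θ y) (z y)) x :=
  (hθ.clm_apply hz.fst).add (contDiffAt_const.mul (hθ.clm_apply hz.snd))

lemma contDiffAt_etaOf {k : ℕ} {θ : Fin k → X → E →L[ℝ] ℂ} {z : Fin k → X → E × E}
    {τ : X → E [⋀^Fin 2]→L[ℝ] ℂ} (hθ : ∀ j, ContDiffAt ℝ ∞ (θ j) x)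
    (hz : ∀ j, ContDiffAt ℝ ∞ (z j) x) (hτ : ContDiffAt ℝ ∞ τ x) (l : Fin k) :
    ContDiffAt ℝ ∞ (fun y => etaOf (fun j => θ j y) (fun j => z j y) (τ y) l) x := by
  have h1 : ContDiffAt ℝ ∞ (fun y => cov (contrC (z l y) (τ y))) x :=
    contDiffAt_cov (contDiffAt_apply_complex (contDiffAt_contrC (hz l)) hτ)
  refine ContDiffAt.sub (ContDiffAt.const_smul (2⁻¹ : ℂ) (ContDiffAt.sum fun i _ => ?_)) h1
  exact contDiffAt_smul_complex (contDiffAt_evC h1 (hz i)) (hθ i)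

lemma cov_contrC_comp (A : E →L[ℝ] E) (z : E × E) (τ : E [⋀^Fin 2]→L[ℝ] ℂ) :
    (cov (contrC (A z.1, A z.2) τ)).comp A = cov (contrC z (pull A τ)) := by
  ext y
  rw [ContinuousLinearMap.comp_apply, cov_contrC_apply, cov_contrC_apply, pull_apply, pull_apply]
  congr 2 <;> congr 1 <;> ext i <;> fin_cases i <;> rfl

lemma etaOf_comp {k : ℕ} (A : E →L[ℝ] E) (θ : Fin k → E →L[ℝ] ℂ) (z : Fin k → E × E)
    (τ : E [⋀^Fin 2]→L[ℝ] ℂ) (l : Fin k) :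
    (etaOf θ (fun j => (A (z j).1, A (z j).2)) τ l).comp A =
      etaOf (fun j => (θ j).comp A) z (pull A τ) l := by
  ext y
  rw [ContinuousLinearMap.comp_apply, etaOf_apply, etaOf_apply, ← cov_contrC_comp]
  rfl

end EtaSmooth

section Coframes

variable {m n : ℕ} {M : Type u} [TopologicalSpace M] [ChartedSpace (Euc (m + n)) M]
  [IsManifold 𝓘(ℝ, Euc (m + n)) ∞ M] (V : Structure m n M)

namespace Structure

/-- The conormal space, as a subspace of the dual of the model space. -/
def con (p : M) : Submodule ℂ (Euc (m + n) →L[ℝ] ℂ) := V.conormal p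

lemma Lam_eq (p : M) : ∀ r k : ℕ, V.Lam p r k = LamE (V.con p) r k
  | 0, k => by rw [Lam, LamE]; rfl
  | r + 1, 0 => by rw [Lam, LamE]; rfl
  | r + 1, k + 1 => by
    rw [Lam, LamE, Lam_eq p r k]
    rfl

lemma mem_con_iff {p : M} (θ : Euc (m + n) →L[ℝ] ℂ) : θ ∈ V.con p ↔
    ∀ z : Euc (m + n) × Euc (m + n), cvec (p := p) z.1 z.2 ∈ V.fib p → evC θ z = 0 := by
  constructor
  · intro h z hz
    rw [← h _ hz]
    exact (pair_cvec (p := p) θ z.1 z.2).symm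
  · intro h Z hZ
    obtain ⟨X, Y, rfl⟩ := cvec_surjective Z
    exact (pair_cvec (p := p) θ X Y).trans (h (X, Y) hZ)

lemma mem_con_iff_frame {p : M} {X Y : Fin n → Tan (m + n) p}
    (h : Submodule.span ℂ (Set.range fun j => cvec (X j) (Y j)) = V.fib p)
    (θ : Euc (m + n) →L[ℝ] ℂ) : θ ∈ V.con p ↔ ∀ j, evC θ ((X j : Euc (m + n)), Y j) = 0 := by
  constructor
  · intro hθ j
    refine (V.mem_con_iff θ).1 hθ (X j, Y j) ?_
    rw [← h]
    exact Submodule.subset_span ⟨j, rfl⟩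
  · intro hθ Z hZ
    rw [← h] at hZ
    refine Submodule.span_induction (p := fun Z _ => pair (p := p) θ Z = 0) ?_ ?_ ?_ ?_ hZ
    · rintro _ ⟨j, rfl⟩
      exact (pair_cvec (p := p) θ (X j) (Y j)).trans (hθ j)
    · exact map_zero _
    · intro a b _ _ ha hb
      exact (map_add _ a b).trans ((congrArg₂ (· + ·) ha hb).trans (add_zero 0))
    · intro c a _ ha
      exact (map_smul _ c a).trans ((congrArg (c • ·) ha).trans (smul_zero c))

/-- If `θ` is a section of the conormal bundle, then the contraction of `dθ` with an element of
`𝒱` is conormal. This is where the involutivity of `𝒱` enters. -/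
lemma cov_contrC_dForm_mem {U : Opens M} {θ : M → Euc (m + n) →L[ℝ] ℂ}
    (hθ : SmIn U (fun a => cotC a θ)) (hcon : ∀ p ∈ U, θ p ∈ V.con p) {p : M} (hp : p ∈ U)
    (b : Euc (m + n) × Euc (m + n)) (hb : ∀ α ∈ V.con p, evC α b = 0) :
    cov (E := Euc (m + n)) (contrC (E := Euc (m + n)) b
      (dForm (fun p' => toForm (d := m + n) (p := p') (θ p')) p)) ∈ V.con p := by
  obtain ⟨U', hp', X, Y, hX, hY, hfr⟩ := V.localFrame p
  set τ : Euc (m + n) [⋀^Fin 2]→L[ℝ] ℂ :=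
    dForm (fun p' => toForm (d := m + n) (p := p') (θ p')) p with hτ
  let W := U ⊓ U'
  have hpW : p ∈ W := ⟨hp, hp'⟩
  have hy0 := ch_mem_chartDom (d := m + n) hpW
  have hτ' : τ = extDeriv (fun y => ofCov (cotC p θ y)) (ch p p) := dForm_eq _ p
  have hsm : ∀ {X : ∀ p : M, Tan (m + n) p}, SmoothFieldOn U' X →
      DifferentiableAt ℝ (fun y => dChart p ((ch p).symm y) (X ((ch p).symm y))) (ch p p) :=
    fun hX => (contDiffAt_of_smoothFieldOn hX (ch_mem_chartDom hp')).differentiableAt (by simp)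
  -- the form vanishes on pairs of elements of the local frame
  have h1 : ∀ j k, evC (cov (contrC (E := Euc (m + n)) (X j p, Y j p) τ)) (X k p, Y k p) = 0 := by
    intro j k
    have hz : ∀ j, ∀ᶠ y in 𝓝 (ch p p), evC (cotC p θ y)
        (dChart p ((ch p).symm y) (X j ((ch p).symm y)),
          dChart p ((ch p).symm y) (Y j ((ch p).symm y))) = 0 := by
      intro j
      filter_upwards [(isOpen_chartDom p W).mem_nhds hy0] with y hy
      refine (evC_cotC θ (fun p => ((X j p : Euc (m + n)), (Y j p : Euc (m + n)))) hy.1).trans ?_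
      exact (V.mem_con_iff_frame (hfr _ hy.2.2).2 _).1 (hcon _ hy.2.1) j
    have hbr := V.involutive U' (X j) (Y j) (X k) (Y k) (hX j) (hY j) (hX k) (hY k)
      (fun p hp => by rw [← (hfr p hp).2]; exact Submodule.subset_span ⟨j, rfl⟩)
      (fun p hp => by rw [← (hfr p hp).2]; exact Submodule.subset_span ⟨k, rfl⟩) p hp'
    have h2 := extDeriv_ofCov_eq_zero (x := ch p p) (θ := cotC p θ)
      ((hθ p _ (ch_mem_chartDom hp)).differentiableAt (by simp))
      (hsm (hX j)) (hsm (hY j)) (hsm (hX k)) (hsm (hY k)) (hz j) (hz k)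
      (by
        rw [cotC_self]
        rw [mlieBracket_eq, mlieBracket_eq, mlieBracket_eq, mlieBracket_eq] at hbr
        exact (V.mem_con_iff _).1 (hcon p hp) (_, _) hbr)
    rw [← hτ'] at h2
    let Z : Fin n → M → Euc (m + n) × Euc (m + n) := fun j p => (X j p, Y j p)
    change evC (cov (contrC (vecC p (Z j) (ch p p)) τ)) (vecC p (Z k) (ch p p)) = 0 at h2
    rw [vecC_self, vecC_self] at h2
    exact h2
  have h2 : ∀ j, cov (contrC (E := Euc (m + n)) (X j p, Y j p) τ) ∈ V.con p := fun j =>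
    (V.mem_con_iff_frame (hfr p hp').2 _).2 (h1 j)
  refine (V.mem_con_iff_frame (hfr p hp').2 _).2 fun j => ?_
  have h3 := hb _ (h2 j)
  have h4 : ∀ v w : Euc (m + n), evC (cov (contrC (v, w) τ)) b = 0 →
      evC (cov (contrC b τ)) (v, w) = 0 := by
    intro v w h
    simp only [evC, cov_contrC_apply] at h ⊢
    rw [map_swap τ v, map_swap τ v, map_swap τ w, map_swap τ w]
    linear_combination -h
  exact h4 _ _ h3

/-- A smooth coframe of the conormal bundle over `U`, together with smooth dual complex vector
fields. -/
structure Coframe (U : Opens M) where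
  θ : Fin m → M → Euc (m + n) →L[ℝ] ℂ
  z : Fin m → M → Euc (m + n) × Euc (m + n)
  smooth_θ : ∀ j, SmIn U (fun a => cotC a (θ j))
  smooth_z : ∀ j, SmIn U (fun a => vecC a (z j))
  dual : ∀ p ∈ U, ∀ i j, evC (θ i p) (z j p) = if i = j then 1 else 0
  span : ∀ p ∈ U, Submodule.span ℂ (Set.range fun j => θ j p) = V.con p

lemma exists_coframe (p₀ : M) : ∃ U : Opens M, p₀ ∈ U ∧ Nonempty (V.Coframe U) := by
  obtain ⟨U, hp₀, X, Y, hX, hY, hfr⟩ := V.localFrame p₀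
  let Z : Fin n → M → Euc (m + n) × Euc (m + n) := fun j p => (X j p, Y j p)
  obtain ⟨θ, z, O, hO, hyO, hOU, h⟩ := exists_smooth_coframe (Z := fun j y => vecC p₀ (Z j) y)
    (isOpen_chartDom p₀ U) (ch_mem_chartDom hp₀)
    (fun j y hy => (contDiffAt_of_smoothFieldOn (hX j) hy).prodMk
      (contDiffAt_of_smoothFieldOn (hY j) hy))
    (by
      simp only [vecC_self]
      exact linearIndependent_cxv (hfr p₀ hp₀).1)
  let W : Opens M := ⟨(ch p₀).source ∩ ch p₀ ⁻¹' O,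
    (continuousOn_extChartAt p₀).isOpen_inter_preimage (isOpen_extChartAt_source p₀) hO⟩
  have hWs : (W : Set M) ⊆ (ch (d := m + n) p₀).source := Set.inter_subset_left
  have hWO : ∀ y ∈ chartDom (m + n) p₀ W, y ∈ O := by
    intro y hy
    have h1 : ch p₀ ((ch p₀).symm y) ∈ O := hy.2.2
    rwa [(ch p₀).right_inv hy.1] at h1
  have hWU : ∀ p ∈ W, p ∈ U := by
    intro p hp
    have h1 := (hOU hp.2).2
    change (ch p₀).symm (ch p₀ p) ∈ U at h1
    rwa [(ch p₀).left_inv hp.1] at h1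
  let θ' : Fin m → M → Euc (m + n) →L[ℝ] ℂ := fun j p => (θ j (ch p₀ p)).comp (dChart p₀ p)
  let z' : Fin m → M → Euc (m + n) × Euc (m + n) := fun j p =>
    (dSymm p₀ (ch p₀ p) (z j).1, dSymm p₀ (ch p₀ p) (z j).2)
  have hθ' : ∀ j, ∀ y ∈ (ch p₀).target, cotC p₀ (θ' j) y = θ j y :=
    fun j y hy => cotC_of_chart (θ j) hy
  have hz' : ∀ j, ∀ y ∈ (ch p₀).target, vecC p₀ (z' j) y = z j :=
    fun j y hy => vecC_of_chart (fun _ => z j) hy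
  have hop : IsOpen (ch (d := m + n) p₀).target := isOpen_extChartAt_target p₀
  have hW0 : ∀ p ∈ W, ∃ y ∈ (ch p₀).target, y ∈ O ∧ (ch (d := m + n) p₀).symm y = p :=
    fun p hp => ⟨ch p₀ p, (ch p₀).map_source hp.1, hp.2, (ch p₀).left_inv hp.1⟩
  refine ⟨W, ⟨mem_extChartAt_source p₀, hyO⟩, ⟨⟨θ', z', fun j => ?_, fun j => ?_, ?_, ?_⟩⟩⟩
  · refine smIn_cot_of_chart hWs fun y hy => ?_
    exact ((h y (hWO y hy)).1 j).congr_of_eventuallyEq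
      (Filter.eventuallyEq_of_mem (hop.mem_nhds hy.1) (hθ' j))
  · refine smIn_vec_of_chart hWs fun y hy => ?_
    exact contDiffAt_const.congr_of_eventuallyEq
      (Filter.eventuallyEq_of_mem (hop.mem_nhds hy.1) (hz' j))
  · intro p hp i j
    obtain ⟨y, hy, hyO, rfl⟩ := hW0 p hp
    rw [← (h y hyO).2.1 i j, ← hθ' i y hy, ← hz' j y hy]
    exact (evC_cotC (θ' i) (z' j) hy).symm
  · intro p hp
    have hpU := hWU p hp
    obtain ⟨y, hy, hyO, rfl⟩ := hW0 p hp
    apply le_antisymm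
    · rw [Submodule.span_le]
      rintro _ ⟨i, rfl⟩
      refine (V.mem_con_iff_frame (hfr _ hpU).2 _).2 fun j => ?_
      rw [← (h y hyO).2.2.1 i j, ← hθ' i y hy]
      exact (evC_cotC (θ' i) (Z j) hy).symm
    · intro α hα
      have h1 := (h y hyO).2.2.2 (α.comp (dSymm p₀ y)) fun j => by
        have h2 := (V.mem_con_iff_frame (hfr _ hpU).2 α).1 hα j
        rw [← h2]
        exact evC_cotC (fun _ => α) (Z j) hy
      obtain ⟨c, hc⟩ := (Submodule.mem_span_range_iff_exists_fun ℂ).1 h1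
      refine (Submodule.mem_span_range_iff_exists_fun ℂ).2 ⟨c, ?_⟩
      ext v
      have h3 := DFunLike.congr_fun hc (dChart p₀ ((ch p₀).symm y) v)
      rw [ContinuousLinearMap.comp_apply, dSymm_dChart hy, sum_apply] at h3
      rw [← h3, sum_apply]
      refine Finset.sum_congr rfl fun i _ => ?_
      change c i * θ i (ch p₀ ((ch p₀).symm y)) (dChart p₀ ((ch p₀).symm y) v) = _
      rw [(ch p₀).right_inv hy]
      rfl

variable {V}

lemma Coframe.mem {U : Opens M} (C : V.Coframe U) {p : M} (hp : p ∈ U) (j : Fin m) :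
    C.θ j p ∈ V.con p := by
  rw [← C.span p hp]; exact Submodule.subset_span ⟨j, rfl⟩

/-- Restriction of a coframe to a smaller open set. -/
def Coframe.restrict {U W : Opens M} (C : V.Coframe U) (h : W ≤ U) : V.Coframe W where
  θ := C.θ
  z := C.z
  smooth_θ j := (C.smooth_θ j).mono h
  smooth_z j := (C.smooth_z j).mono h
  dual p hp := C.dual p (h hp)
  span p hp := C.span p (h hp)

/-- The structure equations `dθ^j = ∑ l, η^j_l ∧ θ^l` of a coframe. -/
lemma Coframe.exists_eta {U : Opens M} (C : V.Coframe U) :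
    ∃ η : Fin m → Fin m → M → Euc (m + n) →L[ℝ] ℂ,
      (∀ j l, SmIn U (fun a => cotC a (η j l))) ∧
      ∀ j, ∀ p ∈ U, dForm (fun p' => toForm (d := m + n) (p := p') (C.θ j p')) p =
        ∑ l, wedgeL (Euc (m + n)) 1 (η j l p) (ofCov (C.θ l p)) := by
  let τ : Fin m → M → Euc (m + n) [⋀^Fin 2]→L[ℝ] ℂ := fun j p =>
    dForm (fun p' => toForm (d := m + n) (p := p') (C.θ j p')) p
  have hτ : ∀ j, SmoothOn U (fun p => (τ j p : Form (m + n) 2 p)) := fun j =>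
    SmoothOn.dForm (smoothCotOn_iff.2 (C.smooth_θ j))
  refine ⟨fun j l p => etaOf (fun i => C.θ i p) (fun i => C.z i p) (τ j p) l, fun j l => ?_,
    fun j p hp => ?_⟩
  · refine SmIn.congr (G := fun a y => etaOf (fun i => cotC a (C.θ i) y) (fun i => vecC a (C.z i) y)
      (inChart a (fun p => (τ j p : Form (m + n) 2 p)) y) l) (fun a y hy => ?_) fun a y hy => ?_
    · exact contDiffAt_etaOf (fun i => C.smooth_θ i a y hy) (fun i => C.smooth_z i a y hy)
        (hτ j a y hy) l
    · have h1 := etaOf_comp (dSymm a y) (fun i => C.θ i ((ch a).symm y)) (fun i => vecC a (C.z i) y)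
        (τ j ((ch a).symm y)) l
      have h2 : (fun i => (dSymm a y (vecC a (C.z i) y).1, dSymm a y (vecC a (C.z i) y).2)) =
          fun i => C.z i ((ch a).symm y) := by
        funext i
        unfold vecC
        rw [dSymm_dChart hy.1, dSymm_dChart hy.1]
      rw [h2] at h1
      exact h1
  · refine eq_sum_etaOf (C.dual p hp) fun b hb => ?_
    rw [C.span p hp]
    refine V.cov_contrC_dForm_mem (C.smooth_θ j) (fun p hp => C.mem hp j) hp b fun α hα => ?_
    rw [← C.span p hp] at hα
    rw [eq_sum_evC (C.dual p hp) hα, sum_evC]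
    refine Finset.sum_eq_zero fun i _ => ?_
    rw [smul_evC, hb i, mul_zero]

end Structure

end Coframes

/-! ### Multiplication by elements of the canonical bundle -/

section FrameMul

variable {E : Type*} [NormedAddCommGroup E] [NormedSpace ℝ E]

/-- The component of a `k`-form `κ` in the top exterior power of the span of a coframe with dual
vectors `z`. -/
def frameCoef {k : ℕ} (z : Fin k → E × E) : (E [⋀^Fin k]→L[ℝ] ℂ) →ₗ[ℂ] ℂ where
  toFun κ := frameC (q := 0) k z κ ![]
  map_add' x y := by rw [map_add]; rfl
  map_smul' c x := by rw [map_smul]; rfl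

lemma eq_frameCoef_smul {k : ℕ} {θ : Fin k → E →L[ℝ] ℂ} {z : Fin k → E × E}
    (h : ∀ i j, evC (θ i) (z j) = if i = j then 1 else 0) {κ : E [⋀^Fin k]→L[ℝ] ℂ}
    (hκ : κ ∈ LamE (Submodule.span ℂ (Set.range θ)) k k) :
    κ = frameCoef z κ • frameW (q := 0) k θ (oneForm E) := by
  have h1 := frameW_frameC (q := 0) h hκ
  rw [eq_smul_oneForm (frameC (q := 0) k z κ), map_smul] at h1
  exact h1.symm

lemma frameCoef_frameW {k : ℕ} {θ : Fin k → E →L[ℝ] ℂ} {z : Fin k → E × E}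
    (h : ∀ i j, evC (θ i) (z j) = if i = j then 1 else 0) :
    frameCoef z (frameW (q := 0) k θ (oneForm E)) = 1 := by
  have h1 := frameC_frameW h (oneForm E)
  rw [LamE, Submodule.mem_bot, sub_eq_zero] at h1
  change frameC (q := 0) k z (frameW (q := 0) k θ (oneForm E)) ![] = 1
  rw [h1]
  rfl

/-- The operator `κ ∧`, for an element `κ` of the top exterior power of the span of a coframe `θ`
with dual vectors `z`. -/
def frameMul {k q : ℕ} (θ : Fin k → E →L[ℝ] ℂ) (z : Fin k → E × E) (κ : E [⋀^Fin k]→L[ℝ] ℂ) :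
    (E [⋀^Fin q]→L[ℝ] ℂ) →L[ℂ] (E [⋀^Fin (k + q)]→L[ℝ] ℂ) :=
  frameCoef z κ • frameW k θ

lemma frameMul_apply {k q : ℕ} (θ : Fin k → E →L[ℝ] ℂ) (z : Fin k → E × E)
    (κ : E [⋀^Fin k]→L[ℝ] ℂ) (v : E [⋀^Fin q]→L[ℝ] ℂ) :
    frameMul θ z κ v = frameCoef z κ • frameW k θ v := rfl

lemma exists_frameW_eq_smul {k : ℕ} {θ φ : Fin k → E →L[ℝ] ℂ} (hθ : LinearIndependent ℂ θ)
    (hφ : ∀ j, φ j ∈ Submodule.span ℂ (Set.range θ)) :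
    ∃ c : ℂ, ∀ (q : ℕ) (u : E [⋀^Fin q]→L[ℝ] ℂ), frameW k φ u = c • frameW k θ u := by
  obtain ⟨c, hc⟩ := exists_iterW_eq_smul hθ hφ
  exact ⟨c, fun q u => by rw [frameW_apply, hc, map_smul, frameW_apply]⟩

lemma frameMul_frameW {k q : ℕ} {θ φ : Fin k → E →L[ℝ] ℂ} {z : Fin k → E × E}
    (h : ∀ i j, evC (θ i) (z j) = if i = j then 1 else 0)
    (hφ : ∀ j, φ j ∈ Submodule.span ℂ (Set.range θ)) (v : E [⋀^Fin q]→L[ℝ] ℂ) :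
    frameMul θ z (frameW (q := 0) k φ (oneForm E)) v = frameW k φ v := by
  obtain ⟨c, hc⟩ := exists_frameW_eq_smul (linearIndependent_of_dual h) hφ
  rw [frameMul_apply, hc, hc, map_smul, frameCoef_frameW h, smul_eq_mul, mul_one]

/-- The operator `κ ∧` does not depend on the coframe. -/
lemma frameMul_congr {k q : ℕ} {θ φ : Fin k → E →L[ℝ] ℂ} {z w : Fin k → E × E}
    (h : ∀ i j, evC (θ i) (z j) = if i = j then 1 else 0)
    (h' : ∀ i j, evC (φ i) (w j) = if i = j then 1 else 0)
    (hs : Submodule.span ℂ (Set.range φ) = Submodule.span ℂ (Set.range θ))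
    {κ : E [⋀^Fin k]→L[ℝ] ℂ} (hκ : κ ∈ LamE (Submodule.span ℂ (Set.range θ)) k k)
    (v : E [⋀^Fin q]→L[ℝ] ℂ) : frameMul θ z κ v = frameMul φ w κ v := by
  have h1 := eq_frameCoef_smul h' (κ := κ) (by rw [hs]; exact hκ)
  have h2 := frameMul_frameW (q := q) h (φ := φ)
    (fun j => by rw [← hs]; exact Submodule.subset_span ⟨j, rfl⟩) v
  rw [frameMul_apply] at h2
  have h3 : frameCoef z κ =
      frameCoef w κ * frameCoef z (frameW (q := 0) k φ (oneForm E)) := by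
    conv_lhs => rw [h1, map_smul, smul_eq_mul]
  rw [frameMul_apply φ, ← h2, ← form_mul_smul, ← h3, frameMul_apply]

/-- A left inverse of `κ ∧` modulo the ideal generated by the coframe. -/
def frameDiv {k q : ℕ} (z : Fin k → E × E) (κ : E [⋀^Fin k]→L[ℝ] ℂ) :
    (E [⋀^Fin (k + q)]→L[ℝ] ℂ) →L[ℂ] (E [⋀^Fin q]→L[ℝ] ℂ) :=
  (frameCoef z κ)⁻¹ • frameC k z

lemma frameMul_frameDiv {k q : ℕ} {θ : Fin k → E →L[ℝ] ℂ} {z : Fin k → E × E}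
    (h : ∀ i j, evC (θ i) (z j) = if i = j then 1 else 0) {κ : E [⋀^Fin k]→L[ℝ] ℂ}
    (hκ : frameCoef z κ ≠ 0) {u : E [⋀^Fin (k + q)]→L[ℝ] ℂ}
    (hu : u ∈ LamE (Submodule.span ℂ (Set.range θ)) k (k + q)) :
    frameMul θ z κ (frameDiv z κ u) = u := by
  rw [frameMul_apply, frameDiv, smul_apply, map_smul, frameW_frameC h hu, ← form_mul_smul,
    mul_inv_cancel₀ hκ, form_one_smul]

lemma frameMul_mem_LamE {k q : ℕ} (θ : Fin k → E →L[ℝ] ℂ) (z : Fin k → E × E)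
    (κ : E [⋀^Fin k]→L[ℝ] ℂ) (v : E [⋀^Fin q]→L[ℝ] ℂ) :
    frameMul θ z κ v ∈ LamE (Submodule.span ℂ (Set.range θ)) k (k + q) := by
  refine Submodule.smul_mem _ _ (castF_mem_LamE _ ?_)
  have key : ∀ (r : ℕ) (φ : Fin r → E →L[ℝ] ℂ), (∀ j, φ j ∈ Submodule.span ℂ (Set.range θ)) →
      iterW r φ v ∈ LamE (Submodule.span ℂ (Set.range θ)) r (q + r) := by
    intro r
    induction r with
    | zero => intro φ _; trivial
    | succ r ih =>
      intro φ hφ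
      exact Submodule.subset_span ⟨φ 0, hφ 0, _, ih (fun j => φ j.succ) fun j => hφ j.succ, rfl⟩
  exact key k θ fun j => Submodule.subset_span ⟨j, rfl⟩

lemma frameMul_eq_zero_iff {k q : ℕ} {θ : Fin k → E →L[ℝ] ℂ} {z : Fin k → E × E}
    (h : ∀ i j, evC (θ i) (z j) = if i = j then 1 else 0) {κ : E [⋀^Fin k]→L[ℝ] ℂ}
    (hκ : frameCoef z κ ≠ 0) {v : E [⋀^Fin q]→L[ℝ] ℂ} :
    frameMul θ z κ v = 0 ↔ v ∈ LamE (Submodule.span ℂ (Set.range θ)) 1 q := by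
  rw [← frameW_eq_zero_iff h, frameMul_apply]
  refine ⟨fun h1 => form_smul_cancel hκ (h1.trans (form_smul_zero _).symm), fun h1 => ?_⟩
  rw [h1, form_smul_zero]

end FrameMul

/-! ### The isomorphism of the fibres -/

section FibreIso

variable {m n : ℕ} {M : Type u} [TopologicalSpace M] [ChartedSpace (Euc (m + n)) M]
  [IsManifold 𝓘(ℝ, Euc (m + n)) ∞ M] (V : Structure m n M)

namespace Structure

lemma exists_dual_frame (p : M) : ∃ (θ : Fin m → Euc (m + n) →L[ℝ] ℂ)
    (z : Fin m → Euc (m + n) × Euc (m + n)),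
    (∀ i j, evC (θ i) (z j) = if i = j then 1 else 0) ∧
      Submodule.span ℂ (Set.range θ) = V.con p := by
  obtain ⟨U, hp, ⟨C⟩⟩ := V.exists_coframe p
  exact ⟨fun j => C.θ j p, fun j => C.z j p, C.dual p hp, C.span p hp⟩

/-- A basis of the conormal space at `p`. -/
def bas (p : M) : Fin m → Euc (m + n) →L[ℝ] ℂ := (V.exists_dual_frame p).choose

/-- Complex vectors dual to the basis `bas` of the conormal space. -/
def basDual (p : M) : Fin m → Euc (m + n) × Euc (m + n) :=
  (V.exists_dual_frame p).choose_spec.choose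

lemma bas_dual (p : M) : ∀ i j, evC (V.bas p i) (V.basDual p j) = if i = j then 1 else 0 :=
  (V.exists_dual_frame p).choose_spec.choose_spec.1

lemma span_bas (p : M) : Submodule.span ℂ (Set.range (V.bas p)) = V.con p :=
  (V.exists_dual_frame p).choose_spec.choose_spec.2

/-- An element of the canonical bundle as a form on the model space. -/
def canF {p : M} (κ : V.canonical p) : Euc (m + n) [⋀^Fin m]→L[ℝ] ℂ := κ.1

lemma canF_mem {p : M} (κ : V.canonical p) : V.canF κ ∈ LamE (V.con p) m m := by
  rw [← V.Lam_eq]; exact κ.2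

/-- The operator `κ ∧` for an element `κ` of the canonical bundle. -/
def mulCan {q : ℕ} {p : M} (κ : V.canonical p) :
    (Euc (m + n) [⋀^Fin q]→L[ℝ] ℂ) →L[ℂ] (Euc (m + n) [⋀^Fin (m + q)]→L[ℝ] ℂ) :=
  frameMul (V.bas p) (V.basDual p) (V.canF κ)

lemma mulCan_eq {q : ℕ} {p : M} {θ : Fin m → Euc (m + n) →L[ℝ] ℂ}
    {z : Fin m → Euc (m + n) × Euc (m + n)}
    (h : ∀ i j, evC (θ i) (z j) = if i = j then 1 else 0)
    (hs : Submodule.span ℂ (Set.range θ) = V.con p) (κ : V.canonical p)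
    (v : Euc (m + n) [⋀^Fin q]→L[ℝ] ℂ) : V.mulCan κ v = frameMul θ z (V.canF κ) v :=
  frameMul_congr (V.bas_dual p) h (by rw [hs, span_bas])
    (by rw [span_bas]; exact V.canF_mem κ) v

lemma mulCan_smul {q : ℕ} {p : M} (c : ℂ) (κ : V.canonical p)
    (v : Euc (m + n) [⋀^Fin q]→L[ℝ] ℂ) : V.mulCan (c • κ) v = c • V.mulCan κ v := by
  have h : V.canF (c • κ) = c • V.canF κ := rfl
  rw [mulCan, frameMul_apply, h, map_smul, smul_eq_mul, form_mul_smul]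
  rfl

lemma frameCoef_ne_zero {p : M} {θ : Fin m → Euc (m + n) →L[ℝ] ℂ}
    {z : Fin m → Euc (m + n) × Euc (m + n)}
    (h : ∀ i j, evC (θ i) (z j) = if i = j then 1 else 0)
    (hs : Submodule.span ℂ (Set.range θ) = V.con p) {κ : V.canonical p} (hκ : κ ≠ 0) :
    frameCoef z (V.canF κ) ≠ 0 := by
  intro h0
  apply hκ
  have h1 := eq_frameCoef_smul h (κ := V.canF κ) (by rw [hs]; exact V.canF_mem κ)
  rw [h0, form_zero_smul] at h1
  exact Subtype.ext h1

lemma mulCan_eq_zero_iff {q : ℕ} {p : M} {κ : V.canonical p} (hκ : κ ≠ 0)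
    {v : Euc (m + n) [⋀^Fin q]→L[ℝ] ℂ} : V.mulCan κ v = 0 ↔ v ∈ LamE (V.con p) 1 q := by
  rw [mulCan, frameMul_eq_zero_iff (V.bas_dual p)
    (V.frameCoef_ne_zero (V.bas_dual p) (V.span_bas p) hκ), span_bas]

lemma mulCan_mem {q : ℕ} {p : M} (κ : V.canonical p) (v : Euc (m + n) [⋀^Fin q]→L[ℝ] ℂ) :
    V.mulCan κ v ∈ LamE (V.con p) m (m + q) := by
  have := frameMul_mem_LamE (V.bas p) (V.basDual p) (V.canF κ) v
  rwa [span_bas] at this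

lemma mulCan_wedgeCan {q : ℕ} {p : M} (θ : Fin m → V.conormal p)
    (v : Euc (m + n) [⋀^Fin q]→L[ℝ] ℂ) :
    V.mulCan (V.wedgeCan θ) v = frameW m (fun j => ((θ j).1 : Euc (m + n) →L[ℝ] ℂ)) v := by
  have h : V.canF (V.wedgeCan θ) =
      frameW (q := 0) m (fun j => ((θ j).1 : Euc (m + n) →L[ℝ] ℂ)) (oneForm (Euc (m + n))) :=
    wedgeAll_eq _
  rw [mulCan, h]
  refine frameMul_frameW (V.bas_dual p) (fun j => ?_) v
  rw [span_bas]; exact (θ j).2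

lemma coe_wedgeLam {q : ℕ} {p : M} (θ : Fin m → V.conormal p)
    (v : Euc (m + n) [⋀^Fin q]→L[ℝ] ℂ) :
    ((V.wedgeLam (p := p) θ v).1 : Euc (m + n) [⋀^Fin (m + q)]→L[ℝ] ℂ) =
      V.mulCan (V.wedgeCan θ) v :=
  (wedgeFrame_eq _ _).trans (V.mulCan_wedgeCan θ v).symm

/-- The distinguished generator of the canonical line at `p`. -/
def can₀ (p : M) : V.canonical p := V.wedgeCan fun j => ⟨V.bas p j, by
  have : V.bas p j ∈ V.con p := by rw [← V.span_bas]; exact Submodule.subset_span ⟨j, rfl⟩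
  exact this⟩

lemma canF_can₀ (p : M) :
    V.canF (V.can₀ p) = frameW (q := 0) m (V.bas p) (oneForm (Euc (m + n))) := wedgeAll_eq _

/-- The component of an element of the canonical line with respect to the generator. -/
def coef₀ (p : M) : V.canonical p →ₗ[ℂ] ℂ where
  toFun κ := frameCoef (V.basDual p) (V.canF κ)
  map_add' x y := (frameCoef (V.basDual p)).map_add (V.canF x) (V.canF y)
  map_smul' c x := (frameCoef (V.basDual p)).map_smul c (V.canF x)

lemma coef₀_can₀ (p : M) : V.coef₀ p (V.can₀ p) = 1 := by
  change frameCoef (V.basDual p) (V.canF (V.can₀ p)) = 1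
  rw [canF_can₀, frameCoef_frameW (V.bas_dual p)]

lemma eq_coef₀_smul {p : M} (κ : V.canonical p) : κ = V.coef₀ p κ • V.can₀ p := by
  apply Subtype.ext
  have h1 := eq_frameCoef_smul (V.bas_dual p) (κ := V.canF κ)
    (by rw [span_bas]; exact V.canF_mem κ)
  rw [← canF_can₀] at h1
  exact h1

lemma can₀_ne_zero (p : M) : V.can₀ p ≠ 0 := by
  intro h
  have := V.coef₀_can₀ p
  rw [h, map_zero] at this
  exact zero_ne_one this

lemma contract_tmul {q : ℕ} {p : M} (κ : V.canonical p) (w : V.Lam p m (m + q))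
    (σ : Module.Dual ℂ (V.canonical p)) :
    V.contract κ (w ⊗ₜ[ℂ] σ) = σ κ • (w : Form (m + n) (m + q) p) := by
  change (((TensorProduct.rid ℂ (V.Lam p m (m + q)))
    (LinearMap.lTensor (V.Lam p m (m + q)) (LinearMap.applyₗ κ) (w ⊗ₜ[ℂ] σ))).1) = _
  rw [LinearMap.lTensor_tmul, TensorProduct.rid_tmul]
  rfl

lemma contract_smul {q : ℕ} {p : M} (c : ℂ) (κ : V.canonical p) (u : V.LamK q p) :
    V.contract (c • κ) u = c • V.contract κ u := by
  induction u using TensorProduct.induction_on with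
  | zero => rw [map_zero, map_zero]; exact (form_smul_zero (E := Euc (m + n)) c).symm
  | tmul w σ => rw [contract_tmul, contract_tmul, map_smul, smul_smul, smul_eq_mul]
  | add x y hx hy => rw [map_add, map_add, hx, hy, smul_add]

/-- The contraction with an element of the canonical line, with values in the forms on the model
space. -/
def ctr {q : ℕ} {p : M} (κ : V.canonical p) (u : V.LamK q p) :
    Euc (m + n) [⋀^Fin (m + q)]→L[ℝ] ℂ := V.contract κ u

lemma ctr_smul {q : ℕ} {p : M} (c : ℂ) (κ : V.canonical p) (u : V.LamK q p) :
    V.ctr (c • κ) u = c • V.ctr κ u := V.contract_smul c κ u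

lemma ctr_mem {q : ℕ} {p : M} (κ : V.canonical p) (u : V.LamK q p) :
    V.ctr κ u ∈ LamE (V.con p) m (m + q) := by
  rw [← V.Lam_eq]
  exact ((TensorProduct.rid ℂ (V.Lam p m (m + q)))
    (LinearMap.lTensor (V.Lam p m (m + q)) (LinearMap.applyₗ κ) u)).2

lemma eq_zero_of_contract {q : ℕ} {p : M} {u : V.LamK q p} (h : V.contract (V.can₀ p) u = 0) :
    u = 0 := by
  have key : ∀ u : V.LamK q p, u = ((TensorProduct.rid ℂ (V.Lam p m (m + q)))
      (LinearMap.lTensor (V.Lam p m (m + q)) (LinearMap.applyₗ (V.can₀ p)) u)) ⊗ₜ[ℂ] V.coef₀ p := by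
    intro u
    induction u using TensorProduct.induction_on with
    | zero => rw [map_zero, map_zero, TensorProduct.zero_tmul]
    | tmul w σ =>
      rw [LinearMap.lTensor_tmul, TensorProduct.rid_tmul, TensorProduct.smul_tmul]
      congr 1
      ext κ
      conv_lhs => rw [V.eq_coef₀_smul κ, map_smul]
      rw [LinearMap.smul_apply, smul_eq_mul, smul_eq_mul, mul_comm]
      rfl
    | add x y hx hy => rw [map_add, map_add, TensorProduct.add_tmul, ← hx, ← hy]
  rw [key u]
  have h1 : (TensorProduct.rid ℂ (V.Lam p m (m + q)))
      (LinearMap.lTensor (V.Lam p m (m + q)) (LinearMap.applyₗ (V.can₀ p)) u) = 0 := Subtype.ext h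
  rw [h1, TensorProduct.zero_tmul]

/-- The form `v` with `u = Θ ∧ v ⊗ Θ^*`, modulo `Λ_𝒱^{1,q-1}`, for the distinguished generator
`Θ` of the canonical line. -/
def divCan {q : ℕ} {p : M} (u : V.LamK q p) : Euc (m + n) [⋀^Fin q]→L[ℝ] ℂ :=
  frameDiv (V.basDual p) (V.canF (V.can₀ p)) (V.ctr (V.can₀ p) u)

lemma mulCan_divCan {q : ℕ} {p : M} (u : V.LamK q p) :
    V.mulCan (V.can₀ p) (V.divCan u) = V.ctr (V.can₀ p) u :=
  frameMul_frameDiv (V.bas_dual p)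
    (V.frameCoef_ne_zero (V.bas_dual p) (V.span_bas p) (V.can₀_ne_zero p))
    (by rw [span_bas]; exact V.ctr_mem _ u)

/-- Each element of `Λ_𝒱^{m,q} ⊗ K_𝒱^{-1}` is of the form `κ ∧ v ⊗ κ^*`. -/
lemma exists_ctr_eq {q : ℕ} {p : M} (u : V.LamK q p) :
    ∃ v : Euc (m + n) [⋀^Fin q]→L[ℝ] ℂ, ∀ κ : V.canonical p, V.ctr κ u = V.mulCan κ v := by
  refine ⟨V.divCan u, fun κ => ?_⟩
  rw [V.eq_coef₀_smul κ, ctr_smul, mulCan_smul, mulCan_divCan]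

/-- The isomorphism `κ ∧ v ⊗ κ^* ↦ (-1)^{qm} v mod Λ_𝒱^{1,q-1}` of the fibres, as a linear map. -/
def phiL (q : ℕ) (p : M) : V.LamK q p →ₗ[ℂ] V.Quot q p :=
  (-1 : ℂ) ^ (q * m) • ((V.Lam p 1 q).mkQ ∘ₗ
    (frameDiv (V.basDual p) (V.canF (V.can₀ p)) :
      (Euc (m + n) [⋀^Fin (m + q)]→L[ℝ] ℂ) →L[ℂ] (Euc (m + n) [⋀^Fin q]→L[ℝ] ℂ)).toLinearMap ∘ₗ
    V.contract (V.can₀ p))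

lemma neg_one_pow_mul_self (r : ℕ) : ((-1 : ℂ) ^ r) * (-1) ^ r = 1 := by
  rw [← mul_pow]; simp

lemma mkQ_eq_iff {q : ℕ} {p : M} (v w : Euc (m + n) [⋀^Fin q]→L[ℝ] ℂ) :
    (V.Lam p 1 q).mkQ v = (V.Lam p 1 q).mkQ w ↔ v - w ∈ LamE (V.con p) 1 q := by
  rw [← V.Lam_eq p 1 q]
  exact Submodule.Quotient.eq (V.Lam p 1 q)

lemma phiL_apply {q : ℕ} {p : M} (u : V.LamK q p) :
    V.phiL q p u = (-1 : ℂ) ^ (q * m) • (V.Lam p 1 q).mkQ (V.divCan u) := rfl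

lemma phiL_eq {q : ℕ} {p : M} {u : V.LamK q p} {κ : V.canonical p} (hκ : κ ≠ 0)
    {v : Euc (m + n) [⋀^Fin q]→L[ℝ] ℂ} (h : V.ctr κ u = V.mulCan κ v) :
    V.phiL q p u = (-1 : ℂ) ^ (q * m) • (V.Lam p 1 q).mkQ v := by
  have hc : V.coef₀ p κ ≠ 0 := fun h0 => hκ (by rw [V.eq_coef₀_smul κ, h0, zero_smul])
  have h2 : V.coef₀ p κ • V.ctr (V.can₀ p) u = V.coef₀ p κ • V.mulCan (V.can₀ p) v := by
    rw [← ctr_smul, ← mulCan_smul, ← V.eq_coef₀_smul κ]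
    exact h
  have h3 : V.mulCan (V.can₀ p) (V.divCan u - v) = 0 := by
    rw [map_sub, mulCan_divCan]
    rw [form_smul_cancel hc h2, sub_self]
  have h4 : (V.Lam p 1 q).mkQ (V.divCan u) = (V.Lam p 1 q).mkQ v :=
    (V.mkQ_eq_iff _ _).2 ((V.mulCan_eq_zero_iff (V.can₀_ne_zero p)).1 h3)
  exact (V.phiL_apply u).trans (congrArg _ h4)

lemma ctr_eq_iff {q : ℕ} {p : M} {u : V.LamK q p} {κ : V.canonical p} (hκ : κ ≠ 0)
    {v : Euc (m + n) [⋀^Fin q]→L[ℝ] ℂ} : V.ctr κ u = V.mulCan κ v ↔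
      V.phiL q p u = (-1 : ℂ) ^ (q * m) • (V.Lam p 1 q).mkQ v := by
  refine ⟨V.phiL_eq hκ, fun h => ?_⟩
  obtain ⟨w, hw⟩ := V.exists_ctr_eq u
  rw [V.phiL_eq hκ (hw κ)] at h
  have h1 := congrArg (fun x => (-1 : ℂ) ^ (q * m) • x) h
  simp only [smul_smul, neg_one_pow_mul_self, one_smul] at h1
  rw [mkQ_eq_iff, ← V.mulCan_eq_zero_iff hκ, map_sub, sub_eq_zero] at h1
  exact (hw κ).trans h1

lemma phiL_bijective (q : ℕ) (p : M) : Function.Bijective (V.phiL q p) := by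
  constructor
  · refine (injective_iff_map_eq_zero _).2 fun u hu => V.eq_zero_of_contract ?_
    have h1 := (V.ctr_eq_iff (u := u) (V.can₀_ne_zero p) (v := 0)).2 (by
      refine hu.trans ?_
      exact ((congrArg _ (map_zero (V.Lam p 1 q).mkQ)).trans (smul_zero _)).symm)
    exact h1.trans (map_zero _)
  · intro s
    obtain ⟨v, rfl⟩ := Submodule.mkQ_surjective _ s
    let κ := V.can₀ p
    let w : V.Lam p m (m + q) := ⟨V.mulCan κ v, by rw [V.Lam_eq]; exact V.mulCan_mem κ v⟩
    refine ⟨(-1 : ℂ) ^ (q * m) • (w ⊗ₜ[ℂ] V.coef₀ p), ?_⟩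
    have h1 : V.ctr κ (w ⊗ₜ[ℂ] V.coef₀ p) = V.mulCan κ v := by
      refine (V.contract_tmul _ _ _).trans ?_
      rw [coef₀_can₀]
      exact form_one_smul (E := Euc (m + n)) _
    rw [map_smul, V.phiL_eq (V.can₀_ne_zero p) h1, smul_smul, neg_one_pow_mul_self, one_smul]

/-- The isomorphism `κ ∧ v ⊗ κ^* ↦ (-1)^{qm} v mod Λ_𝒱^{1,q-1}` of the fibres. -/
def phi (q : ℕ) (p : M) : V.LamK q p ≃ₗ[ℂ] V.Quot q p :=
  LinearEquiv.ofBijective (V.phiL q p) (V.phiL_bijective q p)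

lemma ctr_iff {q : ℕ} {p : M} {u : V.LamK q p} {κ : V.canonical p} (hκ : κ ≠ 0)
    {v : Euc (m + n) [⋀^Fin q]→L[ℝ] ℂ} : V.ctr κ u = V.mulCan κ v ↔
      V.phi q p u = (-1 : ℂ) ^ (q * m) • (V.Lam p 1 q).mkQ v := V.ctr_eq_iff hκ

lemma ctr_iff' {q : ℕ} {p : M} {u : V.LamK q p} {κ : V.canonical p} (hκ : κ ≠ 0)
    {v : Euc (m + n) [⋀^Fin q]→L[ℝ] ℂ} :
    V.ctr κ u = (-1 : ℂ) ^ (q * m) • V.mulCan κ v ↔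
      V.phi q p u = (V.Lam p 1 q).mkQ v := by
  rw [← map_smul, V.ctr_iff hκ]
  refine Eq.congr_right ?_
  refine (congrArg _ (map_smul (V.Lam p 1 q).mkQ _ _)).trans ?_
  rw [smul_smul, neg_one_pow_mul_self, one_smul]

end Structure

end FibreIso

/-! ### Coordinate expressions of the multiplication operators -/

section FrameMulCalculus

variable {E : Type*} [NormedAddCommGroup E] [NormedSpace ℝ E]
  {X : Type*} [NormedAddCommGroup X] [NormedSpace ℝ X] {x : X}

lemma frameCoef_pull {k : ℕ} (A : E →L[ℝ] E) (z : Fin k → E × E) (κ : E [⋀^Fin k]→L[ℝ] ℂ) :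
    frameCoef z (pull A κ) = frameCoef (fun j => (A (z j).1, A (z j).2)) κ := by
  change frameC (q := 0) k z (pull A κ) ![] = frameC (q := 0) k _ κ ![]
  refine (congrArg (fun f : E [⋀^Fin 0]→L[ℝ] ℂ => f ![])
    (pull_frameC (q := 0) A z κ).symm).trans ?_
  rw [pull_apply]
  exact congrArg _ (Subsingleton.elim _ _)

lemma pull_frameMul {k q : ℕ} (A : E →L[ℝ] E) (θ : Fin k → E →L[ℝ] ℂ) (z : Fin k → E × E)
    (κ : E [⋀^Fin k]→L[ℝ] ℂ) (v : E [⋀^Fin q]→L[ℝ] ℂ) :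
    pull A (frameMul θ (fun j => (A (z j).1, A (z j).2)) κ v) =
      frameMul (fun j => (θ j).comp A) z (pull A κ) (pull A v) := by
  rw [frameMul_apply, pull_smul, pull_frameW, frameMul_apply, frameCoef_pull]

lemma pull_frameDiv {k q : ℕ} (A : E →L[ℝ] E) (z : Fin k → E × E)
    (κ : E [⋀^Fin k]→L[ℝ] ℂ) (u : E [⋀^Fin (k + q)]→L[ℝ] ℂ) :
    pull A (frameDiv (fun j => (A (z j).1, A (z j).2)) κ u) =
      frameDiv z (pull A κ) (pull A u) := by
  rw [frameDiv, smul_apply, pull_smul, pull_frameC, frameDiv, smul_apply, frameCoef_pull]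

lemma contDiffAt_frameCoef {k : ℕ} {z : Fin k → X → E × E} {κ : X → E [⋀^Fin k]→L[ℝ] ℂ}
    (hz : ∀ j, ContDiffAt ℝ ∞ (z j) x) (hκ : ContDiffAt ℝ ∞ κ x) :
    ContDiffAt ℝ ∞ (fun y => frameCoef (fun j => z j y) (κ y)) x := by
  have h1 : ContDiffAt ℝ ∞ (fun y => frameC (q := 0) k (fun j => z j y) (κ y)) x :=
    contDiffAt_apply_complex (contDiffAt_frameC hz) hκ
  exact (ContinuousAlternatingMap.apply ℝ E ℂ (![] : Fin 0 → E)).contDiff.contDiffAt.comp x h1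

lemma contDiffAt_frameMul {k q : ℕ} {θ : Fin k → X → E →L[ℝ] ℂ} {z : Fin k → X → E × E}
    {κ : X → E [⋀^Fin k]→L[ℝ] ℂ} (hθ : ∀ j, ContDiffAt ℝ ∞ (θ j) x)
    (hz : ∀ j, ContDiffAt ℝ ∞ (z j) x) (hκ : ContDiffAt ℝ ∞ κ x) :
    ContDiffAt ℝ ∞ (fun y => frameMul (q := q) (fun j => θ j y) (fun j => z j y) (κ y)) x :=
  contDiffAt_smul_complex (contDiffAt_frameCoef hz hκ) (contDiffAt_frameW hθ)

lemma contDiffAt_frameDiv {k q : ℕ} {z : Fin k → X → E × E}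
    {κ : X → E [⋀^Fin k]→L[ℝ] ℂ} (hz : ∀ j, ContDiffAt ℝ ∞ (z j) x) (hκ : ContDiffAt ℝ ∞ κ x)
    (h0 : frameCoef (fun j => z j x) (κ x) ≠ 0) :
    ContDiffAt ℝ ∞ (fun y => frameDiv (q := q) (fun j => z j y) (κ y)) x :=
  contDiffAt_smul_complex ((contDiffAt_frameCoef hz hκ).inv h0) (contDiffAt_frameC hz)

lemma frameMul_wedgeL {k q : ℕ} (θ : Fin k → E →L[ℝ] ℂ) (z : Fin k → E × E)
    (κ : E [⋀^Fin k]→L[ℝ] ℂ) (α : E →L[ℝ] ℂ) (u : E [⋀^Fin q]→L[ℝ] ℂ) :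
    frameMul θ z κ (wedgeL E q α u) = (-1 : ℂ) ^ k • wedgeL E (k + q) α (frameMul θ z κ u) := by
  rw [frameMul_apply, frameMul_apply, frameW_wedgeL, map_smul, form_smul_comm]

end FrameMulCalculus

section Operator

variable {m n : ℕ} {M : Type u} [TopologicalSpace M] [ChartedSpace (Euc (m + n)) M]
  [IsManifold 𝓘(ℝ, Euc (m + n)) ∞ M] (V : Structure m n M)

namespace Structure

/-- The coordinate expression of the operator `s ∧` for a section `s` of the canonical bundle. -/
def opC (q : ℕ) (a : M) (s : ∀ p : M, V.canonical p) (y : Euc (m + n)) :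
    (Euc (m + n) [⋀^Fin q]→L[ℝ] ℂ) →L[ℂ] (Euc (m + n) [⋀^Fin (m + q)]→L[ℝ] ℂ) :=
  frameMul (fun j => cotC a (fun p => V.bas p j) y) (fun j => vecC a (fun p => V.basDual p j) y)
    (inChart a (fun p => (s p : Form (m + n) m p)) y)

lemma dSymm_vecC {a : M} (z : M → Euc (m + n) × Euc (m + n)) {y : Euc (m + n)}
    (hy : y ∈ (ch a).target) :
    (dSymm a y (vecC a z y).1, dSymm a y (vecC a z y).2) = z ((ch a).symm y) := by
  unfold vecC
  rw [dSymm_dChart hy, dSymm_dChart hy]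

lemma pull_dSymm_frameMul {q : ℕ} {a : M} {y : Euc (m + n)} (hy : y ∈ (ch a).target)
    (θ : Fin m → M → Euc (m + n) →L[ℝ] ℂ) (z : Fin m → M → Euc (m + n) × Euc (m + n))
    (s : ∀ p : M, V.canonical p) (v : Euc (m + n) [⋀^Fin q]→L[ℝ] ℂ) :
    pull (dSymm a y) (frameMul (fun j => θ j ((ch a).symm y)) (fun j => z j ((ch a).symm y))
      (V.canF (s ((ch a).symm y))) v) =
    frameMul (fun j => cotC a (θ j) y) (fun j => vecC a (z j) y)
      (inChart a (fun p => (s p : Form (m + n) m p)) y) (pull (dSymm a y) v) := by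
  have h := pull_frameMul (dSymm a y) (fun j => θ j ((ch a).symm y)) (fun j => vecC a (z j) y)
    (V.canF (s ((ch a).symm y))) v
  simp only [dSymm_vecC _ hy] at h
  exact h

lemma inChart_mulCan {q : ℕ} {a : M} {y : Euc (m + n)} (hy : y ∈ (ch a).target)
    (s : ∀ p : M, V.canonical p) (v : M → Euc (m + n) [⋀^Fin q]→L[ℝ] ℂ) :
    inChart a (fun p => (V.mulCan (s p) (v p) : Form (m + n) (m + q) p)) y =
      V.opC q a s y (inChart a (fun p => (v p : Form (m + n) q p)) y) :=
  V.pull_dSymm_frameMul hy (fun j p => V.bas p j) (fun j p => V.basDual p j) s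
    (v ((ch a).symm y))

/-- The pullback by the inverse chart is invertible. -/
lemma pull_dSymm_pull_dChart {k : ℕ} {a : M} {y : Euc (m + n)} (hy : y ∈ (ch a).target)
    (b : Euc (m + n) [⋀^Fin k]→L[ℝ] ℂ) :
    pull (dSymm a y) (pull (dChart a ((ch a).symm y)) b) = b := by
  rw [pull_pull, dChart_comp_dSymm hy, pull_id]

lemma opC_apply {q : ℕ} {a : M} {y : Euc (m + n)} (hy : y ∈ (ch a).target)
    (s : ∀ p : M, V.canonical p) (b : Euc (m + n) [⋀^Fin q]→L[ℝ] ℂ) :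
    V.opC q a s y b = pull (dSymm a y)
      (V.mulCan (s ((ch a).symm y)) (pull (dChart a ((ch a).symm y)) b)) := by
  have h := V.pull_dSymm_frameMul hy (fun j p => V.bas p j) (fun j p => V.basDual p j) s
    (pull (dChart a ((ch a).symm y)) b)
  rw [pull_dSymm_pull_dChart hy] at h
  exact h.symm

variable {V} in
lemma Coframe.opC_eq {U : Opens M} (C : V.Coframe U) {q : ℕ} {a : M} {y : Euc (m + n)}
    (hy : y ∈ chartDom (m + n) a U) (s : ∀ p : M, V.canonical p) :
    V.opC q a s y = frameMul (fun j => cotC a (C.θ j) y) (fun j => vecC a (C.z j) y)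
      (inChart a (fun p => (s p : Form (m + n) m p)) y) := by
  ext1 b
  rw [V.opC_apply hy.1, V.mulCan_eq (C.dual _ hy.2) (C.span _ hy.2),
    V.pull_dSymm_frameMul hy.1, pull_dSymm_pull_dChart hy.1]

lemma contDiffAt_opC (q : ℕ) {U : Opens M} {s : ∀ p : M, V.canonical p}
    (hs : SmoothOn U (fun p => (s p : Form (m + n) m p))) {a : M} {y : Euc (m + n)}
    (hy : y ∈ chartDom (m + n) a U) : ContDiffAt ℝ ∞ (V.opC q a s) y := by
  obtain ⟨W, hW, ⟨C⟩⟩ := V.exists_coframe ((ch a).symm y)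
  have hyW : y ∈ chartDom (m + n) a W := ⟨hy.1, hW⟩
  refine (contDiffAt_frameMul (fun j => C.smooth_θ j a y hyW) (fun j => C.smooth_z j a y hyW)
    (hs a y hy)).congr_of_eventuallyEq ?_
  filter_upwards [(isOpen_chartDom a W).mem_nhds hyW] with y' hy'
  exact C.opC_eq hy' s

lemma opC_wedgeL {q : ℕ} (a : M) (s : ∀ p : M, V.canonical p) (y : Euc (m + n))
    (α : Euc (m + n) →L[ℝ] ℂ) (b : Euc (m + n) [⋀^Fin q]→L[ℝ] ℂ) :
    V.opC (q + 1) a s y (wedgeL _ q α b) = (-1 : ℂ) ^ m • wedgeL _ (m + q) α (V.opC q a s y b) :=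
  frameMul_wedgeL _ _ _ α b

end Structure

end Operator

/-! ### Basic functions and basic frames -/

section Basic

variable {m n : ℕ} {M : Type u} [TopologicalSpace M] [ChartedSpace (Euc (m + n)) M]
  [IsManifold 𝓘(ℝ, Euc (m + n)) ∞ M] (V : Structure m n M)

lemma dFun_eq_fderiv {d : ℕ} {M : Type u} [TopologicalSpace M] [ChartedSpace (Euc d) M]
    [IsManifold 𝓘(ℝ, Euc d) ∞ M] {U : Opens M} {c : M → ℂ}
    (hc : ContMDiffOn 𝓘(ℝ, Euc d) 𝓘(ℝ, ℂ) ∞ c U) {p : M} (hp : p ∈ U) :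
    (dFun c p : Euc d →L[ℝ] ℂ) = fderiv ℝ (c ∘ (ch p).symm) (ch p p) :=
  (cotC_self (fun p => dFun c p) p).symm.trans (cotC_dFun hc (ch_mem_chartDom hp))

lemma frameW_update_smul {E : Type*} [NormedAddCommGroup E] [NormedSpace ℝ E] {k q : ℕ}
    (θ : Fin k → E →L[ℝ] ℂ) (j : Fin k) (c : ℂ) (u : E [⋀^Fin q]→L[ℝ] ℂ) :
    frameW k (Function.update θ j (c • θ j)) u = c • frameW k θ u := by
  have h := (iterWAlt k u).map_update_smul θ j c (θ j)
  rw [Function.update_eq_self] at h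
  rw [frameW_apply, frameW_apply, ← map_smul]
  exact congrArg _ h

lemma eq_smul_frameW_zero {E : Type*} [NormedAddCommGroup E] [NormedSpace ℝ E] {k : ℕ}
    (hk : k = 0) (θ : Fin k → E →L[ℝ] ℂ) (κ : E [⋀^Fin k]→L[ℝ] ℂ) :
    κ = κ 0 • frameW (q := 0) k θ (oneForm E) := by
  subst hk
  refine (eq_smul_oneForm κ).trans ?_
  rw [Subsingleton.elim (![] : Fin 0 → E) 0]
  rfl

namespace Structure

variable {V}

namespace IsBasicFun

lemma differentiableAt {U : Opens M} {g : M → ℂ} (hg : V.IsBasicFun U g) {a : M}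
    {y : Euc (m + n)} (hy : y ∈ chartDom (m + n) a U) :
    DifferentiableAt ℝ (g ∘ (ch a).symm) y :=
  (smIn_fun_iff.1 hg.1 a y hy).differentiableAt (by simp)

lemma mono {U W : Opens M} {g : M → ℂ} (hg : V.IsBasicFun U g) (h : W ≤ U) : V.IsBasicFun W g :=
  ⟨hg.1.mono h, fun p hp => hg.2 p (h hp)⟩

lemma of_fderiv {U : Opens M} {g : M → ℂ} (hg : SmIn U (fun a => g ∘ (ch (d := m + n) a).symm))
    (h : ∀ p ∈ U, fderiv ℝ (g ∘ (ch p).symm) (ch p p) ∈ V.con p) : V.IsBasicFun U g := by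
  refine ⟨smIn_fun_iff.2 hg, fun p hp => ?_⟩
  have h1 := h p hp
  rw [← dFun_eq_fderiv (smIn_fun_iff.2 hg) hp] at h1
  exact h1

lemma fderiv_mem {U : Opens M} {g : M → ℂ} (hg : V.IsBasicFun U g) {p : M} (hp : p ∈ U) :
    fderiv ℝ (g ∘ (ch p).symm) (ch p p) ∈ V.con p := by
  rw [← dFun_eq_fderiv hg.1 hp]
  exact hg.2 p hp

lemma congr {U : Opens M} {g g' : M → ℂ} (hg : V.IsBasicFun U g) (h : ∀ p ∈ U, g' p = g p) :
    V.IsBasicFun U g' := by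
  have e : ∀ a, ∀ y ∈ chartDom (m + n) a U, (g' ∘ (ch a).symm) y = (g ∘ (ch a).symm) y :=
    fun a y hy => h _ hy.2
  refine of_fderiv ((smIn_fun_iff.1 hg.1).congr e) fun p hp => ?_
  rw [(Filter.eventuallyEq_of_mem ((isOpen_chartDom p U).mem_nhds (ch_mem_chartDom hp))
    (e p)).fderiv_eq]
  exact hg.fderiv_mem hp

variable (V) in
lemma const (U : Opens M) (c : ℂ) : V.IsBasicFun U (fun _ => c) := by
  refine of_fderiv (fun a y _ => contDiffAt_const) fun p _ => ?_
  have : fderiv ℝ ((fun _ : M => c) ∘ (ch (d := m + n) p).symm) (ch p p) = 0 :=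
    fderiv_const_apply c
  rw [this]
  exact zero_mem _

lemma inv {U : Opens M} {g : M → ℂ} (hg : V.IsBasicFun U g) (h0 : ∀ p ∈ U, g p ≠ 0) :
    V.IsBasicFun U (fun p => (g p)⁻¹) := by
  refine of_fderiv (fun a y hy => (smIn_fun_iff.1 hg.1 a y hy).inv (h0 _ hy.2)) fun p hp => ?_
  have h1 := (hg.differentiableAt (ch_mem_chartDom hp)).hasFDerivAt
  have h2 : (g ∘ (ch p).symm) (ch p p) ≠ 0 := h0 _ (ch_mem_chartDom (d := m + n) hp).2
  have h3 := (hasDerivAt_inv h2).comp_hasFDerivAt (ch p p) h1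
  have h4 : fderiv ℝ ((fun p => (g p)⁻¹) ∘ (ch p).symm) (ch p p) = _ := h3.fderiv
  rw [h4]
  exact Submodule.smul_mem _ _ (hg.fderiv_mem hp)

end IsBasicFun

/-- A coframe whose `j`-th element is multiplied by a nowhere vanishing function. -/
def Coframe.scale {W : Opens M} (C : V.Coframe W) (j : Fin m) (h : M → ℂ)
    (hs : SmIn W (fun a => h ∘ (ch (d := m + n) a).symm)) (h0 : ∀ p ∈ W, h p ≠ 0) :
    V.Coframe W where
  θ := Function.update C.θ j (fun p => h p • C.θ j p)
  z := Function.update C.z j (fun p => csm (h p)⁻¹ (C.z j p))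
  smooth_θ i := by
    by_cases hij : i = j
    · subst hij
      rw [Function.update_self]
      exact fun a y hy => contDiffAt_smul_complex (hs a y hy) (C.smooth_θ i a y hy)
    · rw [Function.update_of_ne hij]; exact C.smooth_θ i
  smooth_z i := by
    by_cases hij : i = j
    · subst hij
      rw [Function.update_self]
      refine SmIn.congr (G := fun a y => csm (h ((ch a).symm y))⁻¹ (vecC a (C.z i) y))
        (fun a y hy => ?_) fun a y hy => ?_
      · have h1 := (hs a y hy).inv (h0 _ hy.2)
        have hre : ContDiffAt ℝ ∞ (fun y => ((h ((ch a).symm y))⁻¹).re) y :=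
          Complex.reCLM.contDiff.contDiffAt.comp y h1
        have him : ContDiffAt ℝ ∞ (fun y => ((h ((ch a).symm y))⁻¹).im) y :=
          Complex.imCLM.contDiff.contDiffAt.comp y h1
        have hz := C.smooth_z i a y hy
        exact ((hre.smul hz.fst).sub (him.smul hz.snd)).prodMk
          ((hre.smul hz.snd).add (him.smul hz.fst))
      · simp only [vecC, csm, map_sub, map_add, map_smul]
    · rw [Function.update_of_ne hij]; exact C.smooth_z i
  dual p hp i l := by
    have hd := C.dual p hp
    by_cases hij : i = j <;> by_cases hlj : l = j
    · subst hij; subst hlj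
      rw [Function.update_self, Function.update_self, smul_evC, evC_csm, hd, if_pos rfl, mul_one,
        mul_inv_cancel₀ (h0 p hp)]
    · subst hij
      rw [Function.update_self, Function.update_of_ne hlj, smul_evC, hd, if_neg (Ne.symm hlj),
        mul_zero]
    · subst hlj
      rw [Function.update_self, Function.update_of_ne hij, evC_csm, hd, if_neg hij, mul_zero]
    · rw [Function.update_of_ne hij, Function.update_of_ne hlj, hd]
  span p hp := by
    rw [← C.span p hp]
    apply le_antisymm
    · rw [Submodule.span_le]
      rintro _ ⟨i, rfl⟩
      by_cases hij : i = j
      · subst hij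
        simp only [Function.update_self]
        exact Submodule.smul_mem _ _ (Submodule.subset_span ⟨i, rfl⟩)
      · simp only [Function.update_of_ne hij]
        exact Submodule.subset_span ⟨i, rfl⟩
    · rw [Submodule.span_le]
      rintro _ ⟨i, rfl⟩
      by_cases hij : i = j
      · subst hij
        have h1 : C.θ i p = (h p)⁻¹ • (Function.update C.θ i (fun p => h p • C.θ i p) i p) := by
          rw [Function.update_self, smul_smul, inv_mul_cancel₀ (h0 p hp), one_smul]
        simp only [SetLike.mem_coe]
        rw [h1]
        exact Submodule.smul_mem _ _ (Submodule.subset_span ⟨i, rfl⟩)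
      · refine Submodule.subset_span ⟨i, ?_⟩
        simp only [Function.update_of_ne hij]

lemma Coframe.scale_θ {W : Opens M} (C : V.Coframe W) (j : Fin m) (h : M → ℂ)
    (hs : SmIn W (fun a => h ∘ (ch (d := m + n) a).symm)) (h0 : ∀ p ∈ W, h p ≠ 0) (p : M) :
    (fun i => (C.scale j h hs h0).θ i p) =
      Function.update (fun i => C.θ i p) j (h p • C.θ j p) := by
  funext i
  by_cases hij : i = j
  · subst hij
    simp only [Coframe.scale, Function.update_self]
  · simp only [Coframe.scale, Function.update_of_ne hij]

/-- The component of a section of the canonical bundle with respect to a coframe. -/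
def Coframe.coef {W : Opens M} (C : V.Coframe W) (s : ∀ p : M, V.canonical p) (p : M) : ℂ :=
  frameCoef (fun j => C.z j p) (V.canF (s p))

lemma Coframe.coef_chart {W : Opens M} (C : V.Coframe W) (s : ∀ p : M, V.canonical p) {a : M}
    {y : Euc (m + n)} (hy : y ∈ (ch a).target) : C.coef s ((ch a).symm y) =
      frameCoef (fun j => vecC a (C.z j) y) (inChart a (fun p => (s p : Form (m + n) m p)) y) := by
  have h := frameCoef_pull (dSymm a y) (fun j => vecC a (C.z j) y) (V.canF (s ((ch a).symm y)))
  simp only [dSymm_vecC _ hy] at h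
  exact h.symm

lemma Coframe.smooth_coef {W : Opens M} (C : V.Coframe W) {s : ∀ p : M, V.canonical p}
    (hs : SmoothOn W (fun p => (s p : Form (m + n) m p))) :
    SmIn W (fun a => C.coef s ∘ (ch (d := m + n) a).symm) :=
  SmIn.congr (fun a y hy => contDiffAt_frameCoef (fun j => C.smooth_z j a y hy) (hs a y hy))
    fun _ _ hy => C.coef_chart s hy.1

lemma Coframe.coef_ne_zero {W : Opens M} (C : V.Coframe W) {s : ∀ p : M, V.canonical p} {p : M}
    (hp : p ∈ W) (hs : s p ≠ 0) : C.coef s p ≠ 0 :=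
  V.frameCoef_ne_zero (C.dual p hp) (C.span p hp) hs

lemma Coframe.canF_eq {W : Opens M} (C : V.Coframe W) (s : ∀ p : M, V.canonical p) {p : M}
    (hp : p ∈ W) : V.canF (s p) =
      C.coef s p • frameW (q := 0) m (fun j => C.θ j p) (oneForm (Euc (m + n))) :=
  eq_frameCoef_smul (C.dual p hp) (by rw [C.span p hp]; exact V.canF_mem _)

/-- A canonical bundle with basic structure has, near each point, a coframe whose product is a
basic section. -/
lemma BasicCanonical.exists_coframe {ι : Type v} (K : V.BasicCanonical ι) (p₀ : M) :
    ∃ (i : ι) (W : Opens M), p₀ ∈ W ∧ W ≤ K.U i ∧ ∃ C : V.Coframe W,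
      ∀ i', ∃ g : M → ℂ, V.IsBasicFun (W ⊓ K.U i') g ∧ ∀ p ∈ W ⊓ K.U i',
        frameW (q := 0) m (fun j => C.θ j p) (oneForm (Euc (m + n))) =
          g p • V.canF (K.Θ i' p) := by
  obtain ⟨U, hU, ⟨C⟩⟩ := V.exists_coframe p₀
  obtain ⟨i, hi⟩ := K.cover p₀
  refine ⟨i, U ⊓ K.U i, ⟨hU, hi⟩, inf_le_right, ?_⟩
  let C' := C.restrict (inf_le_left : U ⊓ K.U i ≤ U)
  rcases Nat.eq_zero_or_pos m with hm | hm
  · refine ⟨C', fun i' => ⟨fun p => (V.canF (K.Θ i' p) 0)⁻¹, ?_, fun p hp => ?_⟩⟩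
    · refine ((K.unit_basic hm i').inv fun p hp h0 => K.ne_zero i' p hp ?_).mono inf_le_right
      have h1 := eq_smul_frameW_zero hm (V.bas p) (V.canF (K.Θ i' p))
      have h2 : V.canF (K.Θ i' p) 0 = 0 := h0
      rw [h2, form_zero_smul] at h1
      exact Subtype.ext h1
    · have h1 := eq_smul_frameW_zero hm (fun j => C'.θ j p) (V.canF (K.Θ i' p))
      have h2 : V.canF (K.Θ i' p) 0 ≠ 0 := fun h2 => by
        rw [h2, form_zero_smul] at h1
        exact K.ne_zero i' p hp.2 (Subtype.ext h1)
      conv_rhs => rw [h1]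
      rw [← form_mul_smul, inv_mul_cancel₀ h2, form_one_smul]
  · have hs := C'.smooth_coef (s := K.Θ i) ((smoothReg (m + n) M).mono inf_le_right (K.smooth i))
    have h0 : ∀ p ∈ U ⊓ K.U i, C'.coef (K.Θ i) p ≠ 0 := fun p hp =>
      C'.coef_ne_zero hp (K.ne_zero i p hp.2)
    refine ⟨C'.scale ⟨0, hm⟩ _ hs h0, fun i' => ?_⟩
    obtain ⟨g, hg, hgt⟩ := K.transition i' i
    refine ⟨g, hg.mono (le_inf inf_le_right (inf_le_left.trans inf_le_right)), fun p hp => ?_⟩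
    rw [C'.scale_θ, frameW_update_smul, ← C'.canF_eq _ hp.1, hgt p ⟨hp.2, hp.1.2⟩]
    rfl

end Structure

lemma dForm_congr {d k : ℕ} {M : Type u} [TopologicalSpace M] [ChartedSpace (Euc d) M]
    {U : Opens M} {w w' : ∀ p : M, Form d k p} (h : ∀ p ∈ U, w p = w' p) {p : M} (hp : p ∈ U) :
    dForm w p = dForm w' p := by
  have h1 : inChart p w =ᶠ[𝓝 (ch p p)] inChart p w' := by
    filter_upwards [(isOpen_chartDom p U).mem_nhds (ch_mem_chartDom hp)] with y hy
    unfold inChart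
    rw [h _ hy.2]
  unfold dForm
  rw [h1.extDeriv_eq]

namespace Structure

variable {V}

open Classical in
/-- The elements of a coframe over `W` as sections of the conormal bundle, zero outside `W`. -/
def Coframe.ext {W : Opens M} (C : V.Coframe W) (j : Fin m) (p : M) : V.conormal p :=
  if hp : p ∈ W then ⟨C.θ j p, C.mem hp j⟩ else 0

lemma Coframe.coe_ext {W : Opens M} (C : V.Coframe W) (j : Fin m) {p : M} (hp : p ∈ W) :
    ((C.ext j p).1 : Euc (m + n) →L[ℝ] ℂ) = C.θ j p := by
  unfold Coframe.ext
  exact congrArg Subtype.val (dif_pos hp)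

lemma Coframe.canF_wedgeCan_ext {W : Opens M} (C : V.Coframe W) {p : M} (hp : p ∈ W) :
    V.canF (V.wedgeCan fun j => C.ext j p) =
      frameW (q := 0) m (fun j => C.θ j p) (oneForm (Euc (m + n))) := by
  refine (wedgeAll_eq _).trans ?_
  exact congrArg (fun θ : Fin m → Euc (m + n) →L[ℝ] ℂ =>
    frameW (q := 0) m θ (oneForm (Euc (m + n)))) (funext fun j => C.coe_ext j hp)

/-- The basic frame given by a coframe whose product is a basic section. -/
def Coframe.basicFrame {ι : Type v} {K : V.BasicCanonical ι} {W : Opens M} (C : V.Coframe W)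
    (h : ∀ i, ∃ g : M → ℂ, V.IsBasicFun (W ⊓ K.U i) g ∧ ∀ p ∈ W ⊓ K.U i,
        frameW (q := 0) m (fun j => C.θ j p) (oneForm (Euc (m + n))) = g p • V.canF (K.Θ i p)) :
    K.BasicFrame W where
  θ := C.ext
  smooth j := smoothCotOn_iff.2 ((C.smooth_θ j).congr fun a y hy =>
    congrArg (fun θ : Euc (m + n) →L[ℝ] ℂ => θ.comp (dSymm a y)) (C.coe_ext j hy.2))
  linInd p hp := by
    rw [show (fun j => ((C.ext j p).1 : Cot (m + n) p)) = fun j => C.θ j p from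
      funext fun j => C.coe_ext j hp]
    exact linearIndependent_of_dual (C.dual p hp)
  span p hp := by
    rw [show (fun j => ((C.ext j p).1 : Cot (m + n) p)) = fun j => C.θ j p from
      funext fun j => C.coe_ext j hp]
    exact C.span p hp
  basic i := by
    obtain ⟨g, hg, hgt⟩ := h i
    exact ⟨g, hg, fun p hp => Subtype.ext ((C.canF_wedgeCan_ext hp.1).trans (hgt p hp))⟩
  σ p := (V.coef₀ p (V.wedgeCan fun j => C.ext j p))⁻¹ • V.coef₀ p
  σ_apply p hp := by
    rw [LinearMap.smul_apply, smul_eq_mul]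
    refine inv_mul_cancel₀ fun h0 => ?_
    have h2 : V.wedgeCan (fun j => C.ext j p) = 0 := by
      rw [V.eq_coef₀_smul (V.wedgeCan fun j => C.ext j p), h0, zero_smul]
    have h3 := frameCoef_frameW (C.dual p hp)
    rw [← C.canF_wedgeCan_ext hp, h2] at h3
    have h4 : frameCoef (fun j => C.z j p) (V.canF (0 : V.canonical p)) = 0 :=
      map_zero (frameCoef fun j => C.z j p)
    exact zero_ne_one (h4.symm.trans h3)

/-- Near each point there are basic frames, and `Ξ_𝒱` is represented there by a one-form. -/
lemma BasicCanonical.exists_basicFrame {ι : Type v} (K : V.BasicCanonical ι) (p₀ : M) :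
    ∃ (i : ι) (W : Opens M), p₀ ∈ W ∧ W ≤ K.U i ∧ Nonempty (V.Coframe W) ∧
      Nonempty (K.BasicFrame W) ∧ ∃ ξ : ∀ p : M, Cot (m + n) p, K.IsXi W ξ := by
  obtain ⟨i, W, hp, hW, C, hC⟩ := K.exists_coframe p₀
  obtain ⟨η, hη, hd⟩ := C.exists_eta
  refine ⟨i, W, hp, hW, ⟨C⟩, ⟨C.basicFrame hC⟩, fun p => ∑ l, η l l p,
    C.basicFrame hC, η, fun j l => smoothCotOn_iff.2 (hη j l), fun j p hp => ?_, fun p _ => rfl⟩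
  have e : ∀ j, ∀ p ∈ W, (toForm ((C.ext j p).1 : Cot (m + n) p) : Form (m + n) 1 p) =
      toForm (d := m + n) (p := p) (C.θ j p) := fun j p hp =>
    congrArg (fun θ : Euc (m + n) →L[ℝ] ℂ => toForm (d := m + n) (p := p) θ) (C.coe_ext j hp)
  refine (dForm_congr (e j) hp).trans ((hd j p hp).trans ?_)
  exact Finset.sum_congr rfl fun l _ => congrArg (wedgeOne (d := m + n) (p := p) (η j l p))
    (e l p hp).symm

end Structure

end Basic

/-! ### The structure equation for the canonical bundle, and division -/

section StructureEquation

variable {m n : ℕ} {M : Type u} [TopologicalSpace M] [ChartedSpace (Euc (m + n)) M]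
  [IsManifold 𝓘(ℝ, Euc (m + n)) ∞ M] {V : Structure m n M}

lemma sum_cot_comp {E ι : Type*} [NormedAddCommGroup E] [NormedSpace ℝ E] [Fintype ι]
    (θ : ι → E →L[ℝ] ℂ) (A : E →L[ℝ] E) : (∑ i, θ i).comp A = ∑ i, (θ i).comp A := by
  ext v
  simp only [ContinuousLinearMap.comp_apply, sum_apply]

namespace Structure

lemma opC_of_eq_smul_wedgeCan {q : ℕ} {a : M} {y : Euc (m + n)} (hy : y ∈ (ch a).target)
    {s : ∀ p : M, V.canonical p} {c : ℂ} (θ : Fin m → ∀ p : M, V.conormal p)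
    (h : s ((ch a).symm y) = c • V.wedgeCan fun j => θ j ((ch a).symm y)) :
    V.opC q a s y = c • frameW m (fun j => cotC a (fun p => (θ j p).1) y) := by
  ext1 b
  have h1 : V.mulCan (s ((ch a).symm y)) (pull (dChart a ((ch a).symm y)) b) =
      c • frameW m (fun j => ((θ j ((ch a).symm y)).1 : Euc (m + n) →L[ℝ] ℂ))
        (pull (dChart a ((ch a).symm y)) b) := by
    rw [h, mulCan_smul, mulCan_wedgeCan]
  refine (V.opC_apply hy s b).trans ((congrArg _ h1).trans ?_)
  rw [pull_smul]
  refine congrArg (c • ·) ((pull_frameW _ _ _).trans ?_)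
  rw [pull_dSymm_pull_dChart hy]
  rfl

/-- The exterior derivative of `Θ_i ∧ w`: since the transition functions are basic, only the
one-form `ξ` representing `Ξ_𝒱` enters. -/
lemma BasicCanonical.extDeriv_opC {ι : Type v} {K : V.BasicCanonical ι} {W : Opens M}
    {ξ : ∀ p : M, Cot (m + n) p} (hξ : K.IsXi W ξ) (i : ι) {q : ℕ} {a : M} {y : Euc (m + n)}
    (hy : y ∈ chartDom (m + n) a (W ⊓ K.U i)) {w : Euc (m + n) → Euc (m + n) [⋀^Fin q]→L[ℝ] ℂ}
    (hw : DifferentiableAt ℝ w y) :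
    extDeriv (fun y => V.opC q a (K.Θ i) y (w y)) y =
      wedgeL _ (m + q) (cotC a ξ y) (V.opC q a (K.Θ i) y (w y)) +
        (-1 : ℂ) ^ m • V.opC (q + 1) a (K.Θ i) y (extDeriv w y) := by
  obtain ⟨B, η, -, hd, hξ⟩ := hξ
  obtain ⟨g, hg, hgt'⟩ := B.basic i
  have hgt : ∀ p ∈ W ⊓ K.U i, V.wedgeCan (fun j => B.θ j p) = g p • K.Θ i p := hgt'
  have hyW : y ∈ chartDom (m + n) a W := chartDom_mono a inf_le_left hy
  have hg0 : ∀ p ∈ W ⊓ K.U i, g p ≠ 0 := fun p hp h0 => by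
    have h1 := B.σ_apply p hp.1
    rw [hgt p hp, h0, zero_smul, map_zero] at h1
    exact zero_ne_one h1
  have hΘ : ∀ p ∈ W ⊓ K.U i, K.Θ i p = (g p)⁻¹ • V.wedgeCan fun j => B.θ j p := fun p hp => by
    rw [hgt p hp, smul_smul, inv_mul_cancel₀ (hg0 p hp), one_smul]
  have hc := hg.inv hg0
  let c : M → ℂ := fun p => (g p)⁻¹
  let θ : Fin m → M → Euc (m + n) →L[ℝ] ℂ := fun j p => (B.θ j p).1
  have hop : ∀ (q : ℕ), ∀ y ∈ chartDom (m + n) a (W ⊓ K.U i), V.opC q a (K.Θ i) y =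
      (c ∘ (ch a).symm) y • frameW m (fun j => cotC a (θ j) y) := fun q y hy =>
    opC_of_eq_smul_wedgeCan hy.1 B.θ (hΘ _ hy.2)
  have h1 : extDeriv (fun y => V.opC q a (K.Θ i) y (w y)) y =
      extDeriv (fun y => (c ∘ (ch a).symm) y • frameW m (fun j => cotC a (θ j) y) (w y)) y := by
    refine Filter.EventuallyEq.extDeriv_eq ?_
    filter_upwards [(isOpen_chartDom a _).mem_nhds hy] with y' hy'
    rw [hop q y' hy']
    rfl
  have hsp : Submodule.span ℂ (Set.range fun j => θ j ((ch a).symm y)) =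
      V.con ((ch a).symm y) := B.span _ hyW.2
  have h2 := extDeriv_smul_frameW (η := fun j l => cotC a (η j l) y) hw
    (hc.differentiableAt hy) ?_ (fun j => (smoothCotOn_iff.1 (B.smooth j) a y hyW).differentiableAt
      (by simp)) ?_
  · rw [h1]
    refine h2.trans ?_
    rw [hop q y hy, hop (q + 1) y hy]
    congr 2
    refine congrArg _ ?_
    have h3 : cotC a ξ y = (∑ l, (η l l ((ch a).symm y) : Euc (m + n) →L[ℝ] ℂ)).comp
        (dSymm a y) := congrArg (fun θ : Euc (m + n) →L[ℝ] ℂ => θ.comp (dSymm a y)) (hξ _ hyW.2)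
    exact (h3.trans (sum_cot_comp (fun l => (η l l ((ch a).symm y) : Euc (m + n) →L[ℝ] ℂ))
      (dSymm a y))).symm
  · obtain ⟨dc, hdc⟩ : ∃ dc : Euc (m + n) →L[ℝ] ℂ, dc = dFun c ((ch a).symm y) := ⟨_, rfl⟩
    have h3 : fderiv ℝ (c ∘ (ch a).symm) y = dc.comp (dSymm a y) := by
      rw [hdc]; exact (cotC_dFun hc.1 hy).symm
    have h4 : dc ∈ Submodule.span ℂ (Set.range fun j => θ j ((ch a).symm y)) := by
      rw [hsp, hdc]; exact hc.2 _ hy.2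
    obtain ⟨b, hb⟩ := (Submodule.mem_span_range_iff_exists_fun ℂ).1 h4
    refine (Submodule.mem_span_range_iff_exists_fun ℂ).2 ⟨b, ?_⟩
    refine Eq.trans ?_ h3.symm
    rw [← hb]
    exact (sum_cot_comp (fun i => b i • θ i ((ch a).symm y)) (dSymm a y)).symm
  · intro j
    have h3 := inChart_dForm (B.smooth j) hyW
    refine h3.symm.trans ?_
    have h4 : (dForm (fun p' => toForm (B.θ j p' : Cot (m + n) p')) ((ch a).symm y) :
        Euc (m + n) [⋀^Fin 2]→L[ℝ] ℂ) = ∑ l, wedgeL (Euc (m + n)) 1 (η j l ((ch a).symm y))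
          (ofCov (θ l ((ch a).symm y))) := hd j _ hyW.2
    refine (congrArg (pull (dSymm a y)) h4).trans ?_
    rw [pull_sum]
    refine Finset.sum_congr rfl fun l _ => ?_
    exact pull_wedgeL (dSymm a y) (η j l ((ch a).symm y) : Euc (m + n) →L[ℝ] ℂ)
      (ofCov (θ l ((ch a).symm y)))

/-- Division by a section of the canonical bundle, on the fibre at `p`. -/
def Coframe.div {W : Opens M} (C : V.Coframe W) (s : ∀ p : M, V.canonical p) {q : ℕ} (p : M) :
    (Euc (m + n) [⋀^Fin (m + q)]→L[ℝ] ℂ) →L[ℂ] (Euc (m + n) [⋀^Fin q]→L[ℝ] ℂ) :=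
  frameDiv (fun j => C.z j p) (V.canF (s p))

/-- The coordinate expression of the division by a section of the canonical bundle. -/
def Coframe.divC {W : Opens M} (C : V.Coframe W) (q : ℕ) (a : M) (s : ∀ p : M, V.canonical p)
    (y : Euc (m + n)) :
    (Euc (m + n) [⋀^Fin (m + q)]→L[ℝ] ℂ) →L[ℂ] (Euc (m + n) [⋀^Fin q]→L[ℝ] ℂ) :=
  frameDiv (fun j => vecC a (C.z j) y) (inChart a (fun p => (s p : Form (m + n) m p)) y)

lemma Coframe.pull_div {W : Opens M} (C : V.Coframe W) (s : ∀ p : M, V.canonical p) {q : ℕ} {a : M}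
    {y : Euc (m + n)} (hy : y ∈ (ch a).target) (u : Euc (m + n) [⋀^Fin (m + q)]→L[ℝ] ℂ) :
    pull (dSymm a y) (C.div s ((ch a).symm y) u) = C.divC q a s y (pull (dSymm a y) u) := by
  have h := pull_frameDiv (dSymm a y) (fun j => vecC a (C.z j) y) (V.canF (s ((ch a).symm y))) u
  simp only [dSymm_vecC _ hy] at h
  exact h

lemma Coframe.contDiffAt_divC {W : Opens M} (C : V.Coframe W) (q : ℕ)
    {s : ∀ p : M, V.canonical p} (hs : SmoothOn W (fun p => (s p : Form (m + n) m p)))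
    (h0 : ∀ p ∈ W, s p ≠ 0) {a : M} {y : Euc (m + n)} (hy : y ∈ chartDom (m + n) a W) :
    ContDiffAt ℝ ∞ (C.divC q a s) y := by
  refine contDiffAt_frameDiv (fun j => C.smooth_z j a y hy) (hs a y hy) ?_
  have h := C.coef_ne_zero hy.2 (h0 _ hy.2)
  rw [C.coef_chart s hy.1] at h
  exact h

lemma Coframe.mulCan_div {W : Opens M} (C : V.Coframe W) {s : ∀ p : M, V.canonical p} {q : ℕ}
    {p : M} (hp : p ∈ W) (h0 : s p ≠ 0) {u : Euc (m + n) [⋀^Fin (m + q)]→L[ℝ] ℂ}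
    (hu : u ∈ LamE (V.con p) m (m + q)) : V.mulCan (s p) (C.div s p u) = u := by
  rw [V.mulCan_eq (C.dual p hp) (C.span p hp)]
  exact frameMul_frameDiv (C.dual p hp) (C.coef_ne_zero hp h0) (by rw [C.span p hp]; exact hu)

lemma Coframe.div_mulCan {W : Opens M} (C : V.Coframe W) {s : ∀ p : M, V.canonical p} {q : ℕ}
    {p : M} (hp : p ∈ W) (h0 : s p ≠ 0) (v : Euc (m + n) [⋀^Fin q]→L[ℝ] ℂ) :
    C.div s p (V.mulCan (s p) v) - v ∈ LamE (V.con p) 1 q := by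
  rw [← V.mulCan_eq_zero_iff h0, map_sub, C.mulCan_div hp h0 (V.mulCan_mem _ _), sub_self]

lemma Coframe.divC_opC {W : Opens M} (C : V.Coframe W) {s : ∀ p : M, V.canonical p} {q : ℕ}
    {a : M} {y : Euc (m + n)} (hy : y ∈ chartDom (m + n) a W) (h0 : ∀ p ∈ W, s p ≠ 0)
    (b : Euc (m + n) [⋀^Fin q]→L[ℝ] ℂ) : ∃ e ∈ LamE (V.con ((ch a).symm y)) 1 q,
      C.divC q a s y (V.opC q a s y b) = b + pull (dSymm a y) e := by
  refine ⟨_, C.div_mulCan hy.2 (h0 _ hy.2) (pull (dChart a ((ch a).symm y)) b), ?_⟩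
  rw [pull_sub, pull_dSymm_pull_dChart hy.1, C.pull_div s hy.1, V.opC_apply hy.1, add_sub_cancel]

end Structure

end StructureEquation

/-! ### Stability of the regularity classes under smooth operators -/

section Stable

variable {d : ℕ} {M : Type u} [TopologicalSpace M] [ChartedSpace (Euc d) M]

/-- A class of forms is stable if it is preserved by linear operators between bundles of forms
whose coordinate expressions `B a` are smooth. -/
def Regularity.Stable (R : Regularity d M) : Prop :=
  ∀ {k l : ℕ} {U : Opens M}
    {B : M → Euc d → (Euc d [⋀^Fin k]→L[ℝ] ℂ) →L[ℂ] (Euc d [⋀^Fin l]→L[ℝ] ℂ)}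
    {w : ∀ p : M, Form d k p} {w' : ∀ p : M, Form d l p},
    SmIn U B → w ∈ R.P k U → (∀ a, ∀ y ∈ chartDom d a U, inChart a w' y = B a y (inChart a w y)) →
      w' ∈ R.P l U

lemma smoothReg_stable : (smoothReg d M).Stable := by
  intro k l U B w w' hB hw h a y hy
  refine (contDiffAt_apply_complex (hB a y hy) (hw a y hy)).congr_of_eventuallyEq ?_
  exact Filter.eventuallyEq_of_mem ((isOpen_chartDom a U).mem_nhds hy) (h a)

lemma exists_memLp_apply {X F G : Type*} [TopologicalSpace X] [MeasurableSpace X]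
    [OpensMeasurableSpace X] [SecondCountableTopology X] [NormedAddCommGroup F] [NormedSpace ℂ F]
    [NormedAddCommGroup G] [NormedSpace ℂ G] {μ : Measure X} {w : X → F} {w' : X → G}
    {B : X → F →L[ℂ] G} {N U : Set X} {y : X} (hU : IsOpen U) (hy : y ∈ U) (hN : N ∈ 𝓝 y)
    (hw : MemLp w 2 (μ.restrict N)) (hB : ContinuousOn B U) (h : ∀ y ∈ U, w' y = B y (w y)) :
    ∃ N' ∈ 𝓝 y, MemLp w' 2 (μ.restrict N') := by
  have h1 : ∀ᶠ y' in 𝓝 y, ‖B y'‖ < ‖B y‖ + 1 :=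
    (hB.continuousAt (hU.mem_nhds hy)).norm.eventually_lt_const (lt_add_one _)
  obtain ⟨O, hO1, hO, hyO⟩ := mem_nhds_iff.1 h1
  have hO' := hO.inter hU
  have hle : μ.restrict (N ∩ (O ∩ U)) ≤ μ.restrict (O ∩ U) :=
    Measure.restrict_mono Set.inter_subset_right le_rfl
  have hw' : MemLp w 2 (μ.restrict (N ∩ (O ∩ U))) :=
    hw.mono_measure (Measure.restrict_mono Set.inter_subset_left le_rfl)
  have hB' : AEStronglyMeasurable B (μ.restrict (N ∩ (O ∩ U))) :=
    ((hB.mono Set.inter_subset_right).aestronglyMeasurable hO'.measurableSet).mono_measure hle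
  have hae : ∀ᵐ y ∂(μ.restrict (N ∩ (O ∩ U))), y ∈ O ∩ U :=
    (ae_restrict_mem hO'.measurableSet).filter_mono (ae_mono hle)
  refine ⟨N ∩ (O ∩ U), Filter.inter_mem hN (hO'.mem_nhds ⟨hyO, hy⟩), ?_⟩
  have h2 : MemLp (fun y => B y (w y)) 2 (μ.restrict (N ∩ (O ∩ U))) := by
    refine hw'.of_le_mul (c := ‖B y‖ + 1) ?_ ?_
    · exact (ContinuousLinearMap.id ℂ (F →L[ℂ] G)).aestronglyMeasurable_comp₂ hB' hw'.1
    · filter_upwards [hae] with y' hy'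
      exact ((B y').le_opNorm _).trans
        (mul_le_mul_of_nonneg_right (hO1 hy'.1).le (norm_nonneg _))
  refine h2.ae_eq ?_
  filter_upwards [hae] with y' hy' using (h y' hy'.2).symm

lemma l2Reg_stable : (l2Reg d M).Stable := by
  intro k l U B w w' hB hw h a y hy
  obtain ⟨N, hN, hwN⟩ := hw a y hy
  exact exists_memLp_apply (F := Euc d [⋀^Fin k]→L[ℝ] ℂ) (G := Euc d [⋀^Fin l]→L[ℝ] ℂ)
    (isOpen_chartDom a U) hy hN hwN
    (fun y hy => (hB a y hy).continuousAt.continuousWithinAt) (h a)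

lemma SmoothOn.l2LocOn {k : ℕ} {U : Opens M} {w : ∀ p : M, Form d k p} (hw : SmoothOn U w) :
    L2LocOn U w := by
  intro a y hy
  have hcont : ContinuousOn (inChart a w) (chartDom d a U) := fun y hy =>
    (hw a y hy).continuousAt.continuousWithinAt
  obtain ⟨r, hr, hrU⟩ := Metric.nhds_basis_closedBall.mem_iff.1
    ((isOpen_chartDom (d := d) a U).mem_nhds hy)
  refine ⟨Metric.closedBall y r, Metric.closedBall_mem_nhds y hr, ?_⟩
  obtain ⟨C, hC⟩ := (isCompact_closedBall y r).exists_bound_of_continuousOn (hcont.mono hrU)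
  have : IsFiniteMeasure ((volume : Measure (Euc d)).restrict (Metric.closedBall y r)) :=
    ⟨by rw [Measure.restrict_apply_univ]; exact (isCompact_closedBall y r).measure_lt_top⟩
  refine MemLp.of_bound ((hcont.mono hrU).aestronglyMeasurable measurableSet_closedBall) C ?_
  filter_upwards [ae_restrict_mem measurableSet_closedBall] with z hz using hC z hz

end Stable

/-! ### Morphisms between sheaves of sections -/

namespace SectionSpace

variable {M : Type u} [TopologicalSpace M] [SecondCountableTopology M] {S T T' : SectionSpace M}

/-- An operator on sections that induces a morphism between the sheaves of sections. -/
structure LocalOp (S T : SectionSpace M) where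
  L : (∀ p, S.F p) → ∀ p, T.F p
  mem : ∀ {U : Opens M} {s}, s ∈ S.sec U → L s ∈ T.sec U
  add : ∀ {U : Opens M} {s t}, s ∈ S.sec U → t ∈ S.sec U →
    ∀ᶠ p in T.nul, p ∈ U → L (s + t) p = L s p + L t p
  smul : ∀ {U : Opens M} (c : ℂ) {s}, s ∈ S.sec U → ∀ᶠ p in T.nul, p ∈ U → L (c • s) p = c • L s p
  null : ∀ {U : Opens M} {s}, s ∈ S.sec U → (∀ᶠ p in S.nul, p ∈ U → s p = 0) →
    ∀ᶠ p in T.nul, p ∈ U → L s p = 0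

/-- The action of an operator on classes of sections over `U`. -/
def LocalOp.app (A : LocalOp S T) (U : Opens M) :
    (S.sec U ⧸ S.null U) →ₗ[ℂ] (T.sec U ⧸ T.null U) :=
  (S.null U).liftQ
    { toFun := fun s => (T.null U).mkQ ⟨A.L s.1, A.mem s.2⟩
      map_add' := fun s t => (T.cls_eq_iff (A.mem (s + t).2)
        (Submodule.add_mem _ (A.mem s.2) (A.mem t.2))).2 (A.add s.2 t.2)
      map_smul' := fun c s => (T.cls_eq_iff (A.mem (c • s).2)
        (Submodule.smul_mem _ c (A.mem s.2))).2 (A.smul c s.2) }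
    fun s hs => (T.cls_eq_iff (A.mem s.2) (Submodule.zero_mem _)).2 (A.null s.2 hs)

/-- The morphism of sheaves induced by an operator on sections. -/
def LocalOp.hom (A : LocalOp S T) : S.sheaf ⟶ T.sheaf :=
  ⟨{ app := fun U => ModuleCat.ofHom (A.app U.unop)
     naturality := fun U W f => by
      ext x
      obtain ⟨s, hs, rfl⟩ := S.cls_surjective x
      rfl }⟩

lemma sheaf_hom_ext {f g : S.sheaf ⟶ T.sheaf}
    (h : ∀ (U : Opens M) (s : ∀ p, S.F p) (hs : s ∈ S.sec U),
      f.hom.app (op U) (S.cls hs) = g.hom.app (op U) (S.cls hs)) : f = g := by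
  apply Sheaf.hom_ext
  ext U x
  obtain ⟨s, hs, rfl⟩ := S.cls_surjective (U := U.unop) x
  exact h U.unop s hs

/-- Two morphisms agree if they agree locally on each section. -/
lemma sheaf_hom_ext_of_local {f g : S.sheaf ⟶ T.sheaf}
    (h : ∀ (U : Opens M) (s : ∀ p, S.F p) (hs : s ∈ S.sec U), ∀ p ∈ U, ∃ (W : Opens M)
      (hW : W ≤ U), p ∈ W ∧ f.hom.app (op W) (S.cls (S.mono hW hs)) =
        g.hom.app (op W) (S.cls (S.mono hW hs))) : f = g := by
  refine sheaf_hom_ext fun U s hs => ?_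
  choose W hW hpW hfg using fun p : U => h U s hs p.1 p.2
  refine T.sheaf.eq_of_locally_eq' W U (fun p => homOfLE (hW p))
    (fun p hp => Opens.mem_iSup.2 ⟨⟨p, hp⟩, hpW ⟨p, hp⟩⟩) _ _ fun p => ?_
  have h1 := fun f : S.sheaf ⟶ T.sheaf =>
    ConcreteCategory.congr_hom (f.hom.naturality (homOfLE (hW p)).op) (S.cls hs)
  exact ((h1 f).symm.trans (hfg p)).trans (h1 g)

/-- A family of isomorphisms of the fibres that preserves the admissible sections. -/
structure FibreIso (S T : SectionSpace M) where
  e : ∀ p, S.F p ≃ₗ[ℂ] T.F p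
  nul_eq : S.nul = T.nul
  mem_iff : ∀ {U : Opens M} {s : ∀ p, S.F p}, s ∈ S.sec U ↔ (fun p => e p (s p)) ∈ T.sec U

/-- The operator on sections given by a family of isomorphisms of the fibres. -/
def FibreIso.op (A : FibreIso S T) : LocalOp S T where
  L s p := A.e p (s p)
  mem hs := A.mem_iff.1 hs
  add _ _ := Filter.Eventually.of_forall fun p _ => map_add (A.e p) _ _
  smul c _ _ := Filter.Eventually.of_forall fun p _ => map_smul (A.e p) c _
  null _ h := by
    rw [← A.nul_eq]
    filter_upwards [h] with p hp hpU
    rw [hp hpU, map_zero]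

/-- The inverse family of isomorphisms of the fibres. -/
def FibreIso.symm (A : FibreIso S T) : FibreIso T S where
  e p := (A.e p).symm
  nul_eq := A.nul_eq.symm
  mem_iff := by
    intro U s
    rw [A.mem_iff]
    simp only [LinearEquiv.apply_symm_apply]

/-- The isomorphism of sheaves given by a family of isomorphisms of the fibres. -/
def FibreIso.iso (A : FibreIso S T) : S.sheaf ≅ T.sheaf where
  hom := A.op.hom
  inv := A.symm.op.hom
  hom_inv_id := sheaf_hom_ext fun _ s _ => (S.cls_eq_iff _ _).2
    (Filter.Eventually.of_forall fun p _ => (A.e p).symm_apply_apply (s p))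
  inv_hom_id := sheaf_hom_ext fun _ s _ => (T.cls_eq_iff _ _).2
    (Filter.Eventually.of_forall fun p _ => (A.e p).apply_symm_apply (s p))

lemma FibreIso.iso_cls_eq_iff (A : FibreIso S T) {U : Opens M} {s : ∀ p, S.F p}
    (hs : s ∈ S.sec U) {t : ∀ p, T.F p} (ht : t ∈ T.sec U) :
    A.iso.hom.hom.app (Opposite.op U) (S.cls hs) = T.cls ht ↔
      ∀ᶠ p in T.nul, p ∈ U → A.e p (s p) = t p := T.cls_eq_iff _ _

end SectionSpace

/-! ### The isomorphisms of sheaves -/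

section SheafIso

variable {m n : ℕ} {M : Type u} [TopologicalSpace M] [ChartedSpace (Euc (m + n)) M]
  [IsManifold 𝓘(ℝ, Euc (m + n)) ∞ M] {V : Structure m n M}

namespace Structure

variable {R : Regularity (m + n) M}

lemma mulCan_mem_reg (hR : R.Stable) {q : ℕ} {U : Opens M} {s : ∀ p : M, V.canonical p}
    (hs : SmoothOn U (fun p => (s p : Form (m + n) m p))) {v : ∀ p : M, Form (m + n) q p}
    (hv : v ∈ R.P q U) : (fun p => (V.mulCan (s p) (v p) : Form (m + n) (m + q) p)) ∈
      R.P (m + q) U :=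
  hR (B := fun a => V.opC q a s) (fun _ _ hy => V.contDiffAt_opC q hs hy) hv
    fun _ _ hy => V.inChart_mulCan hy.1 s v

lemma Coframe.div_mem_reg (hR : R.Stable) {q : ℕ} {W : Opens M} (C : V.Coframe W)
    {s : ∀ p : M, V.canonical p} (hs : SmoothOn W (fun p => (s p : Form (m + n) m p)))
    (h0 : ∀ p ∈ W, s p ≠ 0) {w : ∀ p : M, Form (m + n) (m + q) p} (hw : w ∈ R.P (m + q) W) :
    (fun p => (C.div s p (w p) : Form (m + n) q p)) ∈ R.P q W :=
  hR (B := fun a => C.divC q a s) (fun _ _ hy => C.contDiffAt_divC q hs h0 hy) hw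
    fun a _ hy => C.pull_div s hy.1 (w ((ch a).symm _))

variable {ι : Type v} (K : V.BasicCanonical ι)

/-- A section of `Λ_𝒱^{m,q}(K_𝒱^{-1})` is locally `κ ∧ v ⊗ κ^*` for a form `v` of the same
regularity. -/
lemma BasicCanonical.exists_local_form (hR : R.Stable) {q : ℕ} {U : Opens M}
    {u : ∀ p : M, V.LamK q p} (hu : u ∈ (K.sections R q).sec U) {i : ι} {W : Opens M}
    (C : V.Coframe W) (hWU : W ≤ U) (hWi : W ≤ K.U i) : ∃ v ∈ R.P q W,
      ∀ p ∈ W, V.phi q p (u p) = (V.Lam p 1 q).mkQ (v p) := by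
  have h0 : ∀ p ∈ W, K.Θ i p ≠ 0 := fun p hp => K.ne_zero i p (hWi hp)
  have hs := (smoothReg (m + n) M).mono hWi (K.smooth i)
  have h1 := C.div_mem_reg hR hs h0 (R.mono (le_inf hWU hWi) (hu i))
  refine ⟨_, Submodule.smul_mem _ ((-1 : ℂ) ^ (q * m)) h1, fun p hp => ?_⟩
  refine (V.ctr_iff' (h0 p hp)).1 ?_
  have h2 : V.mulCan (K.Θ i p) (C.div (K.Θ i) p (V.ctr (K.Θ i p) (u p))) =
      V.ctr (K.Θ i p) (u p) := C.mulCan_div hp (h0 p hp) (V.ctr_mem _ _)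
  have h3 : V.mulCan (K.Θ i p) ((-1 : ℂ) ^ (q * m) •
      C.div (K.Θ i) p (V.ctr (K.Θ i p) (u p))) = (-1 : ℂ) ^ (q * m) • V.ctr (K.Θ i p) (u p) := by
    rw [map_smul, h2]
  refine Eq.trans ?_ (congrArg (((-1 : ℂ) ^ (q * m)) • ·) h3.symm)
  beta_reduce
  rw [← form_mul_smul, neg_one_pow_mul_self, form_one_smul]

lemma BasicCanonical.comp_eq {q : ℕ} {i : ι} {u : ∀ p : M, V.LamK q p} {p : M}
    (hp : p ∈ K.U i) {v : Form (m + n) q p} (h : V.phi q p (u p) = (V.Lam p 1 q).mkQ v) :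
    K.comp u i p = (-1 : ℂ) ^ (q * m) • V.mulCan (K.Θ i p) v :=
  (V.ctr_iff' (K.ne_zero i p hp)).2 h

lemma BasicCanonical.mem_sections_iff (hR : R.Stable) {q : ℕ} {U : Opens M}
    {u : ∀ p : M, V.LamK q p} : u ∈ (K.sections R q).sec U ↔
      (fun p => V.phi q p (u p)) ∈ (V.quotSections R q).sec U := by
  constructor
  · intro hu p hp
    obtain ⟨i, W, hpW, hWi, C, -⟩ := K.exists_coframe p
    obtain ⟨v, hv, h⟩ := K.exists_local_form hR hu (C.restrict (inf_le_left : W ⊓ U ≤ W))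
      inf_le_right (inf_le_left.trans hWi)
    exact ⟨W ⊓ U, ⟨hpW, hp⟩, inf_le_right, v, hv, Filter.Eventually.of_forall h⟩
  · intro h i
    refine R.of_local fun p hp => ?_
    obtain ⟨W, hpW, hWU, v, hv, h⟩ := h p hp.1
    refine ⟨W ⊓ K.U i, ⟨hpW, hp.2⟩, inf_le_inf_right _ hWU, ?_⟩
    have h1 := mulCan_mem_reg hR (q := q)
      ((smoothReg (m + n) M).mono (inf_le_right : W ⊓ K.U i ≤ K.U i) (K.smooth i))
      (R.mono inf_le_left hv)
    refine R.congr (Submodule.smul_mem _ ((-1 : ℂ) ^ (q * m)) h1) ?_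
    filter_upwards [h] with p h hp
    exact (K.comp_eq hp.2 (h hp.1)).symm

/-- The isomorphism of the fibres preserves regular sections. -/
def BasicCanonical.fibreIso [SecondCountableTopology M] (hR : R.Stable) (q : ℕ) :
    SectionSpace.FibreIso (K.sections R q) (V.quotSections R q) where
  e := V.phi q
  nul_eq := rfl
  mem_iff := K.mem_sections_iff hR

end Structure

end SheafIso

/-! ### The local formula for the isomorphism, and uniqueness -/

section LocalFormula

variable {m n : ℕ} {M : Type u} [TopologicalSpace M] [ChartedSpace (Euc (m + n)) M]
  [IsManifold 𝓘(ℝ, Euc (m + n)) ∞ M] {V : Structure m n M} {ι : Type v}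

namespace Structure

namespace BasicCanonical

variable {K : V.BasicCanonical ι}

lemma BasicFrame.wedgeCan_ne_zero {W : Opens M} (B : K.BasicFrame W) {p : M} (hp : p ∈ W) :
    V.wedgeCan (fun j => B.θ j p) ≠ 0 := fun h => by
  have h1 := B.σ_apply p hp
  rw [h, map_zero] at h1
  exact zero_ne_one h1

/-- Restriction of a basic frame to a smaller open set. -/
def BasicFrame.restrict {U W : Opens M} (B : K.BasicFrame U) (h : W ≤ U) : K.BasicFrame W where
  θ := B.θ
  smooth j := (smoothReg (m + n) M).mono h (B.smooth j)
  linInd p hp := B.linInd p (h hp)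
  span p hp := B.span p (h hp)
  basic i := by
    obtain ⟨g, hg, hgt⟩ := B.basic i
    exact ⟨g, hg.mono (inf_le_inf_right _ h), fun p hp => hgt p ⟨h hp.1, hp.2⟩⟩
  σ := B.σ
  σ_apply p hp := B.σ_apply p (h hp)

lemma BasicFrame.phi_wedge {W : Opens M} (B : K.BasicFrame W) {q : ℕ} {p : M} (hp : p ∈ W)
    (v : Form (m + n) q p) :
    V.phi q p (V.wedgeLam (fun j => B.θ j p) v ⊗ₜ[ℂ] B.σ p) =
      (-1 : ℂ) ^ (q * m) • (V.Lam p 1 q).mkQ v := by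
  refine (V.ctr_iff (B.wedgeCan_ne_zero hp)).1 ?_
  refine (V.contract_tmul _ _ _).trans ?_
  rw [B.σ_apply p hp]
  exact (form_one_smul (E := Euc (m + n)) _).trans (V.coe_wedgeLam _ _)

lemma BasicFrame.quot_mem {R : Regularity (m + n) M} {W : Opens M} {q : ℕ}
    {v : ∀ p : M, Form (m + n) q p} (hv : v ∈ R.P q W) (c : ℂ) :
    (fun p => c • (V.Lam p 1 q).mkQ (v p)) ∈ (V.quotSections R q).sec W :=
  fun _ hp => ⟨W, hp, le_rfl, c • v, Submodule.smul_mem _ c hv,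
    Filter.Eventually.of_forall fun p _ => (map_smul (V.Lam p 1 q).mkQ c (v p)).symm⟩

lemma BasicFrame.wedge_mem {R : Regularity (m + n) M} (hR : R.Stable) {W : Opens M}
    (B : K.BasicFrame W) {q : ℕ} {v : ∀ p : M, Form (m + n) q p} (hv : v ∈ R.P q W) :
    (fun p => V.wedgeLam (fun j => B.θ j p) (v p) ⊗ₜ[ℂ] B.σ p) ∈ (K.sections R q).sec W :=
  (K.mem_sections_iff hR).2 <| (V.quotSections R q).congr
    (BasicFrame.quot_mem hv ((-1 : ℂ) ^ (q * m)))
    (Filter.Eventually.of_forall fun _ hp => (B.phi_wedge hp (v _)).symm)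

variable [SecondCountableTopology M]

variable (K) in
lemma fibreIso_extendsLocalMaps (q : ℕ) :
    K.ExtendsLocalMaps (K.fibreIso l2Reg_stable q).iso.hom := by
  intro W B v hv
  refine ⟨B.wedge_mem l2Reg_stable hv, BasicFrame.quot_mem (R := l2Reg (m + n) M) hv _, ?_⟩
  exact ((K.fibreIso l2Reg_stable q).iso_cls_eq_iff _ _).2
    (Filter.Eventually.of_forall fun _ hp => B.phi_wedge hp (v _))

lemma eq_of_extendsLocalMaps {q : ℕ} {Φ Φ' : K.sheafL q ⟶ V.quotL q}
    (h : K.ExtendsLocalMaps Φ) (h' : K.ExtendsLocalMaps Φ') : Φ = Φ' := by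
  refine SectionSpace.sheaf_hom_ext_of_local fun U u hu p hp => ?_
  obtain ⟨i, W, hpW, hWi, ⟨C⟩, ⟨B⟩, -⟩ := K.exists_basicFrame p
  refine ⟨W ⊓ U, inf_le_right, ⟨hpW, hp⟩, ?_⟩
  obtain ⟨v, hv, hvu⟩ := K.exists_local_form l2Reg_stable hu
    (C.restrict (inf_le_left : W ⊓ U ≤ W)) inf_le_right (inf_le_left.trans hWi)
  let B' := B.restrict (inf_le_left : W ⊓ U ≤ W)
  have hv' : L2LocOn (W ⊓ U) ((-1 : ℂ) ^ (q * m) • v) := L2LocOn.smul _ hv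
  obtain ⟨hu1, hs1, e1⟩ := h (W ⊓ U) B' _ hv'
  obtain ⟨hu2, hs2, e2⟩ := h' (W ⊓ U) B' _ hv'
  have e : (K.secL q).cls ((K.secL q).mono inf_le_right hu) = (K.secL q).cls hu1 := by
    refine ((K.secL q).cls_eq_iff _ _).2 (Filter.Eventually.of_forall fun p hp => ?_)
    refine (V.phi q p).injective ((hvu p hp).trans ?_)
    refine Eq.trans ?_ (B'.phi_wedge hp _).symm
    refine Eq.trans ?_ (congrArg _ (map_smul (V.Lam p 1 q).mkQ _ _)).symm
    rw [smul_smul, neg_one_pow_mul_self, one_smul]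
  rw [e]
  exact e1.trans e2.symm

end BasicCanonical

end Structure

end LocalFormula

/-! ### The operators on smooth sections -/

section SmoothCalculus

variable {d : ℕ} {M : Type u} [TopologicalSpace M] [ChartedSpace (Euc d) M]

lemma SmoothOn.wedgeOne {k : ℕ} {U : Opens M} {α : ∀ p : M, Cot d p} {w : ∀ p : M, Form d k p}
    (hα : SmoothCotOn U α) (hw : SmoothOn U w) : SmoothOn U (fun p => wedgeOne (α p) (w p)) := by
  refine SmIn.congr (G := fun a y => wedgeL (Euc d) k (cotC a α y) (inChart a w y))
    (fun a y hy => contDiffAt_apply_complex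
      (contDiffAt_wedgeL (smoothCotOn_iff.1 hα a y hy)) (hw a y hy)) fun a y hy => ?_
  exact pull_wedgeL (dSymm a y) (α ((ch a).symm y) : Euc d →L[ℝ] ℂ) _

lemma SmoothOn.differentiableAt {k : ℕ} {U : Opens M} {w : ∀ p : M, Form d k p}
    (hw : SmoothOn U w) {a : M} {y : Euc d} (hy : y ∈ chartDom d a U) :
    DifferentiableAt ℝ (inChart a w) y := (hw a y hy).differentiableAt (by simp)

variable [IsManifold 𝓘(ℝ, Euc d) ∞ M]

lemma dForm_add {k : ℕ} {U : Opens M} {w w' : ∀ p : M, Form d k p} (hw : SmoothOn U w)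
    (hw' : SmoothOn U w') {p : M} (hp : p ∈ U) :
    dForm (w + w') p = dForm w p + dForm w' p := by
  have hy := ch_mem_chartDom (d := d) hp
  refine (dForm_eq (w + w') p).trans (Eq.trans ?_
    (congrArg₂ (· + ·) (dForm_eq w p) (dForm_eq w' p)).symm)
  rw [inChart_add]
  exact extDeriv_add (hw.differentiableAt hy) (hw'.differentiableAt hy)

lemma dForm_smul {k : ℕ} (c : ℂ) {U : Opens M} {w : ∀ p : M, Form d k p} (hw : SmoothOn U w)
    {p : M} (hp : p ∈ U) : dForm (c • w) p = c • dForm w p := by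
  have hy := ch_mem_chartDom (d := d) hp
  refine (dForm_eq (c • w) p).trans (Eq.trans ?_ (congrArg (c • ·) (dForm_eq w p)).symm)
  rw [inChart_smul, extDeriv, extDeriv]
  have h1 : fderiv ℝ (c • inChart p w) (ch p p) = c • fderiv ℝ (inChart p w) (ch p p) :=
    ((hw.differentiableAt hy).hasFDerivAt.const_smul c).fderiv
  rw [h1, ContinuousAlternatingMap.alternatizeUncurryFin_smul]
  rfl

lemma dForm_zero {k : ℕ} (p : M) : dForm (0 : ∀ p : M, Form d k p) p = 0 := by
  refine (dForm_eq _ p).trans ?_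
  rw [inChart_zero, extDeriv]
  have h : fderiv ℝ (0 : Euc d → Euc d [⋀^Fin k]→L[ℝ] ℂ) (ch p p) = 0 := fderiv_const_apply 0
  rw [h]
  exact (ContinuousAlternatingMap.alternatizeUncurryFinCLM ℝ (Euc d) ℂ).map_zero

lemma dForm_dForm {k : ℕ} {U : Opens M} {w : ∀ p : M, Form d k p} (hw : SmoothOn U w) {p : M}
    (hp : p ∈ U) : dForm (dForm w) p = 0 := by
  have hy := ch_mem_chartDom (d := d) hp
  refine (dForm_eq _ p).trans ?_
  rw [(Filter.eventuallyEq_of_mem ((isOpen_chartDom p U).mem_nhds hy)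
    fun y hy => inChart_dForm hw hy).extDeriv_eq]
  exact extDeriv_extDeriv_apply (hw p _ hy)
    (by rw [minSmoothness_of_isRCLikeNormedField]; exact WithTop.coe_le_coe.2 le_top)

/-- The Leibniz rule for the product of a one-form and a form. -/
lemma dForm_wedgeOne {k : ℕ} {U : Opens M} {α : M → Euc d →L[ℝ] ℂ} {w : ∀ p : M, Form d k p}
    (hα : SmoothCotOn (d := d) U α) (hw : SmoothOn U w) {p : M} (hp : p ∈ U) :
    (dForm (fun p => wedgeOne (d := d) (p := p) (α p) (w p)) p : Euc d [⋀^Fin (k + 2)]→L[ℝ] ℂ) =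
      wedge2 (E := Euc d) (w p) (dForm (fun p => toForm (d := d) (p := p) (α p)) p) -
        wedgeL (Euc d) (k + 1) (α p) (dForm w p) := by
  have hy := ch_mem_chartDom (d := d) hp
  have h1 := extDeriv_wedgeL (θ := cotC p α) (w := inChart p w) (x := ch p p)
    ((smoothCotOn_iff.1 hα p _ hy).differentiableAt (by simp)) (hw.differentiableAt hy)
  rw [inChart_self, cotC_self] at h1
  refine (dForm_eq _ p).trans (Eq.trans ?_ (h1.trans ?_))
  · refine Filter.EventuallyEq.extDeriv_eq (Filter.Eventually.of_forall fun y => ?_)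
    exact pull_wedgeL (dSymm p y) (α ((ch p).symm y)) _
  · have e1 : (dForm (fun p => toForm (d := d) (p := p) (α p)) p : Euc d [⋀^Fin 2]→L[ℝ] ℂ) =
        extDeriv (fun y => ofCov (cotC p α y)) (ch p p) := dForm_eq _ p
    have e2 : (dForm w p : Euc d [⋀^Fin (k + 1)]→L[ℝ] ℂ) = extDeriv (inChart p w) (ch p p) :=
      dForm_eq w p
    rw [e1, e2]

end SmoothCalculus

section SmoothOperators

variable {m n : ℕ} {M : Type u} [TopologicalSpace M] [ChartedSpace (Euc (m + n)) M]
  [IsManifold 𝓘(ℝ, Euc (m + n)) ∞ M] {V : Structure m n M} {ι : Type v}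

namespace Structure

lemma opC_self {q : ℕ} (s : ∀ p : M, V.canonical p) (p : M)
    (b : Euc (m + n) [⋀^Fin q]→L[ℝ] ℂ) : V.opC q p s (ch p p) b = V.mulCan (s p) b := by
  rw [V.opC_apply (mem_extChartAt_target p), dSymm_self,
    show (ch p).symm (extChartAt 𝓘(ℝ, Euc (m + n)) p p) = p from
      (ch p).left_inv (mem_extChartAt_source p), dChart_self]
  rfl

/-- The exterior derivative of `Θ_i ∧ v`. -/
lemma BasicCanonical.dForm_mulCan {K : V.BasicCanonical ι} {W : Opens M}
    {ξ : M → Euc (m + n) →L[ℝ] ℂ} (hξ : K.IsXi W ξ) {i : ι} {q : ℕ} {U : Opens M}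
    {v : ∀ p : M, Form (m + n) q p} (hv : SmoothOn U v) {p : M} (hp : p ∈ U) (hpW : p ∈ W)
    (hpi : p ∈ K.U i) :
    dForm (fun p => (V.mulCan (K.Θ i p) (v p) : Form (m + n) (m + q) p)) p =
      wedgeL (Euc (m + n)) (m + q) (ξ p) (V.mulCan (K.Θ i p) (v p)) +
        (-1 : ℂ) ^ m • V.mulCan (K.Θ i p) (dForm v p) := by
  have hy := ch_mem_chartDom (d := m + n) hp
  have h1 := K.extDeriv_opC hξ i (ch_mem_chartDom (d := m + n) ⟨hpW, hpi⟩)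
    (hv.differentiableAt hy)
  rw [opC_self, opC_self, cotC_self, inChart_self] at h1
  refine (dForm_eq _ p).trans (Eq.trans ?_ (h1.trans ?_))
  · refine Filter.EventuallyEq.extDeriv_eq ?_
    filter_upwards [(isOpen_extChartAt_target p).mem_nhds (mem_extChartAt_target p)] with y hy
    exact V.inChart_mulCan hy (K.Θ i) v
  · congr 3
    exact (dForm_eq v p).symm

/-- The exterior derivative preserves the ideal generated by the conormal forms. -/
lemma BasicCanonical.dForm_mem (K : V.BasicCanonical ι) {q : ℕ} {U : Opens M} {v : ∀ p : M, Form (m + n) q p}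
    (hv : SmoothOn U v) (h : ∀ p ∈ U, v p ∈ V.Lam p 1 q) {p : M} (hp : p ∈ U) :
    dForm v p ∈ V.Lam p 1 (q + 1) := by
  obtain ⟨i, W, hpW, hWi, -, -, ξ, hξ⟩ := K.exists_basicFrame p
  have h1 := K.dForm_mulCan hξ hv hp hpW (hWi hpW)
  have h0 : ∀ p ∈ U ⊓ W, V.mulCan (K.Θ i p) (v p) = 0 := fun p hp => by
    refine (V.mulCan_eq_zero_iff (K.ne_zero i p (hWi hp.2))).2 ?_
    rw [← V.Lam_eq]
    exact h p hp.1
  have h2 : dForm (fun p => (V.mulCan (K.Θ i p) (v p) : Form (m + n) (m + q) p)) p = 0 := by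
    exact (dForm_congr (U := U ⊓ W) (w' := 0) h0 ⟨hp, hpW⟩).trans (dForm_zero p)
  rw [h0 p ⟨hp, hpW⟩, map_zero, zero_add] at h1
  have h3 : V.mulCan (K.Θ i p) (dForm v p) = 0 :=
    form_smul_cancel (c := (-1) ^ m) (pow_ne_zero m (neg_ne_zero.2 one_ne_zero))
      ((h1.symm.trans h2).trans (form_smul_zero (E := Euc (m + n)) _).symm)
  rw [V.Lam_eq]
  exact (V.mulCan_eq_zero_iff (K.ne_zero i p (hWi hpW))).1 h3

end Structure

end SmoothOperators

/-! ### The two complexes of smooth sections -/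

section SmoothComplexes

variable {m n : ℕ} {M : Type u} [TopologicalSpace M] [ChartedSpace (Euc (m + n)) M]
  [IsManifold 𝓘(ℝ, Euc (m + n)) ∞ M] {V : Structure m n M} {ι : Type v}
  {ϑ : M → Euc (m + n) →L[ℝ] ℂ}

/-- The twisted exterior derivative `dv - ϑ ∧ v`. -/
def twist {d : ℕ} {M : Type u} [TopologicalSpace M] [ChartedSpace (Euc d) M]
    (ϑ : M → Euc d →L[ℝ] ℂ) {q : ℕ} (v : ∀ p : M, Form d q p) (p : M) : Form d (q + 1) p :=
  dForm v p - wedgeOne (d := d) (p := p) (ϑ p) (v p)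

lemma twist_eq {d : ℕ} {M : Type u} [TopologicalSpace M] [ChartedSpace (Euc d) M]
    (ϑ : M → Euc d →L[ℝ] ℂ) {q : ℕ} (v : ∀ p : M, Form d q p) (p : M)
    {a : Euc d [⋀^Fin (q + 1)]→L[ℝ] ℂ} (h : dForm v p = a) :
    (twist ϑ v p : Euc d [⋀^Fin (q + 1)]→L[ℝ] ℂ) = a - wedgeL (Euc d) q (ϑ p) (v p) := by
  subst h
  rfl

lemma SmoothOn.twist {q : ℕ} {U : Opens M} (hϑ : SmoothCotOn (d := m + n) ⊤ ϑ)
    {v : ∀ p : M, Form (m + n) q p} (hv : SmoothOn U v) : SmoothOn U (twist ϑ v) :=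
  Submodule.sub_mem ((smoothReg (m + n) M).P (q + 1) U) hv.dForm
    (SmoothOn.wedgeOne ((smoothReg (m + n) M).mono le_top hϑ) hv)

lemma twist_add {q : ℕ} {U : Opens M} {v w : ∀ p : M, Form (m + n) q p} (hv : SmoothOn U v)
    (hw : SmoothOn U w) {p : M} (hp : p ∈ U) : twist ϑ (v + w) p = twist ϑ v p + twist ϑ w p := by
  have h1 : (dForm (v + w) p : Euc (m + n) [⋀^Fin (q + 1)]→L[ℝ] ℂ) = dForm v p + dForm w p :=
    dForm_add hv hw hp
  have h2 : wedgeL (Euc (m + n)) q (ϑ p) ((v + w) p) =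
      wedgeL _ q (ϑ p) (v p) + wedgeL _ q (ϑ p) (w p) := map_add _ _ _
  refine (twist_eq ϑ _ p h1).trans ?_
  rw [h2]
  exact add_sub_add_comm _ _ _ _

lemma twist_smul {q : ℕ} (c : ℂ) {U : Opens M} {v : ∀ p : M, Form (m + n) q p}
    (hv : SmoothOn U v) {p : M} (hp : p ∈ U) : twist ϑ (c • v) p = c • twist ϑ v p := by
  obtain ⟨a, ha⟩ : ∃ a : Euc (m + n) [⋀^Fin (q + 1)]→L[ℝ] ℂ, dForm v p = a := ⟨_, rfl⟩
  have h1 : (dForm (c • v) p : Euc (m + n) [⋀^Fin (q + 1)]→L[ℝ] ℂ) = c • a :=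
    (dForm_smul c hv hp).trans (congrArg (fun a : Euc (m + n) [⋀^Fin (q + 1)]→L[ℝ] ℂ => c • a) ha)
  have h2 : wedgeL (Euc (m + n)) q (ϑ p) ((c • v) p) = c • wedgeL _ q (ϑ p) (v p) :=
    (wedgeL (Euc (m + n)) q (ϑ p)).map_smul c (v p)
  refine (twist_eq ϑ _ p h1).trans ?_
  rw [h2, ← form_smul_sub]
  exact congrArg (fun a : Euc (m + n) [⋀^Fin (q + 1)]→L[ℝ] ℂ => c • a) (twist_eq ϑ v p ha).symm

/-- The square of the twisted derivative is the product with `-dϑ`. -/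
lemma twist_twist {q : ℕ} {U : Opens M} (hϑ : SmoothCotOn (d := m + n) ⊤ ϑ)
    {v : ∀ p : M, Form (m + n) q p} (hv : SmoothOn U v) {p : M} (hp : p ∈ U) :
    (twist ϑ (twist ϑ v) p : Euc (m + n) [⋀^Fin (q + 2)]→L[ℝ] ℂ) =
      -wedge2 (E := Euc (m + n)) (v p)
        (dForm (fun p => toForm (d := m + n) (p := p) (ϑ p)) p) := by
  have hϑU : SmoothCotOn (d := m + n) U ϑ := (smoothReg (m + n) M).mono le_top hϑ
  have hw : SmoothOn U (fun p => wedgeOne (d := m + n) (p := p) (ϑ p) (v p)) :=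
    SmoothOn.wedgeOne hϑU hv
  have e : twist ϑ v = dForm v + (-1 : ℂ) • fun p => wedgeOne (d := m + n) (p := p) (ϑ p) (v p) := by
    funext p
    refine (sub_eq_add_neg _ _).trans (congrArg _ ?_)
    exact ((form_neg_smul (E := Euc (m + n)) 1 _).trans
      (congrArg Neg.neg (form_one_smul (E := Euc (m + n)) _))).symm
  have h1 : (dForm (twist ϑ v) p : Euc (m + n) [⋀^Fin (q + 2)]→L[ℝ] ℂ) =
      -(wedge2 (E := Euc (m + n)) (v p) (dForm (fun p => toForm (d := m + n) (p := p) (ϑ p)) p) -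
        wedgeL (Euc (m + n)) (q + 1) (ϑ p) (dForm v p)) := by
    rw [e]
    refine (dForm_add hv.dForm (Submodule.smul_mem ((smoothReg (m + n) M).P _ U) _ hw) hp).trans ?_
    refine (congrArg₂ (fun a b : Euc (m + n) [⋀^Fin (q + 2)]→L[ℝ] ℂ => a + b) (dForm_dForm hv hp)
      (dForm_smul _ hw hp)).trans ?_
    refine (zero_add _).trans ((congrArg ((-1 : ℂ) • ·) (dForm_wedgeOne hϑU hv hp)).trans ?_)
    exact (form_neg_smul (E := Euc (m + n)) 1 _).trans (congrArg Neg.neg (form_one_smul _))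
  have h2 : wedgeL (Euc (m + n)) (q + 1) (ϑ p) (twist ϑ v p) =
      wedgeL (Euc (m + n)) (q + 1) (ϑ p) (dForm v p) := by
    obtain ⟨a, ha⟩ : ∃ a : Euc (m + n) [⋀^Fin (q + 1)]→L[ℝ] ℂ, dForm v p = a := ⟨_, rfl⟩
    rw [twist_eq ϑ v p ha, map_sub, ha]
    exact (congrArg _ (wedgeL_self (E := Euc (m + n)) (ϑ p) (v p))).trans (sub_zero _)
  refine (twist_eq ϑ _ p h1).trans ?_
  rw [h2]
  abel

namespace Structure

lemma mem_qsecU_iff {q : ℕ} {U : Opens M} {s : ∀ p : M, V.Quot q p} :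
    s ∈ (V.qsecU q).sec U ↔ ∀ p ∈ U, ∃ W : Opens M, p ∈ W ∧ W ≤ U ∧
      ∃ v : ∀ p : M, Form (m + n) q p, SmoothOn W v ∧
        ∀ p ∈ W, s p = (V.Lam p 1 q).mkQ (v p) := Iff.rfl

open Classical in
variable (V ϑ) in
/-- The operator `d'_ϑ` on smooth sections: at each point it is computed with a smooth local
representative. -/
def dQ {q : ℕ} (s : ∀ p : M, V.Quot q p) (p : M) : V.Quot (q + 1) p :=
  if h : ∃ (W : Opens M) (v : ∀ p : M, Form (m + n) q p), p ∈ W ∧ SmoothOn W v ∧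
      ∀ p ∈ W, s p = (V.Lam p 1 q).mkQ (v p) then
    (V.Lam p 1 (q + 1)).mkQ (twist ϑ h.choose_spec.choose p)
  else 0

lemma BasicCanonical.twist_mem (K : V.BasicCanonical ι) {q : ℕ} {U : Opens M}
    {v : ∀ p : M, Form (m + n) q p} (hv : SmoothOn U v) (h : ∀ p ∈ U, v p ∈ V.Lam p 1 q) {p : M}
    (hp : p ∈ U) : twist ϑ v p ∈ V.Lam p 1 (q + 1) := by
  refine Submodule.sub_mem _ (K.dForm_mem hv h hp) ?_
  have h1 := h p hp
  rw [V.Lam_eq] at h1 ⊢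
  exact wedgeL_LamE (ϑ p) h1

lemma BasicCanonical.dQ_eq (K : V.BasicCanonical ι) {q : ℕ} {s : ∀ p : M, V.Quot q p} {W : Opens M}
    {v : ∀ p : M, Form (m + n) q p} (hv : SmoothOn W v)
    (h : ∀ p ∈ W, s p = (V.Lam p 1 q).mkQ (v p)) {p : M} (hp : p ∈ W) :
    V.dQ ϑ s p = (V.Lam p 1 (q + 1)).mkQ (twist ϑ v p) := by
  have hex : ∃ (W : Opens M) (v : ∀ p : M, Form (m + n) q p), p ∈ W ∧ SmoothOn W v ∧
      ∀ p ∈ W, s p = (V.Lam p 1 q).mkQ (v p) := ⟨W, v, hp, hv, h⟩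
  unfold dQ
  rw [dif_pos hex]
  obtain ⟨hp', hv', h'⟩ := hex.choose_spec.choose_spec
  set W' := hex.choose
  set v' := hex.choose_spec.choose
  have hm : ∀ p ∈ W ⊓ W', (v' + (-1 : ℂ) • v) p ∈ V.Lam p 1 q := fun p hp => by
    have h1 : v' p - v p ∈ V.Lam p 1 q :=
      (Submodule.Quotient.eq (V.Lam p 1 q)).1 ((h' p hp.2).symm.trans (h p hp.1))
    have e : (v' + (-1 : ℂ) • v) p = v' p - v p := by
      refine (congrArg (v' p + ·) ((form_neg_smul (E := Euc (m + n)) 1 _).trans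
        (congrArg Neg.neg (form_one_smul (E := Euc (m + n)) _)))).trans ?_
      exact (sub_eq_add_neg _ _).symm
    rw [e]
    exact h1
  have hv1 : SmoothOn (W ⊓ W') v := (smoothReg (m + n) M).mono inf_le_left hv
  have hv2 : SmoothOn (W ⊓ W') v' := (smoothReg (m + n) M).mono inf_le_right hv'
  have hv3 : SmoothOn (W ⊓ W') ((-1 : ℂ) • v) :=
    Submodule.smul_mem ((smoothReg (m + n) M).P q (W ⊓ W')) _ hv1
  have h2 := K.twist_mem (ϑ := ϑ)
    (Submodule.add_mem ((smoothReg (m + n) M).P q (W ⊓ W')) hv2 hv3) hm ⟨hp, hp'⟩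
  rw [twist_add hv2 hv3 ⟨hp, hp'⟩, twist_smul _ hv1 ⟨hp, hp'⟩] at h2
  refine (Submodule.Quotient.eq (V.Lam p 1 (q + 1))).2 ?_
  have e : twist ϑ v' p + (-1 : ℂ) • twist ϑ v p = twist ϑ v' p - twist ϑ v p := by
    refine (congrArg (twist ϑ v' p + ·) ((form_neg_smul (E := Euc (m + n)) 1 _).trans
      (congrArg Neg.neg (form_one_smul (E := Euc (m + n)) _)))).trans ?_
    exact (sub_eq_add_neg _ _).symm
  rw [← e]
  exact h2

lemma BasicCanonical.dQ_mem (K : V.BasicCanonical ι) (hϑ : SmoothCotOn (d := m + n) ⊤ ϑ) {q : ℕ} {U : Opens M}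
    {s : ∀ p : M, V.Quot q p} (hs : s ∈ (V.qsecU q).sec U) :
    V.dQ ϑ s ∈ (V.qsecU (q + 1)).sec U := by
  refine mem_qsecU_iff.2 fun p hp => ?_
  obtain ⟨W, hpW, hWU, v, hv, h⟩ := mem_qsecU_iff.1 hs p hp
  exact ⟨W, hpW, hWU, twist ϑ v, SmoothOn.twist hϑ hv, fun p hp => K.dQ_eq hv h hp⟩

lemma BasicCanonical.dQ_dQ (K : V.BasicCanonical ι) (hϑ : SmoothCotOn (d := m + n) ⊤ ϑ)
    (hdϑ : ∀ p : M, dForm (fun p' => toForm (d := m + n) (p := p') (ϑ p')) p ∈ V.Lam p 1 2)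
    {q : ℕ} {U : Opens M} {s : ∀ p : M, V.Quot q p} (hs : s ∈ (V.qsecU q).sec U) {p : M}
    (hp : p ∈ U) : V.dQ ϑ (V.dQ ϑ s) p = 0 := by
  obtain ⟨W, hpW, hWU, v, hv, h⟩ := mem_qsecU_iff.1 hs p hp
  rw [K.dQ_eq (SmoothOn.twist hϑ hv) (fun p hp => K.dQ_eq hv h hp) hpW]
  refine (Submodule.Quotient.mk_eq_zero (V.Lam p 1 (q + 2))).2 ?_
  have h1 := hdϑ p
  rw [V.Lam_eq] at h1 ⊢
  have h2 := neg_mem (wedge2_LamE (v p) h1)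
  rw [← twist_twist hϑ hv hpW] at h2
  exact h2

lemma BasicCanonical.dQ_add (K : V.BasicCanonical ι) {q : ℕ} {U : Opens M} {s t : ∀ p : M, V.Quot q p}
    (hs : s ∈ (V.qsecU q).sec U) (ht : t ∈ (V.qsecU q).sec U) {p : M} (hp : p ∈ U) :
    V.dQ ϑ (s + t) p = V.dQ ϑ s p + V.dQ ϑ t p := by
  obtain ⟨W, hpW, -, v, hv, h⟩ := mem_qsecU_iff.1 hs p hp
  obtain ⟨W', hpW', -, v', hv', h'⟩ := mem_qsecU_iff.1 ht p hp
  have hv1 : SmoothOn (W ⊓ W') v := (smoothReg (m + n) M).mono inf_le_left hv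
  have hv2 : SmoothOn (W ⊓ W') v' := (smoothReg (m + n) M).mono inf_le_right hv'
  rw [K.dQ_eq hv h hpW, K.dQ_eq hv' h' hpW',
    K.dQ_eq (s := s + t) (v := v + v') (Submodule.add_mem ((smoothReg (m + n) M).P q (W ⊓ W')) hv1 hv2)
      (fun p hp => (congrArg₂ (· + ·) (h p hp.1) (h' p hp.2)).trans
        (map_add (V.Lam p 1 q).mkQ _ _).symm) ⟨hpW, hpW'⟩, twist_add hv1 hv2 ⟨hpW, hpW'⟩]
  exact map_add (V.Lam p 1 (q + 1)).mkQ _ _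

lemma BasicCanonical.dQ_smul (K : V.BasicCanonical ι) {q : ℕ} {U : Opens M} (c : ℂ) {s : ∀ p : M, V.Quot q p}
    (hs : s ∈ (V.qsecU q).sec U) {p : M} (hp : p ∈ U) :
    V.dQ ϑ (c • s) p = c • V.dQ ϑ s p := by
  obtain ⟨W, hpW, -, v, hv, h⟩ := mem_qsecU_iff.1 hs p hp
  rw [K.dQ_eq hv h hpW,
    K.dQ_eq (s := c • s) (v := c • v) (Submodule.smul_mem ((smoothReg (m + n) M).P q W) c hv)
      (fun p hp => (congrArg (c • ·) (h p hp)).trans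
        (map_smul (V.Lam p 1 q).mkQ c _).symm) hpW, twist_smul c hv hpW]
  exact map_smul (V.Lam p 1 (q + 1)).mkQ _ _

lemma BasicCanonical.dQ_congr (K : V.BasicCanonical ι) {q : ℕ} {U : Opens M} {s t : ∀ p : M, V.Quot q p}
    (hs : s ∈ (V.qsecU q).sec U) (h : ∀ p ∈ U, s p = t p) {p : M} (hp : p ∈ U) :
    V.dQ ϑ s p = V.dQ ϑ t p := by
  obtain ⟨W, hpW, hWU, v, hv, hsv⟩ := mem_qsecU_iff.1 hs p hp
  rw [K.dQ_eq hv hsv hpW, K.dQ_eq hv (fun p hp => (h p (hWU hp)).symm.trans (hsv p hp)) hpW]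

/-- The operator `d'_ϑ` on sections of the quotient sheaves. -/
def BasicCanonical.opQ (K : V.BasicCanonical ι) (hϑ : SmoothCotOn (d := m + n) ⊤ ϑ) (q : ℕ) :
    SectionSpace.LocalOp (V.qsecU q) (V.qsecU (q + 1)) where
  L := V.dQ ϑ
  mem hs := K.dQ_mem hϑ hs
  add hs ht := Filter.Eventually.of_forall fun _ hp => K.dQ_add hs ht hp
  smul c _ hs := Filter.Eventually.of_forall fun _ hp => K.dQ_smul c hs hp
  null {U s} hs h := Filter.Eventually.of_forall fun p hp => by
    have h' : ∀ p ∈ U, s p = ((0 : ℂ) • s) p := fun p hp => by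
      refine (Filter.eventually_top.1 h p hp).trans ?_
      exact (zero_smul ℂ (s p)).symm
    exact (K.dQ_congr hs h' hp).trans ((K.dQ_smul 0 hs hp).trans (zero_smul ℂ _))

lemma BasicCanonical.isD'_iff (K : V.BasicCanonical ι) {q : ℕ} {U : Opens M} {s : ∀ p : M, V.Quot q p}
    (hs : s ∈ (V.qsecU q).sec U) {t : ∀ p : M, V.Quot (q + 1) p} :
    V.IsD' ϑ U s t ↔ ∀ p ∈ U, V.dQ ϑ s p = t p := by
  constructor
  · intro h p hp
    obtain ⟨W, hpW, hWU, v, hv, hsv⟩ := mem_qsecU_iff.1 hs p hp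
    exact (K.dQ_eq hv hsv hpW).trans (h W hWU v hv hsv p hpW).symm
  · intro h W hWU v hv hsv p hp
    exact (h p (hWU hp)).symm.trans (K.dQ_eq hv hsv hp)

/-- The operator `d - Ξ_𝒱 - ϑ ∧` on the components corresponds to `d - ϑ ∧`. -/
lemma BasicCanonical.dForm_comp_eq (K : V.BasicCanonical ι) {W : Opens M} {ξ : M → Euc (m + n) →L[ℝ] ℂ}
    (hξ : K.IsXi W ξ) {i : ι} {q : ℕ} {u : ∀ p : M, V.LamK q p} {U : Opens M}
    {v : ∀ p : M, Form (m + n) q p} (hv : SmoothOn U v)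
    (h : ∀ p ∈ U, V.phi q p (u p) = (V.Lam p 1 q).mkQ (v p)) {p : M} (hp : p ∈ U) (hpW : p ∈ W)
    (hpi : p ∈ K.U i) {a : Euc (m + n) [⋀^Fin (m + q + 1)]→L[ℝ] ℂ}
    (ha : dForm (K.comp u i) p = a) :
    a - wedgeL (Euc (m + n)) (m + q) (ξ p) (K.comp u i p) -
      wedgeL (Euc (m + n)) (m + q) (ϑ p) (K.comp u i p) =
        (-1 : ℂ) ^ ((q + 1) * m) • V.mulCan (K.Θ i p) (twist ϑ v p) := by
  have e : ∀ p ∈ U ⊓ K.U i, K.comp u i p =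
      ((-1 : ℂ) ^ (q * m) • fun p => (V.mulCan (K.Θ i p) (v p) : Form (m + n) (m + q) p)) p :=
    fun p hp => K.comp_eq hp.2 (h p hp.1)
  have e0 : (K.comp u i p : Euc (m + n) [⋀^Fin (m + q)]→L[ℝ] ℂ) =
      (-1 : ℂ) ^ (q * m) • V.mulCan (K.Θ i p) (v p) := e p ⟨hp, hpi⟩
  have hsm : SmoothOn (U ⊓ K.U i)
      (fun p => (V.mulCan (K.Θ i p) (v p) : Form (m + n) (m + q) p)) :=
    mulCan_mem_reg smoothReg_stable ((smoothReg (m + n) M).mono inf_le_right (K.smooth i))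
      ((smoothReg (m + n) M).mono inf_le_left hv)
  obtain ⟨b, hb⟩ : ∃ b : Euc (m + n) [⋀^Fin (q + 1)]→L[ℝ] ℂ, dForm v p = b := ⟨_, rfl⟩
  have e1 : a =
      (-1 : ℂ) ^ (q * m) • (wedgeL (Euc (m + n)) (m + q) (ξ p) (V.mulCan (K.Θ i p) (v p)) +
        (-1 : ℂ) ^ m • V.mulCan (K.Θ i p) b) := by
    refine ha.symm.trans ((dForm_congr e ⟨hp, hpi⟩).trans ((dForm_smul _ hsm ⟨hp, hpi⟩).trans ?_))
    rw [← hb]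
    exact congrArg _ (K.dForm_mulCan hξ hv hp hpW hpi)
  have e2 : V.mulCan (K.Θ i p) (wedgeL _ q (ϑ p) (v p)) =
      (-1 : ℂ) ^ m • wedgeL _ (m + q) (ϑ p) (V.mulCan (K.Θ i p) (v p)) :=
    frameMul_wedgeL _ _ _ _ _
  rw [e1, e0, map_smul, map_smul, twist_eq ϑ v p hb, map_sub, e2, form_smul_add, form_smul_sub,
    add_mul, one_mul, pow_add, form_mul_smul, form_mul_smul,
    ← form_mul_smul ((-1 : ℂ) ^ m) ((-1 : ℂ) ^ m), neg_one_pow_mul_self, form_one_smul,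
    add_sub_cancel_left]

lemma BasicCanonical.isD_iff (K : V.BasicCanonical ι) {q : ℕ} {U : Opens M}
    {u : ∀ p : M, V.LamK q p} (hu : u ∈ (K.secA q).sec U) {f : ∀ p : M, V.LamK (q + 1) p} :
    K.IsD ϑ U u f ↔ ∀ p ∈ U, V.dQ ϑ (fun p => V.phi q p (u p)) p = V.phi (q + 1) p (f p) := by
  have hs := (K.mem_sections_iff smoothReg_stable).1 hu
  have key : ∀ (W : Opens M) (ξ : M → Euc (m + n) →L[ℝ] ℂ), K.IsXi W ξ → ∀ i,
      ∀ p ∈ U ⊓ W ⊓ K.U i, (K.comp f i p =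
        dForm (K.comp u i) p - wedgeOne (d := m + n) (p := p) (ξ p) (K.comp u i p) -
          wedgeOne (d := m + n) (p := p) (ϑ p) (K.comp u i p) ↔
        V.dQ ϑ (fun p => V.phi q p (u p)) p = V.phi (q + 1) p (f p)) := by
    intro W ξ hξ i p hp
    obtain ⟨W', hpW', hWU, v, hv, h⟩ := mem_qsecU_iff.1 hs p hp.1.1
    have e := K.dForm_comp_eq (ϑ := ϑ) hξ hv h hpW' hp.1.2 hp.2 rfl
    have e' := V.ctr_iff' (u := f p) (v := twist ϑ v p) (K.ne_zero i p hp.2)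
    rw [K.dQ_eq hv h hpW']
    exact ⟨fun h => (e'.1 (h.trans e)).symm, fun h => (e'.2 h.symm).trans e.symm⟩
  constructor
  · intro h p hp
    obtain ⟨i, W, hpW, hWi, -, -, ξ, hξ⟩ := K.exists_basicFrame p
    exact (key W ξ hξ i p ⟨⟨hp, hpW⟩, hWi hpW⟩).1 (h W ξ hξ i p ⟨⟨hp, hpW⟩, hWi hpW⟩)
  · intro h W ξ hξ i p hp
    exact (key W ξ hξ i p hp).2 (h p hp.1.1)

end Structure

end SmoothComplexes

/-! ### Weak exterior derivatives -/

section WeakDerivative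

variable {d k : ℕ}

/-- The coordinate differential `dx^i`, with values in `ℂ`. -/
def dx (i : Fin d) : Euc d →L[ℝ] ℂ :=
  Complex.ofRealCLM.comp (EuclideanSpace.proj i : Euc d →L[ℝ] ℝ)

section Transpose

variable {X F G D ι : Type*} [NormedAddCommGroup X] [NormedSpace ℝ X] [NormedAddCommGroup F]
  [NormedSpace ℂ F] [NormedAddCommGroup G] [NormedSpace ℂ G] [NormedAddCommGroup D]
  [NormedSpace ℝ D] [Fintype ι] (e : ι → X) (L : ι → G →L[ℂ] F)

/-- The transpose, up to sign, of the first order operator `∑ i, L_i ∂_{e_i}` applied to a family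
of functionals: `b ↦ ∑ i, ⟨∂_{e_i} T, L_i b⟩`. -/
def transposeOp (T : X → F →L[ℂ] ℂ) (y : X) : G →L[ℂ] ℂ :=
  ∑ i, (fderiv ℝ T y (e i)).comp (L i)

lemma transposeOp_apply (T : X → F →L[ℂ] ℂ) (y : X) (b : G) :
    transposeOp e L T y b = ∑ i, fderiv ℝ T y (e i) (L i b) := by
  simp only [transposeOp, sum_apply, ContinuousLinearMap.comp_apply]

lemma continuous_transposeOp {T : X → F →L[ℂ] ℂ} (hT : ContDiff ℝ ∞ T) :
    Continuous (transposeOp e L T) := by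
  have h := hT.continuous_fderiv (by simp)
  unfold transposeOp
  exact continuous_finsetSum _ fun i _ => (h.clm_apply continuous_const).clm_comp continuous_const

lemma tsupport_transposeOp_subset (T : X → F →L[ℂ] ℂ) :
    tsupport (transposeOp e L T) ⊆ tsupport T := by
  refine closure_minimal (fun y hy => ?_) (isClosed_tsupport T)
  refine tsupport_fderiv_subset ℝ (subset_tsupport _ fun h => hy ?_)
  unfold transposeOp
  refine Finset.sum_eq_zero fun i _ => ?_
  rw [h]
  rfl

lemma transposeOp_sum {κ : Type*} [Fintype κ] {T : X → F →L[ℂ] ℂ} {T' : κ → X → F →L[ℂ] ℂ} {y : X}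
    (h : fderiv ℝ T y = ∑ j, fderiv ℝ (T' j) y) (b : G) :
    transposeOp e L T y b = ∑ j, transposeOp e L (T' j) y b := by
  simp only [transposeOp_apply, h, sum_apply]
  exact Finset.sum_comm

/-- A smooth function with compact support is a finite sum of its products with cut-off functions
subordinate to a covering of the support. -/
lemma exists_smooth_decomposition [FiniteDimensional ℝ X] {T : X → D} (hT : ContDiff ℝ ∞ T)
    (hc : HasCompactSupport T) {O : X → Set X} (hO : ∀ y, IsOpen (O y))
    (hyO : ∀ y ∈ tsupport T, y ∈ O y) :
    ∃ (t : Finset X) (ρ : t → X → ℝ), (∀ i : t, i.1 ∈ tsupport T) ∧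
      (∀ i, ContDiff ℝ ∞ (fun y => ρ i y • T y)) ∧
      (∀ i, HasCompactSupport (fun y => ρ i y • T y)) ∧
      (∀ i, tsupport (fun y => ρ i y • T y) ⊆ O i) ∧
      (∀ y, T y = ∑ i, ρ i y • T y) ∧
      ∀ y, fderiv ℝ T y = ∑ i, fderiv ℝ (fun y => ρ i y • T y) y := by
  obtain ⟨t, ht, hcov⟩ := hc.isCompact.elim_nhds_subcover O
    fun y hy => (hO y).mem_nhds (hyO y hy)
  have hcov' : tsupport T ⊆ ⋃ i : t, O i := hcov.trans fun y hy => by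
    obtain ⟨i, hi, hy⟩ := Set.mem_iUnion₂.1 hy
    exact Set.mem_iUnion.2 ⟨⟨i, hi⟩, hy⟩
  obtain ⟨ρ, hρ⟩ := SmoothPartitionOfUnity.exists_isSubordinate 𝓘(ℝ, X)
    (isClosed_tsupport T) (fun i : t => O i) (fun i => hO _) hcov'
  have hsm : ∀ i, ContDiff ℝ ∞ (fun y => ρ i y • T y) := fun i =>
    (ρ i).contMDiff.contDiff.smul hT
  have hsum : ∀ y, T y = ∑ i, ρ i y • T y := fun y => by
    have e : ∑ i, ρ i y • T y = (∑ i, ρ i y) • T y := (Finset.sum_smul (f := fun i => ρ i y)).symm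
    rw [e]
    by_cases hy : y ∈ tsupport T
    · have h1 := ρ.sum_eq_one hy
      rw [finsum_eq_sum_of_fintype] at h1
      rw [h1, one_smul]
    · rw [image_eq_zero_of_notMem_tsupport hy, smul_zero]
  refine ⟨t, fun i => ρ i, fun i => ht i i.2, hsm, fun i => hc.smul_left,
    fun i => (tsupport_smul_subset_left _ _).trans (hρ i), hsum, fun y => ?_⟩
  conv_lhs => rw [funext hsum]
  exact fderiv_fun_sum fun i _ => ((hsm i).differentiable (by simp)).differentiableAt

end Transpose

/-- The transposed exterior derivative of a family of functionals, up to sign: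
`b ↦ ∑ i, ⟨∂_i T, dx^i ∧ b⟩`. -/
def adj (T : Euc d → (Euc d [⋀^Fin (k + 1)]→L[ℝ] ℂ) →L[ℂ] ℂ) (y : Euc d) :
    (Euc d [⋀^Fin k]→L[ℝ] ℂ) →L[ℂ] ℂ :=
  transposeOp (fun i => EuclideanSpace.single i (1 : ℝ)) (fun i => wedgeL (Euc d) k (dx i)) T y

lemma adj_apply (T : Euc d → (Euc d [⋀^Fin (k + 1)]→L[ℝ] ℂ) →L[ℂ] ℂ) (y : Euc d)
    (b : Euc d [⋀^Fin k]→L[ℝ] ℂ) : adj T y b =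
      ∑ i, fderiv ℝ T y (EuclideanSpace.single i 1) (wedgeL (Euc d) k (dx i) b) :=
  transposeOp_apply _ _ T y b

/-- `dw = g` tested against `T`. -/
def WeakEq (T : Euc d → (Euc d [⋀^Fin (k + 1)]→L[ℝ] ℂ) →L[ℂ] ℂ)
    (w : Euc d → Euc d [⋀^Fin k]→L[ℝ] ℂ) (g : Euc d → Euc d [⋀^Fin (k + 1)]→L[ℝ] ℂ) : Prop :=
  ∫ y, T y (g y) = -∫ y, adj T y (w y)

lemma weakD_iff {M : Type u} [TopologicalSpace M] [ChartedSpace (Euc d) M]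
    {S : ∀ p : M, Submodule ℂ (Form d (k + 1) p)} {U : Opens M} {w : ∀ p : M, Form d k p}
    {g : ∀ p : M, Form d (k + 1) p} : WeakD S U w g ↔
      ∀ (a : M) (T : Euc d → (Euc d [⋀^Fin (k + 1)]→L[ℝ] ℂ) →L[ℂ] ℂ),
        ContDiff ℝ ∞ T → HasCompactSupport T → tsupport T ⊆ chartDom d a U →
        (∀ b : ∀ p : M, Form d (k + 1) p, (∀ p, b p ∈ S p) → ∀ y, T y (inChart a b y) = 0) →
        WeakEq T (inChart a w) (inChart a g) := by
  have e : ∀ (a : M) (T : Euc d → (Euc d [⋀^Fin (k + 1)]→L[ℝ] ℂ) →L[ℂ] ℂ) (y : Euc d),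
      adj T y (inChart a w y) = ∑ i : Fin d, (fderiv ℝ T y (EuclideanSpace.single i 1))
        (ContinuousAlternatingMap.alternatizeUncurryFin
          (ContinuousLinearMap.smulRight
            (Complex.ofRealCLM.comp (EuclideanSpace.proj i : Euc d →L[ℝ] ℝ)) (inChart a w y))) :=
    fun a T y => adj_apply T y _
  unfold WeakEq WeakD
  simp only [e]

section Integrability

variable {F : Type*} [NormedAddCommGroup F] [NormedSpace ℂ F] {O : Set (Euc d)}

lemma integrable_apply {w : Euc d → F} (hO : IsOpen O)
    (hw : ∀ y ∈ O, ∃ N ∈ 𝓝 y, MemLp w 2 (volume.restrict N)) {B : Euc d → F →L[ℂ] ℂ}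
    (hB : Continuous B) (hc : HasCompactSupport B) (hs : tsupport B ⊆ O) :
    Integrable (fun y => B y (w y)) := by
  have hsub : Function.support (fun y => B y (w y)) ⊆ tsupport B := fun y hy =>
    subset_tsupport _ fun h => hy (by simp only [h, zero_apply])
  refine (integrableOn_iff_integrable_of_support_subset hsub).1 ?_
  have hl : LocallyIntegrableOn (fun y => B y (w y)) O := fun y hy => by
    obtain ⟨N, hN, h⟩ := hw y hy
    obtain ⟨N', hN', h'⟩ := exists_memLp_apply hO hy hN h hB.continuousOn (fun _ _ => rfl)
    obtain ⟨r, hr, hrN⟩ := Metric.nhds_basis_closedBall.mem_iff.1 hN'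
    refine ⟨Metric.closedBall y r,
      mem_nhdsWithin_of_mem_nhds (Metric.closedBall_mem_nhds y hr), ?_⟩
    have : IsFiniteMeasure ((volume : Measure (Euc d)).restrict (Metric.closedBall y r)) :=
      ⟨by rw [Measure.restrict_apply_univ]; exact (isCompact_closedBall y r).measure_lt_top⟩
    exact (h'.mono_measure (Measure.restrict_mono hrN le_rfl)).integrable (by norm_num)
  exact hl.integrableOn_compact_subset hs hc

end Integrability

lemma integrable_adj {O : Set (Euc d)} {w : Euc d → Euc d [⋀^Fin k]→L[ℝ] ℂ} (hO : IsOpen O)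
    (hw : ∀ y ∈ O, ∃ N ∈ 𝓝 y, MemLp w 2 (volume.restrict N))
    {T : Euc d → (Euc d [⋀^Fin (k + 1)]→L[ℝ] ℂ) →L[ℂ] ℂ} (hT : ContDiff ℝ ∞ T)
    (hc : HasCompactSupport T) (hs : tsupport T ⊆ O) : Integrable (fun y => adj T y (w y)) :=
  integrable_apply hO hw (continuous_transposeOp _ _ hT)
    (hc.mono' ((subset_tsupport _).trans (tsupport_transposeOp_subset _ _ _)))
    ((tsupport_transposeOp_subset _ _ _).trans hs)

/-- The equation `dw = g` can be tested locally. -/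
lemma WeakD.of_local {M : Type u} [TopologicalSpace M] [ChartedSpace (Euc d) M]
    {S : ∀ p : M, Submodule ℂ (Form d (k + 1) p)} {U : Opens M} {w : ∀ p : M, Form d k p}
    {g : ∀ p : M, Form d (k + 1) p} (hw : L2LocOn U w) (hg : L2LocOn U g)
    (h : ∀ p ∈ U, ∃ W : Opens M, p ∈ W ∧ W ≤ U ∧ WeakD S W w g) : WeakD S U w g := by
  refine weakD_iff.2 fun a T hT hc hs hS => ?_
  choose! W hpW hWU hW using h
  let O : Euc d → Set (Euc d) := fun y => chartDom d a (W ((extChartAt 𝓘(ℝ, Euc d) a).symm y))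
  obtain ⟨t, ρ, ht, hTi, hci, hsO, hsum, hfd⟩ := exists_smooth_decomposition hT hc (O := O)
    (fun y => isOpen_chartDom a _) fun y hy => ⟨(hs hy).1, hpW _ (hs hy).2⟩
  have hL : ∀ {l : ℕ} {w : ∀ p : M, Form d l p}, L2LocOn U w → ∀ y ∈ chartDom d a U,
      ∃ N ∈ 𝓝 y, MemLp (inChart a w) 2 (volume.restrict N) := fun hw => hw a
  have hOU : ∀ i : t, O i ⊆ chartDom d a U := fun i => chartDom_mono a (hWU _ (hs (ht i)).2)
  have key : ∀ i : t, WeakEq (fun y => ρ i y • T y) (inChart a w) (inChart a g) := fun i =>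
    weakD_iff.1 (hW _ (hs (ht i)).2) a _ (hTi i) (hci i) (hsO i) fun b hb y => by
      change ρ i y • T y (inChart a b y) = 0
      rw [hS b hb y, smul_zero]
  have i1 : ∀ i : t, Integrable (fun y => (ρ i y • T y) (inChart a g y)) := fun i =>
    integrable_apply (F := Euc d [⋀^Fin (k + 1)]→L[ℝ] ℂ) (isOpen_chartDom a U) (hL hg)
      (hTi i).continuous (hci i) ((hsO i).trans (hOU i))
  have i2 : ∀ i : t, Integrable (fun y => adj (fun y => ρ i y • T y) y (inChart a w y)) := fun i =>
    integrable_adj (isOpen_chartDom a U) (hL hw) (hTi i) (hci i) ((hsO i).trans (hOU i))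
  unfold WeakEq
  have e1 : ∀ y, T y (inChart a g y) = ∑ i, (ρ i y • T y) (inChart a g y) := fun y =>
    (congrArg (fun A : (Euc d [⋀^Fin (k + 1)]→L[ℝ] ℂ) →L[ℂ] ℂ => A (inChart a g y))
      (hsum y)).trans (sum_apply _ _ _)
  have e2 : ∀ y, adj T y (inChart a w y) =
      ∑ i, adj (fun y => ρ i y • T y) y (inChart a w y) := fun y =>
    transposeOp_sum _ _ (hfd y) _
  simp only [e1, e2]
  rw [integral_finsetSum _ fun i _ => i1 i, integral_finsetSum _ fun i _ => i2 i,
    ← Finset.sum_neg_distrib]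
  exact Finset.sum_congr rfl fun i _ => key i

/-- The exterior derivative in coordinates. -/
lemma extDeriv_eq_sum (w : Euc d → Euc d [⋀^Fin k]→L[ℝ] ℂ) (y : Euc d) :
    extDeriv w y = ∑ i, wedgeL (Euc d) k (dx i) (fderiv ℝ w y (EuclideanSpace.single i 1)) := by
  have e : fderiv ℝ w y = ∑ i, ContinuousLinearMap.smulRight (dx i)
      (fderiv ℝ w y (EuclideanSpace.single i 1)) := by
    ext1 v
    have hv : v = ∑ i, v i • EuclideanSpace.single i (1 : ℝ) := by
      have := (EuclideanSpace.basisFun (Fin d) ℝ).sum_repr v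
      simpa using this.symm
    conv_lhs => rw [hv]
    rw [map_sum, sum_apply]
    refine Finset.sum_congr rfl fun i _ => ?_
    rw [map_smul]
    exact (Complex.coe_smul (v i) (fderiv ℝ w y (EuclideanSpace.single i 1))).symm
  have h : extDeriv w y =
      ContinuousAlternatingMap.alternatizeUncurryFinCLM ℝ (Euc d) ℂ (fderiv ℝ w y) := rfl
  rw [h]
  refine (congrArg _ e).trans ((map_sum _ _ _).trans ?_)
  rfl

end WeakDerivative

/-! ### The maximal extensions of the two operators -/

section FDeriv

variable {X F G H : Type*} [NormedAddCommGroup X] [NormedSpace ℝ X]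
  [NormedAddCommGroup F] [NormedSpace ℂ F]
  [NormedAddCommGroup G] [NormedSpace ℂ G] [NormedSpace ℝ G] [IsScalarTower ℝ ℂ G]
  [NormedAddCommGroup H] [NormedSpace ℂ H] [NormedSpace ℝ H] [IsScalarTower ℝ ℂ H]
  {S : X → G →L[ℂ] H} {A : X → F →L[ℂ] G} {y : X}

lemma fderiv_comp_complex_apply (hS : DifferentiableAt ℝ S y) (hA : DifferentiableAt ℝ A y)
    {T : X → F →L[ℂ] H} (hT : T =ᶠ[𝓝 y] fun y => (S y).comp (A y)) (e : X) (b : F) :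
    fderiv ℝ T y e b = fderiv ℝ S y e (A y b) + S y (fderiv ℝ A y e b) := by
  have h1 := ((isBoundedBilinearMap_real
    (isBoundedBilinearMap_comp (𝕜 := ℂ) (E := F) (F := G) (G := H))).hasFDerivAt
      (S y, A y)).comp y (hS.hasFDerivAt.prodMk hA.hasFDerivAt)
  have h2 : HasFDerivAt T _ y := h1.congr_of_eventuallyEq hT
  rw [h2.fderiv, add_comm]
  rfl

lemma fderiv_apply_const_complex (hA : DifferentiableAt ℝ A y) (e : X) (b : F) :
    fderiv ℝ (fun y => A y b) y e = fderiv ℝ A y e b := by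
  have h1 : HasFDerivAt (fun y => A y b) _ y :=
    (((ContinuousLinearMap.apply ℂ G b).restrictScalars ℝ).hasFDerivAt).comp y hA.hasFDerivAt
  rw [h1.fderiv]
  rfl

lemma fderiv_apply_of_eq {F' G' : Type*} [NormedAddCommGroup F'] [NormedSpace ℂ F']
    [NormedAddCommGroup G'] [NormedSpace ℂ G'] [NormedSpace ℝ G'] [IsScalarTower ℝ ℂ G']
    {A' : X → F' →L[ℂ] G'} (hA : DifferentiableAt ℝ A y) (hA' : DifferentiableAt ℝ A' y)
    {L : G →L[ℂ] G'} {b : F} {b' : F'} (h : ∀ y, A' y b' = L (A y b)) (e : X) :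
    fderiv ℝ A' y e b' = L (fderiv ℝ A y e b) := by
  have h1 : HasFDerivAt (fun y => A y b) _ y :=
    (((ContinuousLinearMap.apply ℂ G b).restrictScalars ℝ).hasFDerivAt).comp y hA.hasFDerivAt
  have h2 : HasFDerivAt (fun y => L (A y b)) _ y := ((L.restrictScalars ℝ).hasFDerivAt).comp y h1
  rw [← fderiv_apply_const_complex hA', funext h, h2.fderiv]
  rfl

end FDeriv

section MaximalExtension

variable {m n : ℕ} {M : Type u} [TopologicalSpace M] [ChartedSpace (Euc (m + n)) M]
  [IsManifold 𝓘(ℝ, Euc (m + n)) ∞ M] {V : Structure m n M} {ι : Type v}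
  {ϑ ξ : M → Euc (m + n) →L[ℝ] ℂ}

lemma wedgeOne_mem_reg {d k : ℕ} {M : Type u} [TopologicalSpace M] [ChartedSpace (Euc d) M]
    {R : Regularity d M} (hR : R.Stable) {U : Opens M} {α : ∀ p : M, Cot d p}
    {w : ∀ p : M, Form d k p} (hα : SmoothCotOn U α) (hw : w ∈ R.P k U) :
    (fun p => wedgeOne (α p) (w p)) ∈ R.P (k + 1) U :=
  hR (B := fun a y => wedgeL (Euc d) k (cotC a α y))
    (fun a y hy => contDiffAt_wedgeL (smoothCotOn_iff.1 hα a y hy)) hw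
    fun a y _ => pull_wedgeL (dSymm a y) (α ((ch a).symm y) : Euc d →L[ℝ] ℂ) _

namespace Structure

lemma BasicCanonical.adj_comp_opC {K : V.BasicCanonical ι} {W : Opens M} (hξ : K.IsXi W ξ) {i : ι}
    {q : ℕ} {a : M} {y : Euc (m + n)} (hy : y ∈ chartDom (m + n) a (W ⊓ K.U i))
    {S : Euc (m + n) → (Euc (m + n) [⋀^Fin (m + q + 1)]→L[ℝ] ℂ) →L[ℂ] ℂ}
    {T : Euc (m + n) → (Euc (m + n) [⋀^Fin (q + 1)]→L[ℝ] ℂ) →L[ℂ] ℂ}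
    (hS : DifferentiableAt ℝ S y)
    (hT : T =ᶠ[𝓝 y] fun y => (S y).comp (V.opC (q + 1) a (K.Θ i) y))
    (b : Euc (m + n) [⋀^Fin q]→L[ℝ] ℂ) :
    adj T y b = (-1 : ℂ) ^ m * (adj S y (V.opC q a (K.Θ i) y b) +
      S y (wedgeL _ (m + q) (cotC a ξ y) (V.opC q a (K.Θ i) y b))) := by
  have hyi : y ∈ chartDom (m + n) a (K.U i) := chartDom_mono a inf_le_right hy
  have hA : ∀ q, DifferentiableAt ℝ (V.opC q a (K.Θ i)) y := fun q =>
    (V.contDiffAt_opC q (K.smooth i) hyi).differentiableAt (by simp)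
  have h1 : ∀ j, fderiv ℝ T y (EuclideanSpace.single j 1) (wedgeL _ q (dx j) b) =
      (-1 : ℂ) ^ m * (fderiv ℝ S y (EuclideanSpace.single j 1)
        (wedgeL _ (m + q) (dx j) (V.opC q a (K.Θ i) y b)) +
      S y (wedgeL _ (m + q) (dx j)
        (fderiv ℝ (fun y => V.opC q a (K.Θ i) y b) y (EuclideanSpace.single j 1)))) := by
    intro j
    have e1 := fderiv_comp_complex_apply hS (hA (q + 1)) hT (EuclideanSpace.single j 1)
      (wedgeL _ q (dx j) b)
    have e2 : fderiv ℝ (V.opC (q + 1) a (K.Θ i)) y (EuclideanSpace.single j 1)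
        (wedgeL _ q (dx j) b) = (-1 : ℂ) ^ m • wedgeL _ (m + q) (dx j)
          (fderiv ℝ (fun y => V.opC q a (K.Θ i) y b) y (EuclideanSpace.single j 1)) := by
      rw [fderiv_apply_const_complex (hA q)]
      exact fderiv_apply_of_eq (hA q) (hA (q + 1))
        (L := (-1 : ℂ) ^ m • wedgeL (Euc (m + n)) (m + q) (dx j))
        (fun y => V.opC_wedgeL a (K.Θ i) y (dx j) b) _
    rw [e1, e2, V.opC_wedgeL, map_smul, map_smul, smul_eq_mul, smul_eq_mul, mul_add]
  have h2 := K.extDeriv_opC hξ i hy (w := fun _ => b) (differentiableAt_const b)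
  have h3 : extDeriv (fun _ : Euc (m + n) => b) y = 0 := by
    rw [extDeriv_eq_sum, fderiv_fun_const]
    exact Finset.sum_eq_zero fun j _ => map_zero _
  rw [h3, map_zero, form_smul_zero, add_zero, extDeriv_eq_sum] at h2
  rw [adj_apply, adj_apply, ← h2, map_sum, ← Finset.sum_add_distrib, Finset.mul_sum]
  exact Finset.sum_congr rfl fun j _ => h1 j

/-- The coordinate expression of a form `g + α ∧ w`. -/
lemma inChart_add_wedgeOne {d k : ℕ} {M : Type u} [TopologicalSpace M] [ChartedSpace (Euc d) M]
    (α : M → Euc d →L[ℝ] ℂ) (w : ∀ p : M, Form d k p) (g : ∀ p : M, Form d (k + 1) p) (a : M)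
    (y : Euc d) : inChart a (fun p => g p + wedgeOne (d := d) (p := p) (α p) (w p)) y =
      inChart a g y + wedgeL _ k (cotC a α y) (inChart a w y) :=
  (pull_add _ _ _).trans (congrArg (inChart a g y + ·) (pull_wedgeL (dSymm a y) _ _))

lemma weakEq_iff_integral {d k : ℕ} {T : Euc d → (Euc d [⋀^Fin (k + 1)]→L[ℝ] ℂ) →L[ℂ] ℂ}
    {w : Euc d → Euc d [⋀^Fin k]→L[ℝ] ℂ} {g : Euc d → Euc d [⋀^Fin (k + 1)]→L[ℝ] ℂ}
    {O : Set (Euc d)} (hO : IsOpen O) (hw : ∀ y ∈ O, ∃ N ∈ 𝓝 y, MemLp w 2 (volume.restrict N))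
    (hg : ∀ y ∈ O, ∃ N ∈ 𝓝 y, MemLp g 2 (volume.restrict N)) (hT : ContDiff ℝ ∞ T)
    (hc : HasCompactSupport T) (hs : tsupport T ⊆ O) :
    WeakEq T w g ↔ ∫ y, (T y (g y) + adj T y (w y)) = 0 := by
  rw [integral_add (integrable_apply hO hg hT.continuous hc hs) (integrable_adj hO hw hT hc hs)]
  exact eq_neg_iff_add_eq_zero

/-- A test section `T` of the dual of the bundle of `(q+1)`-forms which factors through `Θ_i ∧`,
say `T = S ∘ (Θ_i ∧)`, tests the equation `dv = g + ϑ ∧ v` in the same way as `S` tests the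
equation for the components of the corresponding sections of `Λ_𝒱^{m,q}(K_𝒱^{-1})`. -/
lemma BasicCanonical.weakEq_iff {K : V.BasicCanonical ι} (hϑ : SmoothCotOn (d := m + n) ⊤ ϑ)
    {W : Opens M} (hξ : K.IsXi W ξ) (hξ' : SmoothCotOn (d := m + n) W ξ) {i : ι} {q : ℕ} {a : M}
    {O : Opens M} (hOW : O ≤ W ⊓ K.U i)
    {u : ∀ p : M, V.LamK q p} {f : ∀ p : M, V.LamK (q + 1) p}
    {v : ∀ p : M, Form (m + n) q p} {g : ∀ p : M, Form (m + n) (q + 1) p}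
    (hu : L2LocOn O (K.comp u i)) (hf : L2LocOn O (K.comp f i))
    (hv : L2LocOn O v) (hg : L2LocOn O g)
    (huv : ∀ᶠ p in aeFilter (m + n) M, p ∈ O → V.phi q p (u p) = (V.Lam p 1 q).mkQ (v p))
    (hfg : ∀ᶠ p in aeFilter (m + n) M, p ∈ O →
      V.phi (q + 1) p (f p) = (V.Lam p 1 (q + 1)).mkQ (g p))
    {S : Euc (m + n) → (Euc (m + n) [⋀^Fin (m + q + 1)]→L[ℝ] ℂ) →L[ℂ] ℂ}
    {T : Euc (m + n) → (Euc (m + n) [⋀^Fin (q + 1)]→L[ℝ] ℂ) →L[ℂ] ℂ}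
    (hS : ContDiff ℝ ∞ S) (hSc : HasCompactSupport S) (hSs : tsupport S ⊆ chartDom (m + n) a O)
    (hT : ContDiff ℝ ∞ T) (hTc : HasCompactSupport T) (hTs : tsupport T ⊆ chartDom (m + n) a O)
    (hTS : ∀ y ∈ chartDom (m + n) a O, T y = (S y).comp (V.opC (q + 1) a (K.Θ i) y)) :
    WeakEq T (inChart a v)
        (inChart a fun p => g p + wedgeOne (d := m + n) (p := p) (ϑ p) (v p)) ↔
      WeakEq S (inChart a (K.comp u i)) (inChart a fun p => K.comp f i p +
        wedgeOne (d := m + n) (p := p) (ξ p) (K.comp u i p) +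
        wedgeOne (d := m + n) (p := p) (ϑ p) (K.comp u i p)) := by
  have hϑO : SmoothCotOn (d := m + n) O ϑ := (smoothReg (m + n) M).mono le_top hϑ
  have hξO : SmoothCotOn (d := m + n) O ξ :=
    (smoothReg (m + n) M).mono (hOW.trans inf_le_left) hξ'
  have hg' : L2LocOn O (fun p => g p + wedgeOne (d := m + n) (p := p) (ϑ p) (v p)) :=
    L2LocOn.add hg (wedgeOne_mem_reg l2Reg_stable hϑO hv)
  have hf' : L2LocOn O (fun p => K.comp f i p +
        wedgeOne (d := m + n) (p := p) (ξ p) (K.comp u i p) +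
        wedgeOne (d := m + n) (p := p) (ϑ p) (K.comp u i p)) :=
    L2LocOn.add (L2LocOn.add hf (wedgeOne_mem_reg l2Reg_stable hξO hu))
      (wedgeOne_mem_reg l2Reg_stable hϑO hu)
  have hOo := isOpen_chartDom (d := m + n) a O
  rw [weakEq_iff_integral hOo (hv a) (hg' a) hT hTc hTs,
    weakEq_iff_integral hOo (hu a) (hf' a) hS hSc hSs]
  have hc : (-1 : ℂ) ^ m * (-1) ^ (q * m) ≠ 0 :=
    mul_ne_zero (pow_ne_zero _ (by norm_num)) (pow_ne_zero _ (by norm_num))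
  have hae : ∀ {q : ℕ} {u : ∀ p : M, V.LamK q p} {v : ∀ p : M, Form (m + n) q p},
      (∀ᶠ p in aeFilter (m + n) M, p ∈ O → V.phi q p (u p) = (V.Lam p 1 q).mkQ (v p)) →
      ∀ᵐ y, y ∈ chartDom (m + n) a O → inChart a (K.comp u i) y =
        (-1 : ℂ) ^ (q * m) • V.opC q a (K.Θ i) y (inChart a v y) := by
    intro q u v h
    let w : ∀ p : M, Form (m + n) (m + q) p := fun p => V.mulCan (K.Θ i p) (v p)
    have h1 : ∀ᶠ p in aeFilter (m + n) M, p ∈ O →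
        K.comp u i p = ((-1 : ℂ) ^ (q * m) • w) p := by
      filter_upwards [h] with p hp hpO
      exact K.comp_eq (hOW hpO).2 (hp hpO)
    have h2 := (ae_restrict_iff' hOo.measurableSet).1 (inChart_ae_eq h1 a)
    filter_upwards [h2] with y hy hyO
    refine (hy hyO).trans ((congrFun (inChart_smul a _ w) y).trans ?_)
    exact congrArg (fun b : Euc (m + n) [⋀^Fin (m + q)]→L[ℝ] ℂ => (-1 : ℂ) ^ (q * m) • b)
      (V.inChart_mulCan hyO.1 (K.Θ i) v)
  have key : ∀ᵐ y, S y (inChart a (fun p => K.comp f i p +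
        wedgeOne (d := m + n) (p := p) (ξ p) (K.comp u i p) +
        wedgeOne (d := m + n) (p := p) (ϑ p) (K.comp u i p)) y) +
      adj S y (inChart a (K.comp u i) y) =
      (-1 : ℂ) ^ m * (-1) ^ (q * m) * (T y (inChart a (fun p => g p +
        wedgeOne (d := m + n) (p := p) (ϑ p) (v p)) y) + adj T y (inChart a v y)) := by
    filter_upwards [hae huv, hae hfg] with y h1 h2
    by_cases hy : y ∈ chartDom (m + n) a O
    · have hT' := K.adj_comp_opC (T := T) hξ (chartDom_mono a hOW hy)
        (hS.differentiable (by simp)).differentiableAt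
        (Filter.eventuallyEq_of_mem (hOo.mem_nhds hy) hTS) (inChart a v y)
      have e1 := inChart_add_wedgeOne ϑ v g a y
      have e2 := inChart_add_wedgeOne ϑ (K.comp u i) (fun p => K.comp f i p +
        wedgeOne (d := m + n) (p := p) (ξ p) (K.comp u i p)) a y
      have e3 := inChart_add_wedgeOne ξ (K.comp u i) (K.comp f i) a y
      rw [hT', e1, e2, e3, h1 hy, h2 hy, hTS y hy]
      have e4 : (-1 : ℂ) ^ ((q + 1) * m) = (-1 : ℂ) ^ m * (-1) ^ (q * m) := by
        rw [← pow_add]; congr 1; ring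
      have e5 := neg_one_pow_mul_self m
      simp only [map_add, map_smul, smul_eq_mul, ContinuousLinearMap.comp_apply, V.opC_wedgeL, e4]
      linear_combination (-(-1 : ℂ) ^ (q * m) *
        (adj S y (V.opC q a (K.Θ i) y (inChart a v y)) +
          S y (wedgeL _ (m + q) (cotC a ξ y) (V.opC q a (K.Θ i) y (inChart a v y))) +
          S y (wedgeL _ (m + q) (cotC a ϑ y) (V.opC q a (K.Θ i) y (inChart a v y))))) * e5
    · have h3 : ∀ {l : ℕ} {T : Euc (m + n) → (Euc (m + n) [⋀^Fin (l + 1)]→L[ℝ] ℂ) →L[ℂ] ℂ},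
          tsupport T ⊆ chartDom (m + n) a O → T y = 0 ∧ adj T y = 0 := fun h =>
        ⟨image_eq_zero_of_notMem_tsupport fun hy' => hy (h hy'),
          image_eq_zero_of_notMem_tsupport fun hy' =>
            hy (h (tsupport_transposeOp_subset _ _ _ hy'))⟩
      rw [(h3 hSs).1, (h3 hSs).2, (h3 hTs).1, (h3 hTs).2]
      simp only [zero_apply, add_zero, mul_zero]
  rw [integral_congr_ae key, integral_const_mul, mul_eq_zero, or_iff_right hc]

end Structure

end MaximalExtension

section MaximalExtensionEquiv

lemma contDiff_comp_of_tsupport {X F G H : Type*} [NormedAddCommGroup X] [NormedSpace ℝ X]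
    [NormedAddCommGroup F] [NormedSpace ℂ F]
    [NormedAddCommGroup G] [NormedSpace ℂ G] [NormedSpace ℝ G] [IsScalarTower ℝ ℂ G]
    [NormedAddCommGroup H] [NormedSpace ℂ H] [NormedSpace ℝ H] [IsScalarTower ℝ ℂ H]
    {T : X → G →L[ℂ] H} {B : X → F →L[ℂ] G} {O : Set X} (hT : ContDiff ℝ ∞ T)
    (hs : tsupport T ⊆ O) (hB : ∀ y ∈ O, ContDiffAt ℝ ∞ B y) :
    ContDiff ℝ ∞ (fun y => (T y).comp (B y)) := by
  refine contDiff_iff_contDiffAt.2 fun y => ?_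
  by_cases hy : y ∈ tsupport T
  · exact contDiffAt_comp_complex hT.contDiffAt (hB y (hs hy))
  · refine contDiffAt_const (c := (0 : F →L[ℂ] H)) |>.congr_of_eventuallyEq ?_
    filter_upwards [(isClosed_tsupport T).isOpen_compl.mem_nhds hy] with z hz
    rw [image_eq_zero_of_notMem_tsupport hz, ContinuousLinearMap.zero_comp]

lemma tsupport_comp_subset_left {X F G H : Type*} [TopologicalSpace X]
    [NormedAddCommGroup F] [NormedSpace ℂ F] [NormedAddCommGroup G] [NormedSpace ℂ G]
    [NormedAddCommGroup H] [NormedSpace ℂ H] (T : X → G →L[ℂ] H) (B : X → F →L[ℂ] G) :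
    tsupport (fun y => (T y).comp (B y)) ⊆ tsupport T :=
  closure_mono fun y hy h => hy (by simp only [h, ContinuousLinearMap.zero_comp])

variable {m n : ℕ} {M : Type u} [TopologicalSpace M] [ChartedSpace (Euc (m + n)) M]
  [IsManifold 𝓘(ℝ, Euc (m + n)) ∞ M] {V : Structure m n M} {ι : Type v}
  {ϑ ξ : M → Euc (m + n) →L[ℝ] ℂ}

namespace Structure

lemma BasicCanonical.IsXi.smooth {K : V.BasicCanonical ι} {W : Opens M} (h : K.IsXi W ξ) :
    SmoothCotOn (d := m + n) W ξ := by
  obtain ⟨B, η, hη, -, hξ⟩ := h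
  refine smoothCotOn_iff.2 (SmIn.congr (G := fun a y => ∑ l, cotC a (η l l) y)
    (fun a y hy => ContDiffAt.sum fun l _ => smoothCotOn_iff.1 (hη l l) a y hy) fun a y hy => ?_)
  have e : ξ ((ch a).symm y) = ∑ l, (η l l ((ch a).symm y) : Euc (m + n) →L[ℝ] ℂ) := hξ _ hy.2
  change (ξ ((ch a).symm y)).comp _ = _
  rw [e]
  let η' : Fin m → M → Euc (m + n) →L[ℝ] ℂ := fun l => η l l
  exact sum_cot_comp (fun l => η' l ((ch a).symm y)) _

/-- If `T` annihilates `Λ_𝒱^{1,q}`, then `T` factors through `Θ_i ∧`. -/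
lemma comp_divC_comp_opC {W : Opens M} (C : V.Coframe W) {s : ∀ p : M, V.canonical p} {q : ℕ}
    {a : M} {y : Euc (m + n)} (hy : y ∈ chartDom (m + n) a W) (h0 : ∀ p ∈ W, s p ≠ 0)
    {T : Euc (m + n) → (Euc (m + n) [⋀^Fin q]→L[ℝ] ℂ) →L[ℂ] ℂ}
    (hT : ∀ b : ∀ p : M, Form (m + n) q p, (∀ p, b p ∈ V.Lam p 1 q) →
      ∀ y, T y (inChart a b y) = 0) :
    T y = ((T y).comp (C.divC q a s y)).comp (V.opC q a s y) := by
  classical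
  ext b
  obtain ⟨e, he, h⟩ := C.divC_opC hy h0 b
  let b' : ∀ p : M, Form (m + n) q p := fun p => if p = (ch a).symm y then e else 0
  have hb' : b' ((ch a).symm y) = e := if_pos rfl
  have h1 : T y (pull (dSymm a y) e) = 0 := by
    refine Eq.trans ?_ (hT b' (fun p => ?_) y)
    · exact congrArg (T y) (congrArg (pull (dSymm a y)) hb').symm
    · by_cases hp : p = (ch a).symm y
      · rw [hp, hb', V.Lam_eq]
        exact he
      · have h0 : b' p = 0 := if_neg hp
        rw [h0]
        exact Submodule.zero_mem _
  change T y b = T y (C.divC q a s y (V.opC q a s y b))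
  rw [h, map_add, h1, add_zero]

lemma BasicCanonical.isMaxD_iff (K : V.BasicCanonical ι) (hϑ : SmoothCotOn (d := m + n) ⊤ ϑ)
    {q : ℕ} {U : Opens M} {u : ∀ p : M, V.LamK q p} (hu : u ∈ (K.secL q).sec U)
    {f : ∀ p : M, V.LamK (q + 1) p} (hf : f ∈ (K.secL (q + 1)).sec U)
    {s : ∀ p : M, V.Quot q p} {t : ∀ p : M, V.Quot (q + 1) p}
    (hus : ∀ᶠ p in aeFilter (m + n) M, p ∈ U → V.phi q p (u p) = s p)
    (hft : ∀ᶠ p in aeFilter (m + n) M, p ∈ U → V.phi (q + 1) p (f p) = t p) :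
    K.IsMaxD ϑ U u f ↔ V.IsMaxD' ϑ U s t := by
  have hmono : ∀ {k : ℕ} {U W : Opens M} {w : ∀ p : M, Form (m + n) k p}, W ≤ U → L2LocOn U w →
      L2LocOn W w := fun h hw => (l2Reg (m + n) M).mono h hw
  constructor
  · intro h U' hU' v g hv hg hsv htg
    have hϑU : SmoothCotOn (d := m + n) U' ϑ := (smoothReg (m + n) M).mono le_top hϑ
    refine WeakD.of_local hv (L2LocOn.add hg (wedgeOne_mem_reg l2Reg_stable hϑU hv))
      fun p hp => ?_
    obtain ⟨i, W, hpW, hWi, ⟨C⟩, -, ξ, hξ⟩ := K.exists_basicFrame p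
    refine ⟨U' ⊓ W, ⟨hp, hpW⟩, inf_le_left, weakD_iff.2 fun a T hT hc hs hS => ?_⟩
    have h0 : ∀ p ∈ W, K.Θ i p ≠ 0 := fun p hp => K.ne_zero i p (hWi hp)
    have hsm : SmoothOn W (fun p => (K.Θ i p : Form (m + n) m p)) :=
      (smoothReg (m + n) M).mono hWi (K.smooth i)
    have hle : U' ⊓ W ≤ U ⊓ W ⊓ K.U i := fun p hp => ⟨⟨hU' hp.1, hp.2⟩, hWi hp.2⟩
    have hle' : U' ⊓ W ≤ U ⊓ K.U i := fun p hp => ⟨hU' hp.1, hWi hp.2⟩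
    let S : Euc (m + n) → (Euc (m + n) [⋀^Fin (m + q + 1)]→L[ℝ] ℂ) →L[ℂ] ℂ :=
      fun y => (T y).comp (C.divC (q + 1) a (K.Θ i) y)
    have hSs : tsupport S ⊆ tsupport T := tsupport_comp_subset_left _ _
    have hS' : ContDiff ℝ ∞ S := contDiff_comp_of_tsupport hT hs fun y hy =>
      C.contDiffAt_divC (q + 1) hsm h0 (chartDom_mono a inf_le_right hy)
    have hSc : HasCompactSupport S := hc.mono' ((subset_tsupport S).trans hSs)
    refine (K.weakEq_iff (O := U' ⊓ W) (u := u) (f := f) (S := S) hϑ hξ hξ.smooth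
      (fun p hp => ⟨hp.2, hWi hp.2⟩) (hmono hle' (hu i))
      (hmono hle' (hf i)) (hmono inf_le_left hv)
      (hmono inf_le_left hg) ?_ ?_ hS' hSc (hSs.trans hs) hT hc hs ?_).2 ?_
    · filter_upwards [hus, hsv] with p h1 h2 hp
      rw [h1 (hU' hp.1), h2 hp.1]
    · filter_upwards [hft, htg] with p h1 h2 hp
      rw [h1 (hU' hp.1), h2 hp.1]
    · intro y hy
      exact comp_divC_comp_opC C (chartDom_mono a inf_le_right hy) h0 hS
    · refine weakD_iff.1 (h W ξ hξ i) a S hS' hSc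
        (hSs.trans (hs.trans (chartDom_mono a hle))) fun b hb y => ?_
      have hb0 : b = 0 := funext fun p => (Submodule.mem_bot ℂ).1 (hb p)
      rw [hb0, inChart_zero]
      exact map_zero (S y)
  · intro h W ξ hξ i
    have hξ' := hξ.smooth
    have hle : U ⊓ W ⊓ K.U i ≤ U ⊓ K.U i := fun p hp => ⟨hp.1.1, hp.2⟩
    have hϑU : SmoothCotOn (d := m + n) (U ⊓ W ⊓ K.U i) ϑ := (smoothReg (m + n) M).mono le_top hϑ
    have hleW : U ⊓ W ⊓ K.U i ≤ W := fun p hp => hp.1.2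
    have hξU : SmoothCotOn (d := m + n) (U ⊓ W ⊓ K.U i) ξ := (smoothReg (m + n) M).mono hleW hξ'
    refine WeakD.of_local (hmono hle (hu i))
      (L2LocOn.add (L2LocOn.add (hmono hle (hf i))
        (wedgeOne_mem_reg l2Reg_stable hξU (hmono hle (hu i))))
        (wedgeOne_mem_reg l2Reg_stable hϑU (hmono hle (hu i)))) fun p hp => ?_
    obtain ⟨N, hpN, ⟨C⟩⟩ := V.exists_coframe p
    let O : Opens M := N ⊓ (U ⊓ W ⊓ K.U i)
    have hOU : O ≤ U := fun p hp => hp.2.1.1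
    have hOi : O ≤ K.U i := fun p hp => hp.2.2
    have hOUi : O ≤ U ⊓ K.U i := le_inf hOU hOi
    obtain ⟨v, hv, huv⟩ := K.exists_local_form l2Reg_stable hu (i := i)
      (C.restrict (W := O) inf_le_left) hOU hOi
    obtain ⟨g, hg, hfg⟩ := K.exists_local_form l2Reg_stable hf (i := i)
      (C.restrict (W := O) inf_le_left) hOU hOi
    refine ⟨O, ⟨hpN, hp⟩, inf_le_right, weakD_iff.2 fun a S hS hc hs _ => ?_⟩
    let T : Euc (m + n) → (Euc (m + n) [⋀^Fin (q + 1)]→L[ℝ] ℂ) →L[ℂ] ℂ :=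
      fun y => (S y).comp (V.opC (q + 1) a (K.Θ i) y)
    have hTs : tsupport T ⊆ tsupport S := tsupport_comp_subset_left _ _
    have hT : ContDiff ℝ ∞ T := contDiff_comp_of_tsupport hS hs fun y hy =>
      V.contDiffAt_opC (q + 1) (K.smooth i) (chartDom_mono a hOi hy)
    have hTc : HasCompactSupport T := hc.mono' ((subset_tsupport T).trans hTs)
    refine (K.weakEq_iff (O := O) (T := T) (v := v) (g := g) hϑ hξ hξ'
      (fun p hp => ⟨hp.2.1.2, hp.2.2⟩) (hmono hOUi (hu i))
      (hmono hOUi (hf i)) hv hg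
      (Filter.Eventually.of_forall huv) (Filter.Eventually.of_forall hfg)
      hS hc hs hT hTc (hTs.trans hs) fun y _ => rfl).1 ?_
    refine weakD_iff.1 (h O hOU v g hv hg ?_ ?_) a T hT hTc (hTs.trans hs) fun b hb y => ?_
    · filter_upwards [hus] with p h1 hp
      rw [← h1 (hOU hp), huv p hp]
    · filter_upwards [hft] with p h1 hp
      rw [← h1 (hOU hp), hfg p hp]
    · by_cases hy : y ∈ tsupport S
      · have hyO := hs hy
        have h1 : V.opC (q + 1) a (K.Θ i) y (inChart a b y) = 0 := by
          refine (V.inChart_mulCan hyO.1 (K.Θ i) b).symm.trans ?_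
          have h2 : V.mulCan (K.Θ i ((ch a).symm y)) (b ((ch a).symm y)) = 0 := by
            refine (V.mulCan_eq_zero_iff (K.ne_zero i _ (hOi hyO.2))).2 ?_
            have := hb ((ch a).symm y)
            rw [V.Lam_eq] at this
            exact this
          exact (congrArg (pull (dSymm a y)) h2).trans (pull_zero _)
        exact (congrArg (S y) h1).trans (map_zero (S y))
      · exact congrArg (fun A : (Euc (m + n) [⋀^Fin (m + (q + 1))]→L[ℝ] ℂ) →L[ℂ] ℂ =>
          A (V.opC (q + 1) a (K.Θ i) y (inChart a b y))) (image_eq_zero_of_notMem_tsupport hy)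

end Structure

end MaximalExtensionEquiv

/-! ### Locally integrable structures -/

section LocallyIntegrable

lemma extDeriv_ofCov_fderiv {E : Type*} [NormedAddCommGroup E] [NormedSpace ℝ E] {F : E → ℂ}
    {x : E} (hF : ContDiffAt ℝ ∞ F x) : extDeriv (fun y => ofCov (fderiv ℝ F y)) x = 0 := by
  have h1 : DifferentiableAt ℝ (fderiv ℝ F) x :=
    (hF.fderiv_right (m := 1) (by norm_cast)).differentiableAt (by simp)
  have h2 : IsSymmSndFDerivAt ℝ F x := hF.isSymmSndFDerivAt (by
    rw [minSmoothness_of_isRCLikeNormedField]; norm_cast)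
  ext v
  have hv : v = ![v 0, v 1] := by
    funext j; fin_cases j <;> rfl
  rw [hv, extDeriv_ofCov_apply h1, h2.eq, sub_self]
  rfl

lemma mem_of_wedgeL_oneForm_mem {E : Type*} [NormedAddCommGroup E] [NormedSpace ℝ E]
    {N : Submodule ℂ (E →L[ℝ] ℂ)} {α : E →L[ℝ] ℂ} (h : wedgeL E 0 α (oneForm E) ∈ LamE N 1 1) :
    α ∈ N := by
  have key : ∀ (θ : E →L[ℝ] ℂ) (u : E [⋀^Fin 0]→L[ℝ] ℂ), cov (wedgeL E 0 θ u) = u ![] • θ := by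
    intro θ u
    ext x
    rw [cov_apply, wedgeL_apply, Fin.sum_univ_one]
    have e : (Fin.removeNth 0 ![x] : Fin 0 → E) = ![] := Subsingleton.elim _ _
    simp [e, mul_comm]
  have h1 : cov (wedgeL E 0 α (oneForm E)) ∈ N := by
    refine LamE_one_induction (p := fun u => cov u ∈ N) ?_ ?_ ?_ ?_ h
    · intro θ hθ u
      rw [key]
      exact N.smul_mem _ hθ
    · have : cov (0 : E [⋀^Fin 1]→L[ℝ] ℂ) = 0 := by ext x; rw [cov_apply]; rfl
      rw [this]
      exact N.zero_mem
    · intro u w hu hw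
      have : cov (u + w) = cov u + cov w := by
        ext x
        exact (cov_apply _ _).trans
          (congrArg₂ (· + ·) (cov_apply u x).symm (cov_apply w x).symm)
      rw [this]
      exact N.add_mem hu hw
    · intro c u hu
      have : cov (c • u) = c • cov u := by
        ext x
        exact (cov_apply _ _).trans (congrArg (c • ·) (cov_apply u x).symm)
      rw [this]
      exact N.smul_mem _ hu
  rw [key] at h1
  have e : oneForm E ![] • α = α := one_smul ℂ α
  rwa [e] at h1

variable {m n : ℕ} {M : Type u} [TopologicalSpace M] [ChartedSpace (Euc (m + n)) M]
  [IsManifold 𝓘(ℝ, Euc (m + n)) ∞ M] {V : Structure m n M}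

namespace Structure

/-- If `α ∧ κ = 0` for a generator `κ` of the canonical line, then `α` is conormal. -/
lemma mem_con_of_wedgeL_eq_zero {p : M} {κ : V.canonical p} (hκ : κ ≠ 0)
    {α : Euc (m + n) →L[ℝ] ℂ} (h : wedgeL _ m α (V.canF κ) = 0) : α ∈ V.con p := by
  refine mem_of_wedgeL_oneForm_mem ?_
  have h1 : frameW m (V.bas p) (wedgeL _ 0 α (oneForm (Euc (m + n)))) = 0 := by
    have h2 : V.canF κ = V.coef₀ p κ • frameW (q := 0) m (V.bas p) (oneForm (Euc (m + n))) := by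
      rw [← canF_can₀]
      exact congrArg V.canF (V.eq_coef₀_smul κ)
    have hc : V.coef₀ p κ ≠ 0 := fun h0 => hκ (by rw [V.eq_coef₀_smul κ, h0, zero_smul])
    rw [h2, map_smul] at h
    have h3 : wedgeL _ m α (frameW (q := 0) m (V.bas p) (oneForm (Euc (m + n)))) = 0 :=
      form_smul_cancel hc (h.trans (form_smul_zero _).symm)
    rw [frameW_wedgeL]
    exact (congrArg _ h3).trans (form_smul_zero _)
  rw [← V.span_bas]
  exact (frameW_eq_zero_iff (V.bas_dual p)).1 h1

/-- The quotient of two closed nowhere vanishing sections of the canonical bundle is basic. -/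
lemma exists_basic_quotient {U : Opens M} {s t : ∀ p : M, V.canonical p}
    (hs : SmoothOn U (fun p => (s p : Form (m + n) m p)))
    (ht : SmoothOn U (fun p => (t p : Form (m + n) m p)))
    (hds : ∀ p ∈ U, dForm (fun p => (s p : Form (m + n) m p)) p = 0)
    (hdt : ∀ p ∈ U, dForm (fun p => (t p : Form (m + n) m p)) p = 0)
    (h0 : ∀ p ∈ U, s p ≠ 0) :
    ∃ g : M → ℂ, V.IsBasicFun U g ∧ ∀ p ∈ U, t p = g p • s p := by
  let g : M → ℂ := fun p => V.coef₀ p (t p) / V.coef₀ p (s p)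
  have hc : ∀ p ∈ U, V.coef₀ p (s p) ≠ 0 := fun p hp hc =>
    h0 p hp (by rw [V.eq_coef₀_smul (s p), hc, zero_smul])
  have hg : ∀ p ∈ U, t p = g p • s p := fun p hp => by
    rw [V.eq_coef₀_smul (t p), V.eq_coef₀_smul (s p), smul_smul]
    simp only [g]
    rw [div_mul_cancel₀ _ (hc p hp)]
  have hsm : SmIn U (fun a => g ∘ (ch (d := m + n) a).symm) := by
    intro a y hy
    obtain ⟨W, hpW, ⟨C⟩⟩ := V.exists_coframe ((ch a).symm y)
    let C' := C.restrict (W := U ⊓ W) inf_le_right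
    have hyW : y ∈ chartDom (m + n) a (U ⊓ W) := ⟨hy.1, hy.2, hpW⟩
    have h1 := C'.smooth_coef ((smoothReg (m + n) M).mono inf_le_left hs) a y hyW
    have h2 := C'.smooth_coef ((smoothReg (m + n) M).mono inf_le_left ht) a y hyW
    refine (h2.mul (h1.inv (C'.coef_ne_zero hyW.2 (h0 _ hy.2)))).congr_of_eventuallyEq ?_
    filter_upwards [(isOpen_chartDom a _).mem_nhds hyW] with z hz
    have h3 : C'.coef t ((ch a).symm z) = g ((ch a).symm z) * C'.coef s ((ch a).symm z) := by
      have h4 : V.canF (t ((ch a).symm z)) = g ((ch a).symm z) • V.canF (s ((ch a).symm z)) :=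
        congrArg V.canF (hg _ hz.2.1)
      unfold Coframe.coef
      rw [h4, map_smul, smul_eq_mul]
    change g ((ch a).symm z) = C'.coef t ((ch a).symm z) * (C'.coef s ((ch a).symm z))⁻¹
    rw [h3, mul_inv_cancel_right₀ (C'.coef_ne_zero hz.2 (h0 _ hz.2.1))]
  refine ⟨g, IsBasicFun.of_fderiv hsm fun p hp => ?_, hg⟩
  have hy := ch_mem_chartDom (d := m + n) hp
  refine mem_con_of_wedgeL_eq_zero (h0 p hp) ?_
  have h1 : extDeriv (inChart p (fun p => (t p : Form (m + n) m p))) (ch p p) = 0 :=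
    (dForm_eq _ p).symm.trans (hdt p hp)
  have h2 : extDeriv (inChart p (fun p => (s p : Form (m + n) m p))) (ch p p) = 0 :=
    (dForm_eq _ p).symm.trans (hds p hp)
  have h3 : inChart p (fun p => (t p : Form (m + n) m p)) =ᶠ[𝓝 (ch p p)] fun y =>
      (g ∘ (ch p).symm) y • inChart p (fun p => (s p : Form (m + n) m p)) y := by
    filter_upwards [(isOpen_chartDom p U).mem_nhds hy] with y hy
    refine Eq.trans (congrArg (fun κ : V.canonical ((ch p).symm y) =>
      pull (dSymm p y) (V.canF κ)) (hg _ hy.2)) ?_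
    exact pull_smul _ _ _
  rw [h3.extDeriv_eq, extDeriv_smul_fun ((hsm p _ hy).differentiableAt (by simp))
    ((hs p _ hy).differentiableAt (by simp)), h2, form_smul_zero, add_zero] at h1
  refine Eq.trans (congrArg _ ?_) h1
  exact (inChart_self (fun p => (s p : Form (m + n) m p)) p).symm

section FirstIntegrals

variable {U : Opens M} {f : Fin m → M → ℂ}

lemma IsFirstIntegrals.mem (hf : V.IsFirstIntegrals U f) {p : M} (hp : p ∈ U) (j : Fin m) :
    dFun (f j) p ∈ V.conormal p := by
  rw [← hf.2 p hp]
  exact Submodule.subset_span ⟨j, rfl⟩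

open Classical in
variable (V f) in
/-- The section `df_1 ∧ ⋯ ∧ df_m` of the canonical bundle; zero at the points where the `df_j` are
not conormal. -/
def dCan (p : M) : V.canonical p :=
  if h : ∀ j, dFun (f j) p ∈ V.conormal p then V.wedgeCan fun j => ⟨dFun (f j) p, h j⟩ else 0

lemma IsFirstIntegrals.coe_dCan (hf : V.IsFirstIntegrals U f) {p : M} (hp : p ∈ U) :
    (V.dCan f p : Form (m + n) m p) = wedgeAll fun j => dFun (f j) p := by
  unfold dCan
  rw [dif_pos (hf.mem hp)]
  rfl

variable {s : ∀ p : M, V.canonical p}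

lemma IsFirstIntegrals.inChart_eq (hf : V.IsFirstIntegrals U f)
    (hs : ∀ p ∈ U, (s p : Form (m + n) m p) = wedgeAll fun j => dFun (f j) p) {a : M}
    {y : Euc (m + n)} (hy : y ∈ chartDom (m + n) a U) :
    inChart a (fun p => (s p : Form (m + n) m p)) y =
      frameW (q := 0) m (fun j => fderiv ℝ (f j ∘ (ch a).symm) y) (oneForm (Euc (m + n))) := by
  have h1 : V.canF (s ((ch a).symm y)) =
      frameW (q := 0) m (fun j => (dFun (f j) ((ch a).symm y) : Euc (m + n) →L[ℝ] ℂ))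
        (oneForm (Euc (m + n))) := (hs _ hy.2).trans (wedgeAll_eq _)
  refine (congrArg (pull (dSymm a y)) h1).trans ((pull_frameW _ _ _).trans ?_)
  refine congrArg (fun θ : Fin m → Euc (m + n) →L[ℝ] ℂ =>
    frameW (q := 0) m θ (oneForm (Euc (m + n)))) (funext fun j => ?_)
  exact cotC_dFun (hf.1 j) hy

lemma IsFirstIntegrals.smooth (hf : V.IsFirstIntegrals U f)
    (hs : ∀ p ∈ U, (s p : Form (m + n) m p) = wedgeAll fun j => dFun (f j) p) :
    SmoothOn U (fun p => (s p : Form (m + n) m p)) := by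
  refine SmIn.congr (G := fun a y => frameW (q := 0) m
    (fun j => fderiv ℝ (f j ∘ (ch a).symm) y) (oneForm (Euc (m + n)))) (fun a y hy => ?_)
    fun a y hy => hf.inChart_eq hs hy
  exact contDiffAt_apply_complex (contDiffAt_frameW fun j =>
    (smIn_fun_iff.1 (hf.1 j) a y hy).fderiv_right (by simp)) contDiffAt_const

lemma IsFirstIntegrals.closed (hf : V.IsFirstIntegrals U f)
    (hs : ∀ p ∈ U, (s p : Form (m + n) m p) = wedgeAll fun j => dFun (f j) p) {p : M}
    (hp : p ∈ U) : dForm (fun p => (s p : Form (m + n) m p)) p = 0 := by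
  have hy := ch_mem_chartDom (d := m + n) hp
  have h1 : inChart p (fun p => (s p : Form (m + n) m p)) =ᶠ[𝓝 (ch p p)] fun y =>
      (1 : ℂ) • frameW (q := 0) m (fun j => fderiv ℝ (f j ∘ (ch p).symm) y)
        (oneForm (Euc (m + n))) := by
    filter_upwards [(isOpen_chartDom p U).mem_nhds hy] with y hy
    rw [hf.inChart_eq hs hy, form_one_smul]
  have h2 := extDeriv_smul_frameW (q := 0) (k := m) (x := ch p p)
    (w := fun _ => oneForm (Euc (m + n))) (c := fun _ => (1 : ℂ)) (η := fun _ _ => 0)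
    (θ := fun j y => fderiv ℝ (f j ∘ (ch p).symm) y)
    (differentiableAt_const _) (differentiableAt_const _)
    (by rw [fderiv_fun_const]; exact Submodule.zero_mem _)
    (fun j => ((smIn_fun_iff.1 (hf.1 j) p _ hy).fderiv_right (m := 1)
      (by norm_cast)).differentiableAt (by simp))
    (fun j => by
      rw [extDeriv_ofCov_fderiv (smIn_fun_iff.1 (hf.1 j) p _ hy)]
      refine (Finset.sum_eq_zero fun l _ => ?_).symm
      rw [map_zero, zero_apply])
  have h3 : extDeriv (fun _ : Euc (m + n) => oneForm (Euc (m + n))) (ch p p) = 0 := by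
    rw [extDeriv_eq_sum, fderiv_fun_const]
    exact Finset.sum_eq_zero fun j _ => map_zero _
  rw [h3, map_zero, form_smul_zero, form_smul_zero, Finset.sum_const_zero, map_zero,
    zero_apply] at h2
  exact (dForm_eq _ p).trans ((h1.extDeriv_eq).trans (h2.trans (add_zero _)))

lemma IsFirstIntegrals.ne_zero (hf : V.IsFirstIntegrals U f)
    (hs : ∀ p ∈ U, (s p : Form (m + n) m p) = wedgeAll fun j => dFun (f j) p) {p : M}
    (hp : p ∈ U) : s p ≠ 0 := by
  intro h0
  let θ : Fin m → Euc (m + n) →L[ℝ] ℂ := fun j => dFun (f j) p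
  have hspan : Submodule.span ℂ (Set.range θ) = V.con p := hf.2 p hp
  have hli : LinearIndependent ℂ θ := by
    rw [linearIndependent_iff_card_eq_finrank_span, Set.finrank, hspan, ← V.span_bas]
    exact (finrank_span_eq_card (linearIndependent_of_dual (V.bas_dual p))).symm
  obtain ⟨c, hc⟩ := exists_frameW_eq_smul (φ := V.bas p) hli fun j => by
    rw [hspan, ← V.span_bas]
    exact Submodule.subset_span ⟨j, rfl⟩
  have h1 : frameW (q := 0) m θ (oneForm (Euc (m + n))) = 0 :=
    (wedgeAll_eq _).symm.trans ((hs p hp).symm.trans (congrArg Subtype.val h0))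
  have h2 := hc 0 (oneForm (Euc (m + n)))
  rw [h1, form_smul_zero, ← V.canF_can₀] at h2
  exact V.can₀_ne_zero p (Subtype.ext h2)

end FirstIntegrals

/-- The canonical bundle of a locally integrable structure, trivialized by the sections
`df_1 ∧ ⋯ ∧ df_m` for local systems of first integrals. -/
lemma LocallyIntegrable.exists_basicCanonical (h : V.LocallyIntegrable) :
    ∃ K : V.BasicCanonical M,
      ∀ (U : Opens M) (f : Fin m → M → ℂ), V.IsFirstIntegrals U f →
        ∀ s : ∀ p : M, V.canonical p,
          (∀ p ∈ U, (s p : Form (m + n) m p) = wedgeAll fun j => dFun (f j) p) →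
          K.IsBasicSection U s := by
  choose U hpU f hf using h
  have hΘ : ∀ i, ∀ p ∈ U i, (V.dCan (f i) p : Form (m + n) m p) =
      wedgeAll fun j => dFun (f i j) p := fun i p hp => (hf i).coe_dCan hp
  have key : ∀ (i : M) (W : Opens M) (g : Fin m → M → ℂ), V.IsFirstIntegrals W g →
      ∀ s : ∀ p : M, V.canonical p,
        (∀ p ∈ W, (s p : Form (m + n) m p) = wedgeAll fun j => dFun (g j) p) →
        ∃ c : M → ℂ, V.IsBasicFun (W ⊓ U i) c ∧
          ∀ p ∈ W ⊓ U i, s p = c p • V.dCan (f i) p := fun i W g hg s hs =>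
    exists_basic_quotient
      ((smoothReg (m + n) M).mono inf_le_right ((hf i).smooth (hΘ i)))
      ((smoothReg (m + n) M).mono inf_le_left (hg.smooth hs))
      (fun p hp => (hf i).closed (hΘ i) hp.2) (fun p hp => hg.closed hs hp.1)
      (fun p hp => (hf i).ne_zero (hΘ i) hp.2)
  refine ⟨{ U := U, cover := fun p => ⟨p, hpU p⟩, Θ := fun i => V.dCan (f i)
            smooth := fun i => (hf i).smooth (hΘ i)
            ne_zero := fun i p hp => (hf i).ne_zero (hΘ i) hp
            transition := fun i j => ?_
            unit_basic := fun hm i => ?_ }, fun W g hg s hs i => key i W g hg s hs⟩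
  · obtain ⟨c, hc, h⟩ := key i (U j) (f j) (hf j) _ (hΘ j)
    rw [inf_comm] at hc h
    exact ⟨c, hc, h⟩
  · refine (IsBasicFun.const V (U i) 1).congr fun p hp => ?_
    rw [hΘ i p hp]
    subst hm
    rfl

end Structure

end LocallyIntegrable

/-! ### The isomorphism of complexes of sheaves -/

section Sheaves

variable {m n : ℕ} {M : Type u} [TopologicalSpace M] [ChartedSpace (Euc (m + n)) M]
  [IsManifold 𝓘(ℝ, Euc (m + n)) ∞ M] [SecondCountableTopology M] {V : Structure m n M}
  {ι : Type v} {ϑ : M → Euc (m + n) →L[ℝ] ℂ}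

namespace Structure

/-- The isomorphism of the sheaves of smooth sections. -/
def BasicCanonical.isoA (K : V.BasicCanonical ι) (q : ℕ) : K.sheafA q ≅ V.quotU q :=
  (K.fibreIso smoothReg_stable q).iso

/-- The isomorphism of the sheaves of `L²_loc` sections. -/
def BasicCanonical.isoL (K : V.BasicCanonical ι) (q : ℕ) : K.sheafL q ≅ V.quotL q :=
  (K.fibreIso l2Reg_stable q).iso

/-- The operator `d_{𝒱,ϑ}` on smooth sections, transported from the quotient sheaves. -/
def BasicCanonical.homA (K : V.BasicCanonical ι) (hϑ : SmoothCotOn (d := m + n) ⊤ ϑ) (q : ℕ) :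
    K.sheafA q ⟶ K.sheafA (q + 1) :=
  (K.isoA q).hom ≫ (K.opQ hϑ q).hom ≫ (K.isoA (q + 1)).inv

lemma BasicCanonical.homA_comp_isoA (K : V.BasicCanonical ι) (hϑ : SmoothCotOn (d := m + n) ⊤ ϑ)
    (q : ℕ) : K.homA hϑ q ≫ (K.isoA (q + 1)).hom = (K.isoA q).hom ≫ (K.opQ hϑ q).hom := by
  unfold BasicCanonical.homA
  rw [Category.assoc, Category.assoc, Iso.inv_hom_id, Category.comp_id]

/-- The operator `d_{𝒱,ϑ}` on a smooth section, computed fibrewise. -/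
lemma BasicCanonical.exists_homA_cls (K : V.BasicCanonical ι)
    (hϑ : SmoothCotOn (d := m + n) ⊤ ϑ) {q : ℕ} {U : Opens M} {u : ∀ p : M, V.LamK q p}
    (hu : u ∈ (K.secA q).sec U) :
    ∃ h : (fun p => (V.phi (q + 1) p).symm (V.dQ ϑ (fun p => V.phi q p (u p)) p)) ∈
      (K.secA (q + 1)).sec U,
      (K.homA hϑ q).hom.app (op U) ((K.secA q).cls hu) = (K.secA (q + 1)).cls h :=
  ⟨(K.fibreIso smoothReg_stable (q + 1)).symm.mem_iff.1
    (K.dQ_mem hϑ ((K.mem_sections_iff smoothReg_stable).1 hu)), rfl⟩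

lemma BasicCanonical.homA_cls_eq_iff (K : V.BasicCanonical ι)
    (hϑ : SmoothCotOn (d := m + n) ⊤ ϑ) {q : ℕ} {U : Opens M} {u : ∀ p : M, V.LamK q p}
    (hu : u ∈ (K.secA q).sec U) {f : ∀ p : M, V.LamK (q + 1) p}
    (hf : f ∈ (K.secA (q + 1)).sec U) :
    (K.homA hϑ q).hom.app (op U) ((K.secA q).cls hu) = (K.secA (q + 1)).cls hf ↔
      K.IsD ϑ U u f := by
  obtain ⟨h, e⟩ := K.exists_homA_cls hϑ hu
  rw [e, K.isD_iff hu]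
  refine (SectionSpace.cls_eq_iff _ _ _).trans (Filter.eventually_top.trans ?_)
  exact forall₂_congr fun p _ => (V.phi (q + 1) p).symm_apply_eq

lemma BasicCanonical.homA_comp_homA (K : V.BasicCanonical ι)
    (hϑ : SmoothCotOn (d := m + n) ⊤ ϑ)
    (hdϑ : ∀ p : M, dForm (fun p' => toForm (d := m + n) (p := p') (ϑ p')) p ∈ V.Lam p 1 2)
    (q : ℕ) (U : Opens M) :
    (K.homA hϑ q).hom.app (op U) ≫ (K.homA hϑ (q + 1)).hom.app (op U) = 0 := by
  ext x
  obtain ⟨u, hu, rfl⟩ := SectionSpace.cls_surjective _ x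
  obtain ⟨h, e⟩ := K.exists_homA_cls hϑ hu
  obtain ⟨h', e'⟩ := K.exists_homA_cls hϑ h
  refine (congrArg ((K.homA hϑ (q + 1)).hom.app (op U)) e).trans (e'.trans ?_)
  refine (SectionSpace.cls_eq_iff _ h' (Submodule.zero_mem _)).2
    (Filter.Eventually.of_forall fun p hp => ?_)
  refine ((V.phi (q + 2) p).symm_apply_eq).2 (Eq.trans ?_ (map_zero (V.phi (q + 2) p)).symm)
  have e : (fun p => V.phi (q + 1) p ((V.phi (q + 1) p).symm
      (V.dQ ϑ (fun p => V.phi q p (u p)) p))) = V.dQ ϑ (fun p => V.phi q p (u p)) :=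
    funext fun p => LinearEquiv.apply_symm_apply _ _
  rw [e]
  exact K.dQ_dQ hϑ hdϑ ((K.mem_sections_iff smoothReg_stable).1 hu) hp

lemma BasicCanonical.opQ_cls_eq_iff (K : V.BasicCanonical ι)
    (hϑ : SmoothCotOn (d := m + n) ⊤ ϑ) {q : ℕ} {U : Opens M} {s : ∀ p : M, V.Quot q p}
    (hs : s ∈ (V.qsecU q).sec U) {t : ∀ p : M, V.Quot (q + 1) p}
    (ht : t ∈ (V.qsecU (q + 1)).sec U) :
    (K.opQ hϑ q).hom.hom.app (op U) ((V.qsecU q).cls hs) = (V.qsecU (q + 1)).cls ht ↔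
      V.IsD' ϑ U s t := by
  refine Iff.trans ?_ (K.isD'_iff hs).symm
  exact (SectionSpace.cls_eq_iff _ (K.dQ_mem hϑ hs) ht).trans Filter.eventually_top

lemma BasicCanonical.opQ_comp_opQ (K : V.BasicCanonical ι)
    (hϑ : SmoothCotOn (d := m + n) ⊤ ϑ)
    (hdϑ : ∀ p : M, dForm (fun p' => toForm (d := m + n) (p := p') (ϑ p')) p ∈ V.Lam p 1 2)
    (q : ℕ) (U : Opens M) :
    (K.opQ hϑ q).hom.hom.app (op U) ≫ (K.opQ hϑ (q + 1)).hom.hom.app (op U) = 0 := by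
  ext x
  obtain ⟨s, hs, rfl⟩ := SectionSpace.cls_surjective _ x
  exact (SectionSpace.cls_eq_iff _ (K.dQ_mem hϑ (K.dQ_mem hϑ hs)) (Submodule.zero_mem _)).2
    (Filter.Eventually.of_forall fun p hp => K.dQ_dQ hϑ hdϑ hs hp)

lemma BasicCanonical.isMaxD_iff_of_isoL (K : V.BasicCanonical ι)
    (hϑ : SmoothCotOn (d := m + n) ⊤ ϑ) {q : ℕ} {U : Opens M} {u : ∀ p : M, V.LamK q p}
    (hu : u ∈ (K.secL q).sec U) {f : ∀ p : M, V.LamK (q + 1) p}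
    (hf : f ∈ (K.secL (q + 1)).sec U) {s : ∀ p : M, V.Quot q p} (hs : s ∈ (V.qsecL q).sec U)
    {t : ∀ p : M, V.Quot (q + 1) p} (ht : t ∈ (V.qsecL (q + 1)).sec U)
    (hus : (K.isoL q).hom.hom.app (op U) ((K.secL q).cls hu) = (V.qsecL q).cls hs)
    (hft : (K.isoL (q + 1)).hom.hom.app (op U) ((K.secL (q + 1)).cls hf) =
      (V.qsecL (q + 1)).cls ht) : K.IsMaxD ϑ U u f ↔ V.IsMaxD' ϑ U s t := by
  have h1 : ∀ᶠ p in aeFilter (m + n) M, p ∈ U → V.phi q p (u p) = s p :=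
    ((K.fibreIso l2Reg_stable q).iso_cls_eq_iff hu hs).1 hus
  have h2 : ∀ᶠ p in aeFilter (m + n) M, p ∈ U → V.phi (q + 1) p (f p) = t p :=
    ((K.fibreIso l2Reg_stable (q + 1)).iso_cls_eq_iff hf ht).1 hft
  exact K.isMaxD_iff hϑ hu hf h1 h2

/-- The isomorphism of the sheaves of smooth sections is the restriction of the isomorphism of the
sheaves of `L²_loc` sections. -/
lemma BasicCanonical.isoL_cls_of_isoA_cls (K : V.BasicCanonical ι) {q : ℕ} {U : Opens M}
    {u : ∀ p : M, V.LamK q p} (hu : u ∈ (K.secA q).sec U) {s : ∀ p : M, V.Quot q p}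
    (hs : s ∈ (V.qsecU q).sec U)
    (h : (K.isoA q).hom.hom.app (op U) ((K.secA q).cls hu) = (V.qsecU q).cls hs) :
    ∃ (hu' : u ∈ (K.secL q).sec U) (hs' : s ∈ (V.qsecL q).sec U),
      (K.isoL q).hom.hom.app (op U) ((K.secL q).cls hu') = (V.qsecL q).cls hs' := by
  have h1 := (SectionSpace.FibreIso.iso_cls_eq_iff _ hu hs).1 h
  have hu' : u ∈ (K.secL q).sec U := fun i => SmoothOn.l2LocOn (hu i)
  have hs' : s ∈ (V.qsecL q).sec U := fun p hp => by
    obtain ⟨W, hpW, hWU, v, hv, hsv⟩ := mem_qsecU_iff.1 hs p hp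
    exact ⟨W, hpW, hWU, v, SmoothOn.l2LocOn hv, Filter.Eventually.of_forall hsv⟩
  exact ⟨hu', hs', (SectionSpace.FibreIso.iso_cls_eq_iff _ hu' hs').2
    (Filter.Eventually.filter_mono le_top h1)⟩

end Structure

end Sheaves

end FormInt

end

open FormInt FormInt.Structure in
theorem proposition4p1 {m n : ℕ} {M : Type u} [TopologicalSpace M]
    [ChartedSpace (Euc (m + n)) M] [IsManifold 𝓘(ℝ, Euc (m + n)) ∞ M]
    [T2Space M] [SecondCountableTopology M]
    (V : Structure m n M) (ϑ : ∀ p : M, Cot (m + n) p) (hϑ : SmoothCotOn ⊤ ϑ)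
    (hdϑ : ∀ p : M, dForm (fun p' => toForm (ϑ p')) p ∈ V.Lam p 1 2) :
    (∀ {ι : Type v} (K : V.BasicCanonical ι),
      -- the local maps patch, in exactly one way, to sheaf isomorphisms `Φ q`
      ∃ Φ : ∀ q : ℕ, K.sheafL q ≅ V.quotL q,
        (∀ q, K.ExtendsLocalMaps (Φ q).hom) ∧
        (∀ q, ∀ Φ' : K.sheafL q ⟶ V.quotL q, K.ExtendsLocalMaps Φ' → Φ' = (Φ q).hom) ∧
        -- which intertwine the maximal extensions of the two operators
        (∀ (q : ℕ) (U : Opens M)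
          (u : ∀ p : M, V.LamK q p) (hu : u ∈ (K.secL q).sec U)
          (f : ∀ p : M, V.LamK (q + 1) p) (hf : f ∈ (K.secL (q + 1)).sec U)
          (s : ∀ p : M, V.Quot q p) (hs : s ∈ (V.qsecL q).sec U)
          (t : ∀ p : M, V.Quot (q + 1) p)
          (ht : t ∈ (V.qsecL (q + 1)).sec U),
          (Φ q).hom.hom.app (op U) ((K.secL q).cls hu) =
            (V.qsecL q).cls hs →
          (Φ (q + 1)).hom.hom.app (op U) ((K.secL (q + 1)).cls hf) =
            (V.qsecL (q + 1)).cls ht →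
          (K.IsMaxD ϑ U u f ↔ V.IsMaxD' ϑ U s t)) ∧
        -- and induce an isomorphism `Ψ` of the two complexes of sheaves of smooth sections
        ∃ (D : ∀ q : ℕ, K.sheafA q ⟶ K.sheafA (q + 1)) (D' : ∀ q : ℕ, V.quotU q ⟶ V.quotU (q + 1))
          (Ψ : ∀ q : ℕ, K.sheafA q ≅ V.quotU q),
          (∀ (q : ℕ) (U : Opens M)
            (u : ∀ p : M, V.LamK q p) (hu : u ∈ (K.secA q).sec U)
            (f : ∀ p : M, V.LamK (q + 1) p)
            (hf : f ∈ (K.secA (q + 1)).sec U),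
            (D q).hom.app (op U) ((K.secA q).cls hu) =
              (K.secA (q + 1)).cls hf ↔ K.IsD ϑ U u f) ∧
          (∀ (q : ℕ) (U : Opens M)
            (s : ∀ p : M, V.Quot q p) (hs : s ∈ (V.qsecU q).sec U)
            (t : ∀ p : M, V.Quot (q + 1) p)
            (ht : t ∈ (V.qsecU (q + 1)).sec U),
            (D' q).hom.app (op U) ((V.qsecU q).cls hs) =
              (V.qsecU (q + 1)).cls ht ↔ V.IsD' ϑ U s t) ∧
          (∀ (q : ℕ) (U : Opens M), (D q).hom.app (op U) ≫ (D (q + 1)).hom.app (op U) = 0) ∧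
          (∀ (q : ℕ) (U : Opens M), (D' q).hom.app (op U) ≫ (D' (q + 1)).hom.app (op U) = 0) ∧
          (∀ (q : ℕ) (U : Opens M)
            (u : ∀ p : M, V.LamK q p) (hu : u ∈ (K.secA q).sec U)
            (s : ∀ p : M, V.Quot q p) (hs : s ∈ (V.qsecU q).sec U),
            (Ψ q).hom.hom.app (op U) ((K.secA q).cls hu) =
              (V.qsecU q).cls hs →
            ∃ (hu' : u ∈ (K.secL q).sec U)
              (hs' : s ∈ (V.qsecL q).sec U),
              (Φ q).hom.hom.app (op U) ((K.secL q).cls hu') =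
                (V.qsecL q).cls hs') ∧
          (∀ q, D q ≫ (Ψ (q + 1)).hom = (Ψ q).hom ≫ D' q)) ∧
    -- if `𝒱` is locally integrable, then the canonical bundle is basic, with basic sections
    -- `df_1 ∧ ⋯ ∧ df_m` for first integrals `f_1, …, f_m`
    (V.LocallyIntegrable → ∃ K : V.BasicCanonical M,
      ∀ (U : Opens M) (f : Fin m → M → ℂ), V.IsFirstIntegrals U f →
        ∀ s : ∀ p : M, V.canonical p,
          (∀ p ∈ U, (s p : Form (m + n) m p) = wedgeAll fun j => dFun (f j) p) →
          K.IsBasicSection U s) := by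
  refine ⟨fun {ι} K => ?_, fun h => h.exists_basicCanonical⟩
  refine ⟨K.isoL, K.fibreIso_extendsLocalMaps, fun q Φ' hΦ' =>
    K.eq_of_extendsLocalMaps hΦ' (K.fibreIso_extendsLocalMaps q), ?_, K.homA hϑ,
    fun q => (K.opQ hϑ q).hom, K.isoA, ?_⟩
  · intro q U u hu f hf s hs t ht hus hft
    exact K.isMaxD_iff_of_isoL hϑ hu hf hs ht hus hft
  refine ⟨?_, ?_, ?_, ?_, ?_, ?_⟩
  · intro q U u hu f hf
    exact K.homA_cls_eq_iff hϑ hu hf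
  · intro q U s hs t ht
    exact K.opQ_cls_eq_iff hϑ hs ht
  · exact K.homA_comp_homA hϑ hdϑ
  · exact K.opQ_comp_opQ hϑ hdϑ
  · intro q U u hu s hs hus
    exact K.isoL_cls_of_isoA_cls hu hs hus
  · exact K.homA_comp_isoA hϑ
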